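/- Notation. Let $n\ge 2$; points are written $x=(x',x_n)\in\mathbb R^{n-1}\times\mathbb R$, and $B'_r$ is the open ball of radius $r$ about $0$ in $\mathbb R^{n-1}$. An $L$-Lipschitz chart of an open set $G$ at $x_0\in\partial G$ on $B'_r$ is an $L$-Lipschitz function $\phi:B'_r\to(-\ell,\ell)$, $\ell=r(1+L)$, $\phi(0')=0$, together with an isometry $Tx=\mathcal R(x-x_0)$, $\mathcal R$ orthogonal, such that in the cylinder $B'_r\times(-\ell,\ell)$ the set $T\partial G$ is the graph of $\phi$ and $TG$ is the part below that graph. An open connected set $\Omega\subset\mathbb R^n$ is a Lipschitz domain with characteristic $(L,R)$, $L>0$, $R\in(0,1)$, if for all $x_0\in\partial\Omega$ and $r\in(0,R]$ it has an $L$-Lipschitz chart at $x_0$ on $B'_r$. For a function class $X$ we write $\partial\Omega\in X$ if at every $x_0\in\partial\Omega$ there is, for some $r>0$, a Lipschitz chart of $\Omega$ on $B'_r$ that belongs to $X(B'_r)$. Construction. Let $\Omega$ be a bounded Lipschitz domain with characteristic $(L,R)$. Choose points $x^1,\dots,x^N\in\partial\Omega$ with $\partial\Omega\subset\bigcup_i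 B_{R/8}(x^i)$ and $L$-Lipschitz charts $\phi^i$ at $x^i$ on $B'_R$, with isometries $T^i$; choose an open set $W\supset\overline\Omega$ and nonnegative smooth functions $\xi_0,\dots,\xi_N$ on $\mathbb R^n$ with $\operatorname{supp}\xi_0\subset\Omega$, $\operatorname{supp}\xi_i\subset B_{R/4}(x^i)$ for $i\ge1$, and $\sum_{i=0}^N\xi_i=1$ on $W$. Let $\rho$ be the multiple of unit mass of the kernel equal to $e^{-1/(1-|y'|^2)}$ for $|y'|<1$ and $0$ otherwise, $\rho_m(y')=m^{n-1}\rho(my')$, $M_m(h)=h*\rho_m$, $$\phi^{j,\pm}_m=M_m(\phi^j)\pm\Big(\|M_m(\phi^j)-\phi^j\|_{L^\infty(B'_{R-1/m})}+\tfrac Lm\Big),\qquad F^{\pm}_m(x)=\sum_{j=1}^N\big(z^j_n-\phi^{j,\pm}_m((z^j)')\big)\,\xi_j(x)-\xi_0(x),\quad z^j=T^jx,$$ and $\Omega_m=\{x\in W: F^+_m(x)<0\}$, $\omega_m=\{x\in W: F^-_m(x)<0\}$. Theorem. The choices above are possible. For any such choices and any $\varepsilon_0\in(0,R/2)$ there are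 functions $\psi^i_m,\varphi^i_m$ ($1\le i\le N$, $m\in\mathbb N$) on $B'_{R-\varepsilon_0}$ such that, for all large $m$, they are of class $C^\infty$ and describe $\partial\Omega_m$ and $\partial\omega_m$ in the same coordinate systems: with $\ell_0=(R-\varepsilon_0)(1+L)$, in the cylinder $B'_{R-\varepsilon_0}\times(-\ell_0,\ell_0)$ the set $T^i\partial\Omega_m$ is the graph of $\psi^i_m$ and $T^i\Omega_m$ is the part below it, the inverse images of these cylinders under $T^1,\dots,T^N$ cover $\partial\Omega_m$, and likewise for $\omega_m$ and $\varphi^i_m$. Moreover, for every $i$, as $m\to\infty$: 1. if $\partial\Omega\in C^k$ for some $k\in\mathbb N$, then $\psi^i_m\to\phi^i$ and $\varphi^i_m\to\phi^i$ in $C^k(B'_{R-\varepsilon_0})$; 2. if $\partial\Omega\in C^{k,\alpha}$ for some $k\in\mathbb N$, $\alpha\in(0,1)$, then $\psi^i_m\to\phi^i$ and $\varphi^i_m\to\phi^i$ in $C^{k,\alpha'}(B'_{R-\varepsilon_0})$ for all $0<\alpha'<\alpha$; 3. if $\partial\Omega\in W^{k,q}$ for some $k\in\mathbb N$, $q\in[1,\infty)$,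 then $\psi^i_m\to\phi^i$ and $\varphi^i_m\to\phi^i$ in $W^{k,q}(B'_{R-\varepsilon_0})$; 4. if $\partial\Omega\in C^{k,1}$ for some $k\in\mathbb N$, then $\psi^i_m\to\phi^i$ and $\varphi^i_m\to\phi^i$ weakly-$*$ in $W^{k+1,\infty}(B'_{R-\varepsilon_0})$, in particular weakly-$*$ in $W^{k,\infty}(B'_{R-\varepsilon_0})$. The functions $\psi^i_m,\varphi^i_m$ are the same in all four parts, for all $k,\alpha,\alpha',q$. -/

import Mathlib

open Set Filter Topology MeasureTheory Metric
open scoped NNReal ENNReal ContDiff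

noncomputable section

namespace LipApprox

/-! ### Coordinates, local boundary charts and Lipschitz domains

The ambient space `ℝⁿ` is `EuclideanSpace ℝ (Fin (d + 1))`, so that `n = d + 1` and `ℝⁿ⁻¹` is
`EuclideanSpace ℝ (Fin d)`. -/

/-- An orthogonal coordinate frame of `ℝⁿ`: a linear isometry `x ↦ (x', xₙ)` onto
`ℝⁿ⁻¹ × ℝ`, the product carrying the Euclidean (`ℓ²`) norm. -/
abbrev Frame (d : ℕ) : Type :=
  EuclideanSpace ℝ (Fin (d + 1)) ≃ₗᵢ[ℝ] WithLp 2 (EuclideanSpace ℝ (Fin d) × ℝ)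

variable {d : ℕ}

/-- The point with coordinates `(y', t)` in the coordinate system with origin `x₀` and frame `T`. -/
def pt (x₀ : EuclideanSpace ℝ (Fin (d + 1))) (T : Frame d) (y : EuclideanSpace ℝ (Fin d)) (t : ℝ) :
    EuclideanSpace ℝ (Fin (d + 1)) :=
  x₀ + T.symm (WithLp.toLp 2 (y, t))

/-- The coordinate cylinder `B'_r × (-h, h)`, as a subset of `ℝⁿ`. -/
def cylinder (x₀ : EuclideanSpace ℝ (Fin (d + 1))) (T : Frame d) (r h : ℝ) :
    Set (EuclideanSpace ℝ (Fin (d + 1))) :=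
  {x | (T (x - x₀)).fst ∈ ball (0 : EuclideanSpace ℝ (Fin d)) r ∧ (T (x - x₀)).snd ∈ Ioo (-h) h}

/-- In the cylinder `B'_r × (-h, h)` the boundary of `G` is the graph of `φ : B'_r → (-h, h)` and
`G` is the part of the cylinder below that graph. -/
def IsGraphIn (G : Set (EuclideanSpace ℝ (Fin (d + 1)))) (x₀ : EuclideanSpace ℝ (Fin (d + 1)))
    (T : Frame d) (r h : ℝ) (φ : EuclideanSpace ℝ (Fin d) → ℝ) : Prop :=
  ∀ y ∈ ball (0 : EuclideanSpace ℝ (Fin d)) r,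
    φ y ∈ Ioo (-h) h ∧
    ∀ t ∈ Ioo (-h) h, (pt x₀ T y t ∈ frontier G ↔ t = φ y) ∧ (pt x₀ T y t ∈ G ↔ t < φ y)

/-- `φ` is an `L`-Lipschitz local boundary chart of `G` on `B'_r`, in the coordinate system with
origin `x₀` and frame `T`; the height of the cylinder is `ℓ = r (1 + L)`. -/
def IsBoundaryChart (G : Set (EuclideanSpace ℝ (Fin (d + 1))))
    (x₀ : EuclideanSpace ℝ (Fin (d + 1))) (T : Frame d) (L : ℝ≥0) (r : ℝ)
    (φ : EuclideanSpace ℝ (Fin d) → ℝ) : Prop :=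
  LipschitzOnWith L φ (ball 0 r) ∧ φ 0 = 0 ∧ IsGraphIn G x₀ T r (r * (1 + L)) φ

/-- `G` is a Lipschitz domain with Lipschitz characteristic `(L, R)`. -/
def IsLipschitzDomain (G : Set (EuclideanSpace ℝ (Fin (d + 1)))) (L : ℝ≥0) (R : ℝ) : Prop :=
  IsOpen G ∧ IsConnected G ∧ 0 < L ∧ R ∈ Ioo (0 : ℝ) 1 ∧
    ∀ x₀ ∈ frontier G, ∀ r ∈ Ioc (0 : ℝ) R, ∃ (T : Frame d) (φ : EuclideanSpace ℝ (Fin d) → ℝ),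
      IsBoundaryChart G x₀ T L r φ

/-- `∂G` is of class `P`: near each of its points, in a suitable coordinate system centred there, it
is described by a Lipschitz chart that belongs to the function class `P (B'_r)`. -/
def BoundaryOfClass (P : Set (EuclideanSpace ℝ (Fin d)) → (EuclideanSpace ℝ (Fin d) → ℝ) → Prop)
    (G : Set (EuclideanSpace ℝ (Fin (d + 1)))) : Prop :=
  ∀ x₀ ∈ frontier G, ∃ (r : ℝ) (L : ℝ≥0) (T : Frame d) (φ : EuclideanSpace ℝ (Fin d) → ℝ),
    0 < r ∧ IsBoundaryChart G x₀ T L r φ ∧ P (ball 0 r) φ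

/-! ### Function spaces on an open set `U ⊆ ℝⁿ⁻¹` and convergence in them -/

/-- `u ∈ C^k(U)`. -/
def InCk (k : ℕ) (U : Set (EuclideanSpace ℝ (Fin d))) (u : EuclideanSpace ℝ (Fin d) → ℝ) : Prop :=
  ContDiffOn ℝ k u U

/-- `u ∈ C^{k,α}(U)`: the derivatives up to order `k` exist and are `α`-Hölder continuous on `U`. -/
def InHolder (k : ℕ) (α : ℝ≥0) (U : Set (EuclideanSpace ℝ (Fin d)))
    (u : EuclideanSpace ℝ (Fin d) → ℝ) : Prop :=
  InCk k U u ∧ ∀ j ≤ k, ∃ C : ℝ≥0, HolderOnWith C α (iteratedFDeriv ℝ j u) U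

/-- The iterated partial derivative `∂_{s 0} ⋯ ∂_{s (j-1)} η`. -/
def partialD {j : ℕ} (s : Fin j → Fin d) (η : EuclideanSpace ℝ (Fin d) → ℝ)
    (y : EuclideanSpace ℝ (Fin d)) : ℝ :=
  iteratedFDeriv ℝ j η y (fun a => EuclideanSpace.single (s a) (1 : ℝ))

/-- `g` is the weak derivative `∂_{s 0} ⋯ ∂_{s (j-1)} u` on `U`. -/
def HasWeakDeriv {j : ℕ} (s : Fin j → Fin d) (U : Set (EuclideanSpace ℝ (Fin d)))
    (u g : EuclideanSpace ℝ (Fin d) → ℝ) : Prop :=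
  LocallyIntegrableOn u U volume ∧ LocallyIntegrableOn g U volume ∧
    ∀ η : EuclideanSpace ℝ (Fin d) → ℝ, ContDiff ℝ ∞ η → HasCompactSupport η → tsupport η ⊆ U →
      ∫ y in U, u y * partialD s η y = (-1) ^ j * ∫ y in U, g y * η y

/-- `u ∈ W^{k,q}(U)`. -/
def InSobolev (k : ℕ) (q : ℝ≥0∞) (U : Set (EuclideanSpace ℝ (Fin d)))
    (u : EuclideanSpace ℝ (Fin d) → ℝ) : Prop :=
  ∀ j ≤ k, ∀ s : Fin j → Fin d, ∃ g : EuclideanSpace ℝ (Fin d) → ℝ,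
    HasWeakDeriv s U u g ∧ MemLp g q (volume.restrict U)

/-- `u m → v` in `C^k(U)`: all derivatives up to order `k` converge uniformly on `U`. -/
def TendstoCk (k : ℕ) (U : Set (EuclideanSpace ℝ (Fin d)))
    (u : ℕ → EuclideanSpace ℝ (Fin d) → ℝ) (v : EuclideanSpace ℝ (Fin d) → ℝ) : Prop :=
  InCk k U v ∧ (∀ᶠ m in atTop, InCk k U (u m)) ∧
    ∀ j ≤ k, TendstoUniformlyOn (fun m => iteratedFDeriv ℝ j (u m)) (iteratedFDeriv ℝ j v) atTop U

/-- `u m → v` in `C^{k,α}(U)`: convergence in `C^k(U)`, and the `α`-Hölder seminorms on `U` of the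
derivatives of `u m - v` up to order `k` tend to zero. -/
def TendstoHolder (k : ℕ) (α : ℝ≥0) (U : Set (EuclideanSpace ℝ (Fin d)))
    (u : ℕ → EuclideanSpace ℝ (Fin d) → ℝ) (v : EuclideanSpace ℝ (Fin d) → ℝ) : Prop :=
  InHolder k α U v ∧ (∀ᶠ m in atTop, InHolder k α U (u m)) ∧ TendstoCk k U u v ∧
    ∀ j ≤ k, ∀ δ : ℝ≥0, 0 < δ → ∀ᶠ m in atTop,
      HolderOnWith δ α (fun y => iteratedFDeriv ℝ j (u m) y - iteratedFDeriv ℝ j v y) U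

/-- `u m → v` in `W^{k,q}(U)`: all weak derivatives up to order `k` converge in `L^q(U)`. -/
def TendstoSobolev (k : ℕ) (q : ℝ≥0∞) (U : Set (EuclideanSpace ℝ (Fin d)))
    (u : ℕ → EuclideanSpace ℝ (Fin d) → ℝ) (v : EuclideanSpace ℝ (Fin d) → ℝ) : Prop :=
  ∀ j ≤ k, ∀ s : Fin j → Fin d,
    ∃ (g : ℕ → EuclideanSpace ℝ (Fin d) → ℝ) (g₀ : EuclideanSpace ℝ (Fin d) → ℝ),
      (HasWeakDeriv s U v g₀ ∧ MemLp g₀ q (volume.restrict U)) ∧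
      (∀ᶠ m in atTop, HasWeakDeriv s U (u m) (g m) ∧ MemLp (g m) q (volume.restrict U)) ∧
      Tendsto (fun m => eLpNorm (fun y => g m y - g₀ y) q (volume.restrict U)) atTop (𝓝 0)

/-- `u m → v` weakly-* in `W^{k,∞}(U)`: all weak derivatives up to order `k` converge weakly-* in
`L^∞(U) = L¹(U)*`. -/
def TendstoWeakStar (k : ℕ) (U : Set (EuclideanSpace ℝ (Fin d)))
    (u : ℕ → EuclideanSpace ℝ (Fin d) → ℝ) (v : EuclideanSpace ℝ (Fin d) → ℝ) : Prop :=
  ∀ j ≤ k, ∀ s : Fin j → Fin d,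
    ∃ (g : ℕ → EuclideanSpace ℝ (Fin d) → ℝ) (g₀ : EuclideanSpace ℝ (Fin d) → ℝ),
      (HasWeakDeriv s U v g₀ ∧ MemLp g₀ ⊤ (volume.restrict U)) ∧
      (∀ᶠ m in atTop, HasWeakDeriv s U (u m) (g m) ∧ MemLp (g m) ⊤ (volume.restrict U)) ∧
      ∀ h : EuclideanSpace ℝ (Fin d) → ℝ, Integrable h (volume.restrict U) →
        Tendsto (fun m => ∫ y in U, g m y * h y) atTop (𝓝 (∫ y in U, g₀ y * h y))

/-! ### The construction of the approximating sets -/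

/-- The kernel `exp (-1 / (1 - |y|²))` for `|y| < 1`, and `0` for `|y| ≥ 1`. -/
def kernel (y : EuclideanSpace ℝ (Fin d)) : ℝ := expNegInvGlue (1 - ‖y‖ ^ 2)

/-- The rescaled kernel `ρ_m (y) = m^{n-1} ρ (m y)`, `ρ` being the kernel normalised to unit mass. -/
def kernelAt (m : ℕ) (y : EuclideanSpace ℝ (Fin d)) : ℝ :=
  (m : ℝ) ^ d * (kernel ((m : ℝ) • y) / ∫ z : EuclideanSpace ℝ (Fin d), kernel z)

/-- The convolution `M_m (h) = h * ρ_m`. -/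
def mollify (m : ℕ) (h : EuclideanSpace ℝ (Fin d) → ℝ) (x : EuclideanSpace ℝ (Fin d)) : ℝ :=
  ∫ y, h y * kernelAt m (x - y)

/-- The vertical shift `‖M_m (φ) - φ‖_{L^∞(B'_{R-1/m})} + L / m`. -/
def shift (L : ℝ≥0) (R : ℝ) (m : ℕ) (φ : EuclideanSpace ℝ (Fin d) → ℝ) : ℝ :=
  sSup ((fun y => |mollify m φ y - φ y|) '' ball 0 (R - 1 / (m : ℝ))) + (L : ℝ) / m

/-- The choices made in the construction: a finite covering of `∂G` by balls centred on `∂G`, with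
`L`-Lipschitz charts on `B'_R` at the centres, and a smooth partition of unity on an open
neighbourhood `W` of the closure of `G`, subordinate to the concentric balls of radius `R / 4`
and to `G`. -/
structure Atlas (G : Set (EuclideanSpace ℝ (Fin (d + 1)))) (L : ℝ≥0) (R : ℝ) where
  N : ℕ
  x : Fin N → EuclideanSpace ℝ (Fin (d + 1))
  x_mem : ∀ i, x i ∈ frontier G
  cover : frontier G ⊆ ⋃ i, ball (x i) (R / 8)
  T : Fin N → Frame d
  φ : Fin N → EuclideanSpace ℝ (Fin d) → ℝ
  chart : ∀ i, IsBoundaryChart G (x i) (T i) L R (φ i)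
  W : Set (EuclideanSpace ℝ (Fin (d + 1)))
  W_open : IsOpen W
  closure_subset : closure G ⊆ W
  ξ₀ : EuclideanSpace ℝ (Fin (d + 1)) → ℝ
  ξ : Fin N → EuclideanSpace ℝ (Fin (d + 1)) → ℝ
  ξ₀_smooth : ContDiff ℝ ∞ ξ₀
  ξ_smooth : ∀ i, ContDiff ℝ ∞ (ξ i)
  ξ₀_nonneg : ∀ z, 0 ≤ ξ₀ z
  ξ_nonneg : ∀ i z, 0 ≤ ξ i z
  ξ₀_supp : tsupport ξ₀ ⊆ G
  ξ_supp : ∀ i, tsupport (ξ i) ⊆ ball (x i) (R / 4)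
  sum_eq_one : ∀ z ∈ W, ξ₀ z + ∑ i, ξ i z = 1

namespace Atlas

variable {G : Set (EuclideanSpace ℝ (Fin (d + 1)))} {L : ℝ≥0} {R : ℝ}

/-- The function `∑ⱼ (zₙ - Φʲ(z')) ξⱼ(p) - ξ₀(p)`, where `(z', zₙ)` are the coordinates of `p` in the
`j`-th coordinate system. -/
def definingFun (D : Atlas G L R) (Φ : Fin D.N → EuclideanSpace ℝ (Fin d) → ℝ)
    (p : EuclideanSpace ℝ (Fin (d + 1))) : ℝ :=
  ∑ j, ((D.T j (p - D.x j)).snd - Φ j (D.T j (p - D.x j)).fst) * D.ξ j p - D.ξ₀ p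

/-- The outer approximating set `Ω_m = {F_m < 0}`, built from the functions
`M_m (φʲ) + ‖M_m (φʲ) - φʲ‖_∞ + L / m`. -/
def outer (D : Atlas G L R) (m : ℕ) : Set (EuclideanSpace ℝ (Fin (d + 1))) :=
  {p ∈ D.W | D.definingFun (fun j y => mollify m (D.φ j) y + shift L R m (D.φ j)) p < 0}

/-- The inner approximating set `ω_m = {F̃_m < 0}`, built from the functions
`M_m (φʲ) - ‖M_m (φʲ) - φʲ‖_∞ - L / m`. -/
def inner (D : Atlas G L R) (m : ℕ) : Set (EuclideanSpace ℝ (Fin (d + 1))) :=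
  {p ∈ D.W | D.definingFun (fun j y => mollify m (D.φ j) y - shift L R m (D.φ j)) p < 0}

/-- `ψ` is a family of smooth local charts, on the balls `B'_{R-ε}` of the coordinate systems of the
atlas, which describes the whole boundary of `A`. -/
def Describes (D : Atlas G L R) (ε : ℝ) (A : Set (EuclideanSpace ℝ (Fin (d + 1))))
    (ψ : Fin D.N → EuclideanSpace ℝ (Fin d) → ℝ) : Prop :=
  (∀ i, ContDiffOn ℝ ∞ (ψ i) (ball 0 (R - ε)) ∧
    IsGraphIn A (D.x i) (D.T i) (R - ε) ((R - ε) * (1 + L)) (ψ i)) ∧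
  frontier A ⊆ ⋃ i, cylinder (D.x i) (D.T i) (R - ε) ((R - ε) * (1 + L))

end Atlas

end LipApprox

end

open Set Filter Topology MeasureTheory Metric
open scoped NNReal ENNReal ContDiff

noncomputable section

namespace LipApprox

variable {d : ℕ}

/-! Let F be the defining function built from the charts themselves, without mollification. It is
negative in Ω, zero on ∂Ω and positive at the points of W outside the closure of Ω. Both F⁺_m and
F⁻_m are locally uniform perturbations of F, so away from ∂Ω the sets Ω_m and ω_m agree with Ω for
large m. The two families are treated by one argument in which the vertical shift is any sequence
tending to 0.

The geometric core is transversality. Let two charts describe Ω near the same boundary point, with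
vertical directions e and e₂. For c = 1/(1+L) the vector e - c e₂ lies in the upward cone of the
first chart, so a short move along it from the boundary does not enter Ω. Read in the second chart,
this is a one-sided difference bound for its graph function, and such a bound survives averaging
(`LocalChart.exists_add_smul_le`, `fderiv_mollify_le`). The weights sum to 1 near ∂Ω, so F_m
increases at rate at least c/2 in the vertical direction of every chart, uniformly in m
(`AdaptedAt.eventually_le_fderiv`). The implicit function theorem then yields graphs that are
smooth, uniformly Lipschitz and uniformly convergent (`exists_graphSeq`).

Convergence of derivatives is a bootstrap (`S_pderiv_implicit`). The gradient of the graph function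
ψ_m is a quotient of directional derivatives of F_m along the graph, and these contain the mollified
gradients of the charts composed with the horizontal projection of the graph to chart j. If l orders
of derivatives of ∇ψ_m are under control, the quotient controls one more. The projections are
bi-Lipschitz, because F_m also increases in the vertical direction of chart j
(`dist_le_mul_dist_horiz`). Only closure under sums, products, reciprocals and bi-Lipschitz
composition is needed; `RegScale` isolates these properties, and there are two models. `holderScale`
serves C^k, C^{k,α} and C^{k,1}. In `sobolevScale`, with K = k - 1, a derivative of order j ≥ 1 of
the gradient lies in L^{Kq/j} and the gradient itself is bounded; Hölder's inequality makes the
weights additive. A Lipschitz function of class W^{K+1,q} belongs to this scale by the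
Gagliardo–Nirenberg inequality between L^∞ and W^{K,q} (`exists_derivEnergy_le`,
`WReg_of_inSobolev`), so no relation between kq and the dimension is required.

The hypothesis supplies regular charts in coordinate systems unrelated to the atlas. That the charts
of the atlas are regular as well follows from the same machinery: mollify a regular chart alone and
solve in the coordinates of the atlas. The resulting graphs converge in the scale to the chart of
the atlas, which inherits the regularity (`HasRegularCharts.exists_WReg`).

Compactness turns the local statements into statements on the whole ball. Hölder convergence with a
smaller exponent follows by interpolation, and weak-* convergence from uniform bounds and testing
with smooth functions. For k = 0 the uniform Lipschitz bound suffices. -/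

/-- The Euclidean space in which the boundary charts are defined. -/
abbrev Sp (d : ℕ) : Type := EuclideanSpace ℝ (Fin d)

/-! ### The mollifying kernel -/

lemma kernel_contDiff : ContDiff ℝ ∞ (kernel (d := d)) :=
  expNegInvGlue.contDiff.comp (contDiff_const.sub (contDiff_norm_sq ℝ))

lemma kernel_nonneg (y : Sp d) : 0 ≤ kernel y := expNegInvGlue.nonneg _

lemma kernel_eq_zero {y : Sp d} (hy : 1 ≤ ‖y‖) : kernel y = 0 :=
  expNegInvGlue.zero_of_nonpos (by nlinarith [norm_nonneg y])

lemma kernel_hasCompactSupport : HasCompactSupport (kernel (d := d)) :=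
  HasCompactSupport.of_support_subset_isCompact (isCompact_closedBall (0 : Sp d) 1) fun y hy => by
    by_contra h
    exact hy (kernel_eq_zero (by simpa using (not_le.1 (by simpa using h)).le))

lemma integral_kernel_pos : 0 < ∫ z : Sp d, kernel z :=
  kernel_contDiff.continuous.integral_pos_of_hasCompactSupport_nonneg_nonzero
    kernel_hasCompactSupport kernel_nonneg (x := 0)
    (expNegInvGlue.pos_of_pos (by simp)).ne'

lemma kernelAt_contDiff (m : ℕ) : ContDiff ℝ ∞ (kernelAt (d := d) m) :=
  contDiff_const.mul ((kernel_contDiff.comp (contDiff_const_smul _)).div_const _)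

lemma kernelAt_nonneg (m : ℕ) (y : Sp d) : 0 ≤ kernelAt m y :=
  mul_nonneg (by positivity) (div_nonneg (kernel_nonneg _) integral_kernel_pos.le)

lemma kernelAt_eq_zero {m : ℕ} (hm : 1 ≤ m) {y : Sp d} (hy : 1 / (m : ℝ) ≤ ‖y‖) :
    kernelAt m y = 0 := by
  have hm' : (0 : ℝ) < m := by exact_mod_cast hm
  rw [kernelAt, kernel_eq_zero, zero_div, mul_zero]
  rw [norm_smul, Real.norm_of_nonneg hm'.le]
  rwa [div_le_iff₀' hm'] at hy

lemma support_kernelAt_subset {m : ℕ} (hm : 1 ≤ m) :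
    Function.support (kernelAt (d := d) m) ⊆ ball 0 (1 / (m : ℝ)) := fun y hy => by
  by_contra h
  exact hy (kernelAt_eq_zero hm (by simpa using h))

lemma kernelAt_hasCompactSupport {m : ℕ} (hm : 1 ≤ m) : HasCompactSupport (kernelAt (d := d) m) :=
  HasCompactSupport.of_support_subset_isCompact (isCompact_closedBall (0 : Sp d) _)
    ((support_kernelAt_subset hm).trans ball_subset_closedBall)

lemma integral_kernelAt {m : ℕ} (hm : 1 ≤ m) : ∫ y : Sp d, kernelAt m y = 1 := by
  have hm' : (0 : ℝ) < m := by exact_mod_cast hm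
  have := integral_kernel_pos (d := d)
  simp only [kernelAt]
  rw [integral_const_mul, integral_div, Measure.integral_comp_smul]
  simp only [finrank_euclideanSpace, Fintype.card_fin, smul_eq_mul]
  rw [abs_of_nonneg (by positivity)]
  field_simp

lemma integrable_kernelAt {m : ℕ} (hm : 1 ≤ m) : Integrable (kernelAt (d := d) m) :=
  (kernelAt_contDiff m).continuous.integrable_of_hasCompactSupport (kernelAt_hasCompactSupport hm)

/-! ### Elementary properties of the mollification -/

lemma mollify_eq (m : ℕ) (h : Sp d → ℝ) (x : Sp d) :
    mollify m h x = ∫ z, h (x - z) * kernelAt m z := by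
  rw [mollify, ← integral_sub_left_eq_self _ volume x]
  simp

lemma integrable_mollify_integrand {m : ℕ} (hm : 1 ≤ m) {h : Sp d → ℝ} {x : Sp d}
    (hh : IntegrableOn h (ball x (1 / m))) : Integrable fun y => h y * kernelAt m (x - y) := by
  have hc : Continuous fun y : Sp d => kernelAt m (x - y) :=
    (kernelAt_contDiff m).continuous.comp (continuous_const.sub continuous_id)
  obtain ⟨C, hC⟩ := (kernelAt_hasCompactSupport (d := d) hm).exists_bound_of_continuous
    (kernelAt_contDiff m).continuous
  refine IntegrableOn.integrable_of_forall_notMem_eq_zero (s := ball x (1 / m)) ?_ fun y hy => ?_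
  · exact Integrable.mul_bdd (c := C) hh hc.aestronglyMeasurable (.of_forall fun y => hC _)
  · rw [kernelAt_eq_zero hm, mul_zero]
    rw [mem_ball, not_lt, dist_comm, dist_eq_norm] at hy
    exact hy

lemma integrable_mollify_integrand' {m : ℕ} (hm : 1 ≤ m) {h : Sp d → ℝ} {x : Sp d}
    (hh : IntegrableOn h (ball x (1 / m))) : Integrable fun z => h (x - z) * kernelAt m z := by
  have := (integrable_mollify_integrand hm hh).comp_sub_left x
  simpa using this

lemma mollify_congr {m : ℕ} (hm : 1 ≤ m) {h h' : Sp d → ℝ} {x : Sp d}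
    (H : EqOn h h' (ball x (1 / m))) : mollify m h x = mollify m h' x := by
  refine integral_congr_ae (.of_forall fun y => ?_)
  by_cases hy : y ∈ ball x (1 / (m : ℝ))
  · simp only [H hy]
  · rw [mem_ball, not_lt, dist_comm, dist_eq_norm] at hy
    simp only [kernelAt_eq_zero hm hy, mul_zero]

lemma mollify_const {m : ℕ} (hm : 1 ≤ m) (c : ℝ) (x : Sp d) : mollify m (fun _ => c) x = c := by
  rw [mollify_eq, integral_const_mul, integral_kernelAt hm, mul_one]

/-- Averaging against a probability density preserves inequalities between translates. Allowing two
functions and two base points covers Lipschitz bounds, difference quotients and the error of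
mollification at once. -/
lemma mollify_mono {m : ℕ} (hm : 1 ≤ m) {h h' : Sp d → ℝ} {x x' : Sp d} {c : ℝ}
    (h1 : IntegrableOn h (ball x (1 / m))) (h2 : IntegrableOn h' (ball x' (1 / m)))
    (H : ∀ z ∈ ball (0 : Sp d) (1 / m), h (x - z) ≤ h' (x' - z) + c) :
    mollify m h x ≤ mollify m h' x' + c := by
  have hc : c = ∫ z : Sp d, c * kernelAt m z := by
    rw [integral_const_mul, integral_kernelAt hm, mul_one]
  rw [mollify_eq, mollify_eq, hc, ← integral_add (integrable_mollify_integrand' hm h2)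
    ((integrable_kernelAt hm).const_mul c)]
  refine integral_mono (integrable_mollify_integrand' hm h1)
    ((integrable_mollify_integrand' hm h2).add ((integrable_kernelAt hm).const_mul c)) fun z => ?_
  by_cases hz : z ∈ ball (0 : Sp d) (1 / m)
  · have := mul_le_mul_of_nonneg_right (H z hz) (kernelAt_nonneg m z)
    simpa [add_mul] using this
  · have := kernelAt_eq_zero hm (by simpa using hz : 1 / (m : ℝ) ≤ ‖z‖)
    simp [this]

lemma abs_mollify_sub_le {m : ℕ} (hm : 1 ≤ m) {h h' : Sp d → ℝ} {x x' : Sp d} {c : ℝ}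
    (h1 : IntegrableOn h (ball x (1 / m))) (h2 : IntegrableOn h' (ball x' (1 / m)))
    (H : ∀ z ∈ ball (0 : Sp d) (1 / m), |h (x - z) - h' (x' - z)| ≤ c) :
    |mollify m h x - mollify m h' x'| ≤ c := by
  rw [abs_sub_le_iff]
  constructor
  · have := mollify_mono (c := c) hm h1 h2 fun z hz => by linarith [(abs_sub_le_iff.1 (H z hz)).1]
    linarith
  · have := mollify_mono (c := c) hm h2 h1 fun z hz => by linarith [(abs_sub_le_iff.1 (H z hz)).2]
    linarith

lemma abs_mollify_sub_self_le {m : ℕ} (hm : 1 ≤ m) {h : Sp d → ℝ} {x : Sp d} {c : ℝ}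
    (h1 : IntegrableOn h (ball x (1 / m)))
    (H : ∀ y ∈ ball x (1 / m), |h y - h x| ≤ c) : |mollify m h x - h x| ≤ c := by
  have := abs_mollify_sub_le (h' := fun _ => h x) (x' := x) hm h1 (integrableOn_const
    measure_ball_lt_top.ne) (c := c) fun z hz => H _ (by simpa [mem_ball, dist_eq_norm] using hz)
  rwa [mollify_const hm] at this

lemma integrableOn_ball_of_continuous {h : Sp d → ℝ} (hh : Continuous h) (x : Sp d) (r : ℝ) :
    IntegrableOn h (ball x r) :=
  (hh.locallyIntegrable.integrableOn_isCompact (isCompact_closedBall x r)).mono_set ball_subset_closedBall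

lemma abs_mollify_sub_le_of_lipschitz {m : ℕ} (hm : 1 ≤ m) {K : ℝ≥0} {h : Sp d → ℝ}
    (hh : LipschitzWith K h) (x : Sp d) : |mollify m h x - h x| ≤ K / m := by
  refine abs_mollify_sub_self_le hm (integrableOn_ball_of_continuous hh.continuous _ _)
    fun y hy => ?_
  have h1 := hh.dist_le_mul y x
  rw [Real.dist_eq] at h1
  have h2 : (K : ℝ) * dist y x ≤ K * (1 / m) :=
    mul_le_mul_of_nonneg_left (mem_ball.1 hy).le K.2
  rw [div_eq_mul_one_div]
  linarith

lemma lipschitzWith_mollify {m : ℕ} (hm : 1 ≤ m) {K : ℝ≥0} {h : Sp d → ℝ}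
    (hh : LipschitzWith K h) : LipschitzWith K (mollify m h) := by
  refine LipschitzWith.of_dist_le_mul fun x y => ?_
  rw [Real.dist_eq]
  refine abs_mollify_sub_le hm (integrableOn_ball_of_continuous hh.continuous _ _)
    (integrableOn_ball_of_continuous hh.continuous _ _) fun z _ => ?_
  have := hh.dist_le_mul (x - z) (y - z)
  rwa [Real.dist_eq, dist_sub_right] at this

/-! ### Partial derivatives and convolution with a test function -/

/-- The `a`-th partial derivative. -/
def pderiv (a : Fin d) (f : Sp d → ℝ) (y : Sp d) : ℝ :=
  fderiv ℝ f y (EuclideanSpace.single a (1 : ℝ))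

/-- The convolution of `h` with `κ`. -/
def conv (h κ : Sp d → ℝ) (x : Sp d) : ℝ := ∫ y, h y * κ (x - y)

lemma mollify_eq_conv (m : ℕ) (h : Sp d → ℝ) : mollify m h = conv h (kernelAt m) := rfl

lemma conv_eq_convolution (h κ : Sp d → ℝ) :
    conv h κ = convolution h κ (ContinuousLinearMap.mul ℝ ℝ) volume := rfl

lemma pderiv_contDiff {κ : Sp d → ℝ} (hκ : ContDiff ℝ ∞ κ) (a : Fin d) :
    ContDiff ℝ ∞ (pderiv a κ) :=
  (hκ.fderiv_right (m := ∞) (by simp)).clm_apply contDiff_const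

lemma pderiv_hasCompactSupport {κ : Sp d → ℝ} (hκ : HasCompactSupport κ) (a : Fin d) :
    HasCompactSupport (pderiv a κ) :=
  hκ.fderiv_apply (𝕜 := ℝ) _

lemma contDiff_conv {h κ : Sp d → ℝ} (hh : LocallyIntegrable h) (hκ : ContDiff ℝ ∞ κ)
    (hc : HasCompactSupport κ) : ContDiff ℝ ∞ (conv h κ) := by
  rw [conv_eq_convolution]
  exact hc.contDiff_convolution_right _ hh hκ

lemma pderiv_conv {h κ : Sp d → ℝ} (hh : LocallyIntegrable h) (hκ : ContDiff ℝ ∞ κ)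
    (hc : HasCompactSupport κ) (a : Fin d) : pderiv a (conv h κ) = conv h (pderiv a κ) := by
  ext x
  rw [pderiv, conv_eq_convolution, (hc.hasFDerivAt_convolution_right _ hh
    (hκ.of_le (by exact_mod_cast le_top)) x).fderiv,
    convolution_precompR_apply _ hh (hc.fderiv (𝕜 := ℝ)) (hκ.continuous_fderiv (by simp))]
  rfl

lemma contDiff_mollify {m : ℕ} (hm : 1 ≤ m) {h : Sp d → ℝ} (hh : LocallyIntegrable h) :
    ContDiff ℝ ∞ (mollify m h) :=
  contDiff_conv hh (kernelAt_contDiff m) (kernelAt_hasCompactSupport hm)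

/-- A directional difference bound is inherited by the derivative of the mollification. -/
lemma fderiv_mollify_le {m : ℕ} (hm : 1 ≤ m) {h : Sp d → ℝ} (hh : Continuous h)
    {x a : Sp d} {b ρ : ℝ} (hρ : 0 < ρ)
    (H : ∀ w ∈ ball x (1 / m), ∀ s ∈ Icc 0 ρ, h (w + s • a) ≤ h w + s * b) :
    fderiv ℝ (mollify m h) x a ≤ b := by
  have hd : DifferentiableAt ℝ (mollify m h) x :=
    (contDiff_mollify hm hh.locallyIntegrable).differentiable (by simp) x
  have h1 : HasDerivAt (fun s : ℝ => mollify m h (x + s • a)) (fderiv ℝ (mollify m h) x a) 0 := by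
    have h2 : HasDerivAt (fun s : ℝ => x + s • a) a 0 := by
      simpa using ((hasDerivAt_id (0 : ℝ)).smul_const a).const_add x
    have h3 : HasFDerivAt (mollify m h) (fderiv ℝ (mollify m h) x) (x + (0 : ℝ) • a) := by
      simpa using hd.hasFDerivAt
    exact h3.comp_hasDerivAt (0 : ℝ) h2
  -- The hypothesis concerns only s ≥ 0, so slopes from the right are used.
  have h4 := (hasDerivAt_iff_tendsto_slope.1 h1).mono_left
    (nhdsWithin_mono (0 : ℝ) (fun x (hx : x ∈ Ioi (0 : ℝ)) => (ne_of_gt hx)))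
  refine le_of_tendsto h4 ?_
  filter_upwards [Ioc_mem_nhdsGT hρ] with s hs
  have h5 : mollify m h (x + s • a) ≤ mollify m h x + s * b :=
    mollify_mono hm (integrableOn_ball_of_continuous hh _ _)
      (integrableOn_ball_of_continuous hh _ _) fun z hz => by
      have := H (x - z) (by simpa [mem_ball, dist_eq_norm] using hz) s ⟨hs.1.le, hs.2⟩
      rwa [show x + s • a - z = x - z + s • a by abel]
  rw [slope_def_field]
  simp only [zero_smul, add_zero, sub_zero]
  rw [div_le_iff₀ hs.1]
  linarith

/-! ### `L^p` estimates -/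

/-- Jensen's inequality for the probability measure with density `kernelAt m`, followed by Tonelli
and translation invariance. -/
lemma eLpNorm_mollify_le {m : ℕ} (hm : 1 ≤ m) {p : ℝ≥0∞} (hp : 1 ≤ p) (hp' : p ≠ ⊤)
    {g : Sp d → ℝ} (hg : MemLp g p) : eLpNorm (mollify m g) p volume ≤ eLpNorm g p volume := by
  have hp0 : p ≠ 0 := (zero_lt_one.trans_le hp).ne'
  have hpr : 0 < p.toReal := ENNReal.toReal_pos hp0 hp'
  set κ : Sp d → ℝ≥0∞ := fun z => ENNReal.ofReal (kernelAt m z) with hκ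
  have hκm : Measurable κ := (kernelAt_contDiff m).continuous.measurable.ennreal_ofReal
  set ν : Measure (Sp d) := volume.withDensity κ with hν
  have hν1 : IsProbabilityMeasure ν := ⟨by
    rw [hν, withDensity_apply _ MeasurableSet.univ, setLIntegral_univ, hκ,
      ← ofReal_integral_eq_lintegral_ofReal (integrable_kernelAt hm)
        (.of_forall (kernelAt_nonneg m)), integral_kernelAt hm, ENNReal.ofReal_one]⟩
  rw [eLpNorm_eq_lintegral_rpow_enorm_toReal hp0 hp', eLpNorm_eq_lintegral_rpow_enorm_toReal hp0 hp']
  refine ENNReal.rpow_le_rpow ?_ (by positivity)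
  -- A measurable representative makes `g' (x - z)` jointly measurable, as Tonelli requires; neither
  -- side of the inequality changes.
  obtain ⟨g', hg'm, hgg'⟩ := hg.1
  have hmg : mollify m g = mollify m g' := by
    ext x
    exact integral_congr_ae (hgg'.mono fun y hy => by simp only [hy])
  rw [hmg, lintegral_congr_ae (hgg'.mono fun y hy => by simp only [hy] : 
    (fun x => ‖g x‖ₑ ^ p.toReal) =ᵐ[volume] fun x => ‖g' x‖ₑ ^ p.toReal)]
  have hgm : Measurable g' := hg'm.measurable
  have hF : Measurable fun q : Sp d × Sp d => ‖g' (q.1 - q.2)‖ₑ ^ p.toReal :=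
    (hgm.comp (measurable_fst.sub measurable_snd)).enorm.pow_const _
  have key : ∀ x, ‖mollify m g' x‖ₑ ^ p.toReal ≤ ∫⁻ z, ‖g' (x - z)‖ₑ ^ p.toReal ∂ν := by
    intro x
    have hmx : Measurable fun z => g' (x - z) := hgm.comp (measurable_const.sub measurable_id)
    have h1 : ‖mollify m g' x‖ₑ ≤ ∫⁻ z, ‖g' (x - z)‖ₑ ∂ν := by
      rw [mollify_eq, hν, lintegral_withDensity_eq_lintegral_mul _ hκm hmx.enorm]
      refine (enorm_integral_le_lintegral_enorm _).trans (lintegral_mono fun z => ?_)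
      rw [enorm_mul, Pi.mul_apply, mul_comm, Real.enorm_of_nonneg (kernelAt_nonneg m z)]
    have h2 := eLpNorm_le_eLpNorm_of_exponent_le hp
      (hmx.aestronglyMeasurable (μ := ν))
    rw [eLpNorm_one_eq_lintegral_enorm, eLpNorm_eq_lintegral_rpow_enorm_toReal hp0 hp'] at h2
    calc _ ≤ ((∫⁻ z, ‖g' (x - z)‖ₑ ^ p.toReal ∂ν) ^ (1 / p.toReal)) ^ p.toReal :=
          ENNReal.rpow_le_rpow (h1.trans h2) hpr.le
      _ = _ := by rw [← ENNReal.rpow_mul, one_div_mul_cancel hpr.ne', ENNReal.rpow_one]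
  calc ∫⁻ x, ‖mollify m g' x‖ₑ ^ p.toReal
      ≤ ∫⁻ x, (∫⁻ z, ‖g' (x - z)‖ₑ ^ p.toReal ∂ν) ∂volume := lintegral_mono key
    _ = ∫⁻ z, (∫⁻ x, ‖g' (x - z)‖ₑ ^ p.toReal ∂volume) ∂ν :=
        lintegral_lintegral_swap hF.aemeasurable
    _ = ∫⁻ _, (∫⁻ x, ‖g' x‖ₑ ^ p.toReal ∂volume) ∂ν := by
        refine lintegral_congr fun z => ?_
        exact lintegral_sub_right_eq_self (fun x => ‖g' x‖ₑ ^ p.toReal) z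
    _ = _ := by simp

lemma mollify_sub {m : ℕ} (hm : 1 ≤ m) {g h : Sp d → ℝ} (hg : LocallyIntegrable g)
    (hh : LocallyIntegrable h) : mollify m (g - h) = mollify m g - mollify m h := by
  ext x
  have hi : ∀ {k : Sp d → ℝ}, LocallyIntegrable k → IntegrableOn k (ball x (1 / m)) := fun hk =>
    (hk.integrableOn_isCompact (isCompact_closedBall x _)).mono_set ball_subset_closedBall
  simp only [mollify, Pi.sub_apply, sub_mul]
  exact integral_sub (integrable_mollify_integrand hm (hi hg)) (integrable_mollify_integrand hm (hi hh))

/-- The mollifications are contractions of L^p, so it suffices to treat the dense class of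
continuous compactly supported functions, for which the convergence is uniform. -/
lemma tendsto_eLpNorm_mollify_sub {p : ℝ≥0∞} (hp : 1 ≤ p) (hp' : p ≠ ⊤) {g : Sp d → ℝ}
    (hg : MemLp g p) :
    Tendsto (fun m => eLpNorm (mollify m g - g) p volume) atTop (𝓝 0) := by
  rw [ENNReal.tendsto_nhds_zero]
  intro ε hε
  by_cases hεt : ε = ⊤
  · simp [hεt]
  have hε3 : ε / 3 ≠ 0 := by simp [hε.ne']
  obtain ⟨h, hcs, hgh, hhc, hhm⟩ := hg.exists_hasCompactSupport_eLpNorm_sub_le hp' hε3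
  -- One compact set contains the supports of h and of all its mollifications, so a uniform estimate
  -- is an L^p estimate.
  set K : Set (Sp d) := cthickening 1 (tsupport h) with hK
  have hKc : IsCompact K := IsCompact.cthickening hcs
  have hunif := Metric.uniformContinuous_iff.1 (hcs.uniformContinuous_of_continuous hhc)
  have hvt : volume K ^ (1 / p.toReal) ≠ ⊤ :=
    ENNReal.rpow_ne_top_of_nonneg (by positivity) hKc.measure_lt_top.ne
  obtain ⟨c, hc0, hc⟩ : ∃ c : ℝ, 0 < c ∧ volume K ^ (1 / p.toReal) * ENNReal.ofReal c ≤ ε / 3 := by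
    obtain ⟨c, hc, hc'⟩ := ENNReal.exists_nnreal_pos_mul_lt hvt hε3
    exact ⟨c, hc, by rw [mul_comm, ENNReal.ofReal_coe_nnreal]; exact hc'.le⟩
  obtain ⟨δ, hδ, hδ'⟩ := hunif c hc0
  obtain ⟨N, hN⟩ := exists_nat_one_div_lt hδ
  filter_upwards [eventually_ge_atTop (N + 1), eventually_ge_atTop 1] with m hmN hm
  have hm1 : 1 / (m : ℝ) < δ := lt_of_le_of_lt
    (one_div_le_one_div_of_le (by positivity) (by exact_mod_cast hmN)) hN
  have hm2 : 1 / (m : ℝ) ≤ 1 := by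
    rw [div_le_one (by exact_mod_cast hm)]; exact_mod_cast hm
  have hsub : mollify m g - g = mollify m (g - h) + (mollify m h - h) + (h - g) := by
    rw [mollify_sub hm (hg.locallyIntegrable hp) hhc.locallyIntegrable]; abel
  have hcont : Continuous (mollify m h - h) :=
    (contDiff_mollify hm hhc.locallyIntegrable).continuous.sub hhc
  have hcont' : Continuous (mollify m (g - h)) :=
    (contDiff_mollify hm ((hg.sub hhm).locallyIntegrable hp)).continuous
  have h2 : eLpNorm (mollify m h - h) p volume ≤ ε / 3 := by
    have hz : ∀ x ∉ K, (mollify m h - h) x = 0 := by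
      intro x hx
      have hz' : ∀ y ∈ ball x (1 / (m : ℝ)), h y = 0 := by
        intro y hy
        by_contra hne
        refine hx (mem_cthickening_of_dist_le x y 1 _ (subset_tsupport _ hne) ?_)
        rw [dist_comm]; exact (mem_ball.1 hy).le.trans hm2
      have h0 := hz' x (mem_ball_self (by positivity))
      rw [Pi.sub_apply, h0, mollify_congr hm (h' := fun _ => 0) hz', mollify_const hm, sub_zero]
    have hb : ∀ x, ‖(mollify m h - h) x‖ ≤ c := fun x => by
      rw [Real.norm_eq_abs, Pi.sub_apply]
      refine abs_mollify_sub_self_le hm (integrableOn_ball_of_continuous hhc _ _) fun y hy => ?_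
      exact (hδ' ((mem_ball.1 hy).trans hm1)).le
    rw [← eLpNorm_restrict_eq_of_support_subset (s := K)
      (fun x hx => by by_contra hn; exact hx (hz x hn))]
    refine (eLpNorm_le_of_ae_bound (.of_forall hb)).trans ?_
    simpa [one_div] using hc
  rw [hsub]
  calc _ ≤ eLpNorm (mollify m (g - h) + (mollify m h - h)) p volume + eLpNorm (h - g) p volume :=
        eLpNorm_add_le (hcont'.add hcont).aestronglyMeasurable (hhm.sub hg).1 hp
    _ ≤ eLpNorm (mollify m (g - h)) p volume + eLpNorm (mollify m h - h) p volume
          + eLpNorm (h - g) p volume := by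
        gcongr; exact eLpNorm_add_le hcont'.aestronglyMeasurable hcont.aestronglyMeasurable hp
    _ ≤ ε / 3 + ε / 3 + ε / 3 := by
        gcongr
        · exact (eLpNorm_mollify_le hm hp hp' (hg.sub hhm)).trans hgh
        · rw [eLpNorm_sub_comm]; exact hgh
    _ = ε := ENNReal.add_thirds ε

/-! ### Iterated partial derivatives -/

@[simp] lemma partialD_fin_zero (σ : Fin 0 → Fin d) (f : Sp d → ℝ) : partialD σ f = f := by
  ext y; simp [partialD]

/-- The last index is the one applied first to f. This convention is why every induction on
multi-indices splits σ into `Fin.init σ` and its last entry. -/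
lemma partialD_succ {j : ℕ} (σ : Fin (j + 1) → Fin d) {f : Sp d → ℝ} {y : Sp d}
    (hf : ContDiffAt ℝ (j + 1 : ℕ) f y) :
    partialD σ f y = partialD (Fin.init σ) (pderiv (σ (Fin.last j)) f) y := by
  have h1 : ContDiffAt ℝ j (fderiv ℝ f) y := hf.fderiv_right (by norm_cast)
  rw [partialD, iteratedFDeriv_succ_apply_right, partialD]
  have h2 := ContinuousLinearMap.iteratedFDeriv_comp_left
    (ContinuousLinearMap.apply ℝ ℝ (EuclideanSpace.single (σ (Fin.last j)) (1 : ℝ))) h1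
    (i := j) le_rfl
  have h3 : pderiv (σ (Fin.last j)) f = (ContinuousLinearMap.apply ℝ ℝ
    (EuclideanSpace.single (σ (Fin.last j)) (1 : ℝ))) ∘ fderiv ℝ f := rfl
  rw [h3, h2]
  rfl

lemma partialD_congr {j : ℕ} (σ : Fin j → Fin d) {f g : Sp d → ℝ} {V : Set (Sp d)} (hV : IsOpen V)
    (h : EqOn f g V) : EqOn (partialD σ f) (partialD σ g) V := fun y hy => by
  have : f =ᶠ[𝓝 y] g := h.eventuallyEq_of_mem (hV.mem_nhds hy)
  rw [partialD, partialD, (this.iteratedFDeriv (𝕜 := ℝ) j).eq_of_nhds]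

lemma pderiv_congr (a : Fin d) {f g : Sp d → ℝ} {V : Set (Sp d)} (hV : IsOpen V)
    (h : EqOn f g V) : EqOn (pderiv a f) (pderiv a g) V := fun y hy => by
  have : f =ᶠ[𝓝 y] g := h.eventuallyEq_of_mem (hV.mem_nhds hy)
  rw [pderiv, pderiv, this.fderiv_eq]

lemma contDiffOn_pderiv {V : Set (Sp d)} (hV : IsOpen V) {f : Sp d → ℝ} {n m : WithTop ℕ∞}
    (hf : ContDiffOn ℝ n f V) (hmn : m + 1 ≤ n) (a : Fin d) : ContDiffOn ℝ m (pderiv a f) V :=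
  (hf.fderiv_of_isOpen hV hmn).clm_apply contDiffOn_const

lemma contDiffOn_pderiv_infty {V : Set (Sp d)} (hV : IsOpen V) {f : Sp d → ℝ}
    (hf : ContDiffOn ℝ ∞ f V) (a : Fin d) : ContDiffOn ℝ ∞ (pderiv a f) V :=
  contDiffOn_pderiv hV hf (by simp) a

lemma continuousOn_partialD {V : Set (Sp d)} (hV : IsOpen V) {f : Sp d → ℝ} {j : ℕ}
    (σ : Fin j → Fin d) (hf : ContDiffOn ℝ j f V) : ContinuousOn (partialD σ f) V := by
  intro y hy
  refine ContinuousAt.continuousWithinAt ?_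
  have h1 : ContinuousAt (iteratedFDeriv ℝ j f) y :=
    ((hf.contDiffAt (hV.mem_nhds hy)).iteratedFDeriv_right (m := 0) (i := j) (by rw [zero_add])).continuousAt
  exact (ContinuousMultilinearMap.apply ℝ (fun _ : Fin j => Sp d) ℝ
    (fun a => EuclideanSpace.single (σ a) (1 : ℝ))).continuous.continuousAt.comp h1

lemma contDiff_partialD {f : Sp d → ℝ} {j : ℕ} (σ : Fin j → Fin d) (hf : ContDiff ℝ ∞ f) :
    ContDiff ℝ ∞ (partialD σ f) :=
  (ContinuousMultilinearMap.apply ℝ (fun _ : Fin j => Sp d) ℝ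
    (fun a => EuclideanSpace.single (σ a) (1 : ℝ))).contDiff.comp
    (hf.iteratedFDeriv_right (m := ∞) (i := j) (by exact le_rfl))

lemma tsupport_pderiv_subset (a : Fin d) (f : Sp d → ℝ) : tsupport (pderiv a f) ⊆ tsupport f :=
  tsupport_fderiv_apply_subset ℝ _

lemma support_partialD_subset {j : ℕ} (σ : Fin j → Fin d) (f : Sp d → ℝ) :
    Function.support (partialD σ f) ⊆ tsupport f := fun y hy => by
  by_contra h
  have h0 : (Function.support f)ᶜ ∈ 𝓝 y := by
    filter_upwards [(isClosed_tsupport f).isOpen_compl.mem_nhds h] with z hz hz'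
    exact hz (subset_tsupport f hz')
  have h1 : f =ᶠ[𝓝 y] fun _ => 0 := by
    filter_upwards [h0] with z hz using by simpa using hz
  apply hy
  rw [partialD, (h1.iteratedFDeriv (𝕜 := ℝ) j).eq_of_nhds]
  have : iteratedFDeriv ℝ j (fun _ : Sp d => (0 : ℝ)) = 0 := iteratedFDeriv_fun_zero
  rw [this]; rfl

lemma partialD_hasCompactSupport {j : ℕ} (σ : Fin j → Fin d) {f : Sp d → ℝ}
    (hf : HasCompactSupport f) : HasCompactSupport (partialD σ f) :=
  HasCompactSupport.of_support_subset_isCompact hf (support_partialD_subset σ f)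

lemma pderiv_comm (a b : Fin d) {f : Sp d → ℝ} (hf : ContDiff ℝ ∞ f) :
    pderiv a (pderiv b f) = pderiv b (pderiv a f) := by
  ext y
  have hd : DifferentiableAt ℝ (fderiv ℝ f) y :=
    (hf.fderiv_right (m := ∞) (by simp)).differentiable (by simp) y
  have h : ∀ a b : Fin d, pderiv a (pderiv b f) y = fderiv ℝ (fderiv ℝ f) y
      (EuclideanSpace.single a 1) (EuclideanSpace.single b 1) := fun a b => by
    have : pderiv b f = fun z => fderiv ℝ f z (EuclideanSpace.single b 1) := rfl
    rw [pderiv, this, fderiv_clm_apply hd (differentiableAt_const _)]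
    simp
  rw [h, h]
  exact ((contDiff_infty.1 hf 2).contDiffAt.isSymmSndFDerivAt (by simp)) _ _

/-- Symmetry of second derivatives moves the additional index through the multi-index. This
reconciles the order fixed by `partialD_succ` with integration by parts, which removes the outermost
derivative. -/
lemma pderiv_partialD {j : ℕ} (σ : Fin j → Fin d) (a : Fin d) {f : Sp d → ℝ}
    (hf : ContDiff ℝ ∞ f) : pderiv a (partialD σ f) = partialD σ (pderiv a f) := by
  induction j generalizing f with
  | zero => simp
  | succ j ih =>
    have h1 : partialD σ f = partialD (Fin.init σ) (pderiv (σ (Fin.last j)) f) := by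
      ext y; exact partialD_succ σ (hf.of_le (by exact_mod_cast le_top)).contDiffAt
    have h2 : partialD σ (pderiv a f) =
        partialD (Fin.init σ) (pderiv (σ (Fin.last j)) (pderiv a f)) := by
      ext y
      exact partialD_succ σ ((pderiv_contDiff hf a).of_le (by exact_mod_cast le_top)).contDiffAt
    rw [h1, h2, ih _ (pderiv_contDiff hf _), pderiv_comm _ _ hf]

lemma partialD_conv {h κ : Sp d → ℝ} (hh : LocallyIntegrable h) (hκ : ContDiff ℝ ∞ κ)
    (hc : HasCompactSupport κ) {j : ℕ} (σ : Fin j → Fin d) :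
    partialD σ (conv h κ) = conv h (partialD σ κ) := by
  induction j generalizing κ with
  | zero => simp
  | succ j ih =>
    ext y
    rw [partialD_succ σ ((contDiff_conv hh hκ hc).of_le (by exact_mod_cast le_top)).contDiffAt,
      pderiv_conv hh hκ hc, ih (pderiv_contDiff hκ _) (pderiv_hasCompactSupport hc _)]
    congr 1
    ext z
    exact (partialD_succ σ (hκ.of_le (by exact_mod_cast le_top)).contDiffAt).symm

/-- Each derivative of the reflected kernel contributes a sign; the factor `c` is there to carry it
through the induction. -/
lemma partialD_comp_sub_left {κ : Sp d → ℝ} (hκ : ContDiff ℝ ∞ κ) {j : ℕ} (σ : Fin j → Fin d)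
    (c : ℝ) (x y : Sp d) :
    partialD σ (fun y => c * κ (x - y)) y = c * (-1) ^ j * partialD σ κ (x - y) := by
  induction j generalizing κ c with
  | zero => simp
  | succ j ih =>
    have hs : ContDiff ℝ ∞ fun y => c * κ (x - y) :=
      contDiff_const.mul (hκ.comp (contDiff_const.sub contDiff_id))
    have h1 : pderiv (σ (Fin.last j)) (fun y => c * κ (x - y)) =
        fun y => (-c) * pderiv (σ (Fin.last j)) κ (x - y) := by
      ext z
      have hd : HasFDerivAt κ (fderiv ℝ κ (x - z)) (x - z) :=
        (hκ.differentiable (by simp) _).hasFDerivAt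
      have := ((hd.comp z ((hasFDerivAt_id z).const_sub x)).const_mul c).fderiv
      simp only [Function.comp_def] at this
      rw [pderiv, this]
      simp [pderiv]
    rw [partialD_succ σ (hs.of_le (by exact_mod_cast le_top)).contDiffAt, h1,
      ih (pderiv_contDiff hκ _), partialD_succ σ (hκ.of_le (by exact_mod_cast le_top)).contDiffAt]
    ring

/-! ### Products with functions of compact support -/

lemma contDiff_mul_of_tsupport_subset {E : Type*} [NormedAddCommGroup E] [NormedSpace ℝ E]
    {V : Set E} (hV : IsOpen V) {f η : E → ℝ} {n : WithTop ℕ∞} (hf : ContDiffOn ℝ n f V)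
    (hη : ContDiff ℝ n η) (hs : tsupport η ⊆ V) : ContDiff ℝ n fun y => f y * η y := by
  rw [contDiff_iff_contDiffAt]
  intro y
  by_cases hy : y ∈ tsupport η
  · exact (hf.contDiffAt (hV.mem_nhds (hs hy))).mul hη.contDiffAt
  · have : (fun y => f y * η y) =ᶠ[𝓝 y] fun _ => 0 := by
      filter_upwards [(isClosed_tsupport η).isOpen_compl.mem_nhds hy] with z hz
      rw [image_eq_zero_of_notMem_tsupport hz, mul_zero]
    exact contDiffAt_const.congr_of_eventuallyEq this

lemma setIntegral_mul_test {V : Set (Sp d)} (u : Sp d → ℝ) {η : Sp d → ℝ}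
    (hs : Function.support η ⊆ V) : ∫ y in V, u y * η y = ∫ y, u y * η y :=
  setIntegral_eq_integral_of_forall_compl_eq_zero fun y hy => by
    rw [Function.notMem_support.1 (fun h => hy (hs h)), mul_zero]

/-! ### Weak derivatives -/

/-- First-order integration by parts against a test function. -/
lemma setIntegral_mul_pderiv {V : Set (Sp d)} (hV : IsOpen V) {f η : Sp d → ℝ}
    (hf : ContDiffOn ℝ 1 f V) (hη : ContDiff ℝ ∞ η) (hc : HasCompactSupport η)
    (hs : tsupport η ⊆ V) (a : Fin d) :
    ∫ y in V, f y * pderiv a η y = - ∫ y in V, pderiv a f y * η y := by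
  have hsup : Function.support η ⊆ V := (subset_tsupport η).trans hs
  have hη1 : ContDiff ℝ 1 η := hη.of_le (by exact_mod_cast le_top)
  have hF : ContDiff ℝ 1 fun y => f y * η y := contDiff_mul_of_tsupport_subset hV hf hη1 hs
  have hFc : HasCompactSupport fun y => f y * η y := hc.mul_left
  have hpc : HasCompactSupport (pderiv a η) := pderiv_hasCompactSupport hc a
  have hi1 : Continuous fun y => f y * pderiv a η y :=
    (contDiff_mul_of_tsupport_subset (n := 0) hV (hf.of_le zero_le_one)
      ((pderiv_contDiff hη a).of_le (by simp)) ((tsupport_pderiv_subset a η).trans hs)).continuous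
  have hi2 : Continuous fun y => pderiv a f y * η y :=
    (contDiff_mul_of_tsupport_subset (n := 0) hV (contDiffOn_pderiv hV hf (by simp) a)
      (hη.of_le (by simp)) hs).continuous
  have hprod : ∀ y, pderiv a (fun y => f y * η y) y = f y * pderiv a η y + pderiv a f y * η y := by
    intro y
    by_cases hy : y ∈ V
    · have h1 := ((hf.contDiffAt (hV.mem_nhds hy)).differentiableAt (by simp)).hasFDerivAt
      have h2 := ((hη1.differentiable (by simp)) y).hasFDerivAt
      have := (h1.mul h2).fderiv
      rw [pderiv, show (fun y => f y * η y) = f * η from rfl, this]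
      simp [pderiv, mul_comm]
    · have hy' : y ∉ tsupport η := fun h => hy (hs h)
      have h1 : y ∉ tsupport (fun y => f y * η y) := fun h => hy' (tsupport_mul_subset_right h)
      rw [image_eq_zero_of_notMem_tsupport (fun h => h1 (tsupport_pderiv_subset a _ h)),
        image_eq_zero_of_notMem_tsupport (fun h => hy' (tsupport_pderiv_subset a _ h)),
        image_eq_zero_of_notMem_tsupport hy']
      ring
  have hzero : ∫ y, pderiv a (fun y => f y * η y) y = 0 := by
    have hfη : Integrable fun y => f y * η y := hF.continuous.integrable_of_hasCompactSupport hFc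
    have hfη' : Integrable fun y => pderiv a (fun y => f y * η y) y := by
      refine Continuous.integrable_of_hasCompactSupport ?_ (pderiv_hasCompactSupport hFc a)
      exact (hF.continuous_fderiv (by simp)).clm_apply continuous_const
    -- Integration by parts against the constant function 1: the derivative of a compactly supported
    -- function has integral zero.
    have := integral_mul_fderiv_eq_neg_fderiv_mul_of_integrable (μ := (volume : Measure (Sp d)))
      (f := fun _ : Sp d => (1 : ℝ)) (g := fun y => f y * η y) (v := EuclideanSpace.single a 1)
      (by simp) (by simpa [pderiv] using hfη') (by simpa using hfη)
      (fun _ _ => by fun_prop) (fun x _ => hF.differentiable (by simp) x)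
    simpa [pderiv] using this
  rw [setIntegral_mul_test f (((subset_tsupport _).trans (tsupport_pderiv_subset a η)).trans hs),
    setIntegral_mul_test _ hsup]
  simp only [hprod] at hzero
  rw [integral_add (hi1.integrable_of_hasCompactSupport hpc.mul_left)
    (hi2.integrable_of_hasCompactSupport hc.mul_left)] at hzero
  linarith

/-- One integration by parts for each index. The outermost derivative of the test function is moved
to f, and the remaining derivatives of the test function are handled by induction. -/
lemma hasWeakDeriv_partialD {V : Set (Sp d)} (hV : IsOpen V) {j : ℕ} (σ : Fin j → Fin d)
    {f : Sp d → ℝ} (hf : ContDiffOn ℝ j f V) : HasWeakDeriv σ V f (partialD σ f) := by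
  refine ⟨hf.continuousOn.locallyIntegrableOn hV.measurableSet,
    (continuousOn_partialD hV σ hf).locallyIntegrableOn hV.measurableSet, fun η hη hc hs => ?_⟩
  induction j generalizing f with
  | zero => simp
  | succ j ih =>
    have h1 : partialD σ η = pderiv (σ (Fin.last j)) (partialD (Fin.init σ) η) := by
      ext y
      rw [partialD_succ σ (hη.of_le (by exact_mod_cast le_top)).contDiffAt, pderiv_partialD _ _ hη]
    rw [h1, setIntegral_mul_pderiv hV (hf.of_le (by exact_mod_cast Nat.le_add_left 1 j))
      (contDiff_partialD _ hη) (partialD_hasCompactSupport _ hc)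
      ((closure_minimal (support_partialD_subset _ η) (isClosed_tsupport η)).trans hs),
      ih (Fin.init σ) (contDiffOn_pderiv hV hf (by norm_cast) _), pow_succ]
    rw [setIntegral_congr_fun hV.measurableSet (fun y hy => by
      beta_reduce
      rw [partialD_succ σ (hf.contDiffAt (hV.mem_nhds hy))] :
      EqOn (fun y => partialD σ f y * η y) (fun y => partialD (Fin.init σ)
        (pderiv (σ (Fin.last j)) f) y * η y) V)]
    ring

/-- The derivatives of a mollified function are the mollified weak derivatives. -/
lemma HasWeakDeriv.partialD_mollify {V : Set (Sp d)} {j : ℕ} {σ : Fin j → Fin d} {f g : Sp d → ℝ}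
    (h : HasWeakDeriv σ V f g) (hf : LocallyIntegrable f) {m : ℕ} (hm : 1 ≤ m) {x : Sp d}
    (hx : closedBall x (1 / m) ⊆ V) : partialD σ (mollify m f) x = mollify m g x := by
  have hsup : Function.support (fun y => kernelAt m (x - y)) ⊆ closedBall x (1 / m) := by
    intro y hy
    have := support_kernelAt_subset hm hy
    rw [mem_ball_zero_iff, ← dist_eq_norm, dist_comm] at this
    exact this.le
  have hts : tsupport (fun y => kernelAt m (x - y)) ⊆ closedBall x (1 / m) :=
    closure_minimal hsup isClosed_closedBall
  have hc : HasCompactSupport fun y => kernelAt m (x - y) :=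
    HasCompactSupport.of_support_subset_isCompact (isCompact_closedBall x _) hsup
  have hsm : ContDiff ℝ ∞ fun y : Sp d => kernelAt m (x - y) :=
    (kernelAt_contDiff m).comp (contDiff_const.sub contDiff_id)
  -- The test function is the reflected kernel centred at x. The sign produced by differentiating it
  -- cancels the sign in the definition of the weak derivative.
  have h1 := h.2.2 _ hsm hc (hts.trans hx)
  rw [setIntegral_mul_test _ (hsup.trans hx), setIntegral_mul_test _
    ((support_partialD_subset _ _).trans (hts.trans hx))] at h1
  rw [mollify_eq_conv, partialD_conv hf (kernelAt_contDiff m) (kernelAt_hasCompactSupport hm)]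
  have h2 : ∀ y, partialD σ (fun y => kernelAt m (x - y)) y
      = (-1) ^ j * partialD σ (kernelAt m) (x - y) := fun y => by
    have := partialD_comp_sub_left (kernelAt_contDiff m) σ 1 x y
    simpa using this
  simp only [h2] at h1
  have h3 : ∫ y, f y * ((-1) ^ j * partialD σ (kernelAt m) (x - y)) =
      (-1) ^ j * conv f (partialD σ (kernelAt m)) x := by
    rw [conv, ← integral_const_mul]
    congr 1; ext y; ring
  rw [h3] at h1
  exact mul_left_cancel₀ (pow_ne_zero _ (by norm_num)) h1

lemma tendsto_setIntegral_mul_of_L1 {ι : Type*} {l : Filter ι} {V : Set (Sp d)}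
    {f : ι → Sp d → ℝ} {f₀ ζ : Sp d → ℝ} {C : ℝ} (hζ : Continuous ζ) (hC : ∀ y, ‖ζ y‖ ≤ C)
    (hf : ∀ᶠ m in l, MemLp (f m) 1 (volume.restrict V)) (hf₀ : MemLp f₀ 1 (volume.restrict V))
    (h : Tendsto (fun m => eLpNorm (f m - f₀) 1 (volume.restrict V)) l (𝓝 0)) :
    Tendsto (fun m => ∫ y in V, f m y * ζ y) l (𝓝 (∫ y in V, f₀ y * ζ y)) := by
  have hb : ∀ g : Sp d → ℝ, Integrable g (volume.restrict V) →
      Integrable (fun y => g y * ζ y) (volume.restrict V) := fun g hg =>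
    hg.mul_bdd (c := C) hζ.aestronglyMeasurable (.of_forall hC)
  refine tendsto_integral_of_L1' _ (hb _ (memLp_one_iff_integrable.1 hf₀)).1 ?_ ?_
  · filter_upwards [hf] with m hm using hb _ (memLp_one_iff_integrable.1 hm)
  · have h2 : Tendsto (fun m => ENNReal.ofReal C * eLpNorm (f m - f₀) 1 (volume.restrict V)) l
        (𝓝 0) := by simpa using ENNReal.Tendsto.const_mul h (Or.inr ENNReal.ofReal_ne_top)
    refine tendsto_of_tendsto_of_tendsto_of_le_of_le tendsto_const_nhds h2 (fun _ => zero_le) ?_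
    intro m
    refine eLpNorm_le_mul_eLpNorm_of_ae_le_mul (.of_forall fun y => ?_) 1
    simp only [Pi.sub_apply, ← sub_mul, norm_mul]
    rw [mul_comm]
    gcongr
    exact hC y

/-- Both sides of the defining identity are integrals against bounded functions, hence continuous
for L¹ convergence. -/
lemma hasWeakDeriv_of_tendsto_L1 {V : Set (Sp d)} {j : ℕ} {σ : Fin j → Fin d}
    {f g : ℕ → Sp d → ℝ} {f₀ g₀ : Sp d → ℝ} (h : ∀ᶠ m in atTop, HasWeakDeriv σ V (f m) (g m))
    (hf : ∀ᶠ m in atTop, MemLp (f m) 1 (volume.restrict V)) (hf₀ : MemLp f₀ 1 (volume.restrict V))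
    (hg : ∀ᶠ m in atTop, MemLp (g m) 1 (volume.restrict V)) (hg₀ : MemLp g₀ 1 (volume.restrict V))
    (hff : Tendsto (fun m => eLpNorm (f m - f₀) 1 (volume.restrict V)) atTop (𝓝 0))
    (hgg : Tendsto (fun m => eLpNorm (g m - g₀) 1 (volume.restrict V)) atTop (𝓝 0)) :
    HasWeakDeriv σ V f₀ g₀ := by
  refine ⟨IntegrableOn.locallyIntegrableOn (memLp_one_iff_integrable.1 hf₀),
    IntegrableOn.locallyIntegrableOn (memLp_one_iff_integrable.1 hg₀), fun η hη hc hs => ?_⟩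
  obtain ⟨C, hC⟩ := hc.exists_bound_of_continuous hη.continuous
  obtain ⟨C', hC'⟩ := (partialD_hasCompactSupport σ hc).exists_bound_of_continuous
    (contDiff_partialD σ hη).continuous
  have h1 := tendsto_setIntegral_mul_of_L1 (contDiff_partialD σ hη).continuous hC' hf hf₀ hff
  have h2 := (tendsto_setIntegral_mul_of_L1 hη.continuous hC hg hg₀ hgg).const_mul ((-1 : ℝ) ^ j)
  refine tendsto_nhds_unique h1 (h2.congr' ?_)
  filter_upwards [h] with m hm using (hm.2.2 η hη hc hs).symm

lemma HasWeakDeriv.mono {V V' : Set (Sp d)} (hV : V' ⊆ V) {j : ℕ} {σ : Fin j → Fin d}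
    {f g : Sp d → ℝ} (h : HasWeakDeriv σ V f g) : HasWeakDeriv σ V' f g := by
  refine ⟨h.1.mono_set hV, h.2.1.mono_set hV, fun η hη hc hs => ?_⟩
  have hs' : Function.support η ⊆ V' := (subset_tsupport η).trans hs
  have := h.2.2 η hη hc (hs.trans hV)
  rwa [setIntegral_mul_test _ (hs'.trans hV), setIntegral_mul_test _
    ((support_partialD_subset σ η).trans (hs.trans hV)),
    ← setIntegral_mul_test _ hs', ← setIntegral_mul_test _
    ((support_partialD_subset σ η).trans hs)] at this

lemma HasWeakDeriv.congr_left {V : Set (Sp d)} (hV : MeasurableSet V) {j : ℕ} {σ : Fin j → Fin d}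
    {f f' g : Sp d → ℝ} (h : HasWeakDeriv σ V f g) (hff : EqOn f f' V) :
    HasWeakDeriv σ V f' g := by
  refine ⟨fun x hx => ?_, h.2.1, fun η hη hc hs => ?_⟩
  · obtain ⟨s, hs, hi⟩ := h.1 x hx
    refine ⟨s ∩ V, inter_mem hs self_mem_nhdsWithin, ?_⟩
    obtain ⟨t, ht, hts⟩ := mem_nhdsWithin_iff_exists_mem_nhds_inter.1 hs
    refine ((hi.mono_set inter_subset_left).congr ?_)
    exact ae_restrict_of_ae_restrict_of_subset inter_subset_right
      ((ae_restrict_iff' hV).2 (.of_forall fun y hy => hff hy))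
  · rw [← h.2.2 η hη hc hs]
    exact setIntegral_congr_fun hV fun y hy => by simp only [hff hy]

/-- Composition of weak derivatives. -/
lemma HasWeakDeriv.snoc {V : Set (Sp d)} {j : ℕ} {σ : Fin (j + 1) → Fin d} {f u g : Sp d → ℝ}
    (h : HasWeakDeriv (Fin.init σ) V f u)
    (h' : HasWeakDeriv (fun _ : Fin 1 => σ (Fin.last j)) V u g) : HasWeakDeriv σ V f g := by
  refine ⟨h.1, h'.2.1, fun η hη hc hs => ?_⟩
  have h1 : partialD σ η = partialD (Fin.init σ) (pderiv (σ (Fin.last j)) η) := by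
    ext y; exact partialD_succ σ (hη.of_le (by exact_mod_cast le_top)).contDiffAt
  have h2 : partialD (fun _ : Fin 1 => σ (Fin.last j)) η = pderiv (σ (Fin.last j)) η := by
    ext y
    rw [partialD_succ _ (hη.of_le (by exact_mod_cast le_top)).contDiffAt]
    simp
  have h3 := h'.2.2 η hη hc hs
  rw [h2] at h3
  rw [h1, h.2.2 _ (pderiv_contDiff hη _) (pderiv_hasCompactSupport hc _)
    ((tsupport_pderiv_subset _ η).trans hs), h3]
  ring

/-- A Lipschitz function has bounded weak derivatives. -/
lemma exists_hasWeakDeriv_of_lipschitzOnWith {V : Set (Sp d)} (hV : IsOpen V)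
    {u : Sp d → ℝ} {C : ℝ≥0} (hu : LipschitzOnWith C u V) (a : Fin d) :
    ∃ g : Sp d → ℝ, HasWeakDeriv (fun _ : Fin 1 => a) V u g ∧ (∀ y, |g y| ≤ C) ∧
      Measurable g := by
  -- The weak derivative is the directional derivative of a global Lipschitz extension. `lineDeriv`
  -- is 0 where the limit does not exist, so the bound C holds at every point and not only almost
  -- everywhere.
  obtain ⟨v, hv, huv⟩ := hu.extend_real
  refine ⟨fun y => lineDeriv ℝ v y (EuclideanSpace.single a 1), ?_, fun y => ?_, ?_⟩
  · have hmeas : Measurable fun y => lineDeriv ℝ v y (EuclideanSpace.single a (1 : ℝ)) :=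
      measurable_lineDeriv hv.continuous
    have hbd : ∀ y, ‖lineDeriv ℝ v y (EuclideanSpace.single a (1 : ℝ))‖ ≤ C := fun y => by
      have := norm_lineDeriv_le_of_lipschitz ℝ hv (x₀ := y) (v := EuclideanSpace.single a (1 : ℝ))
      simpa using this
    have : HasWeakDeriv (fun _ : Fin 1 => a) V v
        (fun y => lineDeriv ℝ v y (EuclideanSpace.single a 1)) := by
      refine ⟨hv.continuous.locallyIntegrable.locallyIntegrableOn _,
        LocallyIntegrable.locallyIntegrableOn ?_ _, fun η hη hc hs => ?_⟩
      · refine (locallyIntegrable_const (C : ℝ)).mono hmeas.aestronglyMeasurable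
          (.of_forall fun y => ?_)
        simpa using hbd y
      · have h2 : partialD (fun _ : Fin 1 => a) η = pderiv a η := by
          ext y
          rw [partialD_succ _ (hη.of_le (by exact_mod_cast le_top)).contDiffAt]
          simp
        have hsup : Function.support η ⊆ V := (subset_tsupport η).trans hs
        obtain ⟨D, hD⟩ := ContDiff.lipschitzWith_of_hasCompactSupport hc
          (hη.of_le (by exact_mod_cast le_top) : ContDiff ℝ 1 η) (by simp)
        have h3 := hv.integral_lineDeriv_mul_eq (μ := volume) hD hc (EuclideanSpace.single a (1 : ℝ))
        have h4 : ∀ y, lineDeriv ℝ η y (-EuclideanSpace.single a (1 : ℝ)) = - pderiv a η y :=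
          fun y => by
            rw [((hη.differentiable (by simp)) y).lineDeriv_eq_fderiv]
            simp [pderiv]
        rw [h2, setIntegral_mul_test _ hsup, setIntegral_mul_test _
          (((subset_tsupport _).trans (tsupport_pderiv_subset a η)).trans hs), h3]
        simp only [h4, pow_one, neg_mul, one_mul, integral_neg, neg_neg]
        congr 1; ext y; ring
    exact this.congr_left hV.measurableSet fun y hy => (huv hy).symm
  · have := norm_lineDeriv_le_of_lipschitz ℝ hv (x₀ := y) (v := EuclideanSpace.single a (1 : ℝ))
    simpa using this
  · exact measurable_lineDeriv hv.continuous

/-! ### Coordinates of a frame -/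

/-- The embedding `(y, t) ↦ T⁻¹ (y, t)` of the coordinate space of a frame. -/
def frameInv (T : Frame d) : Sp d × ℝ →L[ℝ] Sp (d + 1) :=
  (T.symm.toContinuousLinearEquiv : WithLp 2 (Sp d × ℝ) →L[ℝ] Sp (d + 1)).comp
    ((WithLp.prodContinuousLinearEquiv 2 ℝ (Sp d) ℝ).symm : Sp d × ℝ →L[ℝ] WithLp 2 (Sp d × ℝ))

/-- The horizontal coordinates of a frame. -/
def horiz (T : Frame d) : Sp (d + 1) →L[ℝ] Sp d :=
  (ContinuousLinearMap.fst ℝ (Sp d) ℝ).comp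
  (((WithLp.prodContinuousLinearEquiv 2 ℝ (Sp d) ℝ) : WithLp 2 (Sp d × ℝ) →L[ℝ] Sp d × ℝ).comp
  (T.toContinuousLinearEquiv : Sp (d + 1) →L[ℝ] WithLp 2 (Sp d × ℝ)))

/-- The vertical coordinate of a frame. -/
def vert (T : Frame d) : Sp (d + 1) →L[ℝ] ℝ :=
  (ContinuousLinearMap.snd ℝ (Sp d) ℝ).comp
  (((WithLp.prodContinuousLinearEquiv 2 ℝ (Sp d) ℝ) : WithLp 2 (Sp d × ℝ) →L[ℝ] Sp d × ℝ).comp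
  (T.toContinuousLinearEquiv : Sp (d + 1) →L[ℝ] WithLp 2 (Sp d × ℝ)))

lemma horiz_apply (T : Frame d) (p : Sp (d + 1)) : horiz T p = (T p).fst := rfl
lemma vert_apply (T : Frame d) (p : Sp (d + 1)) : vert T p = (T p).snd := rfl
lemma pt_eq (x : Sp (d + 1)) (T : Frame d) (y : Sp d) (t : ℝ) : pt x T y t = x + frameInv T (y, t) := rfl
@[simp] lemma horiz_frameInv (T : Frame d) (q) : horiz T (frameInv T q) = q.1 := by
  simp [horiz, frameInv]
@[simp] lemma vert_frameInv (T : Frame d) (q) : vert T (frameInv T q) = q.2 := by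
  simp [vert, frameInv]
lemma frameInv_horiz_vert (T : Frame d) (p) : frameInv T (horiz T p, vert T p) = p := by
  have : (horiz T p, vert T p) = WithLp.prodContinuousLinearEquiv 2 ℝ (Sp d) ℝ (T p) := rfl
  rw [this]
  simp [frameInv]
lemma norm_sq_eq (T : Frame d) (p : Sp (d + 1)) : ‖p‖ ^ 2 = ‖horiz T p‖ ^ 2 + vert T p ^ 2 := by
  rw [← T.norm_map p, WithLp.prod_norm_sq_eq_of_L2, Real.norm_eq_abs, sq_abs]; rfl

lemma norm_horiz_le (T : Frame d) (p : Sp (d + 1)) : ‖horiz T p‖ ≤ ‖p‖ := by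
  have := norm_sq_eq T p
  nlinarith [norm_nonneg (horiz T p), norm_nonneg p, sq_nonneg (vert T p)]

lemma abs_vert_le (T : Frame d) (p : Sp (d + 1)) : |vert T p| ≤ ‖p‖ := by
  have := norm_sq_eq T p
  rw [← sq_abs (vert T p)] at this
  nlinarith [abs_nonneg (vert T p), norm_nonneg p, sq_nonneg ‖horiz T p‖]

lemma norm_le_horiz_add_vert (T : Frame d) (p : Sp (d + 1)) :
    ‖p‖ ≤ ‖horiz T p‖ + |vert T p| := by
  have := norm_sq_eq T p
  rw [← sq_abs (vert T p)] at this
  have h1 := norm_nonneg (horiz T p)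
  have h2 := abs_nonneg (vert T p)
  nlinarith [norm_nonneg p, mul_nonneg h1 h2]

lemma norm_frameInv_le (T : Frame d) (v : Sp d) (t : ℝ) : ‖frameInv T (v, t)‖ ≤ ‖v‖ + |t| := by
  simpa using norm_le_horiz_add_vert T (frameInv T (v, t))

lemma pt_sub_pt (x : Sp (d + 1)) (T : Frame d) (y y' : Sp d) (t t' : ℝ) :
    pt x T y t - pt x T y' t' = frameInv T (y - y', t - t') := by
  rw [pt_eq, pt_eq, add_sub_add_left_eq_sub, ← map_sub]; rfl

lemma dist_pt_le (x : Sp (d + 1)) (T : Frame d) (y y' : Sp d) (t t' : ℝ) :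
    dist (pt x T y t) (pt x T y' t') ≤ dist y y' + |t - t'| := by
  rw [dist_eq_norm, pt_sub_pt, dist_eq_norm]; exact norm_frameInv_le _ _ _

lemma dist_le_dist_pt (x : Sp (d + 1)) (T : Frame d) (y y' : Sp d) (t t' : ℝ) :
    dist y y' ≤ dist (pt x T y t) (pt x T y' t') := by
  rw [dist_eq_norm, dist_eq_norm, pt_sub_pt]
  simpa using norm_horiz_le T (frameInv T (y - y', t - t'))

lemma pt_horiz_vert (x : Sp (d + 1)) (T : Frame d) (p : Sp (d + 1)) :
    pt x T (horiz T (p - x)) (vert T (p - x)) = p := by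
  rw [pt_eq, frameInv_horiz_vert]; abel

@[simp] lemma horiz_pt_sub (x : Sp (d + 1)) (T : Frame d) (y : Sp d) (t : ℝ) :
    horiz T (pt x T y t - x) = y := by simp [pt_eq]

@[simp] lemma vert_pt_sub (x : Sp (d + 1)) (T : Frame d) (y : Sp d) (t : ℝ) :
    vert T (pt x T y t - x) = t := by simp [pt_eq]

lemma fderiv_eq_sum_pderiv (f : Sp d → ℝ) (y w : Sp d) :
    fderiv ℝ f y w = ∑ b, w b * pderiv b f y := by
  conv_lhs => rw [show w = ∑ b, w b • EuclideanSpace.single b (1 : ℝ) by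
    ext i; simp [Finset.sum_apply, Pi.single_apply]]
  simp [map_sum, pderiv]

/-! ### Abstract scales of function spaces -/

/-- A graded scale of local function classes. `Conv s V f` expresses convergence on `V`, with
weight `s`, of a sequence of functions, and `Reg s V g` the corresponding regularity of a limit. -/
structure RegScale (d K : ℕ) where
  Conv : ℕ → Set (Sp d) → (ℕ → Sp d → ℝ) → Prop
  Reg : ℕ → Set (Sp d) → (Sp d → ℝ) → Prop
  congr : ∀ {s : ℕ} {V : Set (Sp d)} {f g : ℕ → Sp d → ℝ}, IsOpen V →
    (∀ᶠ m in atTop, EqOn (f m) (g m) V) → Conv s V f → Conv s V g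
  weight : ∀ {s : ℕ} {V : Set (Sp d)} {f : ℕ → Sp d → ℝ}, s + 1 ≤ K → Bornology.IsBounded V →
    Conv s V f → Conv (s + 1) V f
  add : ∀ {s : ℕ} {V : Set (Sp d)} {f g : ℕ → Sp d → ℝ}, s ≤ K → Conv s V f → Conv s V g →
    Conv s V (fun m y => f m y + g m y)
  mul : ∀ {s t : ℕ} {V : Set (Sp d)} {f g : ℕ → Sp d → ℝ}, s + t ≤ K →
    IsOpen V → Bornology.IsBounded V → Conv s V f → Conv t V g → Conv (s + t) V (fun m y => f m y * g m y)
  inv : ∀ {V : Set (Sp d)} {f : ℕ → Sp d → ℝ} {c : ℝ}, IsOpen V →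
    Bornology.IsBounded V → 0 < c → (∀ᶠ m in atTop, ∀ y ∈ V, c ≤ f m y) → Conv 0 V f → Conv 0 V (fun m y => (f m y)⁻¹)
  unif : ∀ {V : Set (Sp d)} {f : ℕ → Sp d → ℝ} {f₀ : Sp d → ℝ} {C : ℝ≥0}, IsOpen V →
    Bornology.IsBounded V → (∀ᶠ m in atTop, LipschitzOnWith C (f m) V) →
    TendstoUniformlyOn f f₀ atTop V → Conv 0 V f
  comp : ∀ {s : ℕ} {V V' : Set (Sp d)} {g : ℕ → Sp d → ℝ} {Y : ℕ → Sp d → Sp d} {Y₀ : Sp d → Sp d}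
    {C : ℝ≥0}, s ≤ K → IsOpen V → Bornology.IsBounded V → IsOpen V' → Bornology.IsBounded V' →
    Conv s V' g →
    (∀ᶠ m in atTop, ContinuousOn (g m) V') → (∀ᶠ m in atTop, LipschitzOnWith C (Y m) V) →
    (∀ᶠ m in atTop, ∀ y ∈ V, ∀ y' ∈ V, dist y y' ≤ C * dist (Y m y) (Y m y')) →
    (∀ᶠ m in atTop, MapsTo (Y m) V V') → TendstoUniformlyOn Y Y₀ atTop V →
    Conv s V (fun m y => g m (Y m y))
  lim : ∀ {s : ℕ} {V : Set (Sp d)} {f : ℕ → Sp d → ℝ}, s ≤ K → IsOpen V → Bornology.IsBounded V →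
    (∀ᶠ m in atTop, ContinuousOn (f m) V) → Conv s V f →
    ∃ g : Sp d → ℝ, Reg s V g ∧ (∀ᶠ m in atTop, MemLp (f m) 1 (volume.restrict V)) ∧
      MemLp g 1 (volume.restrict V) ∧
      Tendsto (fun m => eLpNorm (f m - g) 1 (volume.restrict V)) atTop (𝓝 0)
  moll : ∀ {s : ℕ} {V V' : Set (Sp d)} {g : Sp d → ℝ} {δ : ℝ}, s ≤ K → IsOpen V →
    Bornology.IsBounded V → Reg s V g → 0 < δ → thickening δ V' ⊆ V → IsOpen V' →
    Conv s V' (fun m => mollify m g)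

namespace RegScale

variable {K : ℕ} (Q : RegScale d K) {V : Set (Sp d)}

/-- Convergence of the derivatives of order `< l`, the derivatives of order `j` having weight
`s + j`. -/
def S (V : Set (Sp d)) : ℕ → ℕ → (ℕ → Sp d → ℝ) → Prop
  | 0, _, f => ∀ᶠ m in atTop, ContDiffOn ℝ ∞ (f m) V
  | l + 1, s, f => (∀ᶠ m in atTop, ContDiffOn ℝ ∞ (f m) V) ∧ Q.Conv s V f ∧
      ∀ a, S V l (s + 1) (fun m => pderiv a (f m))

variable {Q} {l s t u : ℕ} {f g : ℕ → Sp d → ℝ}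

lemma S.smooth (h : Q.S V l s f) : ∀ᶠ m in atTop, ContDiffOn ℝ ∞ (f m) V := by
  cases l with
  | zero => exact h
  | succ l => exact h.1

lemma S.pred (h : Q.S V (l + 1) s f) : Q.S V l s f := by
  induction l generalizing s f with
  | zero => exact h.1
  | succ l ih => exact ⟨h.1, h.2.1, fun a => ih (h.2.2 a)⟩

lemma S.of_le {l' : ℕ} (hl : l' ≤ l) (h : Q.S V l s f) : Q.S V l' s f := by
  induction l, hl using Nat.le_induction with
  | base => exact h
  | succ l _ ih => exact ih h.pred

lemma S.congr (hV : IsOpen V) (hfg : ∀ᶠ m in atTop, EqOn (f m) (g m) V) (h : Q.S V l s f) :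
    Q.S V l s g := by
  have hs : ∀ᶠ m in atTop, ContDiffOn ℝ ∞ (g m) V := by
    filter_upwards [hfg, h.smooth] with m hm hf using hf.congr fun y hy => (hm hy).symm
  induction l generalizing s f g with
  | zero => exact hs
  | succ l ih =>
    refine ⟨hs, Q.congr hV hfg h.2.1, fun a => ih ?_ (h.2.2 a) ?_⟩
    · filter_upwards [hfg] with m hm using pderiv_congr a hV hm
    · filter_upwards [hs] with m hm using contDiffOn_pderiv_infty hV hm a

/-- The condition on the indices says that `s + l`, the largest weight that occurs after the
increase, is still at most K. -/
lemma S.weight (hb : Bornology.IsBounded V) (hs : s + 1 + l ≤ K + 1) (h : Q.S V l s f) :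
    Q.S V l (s + 1) f := by
  induction l generalizing s f with
  | zero => exact h
  | succ l ih =>
    exact ⟨h.1, Q.weight (by omega) hb h.2.1, fun a => ih (by omega) (h.2.2 a)⟩

lemma S.add (hV : IsOpen V) (hs : s + l ≤ K + 1) (hf : Q.S V l s f) (hg : Q.S V l s g) :
    Q.S V l s (fun m y => f m y + g m y) := by
  have hsm : ∀ᶠ m in atTop, ContDiffOn ℝ ∞ (fun y => f m y + g m y) V := by
    filter_upwards [hf.smooth, hg.smooth] with m h1 h2 using h1.add h2
  induction l generalizing s f g with
  | zero => exact hsm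
  | succ l ih =>
    refine ⟨hsm, Q.add (by omega) hf.2.1 hg.2.1, fun a => ?_⟩
    have h1 : ∀ᶠ m in atTop, ContDiffOn ℝ ∞ (fun y => pderiv a (f m) y + pderiv a (g m) y) V := by
      filter_upwards [(hf.2.2 a).smooth, (hg.2.2 a).smooth] with m h1 h2 using h1.add h2
    refine (ih (by omega) (hf.2.2 a) (hg.2.2 a) h1).congr hV ?_
    filter_upwards [hf.1, hg.1] with m h1 h2 y hy
    have d1 := (h1.contDiffAt (hV.mem_nhds hy)).differentiableAt (by simp)
    have d2 := (h2.contDiffAt (hV.mem_nhds hy)).differentiableAt (by simp)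
    simp only [pderiv]
    rw [show (fun y => f m y + g m y) = f m + g m from rfl, fderiv_add d1 d2]
    rfl

lemma pderiv_mul_eqOn (hV : IsOpen V) {f g : Sp d → ℝ} (hf : ContDiffOn ℝ ∞ f V)
    (hg : ContDiffOn ℝ ∞ g V) (a : Fin d) :
    EqOn (fun y => pderiv a f y * g y + f y * pderiv a g y) (pderiv a fun y => f y * g y) V := by
  intro y hy
  have d1 := (hf.contDiffAt (hV.mem_nhds hy)).differentiableAt (by simp)
  have d2 := (hg.contDiffAt (hV.mem_nhds hy)).differentiableAt (by simp)
  simp only [pderiv]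
  rw [show (fun y => f y * g y) = f * g from rfl, fderiv_mul d1 d2]
  simp [mul_comm, add_comm]

/-- Leibniz rule: weights add under products, and each of the two terms of the derivative of `f * g`
has weight one more than the product. -/
lemma S.mul (hV : IsOpen V) (hb : Bornology.IsBounded V) (hu : u = s + t) (hs : u + l ≤ K + 1)
    (hf : Q.S V l s f) (hg : Q.S V l t g) : Q.S V l u (fun m y => f m y * g m y) := by
  have hsm : ∀ᶠ m in atTop, ContDiffOn ℝ ∞ (fun y => f m y * g m y) V := by
    filter_upwards [hf.smooth, hg.smooth] with m h1 h2 using h1.mul h2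
  induction l generalizing s t u f g with
  | zero => exact hsm
  | succ l ih =>
    refine ⟨hsm, hu ▸ Q.mul (by omega) hV hb hf.2.1 hg.2.1, fun a => ?_⟩
    have h1 : Q.S V l (u + 1) (fun m y => pderiv a (f m) y * g m y) := by
      refine ih (by omega) (by omega) (hf.2.2 a) hg.pred ?_
      filter_upwards [(hf.2.2 a).smooth, hg.smooth] with m h1 h2 using h1.mul h2
    have h2 : Q.S V l (u + 1) (fun m y => f m y * pderiv a (g m) y) := by
      refine ih (by omega) (by omega) hf.pred (hg.2.2 a) ?_
      filter_upwards [hf.smooth, (hg.2.2 a).smooth] with m h1 h2 using h1.mul h2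
    refine (h1.add hV (by omega) h2).congr hV ?_
    filter_upwards [hf.1, hg.1] with m h1 h2 using pderiv_mul_eqOn hV h1 h2 a

lemma S.const (hV : IsOpen V) (hb : Bornology.IsBounded V) (hs : s + l ≤ K + 1) (c : ℝ) :
    Q.S V l s (fun _ _ => c) := by
  induction l generalizing s c with
  | zero => exact .of_forall fun _ => contDiffOn_const
  | succ l ih =>
    refine ⟨.of_forall fun _ => contDiffOn_const, ?_, fun a => ?_⟩
    · have h0 : Q.Conv 0 V (fun _ _ => c) :=
        Q.unif (f₀ := fun _ => c) (C := 0) hV hb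
          (.of_forall fun _ => (LipschitzWith.const c).lipschitzOnWith)
          (fun u hu => .of_forall fun m y _ => refl_mem_uniformity hu)
      -- Constants belong to weight 0 as uniform limits of Lipschitz functions; higher weights are
      -- weaker on bounded sets.
      have h1 : ∀ s, s ≤ K → Q.Conv s V (fun _ _ => c) := by
        intro s
        induction s with
        | zero => exact fun _ => h0
        | succ s ih => exact fun hs => Q.weight hs hb (ih (by omega))
      exact h1 s (by omega)
    · have : pderiv a (fun _ : Sp d => c) = fun _ => 0 := by ext y; simp [pderiv]
      simp only [this]
      exact ih (by omega) 0

lemma S.sum {ι : Type*} (hV : IsOpen V) (hb : Bornology.IsBounded V) (hs : s + l ≤ K + 1)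
    (I : Finset ι) {f : ι → ℕ → Sp d → ℝ} (hf : ∀ i ∈ I, Q.S V l s (f i)) :
    Q.S V l s (fun m y => ∑ i ∈ I, f i m y) := by
  classical
  induction I using Finset.induction_on with
  | empty => simpa using S.const hV hb hs 0
  | insert i I hi ih =>
    simp only [Finset.sum_insert hi]
    exact (hf i (Finset.mem_insert_self _ _)).add hV hs
      (ih fun j hj => hf j (Finset.mem_insert_of_mem hj))

lemma S.const_mul (hV : IsOpen V) (hb : Bornology.IsBounded V) (hs : s + l ≤ K + 1) (c : ℝ)
    (hf : Q.S V l s f) : Q.S V l s (fun m y => c * f m y) :=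
  S.mul hV hb (Nat.zero_add s).symm hs (S.const hV hb (by omega) c) hf

lemma S.sub (hV : IsOpen V) (hb : Bornology.IsBounded V) (hs : s + l ≤ K + 1)
    (hf : Q.S V l s f) (hg : Q.S V l s g) : Q.S V l s (fun m y => f m y - g m y) := by
  have := hf.add hV hs (hg.const_mul hV hb hs (-1))
  simpa [← sub_eq_add_neg] using this

/-- The derivative of the reciprocal is -f⁻²∂f, so one more order for 1/f needs only the lower
orders of 1/f, already known by induction. -/
lemma S.inv (hV : IsOpen V) (hb : Bornology.IsBounded V) (hl : l ≤ K + 1) {c : ℝ} (hc : 0 < c)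
    (hfc : ∀ᶠ m in atTop, ∀ y ∈ V, c ≤ f m y) (hf : Q.S V l 0 f) :
    Q.S V l 0 (fun m y => (f m y)⁻¹) := by
  have hsm : ∀ᶠ m in atTop, ContDiffOn ℝ ∞ (fun y => (f m y)⁻¹) V := by
    filter_upwards [hf.smooth, hfc] with m h1 h2 using h1.inv fun y hy => (hc.trans_le (h2 y hy)).ne'
  induction l with
  | zero => exact hsm
  | succ l ih =>
    refine ⟨hsm, Q.inv hV hb hc hfc hf.2.1, fun a => ?_⟩
    have h1 := ih (by omega) hf.pred
    have h2 : Q.S V l 0 (fun m y => (f m y)⁻¹ * (f m y)⁻¹) :=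
      S.mul hV hb rfl (by omega) h1 h1
    have h3 := (S.mul hV hb (Nat.zero_add 1).symm (by omega) h2 (hf.2.2 a)).const_mul hV hb
      (by omega) (-1)
    refine h3.congr hV ?_
    filter_upwards [hf.1, hfc] with m h1 h2 y hy
    have d1 := ((h1.contDiffAt (hV.mem_nhds hy)).differentiableAt (by simp)).hasFDerivAt
    have := ((hasDerivAt_inv (hc.trans_le (h2 y hy)).ne').comp_hasFDerivAt y d1).fderiv
    simp only [pderiv]
    rw [show (fun y => (f m y)⁻¹) = Inv.inv ∘ f m from rfl, this]
    simp only [smul_apply, smul_eq_mul]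
    field_simp

/-- Chain rule in the scale. -/
lemma S.comp {V' : Set (Sp d)} (hV : IsOpen V) (hb : Bornology.IsBounded V) (hV' : IsOpen V')
    (hb' : Bornology.IsBounded V') {Y : ℕ → Sp d → Sp d} {Y₀ : Sp d → Sp d} {C : ℝ≥0}
    (hsm : ∀ᶠ m in atTop, ContDiffOn ℝ ∞ (Y m) V)
    (hlip : ∀ᶠ m in atTop, LipschitzOnWith C (Y m) V)
    (hanti : ∀ᶠ m in atTop, ∀ y ∈ V, ∀ y' ∈ V, dist y y' ≤ C * dist (Y m y) (Y m y'))
    (hmaps : ∀ᶠ m in atTop, MapsTo (Y m) V V') (hunif : TendstoUniformlyOn Y Y₀ atTop V)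
    (hs : s + (l + 1) ≤ K + 1)
    (hY : ∀ a b, Q.S V l 0 (fun m => pderiv a fun y => Y m y b)) (hg : Q.S V' (l + 1) s g) :
    Q.S V (l + 1) s (fun m y => g m (Y m y)) := by
  -- Weight and outer function vary in the induction, since the chain rule replaces g by its partial
  -- derivatives. The first derivatives of Y are required to one level less than g; the bootstrap
  -- gains its extra derivative from this.
  have key : ∀ l s g, s + (l + 1) ≤ K + 1 →
      (∀ a b, Q.S V l 0 (fun m => pderiv a fun y => Y m y b)) → Q.S V' (l + 1) s g →
      Q.S V (l + 1) s (fun m y => g m (Y m y)) := by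
    intro l
    induction l with
    | zero =>
      intro s g hs hY hg
      have hsm' : ∀ᶠ m in atTop, ContDiffOn ℝ ∞ (fun y => g m (Y m y)) V := by
        filter_upwards [hg.smooth, hsm, hmaps] with m h1 h2 h3 using h1.comp h2 h3
      refine ⟨hsm', ?_, fun a => ?_⟩
      · exact Q.comp (by omega) hV hb hV' hb' hg.2.1 (hg.smooth.mono fun m h => h.continuousOn)
          hlip hanti hmaps hunif
      · filter_upwards [hsm'] with m hm using contDiffOn_pderiv_infty hV hm a
    | succ l ih =>
      intro s g hs hY hg
      have hsm' : ∀ᶠ m in atTop, ContDiffOn ℝ ∞ (fun y => g m (Y m y)) V := by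
        filter_upwards [hg.smooth, hsm, hmaps] with m h1 h2 h3 using h1.comp h2 h3
      refine ⟨hsm', ?_, fun a => ?_⟩
      · exact Q.comp (by omega) hV hb hV' hb' hg.2.1 (hg.smooth.mono fun m h => h.continuousOn)
          hlip hanti hmaps hunif
      · have h1 : ∀ b, Q.S V (l + 1) (s + 1)
            (fun m y => pderiv a (fun y => Y m y b) y * pderiv b (g m) (Y m y)) := fun b =>
          S.mul hV hb (Nat.zero_add _).symm (by omega) (hY a b)
            (ih (s + 1) (fun m => pderiv b (g m)) (by omega) (fun a b => (hY a b).pred) (hg.2.2 b))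
        refine (S.sum hV hb (by omega) Finset.univ fun b _ => h1 b).congr hV ?_
        filter_upwards [hg.smooth, hsm, hmaps] with m h1 h2 h3 y hy
        have d1 := ((h1.contDiffAt (hV'.mem_nhds (h3 hy))).differentiableAt (by simp)).hasFDerivAt
        have d2 := ((h2.contDiffAt (hV.mem_nhds hy)).differentiableAt (by simp)).hasFDerivAt
        have d3 : ∀ b, pderiv a (fun y => Y m y b) y =
            (fderiv ℝ (Y m) y (EuclideanSpace.single a 1)) b := fun b => by
          have : HasFDerivAt (fun y => Y m y b) _ y :=
            (EuclideanSpace.proj b : Sp d →L[ℝ] ℝ).hasFDerivAt.comp y d2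
          rw [pderiv, this.fderiv]; rfl
        have d4 : pderiv a (fun y => g m (Y m y)) y =
            fderiv ℝ (g m) (Y m y) (fderiv ℝ (Y m) y (EuclideanSpace.single a 1)) := by
          have := d1.comp y d2
          rw [pderiv, show (fun y => g m (Y m y)) = g m ∘ Y m from rfl, this.fderiv]; rfl
        rw [d4, fderiv_eq_sum_pderiv]
        simp only [d3]
  exact key l s g hs hY hg

end RegScale

/-! ### Sequences of graphs and smooth functions along them -/

lemma exists_lipschitzOnWith_closedBall {E F : Type*} [NormedAddCommGroup E] [NormedSpace ℝ E]
    [FiniteDimensional ℝ E] [NormedAddCommGroup F] [NormedSpace ℝ F] {h : E → F}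
    (hh : ContDiff ℝ 1 h) (x : E) (r : ℝ) : ∃ C : ℝ≥0, LipschitzOnWith C h (closedBall x r) := by
  have : ProperSpace E := FiniteDimensional.proper_real E
  obtain ⟨C, hC⟩ := (isCompact_closedBall x r).exists_bound_of_continuousOn
    (hh.continuous_fderiv (by simp)).continuousOn
  refine ⟨C.toNNReal, (convex_closedBall x r).lipschitzOnWith_of_nnnorm_fderiv_le
    (fun y _ => hh.differentiable (by simp) y) fun y hy => ?_⟩
  rw [← NNReal.coe_le_coe, coe_nnnorm]
  exact (hC y hy).trans (Real.le_coe_toNNReal C)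

/-- A sequence of uniformly Lipschitz smooth functions which converges uniformly on a bounded
open set. -/
structure GraphSeq (V : Set (Sp d)) (ψ : ℕ → Sp d → ℝ) (ψ₀ : Sp d → ℝ) (Λ : ℝ≥0) : Prop where
  isOpen : IsOpen V
  bounded : Bornology.IsBounded V
  smooth : ∀ᶠ m in atTop, ContDiffOn ℝ ∞ (ψ m) V
  lip : ∀ᶠ m in atTop, LipschitzOnWith Λ (ψ m) V
  unif : TendstoUniformlyOn ψ ψ₀ atTop V

namespace GraphSeq

variable {V : Set (Sp d)} {ψ : ℕ → Sp d → ℝ} {ψ₀ : Sp d → ℝ} {Λ : ℝ≥0}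

lemma mono (hG : GraphSeq V ψ ψ₀ Λ) {V' : Set (Sp d)} (hV' : IsOpen V') (h : V' ⊆ V) :
    GraphSeq V' ψ ψ₀ Λ :=
  ⟨hV', hG.bounded.subset h, hG.smooth.mono fun _ hm => hm.mono h,
    hG.lip.mono fun _ hm => hm.mono h, hG.unif.mono h⟩

lemma exists_bound (hG : GraphSeq V ψ ψ₀ Λ) :
    ∃ M : ℝ, (∀ᶠ m in atTop, ∀ y ∈ V, |ψ m y| ≤ M) ∧ ∀ y ∈ V, |ψ₀ y| ≤ M := by
  obtain ⟨m, h1, h2⟩ := (hG.lip.and (Metric.tendstoUniformlyOn_iff.1 hG.unif 1 one_pos)).exists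
  obtain ⟨M, hM⟩ : ∃ M, ∀ y ∈ V, |ψ m y| ≤ M := by
    obtain ⟨D, hD⟩ := Metric.isBounded_iff.1 hG.bounded
    rcases V.eq_empty_or_nonempty with rfl | ⟨y₀, hy₀⟩
    · exact ⟨0, fun y hy => hy.elim⟩
    · refine ⟨|ψ m y₀| + Λ * D, fun y hy => ?_⟩
      have h3 := h1.dist_le_mul y hy y₀ hy₀
      have h4 := mul_le_mul_of_nonneg_left (hD hy hy₀) Λ.2
      rw [Real.dist_eq] at h3
      have h5 := abs_sub_abs_le_abs_sub (ψ m y) (ψ m y₀)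
      have h6 : (Λ : ℝ) * dist y y₀ ≤ Λ * D := h4
      linarith
  have h0 : ∀ y ∈ V, |ψ₀ y| ≤ M + 1 := fun y hy => by
    have h3 := h2 y hy
    rw [Real.dist_eq, abs_sub_lt_iff] at h3
    have := abs_le.1 (hM y hy)
    exact abs_le.2 ⟨by linarith, by linarith⟩
  refine ⟨M + 2, ?_, fun y hy => (h0 y hy).trans (by linarith)⟩
  filter_upwards [Metric.tendstoUniformlyOn_iff.1 hG.unif 1 one_pos] with k hk y hy
  have h3 := hk y hy
  rw [Real.dist_eq, abs_sub_lt_iff] at h3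
  have := abs_le.1 (h0 y hy)
  exact abs_le.2 ⟨by linarith, by linarith⟩

/-- All the graphs lie in one bounded region, where h is Lipschitz; this makes the Lipschitz
constant independent of m and transfers the uniform convergence. -/
lemma comp_smooth {F : Type*} [NormedAddCommGroup F] [NormedSpace ℝ F]
    (hG : GraphSeq V ψ ψ₀ Λ) (x : Sp (d + 1)) (T : Frame d) {h : Sp (d + 1) → F}
    (hh : ContDiff ℝ ∞ h) :
    (∀ᶠ m in atTop, ContDiffOn ℝ ∞ (fun y => h (pt x T y (ψ m y))) V) ∧
    (∃ C : ℝ≥0, ∀ᶠ m in atTop, LipschitzOnWith C (fun y => h (pt x T y (ψ m y))) V) ∧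
    TendstoUniformlyOn (fun m y => h (pt x T y (ψ m y))) (fun y => h (pt x T y (ψ₀ y))) atTop V := by
  obtain ⟨M, hM, hM₀⟩ := hG.exists_bound
  obtain ⟨B, hB⟩ := isBounded_iff_forall_norm_le.1 hG.bounded
  obtain ⟨C, hC⟩ := exists_lipschitzOnWith_closedBall (hh.of_le (by exact_mod_cast le_top)) x (B + M)
  have hmem : ∀ y ∈ V, ∀ t, |t| ≤ M → pt x T y t ∈ closedBall x (B + M) := fun y hy t ht => by
    rw [mem_closedBall, dist_eq_norm, pt_eq, add_sub_cancel_left]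
    exact (norm_frameInv_le T y t).trans (add_le_add (hB y hy) ht)
  refine ⟨?_, ⟨C * (1 + Λ), ?_⟩, ?_⟩
  · filter_upwards [hG.smooth] with m hm
    refine hh.comp_contDiffOn ?_
    exact contDiffOn_const.add ((frameInv T).contDiff.comp_contDiffOn (contDiffOn_id.prodMk hm))
  · filter_upwards [hG.lip, hM] with m h1 h2
    refine LipschitzOnWith.of_dist_le_mul fun y hy y' hy' => ?_
    refine (hC.dist_le_mul _ (hmem y hy _ (h2 y hy)) _ (hmem y' hy' _ (h2 y' hy'))).trans ?_
    rw [NNReal.coe_mul, mul_assoc]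
    refine mul_le_mul_of_nonneg_left ((dist_pt_le _ _ _ _ _ _).trans ?_) C.2
    have := h1.dist_le_mul y hy y' hy'
    rw [Real.dist_eq] at this
    push_cast
    linarith
  · rw [Metric.tendstoUniformlyOn_iff]
    intro ε hε
    filter_upwards [hM, Metric.tendstoUniformlyOn_iff.1 hG.unif (ε / (C + 1)) (by positivity)]
      with m h1 h2 y hy
    have h3 := hC.dist_le_mul _ (hmem y hy _ (hM₀ y hy)) _ (hmem y hy _ (h1 y hy))
    have h4 := dist_pt_le x T y y (ψ₀ y) (ψ m y)
    have h5 := h2 y hy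
    rw [Real.dist_eq, lt_div_iff₀ (by positivity)] at h5
    rw [dist_self, zero_add] at h4
    have h6 : (C : ℝ) * dist (pt x T y (ψ₀ y)) (pt x T y (ψ m y)) ≤ C * |ψ₀ y - ψ m y| :=
      mul_le_mul_of_nonneg_left h4 C.2
    have h7 := abs_nonneg (ψ₀ y - ψ m y)
    by_cases h8 : |ψ₀ y - ψ m y| = 0
    · rw [h8] at h6; linarith
    · have : 0 < |ψ₀ y - ψ m y| := lt_of_le_of_ne h7 (Ne.symm h8)
      nlinarith

lemma hasFDerivAt_graph (x : Sp (d + 1)) (T : Frame d) {f : Sp d → ℝ} {y : Sp d}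
    {f' : Sp d →L[ℝ] ℝ} (hf : HasFDerivAt f f' y) :
    HasFDerivAt (fun y => pt x T y (f y))
      ((frameInv T).comp ((ContinuousLinearMap.id ℝ (Sp d)).prod f')) y :=
  ((frameInv T).hasFDerivAt.comp y ((hasFDerivAt_id y).prodMk hf)).const_add x

lemma frameInv_split (T : Frame d) (v : Sp d) (t : ℝ) :
    frameInv T (v, t) = frameInv T (v, 0) + t • frameInv T (0, 1) := by
  rw [← map_smul, ← map_add]; simp

lemma pderiv_comp_graph (x : Sp (d + 1)) (T : Frame d) {f : Sp d → ℝ} {y : Sp d}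
    (hf : DifferentiableAt ℝ f y) {h : Sp (d + 1) → ℝ}
    (hh : DifferentiableAt ℝ h (pt x T y (f y))) (a : Fin d) :
    pderiv a (fun y => h (pt x T y (f y))) y =
      fderiv ℝ h (pt x T y (f y)) (frameInv T (EuclideanSpace.single a 1, 0)) +
      fderiv ℝ h (pt x T y (f y)) (frameInv T (0, 1)) * pderiv a f y := by
  have h1 := (hh.hasFDerivAt.comp y (hasFDerivAt_graph x T hf.hasFDerivAt)).fderiv
  rw [pderiv, show (fun y => h (pt x T y (f y))) = h ∘ (fun y => pt x T y (f y)) from rfl, h1]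
  simp only [ContinuousLinearMap.comp_apply, ContinuousLinearMap.prod_apply,
    ContinuousLinearMap.id_apply]
  rw [frameInv_split, map_add, map_smul, smul_eq_mul, mul_comm]
  rfl

/-- A fixed smooth function along the graphs belongs to the scale. -/
lemma S_comp_smooth {K : ℕ} {Q : RegScale d K} (hG : GraphSeq V ψ ψ₀ Λ) (x : Sp (d + 1))
    (T : Frame d) {l : ℕ} (hl : l ≤ K) (hψ : ∀ a, Q.S V l 0 (fun m => pderiv a (ψ m)))
    {h : Sp (d + 1) → ℝ} (hh : ContDiff ℝ ∞ h) :
    Q.S V (l + 1) 0 (fun m y => h (pt x T y (ψ m y))) := by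
  induction l generalizing h with
  | zero =>
    obtain ⟨h1, ⟨C, h2⟩, h3⟩ := hG.comp_smooth x T hh
    exact ⟨h1, Q.unif hG.isOpen hG.bounded h2 h3, fun a =>
      h1.mono fun m hm => contDiffOn_pderiv_infty hG.isOpen hm a⟩
  | succ l ih =>
    obtain ⟨h1, ⟨C, h2⟩, h3⟩ := hG.comp_smooth x T hh
    refine ⟨h1, Q.unif hG.isOpen hG.bounded h2 h3, fun a => ?_⟩
    have hd : ∀ v, ContDiff ℝ ∞ fun p => fderiv ℝ h p v := fun v =>
      (hh.fderiv_right (m := ∞) (by simp)).clm_apply contDiff_const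
    have h4 : ∀ v, Q.S V (l + 1) 0 (fun m y => fderiv ℝ h (pt x T y (ψ m y)) v) := fun v =>
      ih (by omega) (fun a => (hψ a).pred) (hd v)
    have h5 := (h4 (frameInv T (EuclideanSpace.single a 1, 0))).add hG.isOpen (by omega)
      (RegScale.S.mul hG.isOpen hG.bounded (Nat.zero_add 0).symm (by omega)
        (h4 (frameInv T (0, 1))) (hψ a))
    -- The chain rule even gives weight 0 for the first derivatives; raising it to the weight 1
    -- demanded by `S` costs nothing.
    refine (h5.congr hG.isOpen ?_).weight hG.bounded (by omega)
    filter_upwards [hG.smooth] with m hm y hy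
    exact (pderiv_comp_graph x T ((hm.contDiffAt (hG.isOpen.mem_nhds hy)).differentiableAt
      (by simp)) (hh.differentiable (by simp) _) a).symm

end GraphSeq

/-! ### Defining functions built from finitely many charts -/

/-- Finitely many coordinate systems with smooth weights. -/
structure Patches (d : ℕ) where
  N : ℕ
  x : Fin N → Sp (d + 1)
  T : Fin N → Frame d
  ξ₀ : Sp (d + 1) → ℝ
  ξ : Fin N → Sp (d + 1) → ℝ
  ξ₀_smooth : ContDiff ℝ ∞ ξ₀
  ξ_smooth : ∀ i, ContDiff ℝ ∞ (ξ i)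

namespace Patches

variable (A : Patches d)

/-- The weighted defining function of the family of graphs `Φ`. -/
def F (Φ : Fin A.N → Sp d → ℝ) (p : Sp (d + 1)) : ℝ :=
  ∑ j, ((A.T j (p - A.x j)).snd - Φ j (A.T j (p - A.x j)).fst) * A.ξ j p - A.ξ₀ p

/-- The horizontal coordinates in the `j`-th coordinate system. -/
def hor (j : Fin A.N) (p : Sp (d + 1)) : Sp d := horiz (A.T j) (p - A.x j)

/-- The vertical coordinate in the `j`-th coordinate system. -/
def ver (j : Fin A.N) (p : Sp (d + 1)) : ℝ := vert (A.T j) (p - A.x j)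

lemma F_eq (Φ : Fin A.N → Sp d → ℝ) (p : Sp (d + 1)) :
    A.F Φ p = ∑ j, (A.ver j p - Φ j (A.hor j p)) * A.ξ j p - A.ξ₀ p := rfl

lemma contDiff_hor (j : Fin A.N) : ContDiff ℝ ∞ (A.hor j) :=
  (horiz (A.T j)).contDiff.comp (contDiff_id.sub contDiff_const)

lemma contDiff_ver (j : Fin A.N) : ContDiff ℝ ∞ (A.ver j) :=
  (vert (A.T j)).contDiff.comp (contDiff_id.sub contDiff_const)

lemma hasFDerivAt_hor (j : Fin A.N) (p : Sp (d + 1)) : HasFDerivAt (A.hor j) (horiz (A.T j)) p :=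
  (horiz (A.T j)).hasFDerivAt.comp p ((hasFDerivAt_id p).sub_const _)

lemma hasFDerivAt_ver (j : Fin A.N) (p : Sp (d + 1)) : HasFDerivAt (A.ver j) (vert (A.T j)) p :=
  (vert (A.T j)).hasFDerivAt.comp p ((hasFDerivAt_id p).sub_const _)

lemma dist_hor_le (j : Fin A.N) (p q : Sp (d + 1)) : dist (A.hor j p) (A.hor j q) ≤ dist p q := by
  rw [dist_eq_norm, hor, hor, ← map_sub, sub_sub_sub_cancel_right, dist_eq_norm]
  exact norm_horiz_le _ _

lemma contDiff_F {Φ : Fin A.N → Sp d → ℝ} (hΦ : ∀ j, ContDiff ℝ ∞ (Φ j)) :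
    ContDiff ℝ ∞ (A.F Φ) :=
  (ContDiff.sum fun j _ => ((A.contDiff_ver j).sub ((hΦ j).comp (A.contDiff_hor j))).mul
    (A.ξ_smooth j)).sub A.ξ₀_smooth

lemma fderiv_F {Φ : Fin A.N → Sp d → ℝ} (hΦ : ∀ j, ContDiff ℝ ∞ (Φ j)) (p v : Sp (d + 1)) :
    fderiv ℝ (A.F Φ) p v =
      ∑ j, ((vert (A.T j) v - fderiv ℝ (Φ j) (A.hor j p) (horiz (A.T j) v)) * A.ξ j p +
        (A.ver j p - Φ j (A.hor j p)) * fderiv ℝ (A.ξ j) p v) - fderiv ℝ A.ξ₀ p v := by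
  have h1 : ∀ j, HasFDerivAt (fun p => (A.ver j p - Φ j (A.hor j p)) * A.ξ j p)
      ((A.ver j p - Φ j (A.hor j p)) • fderiv ℝ (A.ξ j) p + A.ξ j p •
        (vert (A.T j) - (fderiv ℝ (Φ j) (A.hor j p)).comp (horiz (A.T j)))) p := fun j =>
    ((A.hasFDerivAt_ver j p).sub (((hΦ j).differentiable (by simp) _).hasFDerivAt.comp p
      (A.hasFDerivAt_hor j p))).mul ((A.ξ_smooth j).differentiable (by simp) p).hasFDerivAt
  have h2 : HasFDerivAt (A.F Φ) _ p := (HasFDerivAt.fun_sum (u := Finset.univ) fun j _ => h1 j).sub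
    (A.ξ₀_smooth.differentiable (by simp) p).hasFDerivAt
  rw [h2.fderiv]
  simp only [sub_apply, sum_apply,
    add_apply, smul_apply, smul_eq_mul,
    ContinuousLinearMap.comp_apply]
  congr 1
  exact Finset.sum_congr rfl fun j _ => by ring

open RegScale in
/-- Bootstrapping: the implicit functions inherit the regularity of the charts. -/
theorem S_pderiv_implicit {K : ℕ} {Q : RegScale d K} {V : Set (Sp d)} {ψ : ℕ → Sp d → ℝ}
    {ψ₀ : Sp d → ℝ} {Λ : ℝ≥0} (hG : GraphSeq V ψ ψ₀ Λ) (x : Sp (d + 1)) (T : Frame d)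
    {Φ : ℕ → Fin A.N → Sp d → ℝ} (hΦ : ∀ᶠ m in atTop, ∀ j, ContDiff ℝ ∞ (Φ m j))
    {C : ℝ≥0} {c : ℝ} (hc : 0 < c) (hF : ∀ᶠ m in atTop, ∀ y ∈ V, A.F (Φ m) (pt x T y (ψ m y)) = 0)
    (hD : ∀ᶠ m in atTop, ∀ y ∈ V,
      c ≤ fderiv ℝ (A.F (Φ m)) (pt x T y (ψ m y)) (frameInv T (0, 1)))
    (hact : ∀ j, (∀ᶠ m in atTop, ∀ y ∈ V, pt x T y (ψ m y) ∉ tsupport (A.ξ j)) ∨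
      ∃ V' : Set (Sp d), IsOpen V' ∧ Bornology.IsBounded V' ∧
        (∀ᶠ m in atTop, MapsTo (fun y => A.hor j (pt x T y (ψ m y))) V V') ∧
        (∀ᶠ m in atTop, ∀ y ∈ V, ∀ y' ∈ V, dist y y' ≤
          C * dist (A.hor j (pt x T y (ψ m y))) (A.hor j (pt x T y' (ψ m y')))) ∧
        Q.Conv 0 V' (fun m => Φ m j) ∧ ∀ b, Q.S V' (K + 1) 0 (fun m => pderiv b (Φ m j))) :
    ∀ a, Q.S V (K + 1) 0 (fun m => pderiv a (ψ m)) := by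
  have hV := hG.isOpen
  have hb := hG.bounded
  -- The induction is on the number l of controlled levels of ∇ψ_m. It starts from smoothness alone.
  suffices H : ∀ l, l ≤ K + 1 → ∀ a, Q.S V l 0 (fun m => pderiv a (ψ m)) from H _ le_rfl
  intro l
  induction l with
  | zero =>
    intro _ a
    filter_upwards [hG.smooth] with m hm using contDiffOn_pderiv_infty hV hm a
  | succ l ih =>
    intro hl
    have hψ := ih (by omega)
    have hl' : l ≤ K := by omega
    have hsmooth : ∀ {h : Sp (d + 1) → ℝ}, ContDiff ℝ ∞ h →
        Q.S V (l + 1) 0 (fun m y => h (pt x T y (ψ m y))) := fun hh =>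
      hG.S_comp_smooth x T hl' hψ hh
    -- The gain of one level: along the graph the gradient of F_m is controlled to level `l + 1`
    -- although ∇ψ_m is so far known only to level l.
    have hdir : ∀ v, Q.S V (l + 1) 0 (fun m y => fderiv ℝ (A.F (Φ m)) (pt x T y (ψ m y)) v) := by
      intro v
      have hterm : ∀ j, Q.S V (l + 1) 0 (fun m y =>
          (vert (A.T j) v - fderiv ℝ (Φ m j) (A.hor j (pt x T y (ψ m y))) (horiz (A.T j) v)) *
            A.ξ j (pt x T y (ψ m y)) +
          (A.ver j (pt x T y (ψ m y)) - Φ m j (A.hor j (pt x T y (ψ m y)))) *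
            fderiv ℝ (A.ξ j) (pt x T y (ψ m y)) v) := by
        intro j
        rcases hact j with h0 | ⟨V', hV', hb', hmaps, hanti, hconv, hS⟩
        -- A weight whose support misses the graphs contributes nothing, so no regularity of its
        -- chart is needed.
        · refine (S.const hV hb (by omega) 0).congr hV ?_
          filter_upwards [h0] with m hm y hy
          have h1 := hm y hy
          beta_reduce
          rw [image_eq_zero_of_notMem_tsupport h1, image_eq_zero_of_notMem_tsupport
            (fun h => h1 (tsupport_fderiv_apply_subset ℝ v h))]
          ring
        · obtain ⟨hY1, ⟨C', hY2⟩, hY3⟩ := hG.comp_smooth x T (A.contDiff_hor j)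
          have hYlip : ∀ᶠ m in atTop, LipschitzOnWith (max C C')
              (fun y => A.hor j (pt x T y (ψ m y))) V := by
            filter_upwards [hY2] with m hm using hm.weaken (le_max_right _ _)
          have hYanti : ∀ᶠ m in atTop, ∀ y ∈ V, ∀ y' ∈ V, dist y y' ≤
              (max C C' : ℝ≥0) * dist (A.hor j (pt x T y (ψ m y))) (A.hor j (pt x T y' (ψ m y'))) := by
            filter_upwards [hanti] with m hm y hy y' hy'
            exact (hm y hy y' hy').trans (mul_le_mul_of_nonneg_right
              (by exact_mod_cast le_max_left C C') dist_nonneg)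
          have hYd : ∀ a b, Q.S V l 0 (fun m => pderiv a fun y => A.hor j (pt x T y (ψ m y)) b) := by
            intro a b
            have h1 := (S.const (Q := Q) (s := 0) (l := l) hV hb (by omega)
                (horiz (A.T j) (frameInv T (EuclideanSpace.single a 1, 0)) b)).add hV
              (by omega) ((hψ a).const_mul hV hb (by omega)
                (horiz (A.T j) (frameInv T (0, 1)) b))
            refine h1.congr hV ?_
            filter_upwards [hG.smooth] with m hm y hy
            have hbd : HasFDerivAt (fun p => A.hor j p b)
                ((EuclideanSpace.proj b : Sp d →L[ℝ] ℝ).comp (horiz (A.T j))) (pt x T y (ψ m y)) :=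
              (EuclideanSpace.proj b : Sp d →L[ℝ] ℝ).hasFDerivAt.comp _ (A.hasFDerivAt_hor j _)
            rw [GraphSeq.pderiv_comp_graph x T ((hm.contDiffAt (hV.mem_nhds hy)).differentiableAt
              (by simp)) hbd.differentiableAt a, hbd.fderiv]
            rfl
          have hcomp : ∀ {g : ℕ → Sp d → ℝ}, Q.S V' (l + 1) 0 g →
              Q.S V (l + 1) 0 (fun m y => g m (A.hor j (pt x T y (ψ m y)))) := fun hg =>
            S.comp hV hb hV' hb' hY1 hYlip hYanti hmaps hY3 (by omega) hYd hg
          have h1 : Q.S V (l + 1) 0 (fun m y => fderiv ℝ (Φ m j) (A.hor j (pt x T y (ψ m y)))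
              (horiz (A.T j) v)) := by
            simp only [fderiv_eq_sum_pderiv]
            exact S.sum hV hb (by omega) _ fun b _ =>
              (hcomp ((hS b).of_le (by omega))).const_mul hV hb (by omega) _
          have h2 : Q.S V (l + 1) 0 (fun m y => Φ m j (A.hor j (pt x T y (ψ m y)))) := by
            -- Here Φ itself occurs and not its gradient, so only l levels of ∇Φ are used and their
            -- weights are raised by one.
            refine hcomp ⟨hΦ.mono fun m hm => (hm j).contDiffOn, hconv, fun b => ?_⟩
            exact ((hS b).of_le (by omega)).weight hb' (by omega)
          have hdξ : ContDiff ℝ ∞ fun p => fderiv ℝ (A.ξ j) p v :=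
            ((A.ξ_smooth j).fderiv_right (m := ∞) (by simp)).clm_apply contDiff_const
          exact (S.mul hV hb (Nat.zero_add 0).symm (by omega)
              ((S.const hV hb (by omega) _).sub hV hb (by omega) h1) (hsmooth (A.ξ_smooth j))).add
            hV (by omega) (S.mul hV hb (Nat.zero_add 0).symm (by omega)
              ((hsmooth (A.contDiff_ver j)).sub hV hb (by omega) h2) (hsmooth hdξ))
      have hdξ₀ : ContDiff ℝ ∞ fun p => fderiv ℝ A.ξ₀ p v :=
        (A.ξ₀_smooth.fderiv_right (m := ∞) (by simp)).clm_apply contDiff_const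
      have h3 := (S.sum hV hb (by omega) Finset.univ fun j _ => hterm j).sub hV hb (by omega)
        (hsmooth hdξ₀)
      refine h3.congr hV ?_
      filter_upwards [hΦ] with m hm y _
      exact (A.fderiv_F hm _ v).symm
    intro a
    -- Differentiating F_m(y, ψ_m(y)) = 0 gives ∂_aψ_m as minus the horizontal derivative of F_m
    -- divided by the vertical one, which is at least c.
    have hinv := (hdir (frameInv T (0, 1))).inv hV hb (by omega) hc hD
    have hres := (S.mul hV hb (Nat.zero_add 0).symm (by omega)
      (hdir (frameInv T (EuclideanSpace.single a 1, 0))) hinv).const_mul hV hb (by omega) (-1)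
    refine hres.congr hV ?_
    filter_upwards [hG.smooth, hΦ, hF, hD] with m h1 h2 h3 h4 y hy
    have h5 : EqOn (fun y => A.F (Φ m) (pt x T y (ψ m y))) (fun _ => 0) V := fun y hy => h3 y hy
    have h6 := pderiv_congr a hV h5 hy
    rw [GraphSeq.pderiv_comp_graph x T ((h1.contDiffAt (hV.mem_nhds hy)).differentiableAt (by simp))
      ((A.contDiff_F h2).differentiable (by simp) _) a] at h6
    have h7 : pderiv a (fun _ : Sp d => (0 : ℝ)) y = 0 := by simp [pderiv]
    rw [h7] at h6
    have h8 := (hc.trans_le (h4 y hy)).ne'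
    field_simp
    linarith

end Patches

/-! ### The scale of uniform convergence with Hölder bounds -/

lemma holderOnWith_iff_dist {X Y : Type*} [PseudoMetricSpace X] [PseudoMetricSpace Y] {C α : ℝ≥0}
    {f : X → Y} {V : Set X} :
    HolderOnWith C α f V ↔ ∀ x ∈ V, ∀ y ∈ V, dist (f x) (f y) ≤ C * dist x y ^ (α : ℝ) := by
  refine forall₂_congr fun x _ => forall₂_congr fun y _ => ?_
  rw [edist_dist, edist_dist, ENNReal.ofReal_rpow_of_nonneg dist_nonneg α.coe_nonneg,
    ← ENNReal.ofReal_coe_nnreal, ← ENNReal.ofReal_mul C.coe_nonneg, ENNReal.ofReal_le_ofReal_iff]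
  exact mul_nonneg C.coe_nonneg (Real.rpow_nonneg dist_nonneg _)

lemma _root_.Bornology.IsBounded.volume_restrict_isFiniteMeasure {V : Set (Sp d)}
    (hb : Bornology.IsBounded V) : IsFiniteMeasure (volume.restrict V) :=
  ⟨by simpa using hb.measure_lt_top⟩

lemma memLp_of_bound_on {V : Set (Sp d)} (hV : IsOpen V) (hb : Bornology.IsBounded V)
    {f : Sp d → ℝ} (hf : ContinuousOn f V) {C : ℝ} (hC : ∀ y ∈ V, |f y| ≤ C) (p : ℝ≥0∞) :
    MemLp f p (volume.restrict V) :=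
  have := hb.volume_restrict_isFiniteMeasure
  MemLp.of_bound (hf.aestronglyMeasurable hV.measurableSet) C
    ((ae_restrict_iff' hV.measurableSet).2 (.of_forall hC))

lemma eLpNorm_restrict_le_of_bound {V : Set (Sp d)} (hV : IsOpen V)
    {f : Sp d → ℝ} {C : ℝ} (hC : ∀ y ∈ V, |f y| ≤ C) (p : ℝ≥0∞) :
    eLpNorm f p (volume.restrict V) ≤ volume V ^ p.toReal⁻¹ * ENNReal.ofReal C := by
  simpa using eLpNorm_le_of_ae_bound (p := p)
    ((ae_restrict_iff' hV.measurableSet).2 (.of_forall hC) : ∀ᵐ y ∂(volume.restrict V), ‖f y‖ ≤ C)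

lemma exists_pos_measure_mul_le {V : Set (Sp d)} (hb : Bornology.IsBounded V) (p : ℝ≥0∞)
    {ε : ℝ≥0∞} (hε : 0 < ε) :
    ∃ c : ℝ, 0 < c ∧ volume V ^ p.toReal⁻¹ * ENNReal.ofReal c ≤ ε := by
  have hvt : volume V ^ p.toReal⁻¹ ≠ ⊤ :=
    ENNReal.rpow_ne_top_of_nonneg (by positivity) hb.measure_lt_top.ne
  obtain ⟨c, hc, hc'⟩ := ENNReal.exists_nnreal_pos_mul_lt hvt hε.ne'
  exact ⟨c, hc, by rw [mul_comm, ENNReal.ofReal_coe_nnreal]; exact hc'.le⟩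

lemma tendsto_eLpNorm_of_tendstoUniformlyOn {V : Set (Sp d)} (hV : IsOpen V)
    (hb : Bornology.IsBounded V) {f : ℕ → Sp d → ℝ} {g : Sp d → ℝ}
    (h : TendstoUniformlyOn f g atTop V) (p : ℝ≥0∞) :
    Tendsto (fun m => eLpNorm (f m - g) p (volume.restrict V)) atTop (𝓝 0) := by
  rw [ENNReal.tendsto_nhds_zero]
  intro ε hε
  obtain ⟨c, hc, hc'⟩ := exists_pos_measure_mul_le hb p hε
  filter_upwards [Metric.tendstoUniformlyOn_iff.1 h c hc] with m hm
  refine (eLpNorm_restrict_le_of_bound hV (fun y hy => ?_) p).trans hc'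
  rw [Pi.sub_apply, ← Real.dist_eq, dist_comm]
  exact (hm y hy).le

lemma tendstoUniformlyOn_mollify {V V' : Set (Sp d)} {g : Sp d → ℝ} {δ : ℝ}
    (hg : UniformContinuousOn g V) (hi : IntegrableOn g V) (hδ : 0 < δ)
    (hVV : thickening δ V' ⊆ V) : TendstoUniformlyOn (fun m => mollify m g) g atTop V' := by
  rw [Metric.tendstoUniformlyOn_iff]
  intro ε hε
  obtain ⟨η, hη, hη'⟩ := Metric.uniformContinuousOn_iff.1 hg (ε / 2) (by positivity)
  obtain ⟨N, hN⟩ := exists_nat_one_div_lt (lt_min hδ hη)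
  filter_upwards [eventually_ge_atTop (N + 1), eventually_ge_atTop 1] with m hmN hm x hx
  have hm1 : 1 / (m : ℝ) < min δ η := lt_of_le_of_lt
    (one_div_le_one_div_of_le (by positivity) (by exact_mod_cast hmN)) hN
  have hsub : ball x (1 / (m : ℝ)) ⊆ V := fun y hy =>
    hVV (mem_thickening_iff.2 ⟨x, hx, (mem_ball.1 hy).trans (hm1.trans_le (min_le_left _ _))⟩)
  have := abs_mollify_sub_self_le hm (hi.mono_set hsub) (c := ε / 2) fun y hy => by
    rw [← Real.dist_eq]
    exact (hη' y (hsub hy) x (hsub (mem_ball_self (by positivity)))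
      ((mem_ball.1 hy).trans (hm1.trans_le (min_le_right _ _)))).le
  rw [dist_comm, Real.dist_eq]
  linarith

/-- Eventually in `m`, the balls of radius `1 / m` about points of `V'` lie in `V`. -/
lemma eventually_ball_subset {V V' : Set (Sp d)} {δ : ℝ} (hδ : 0 < δ)
    (hVV : thickening δ V' ⊆ V) :
    ∀ᶠ m : ℕ in atTop, 1 ≤ m ∧ ∀ x ∈ V', closedBall x (1 / (m : ℝ)) ⊆ V := by
  obtain ⟨N, hN⟩ := exists_nat_one_div_lt hδ
  filter_upwards [eventually_ge_atTop (N + 1), eventually_ge_atTop 1] with m hmN hm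
  have hm1 : 1 / (m : ℝ) < δ := lt_of_le_of_lt
    (one_div_le_one_div_of_le (by positivity) (by exact_mod_cast hmN)) hN
  exact ⟨hm, fun x hx y hy => hVV (mem_thickening_iff.2 ⟨x, hx, (mem_closedBall.1 hy).trans_lt hm1⟩)⟩

/-- The scale of uniform convergence with uniform `α`-Hölder bounds; for `α = 0` this is just uniform
convergence of bounded functions. -/
def holderScale (d K : ℕ) (α : ℝ≥0) (hα : α ≤ 1) : RegScale d K where
  Conv _ V f := UniformCauchySeqOn f atTop V ∧ (∀ᶠ m in atTop, UniformContinuousOn (f m) V) ∧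
    ∃ C : ℝ≥0, ∀ᶠ m in atTop, (∀ y ∈ V, |f m y| ≤ C) ∧ HolderOnWith C α (f m) V
  Reg _ V g := UniformContinuousOn g V ∧ ∃ C : ℝ≥0, (∀ y ∈ V, |g y| ≤ C) ∧ HolderOnWith C α g V
  congr := by
    rintro s V f g - hfg ⟨h1, h2, C, h3⟩
    refine ⟨?_, ?_, C, ?_⟩
    · rw [Metric.uniformCauchySeqOn_iff] at h1 ⊢
      intro ε hε
      obtain ⟨N, hN⟩ := h1 ε hε
      obtain ⟨N', hN'⟩ := eventually_atTop.1 hfg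
      refine ⟨max N N', fun m hm n hn x hx => ?_⟩
      rw [← hN' m (le_of_max_le_right hm) hx, ← hN' n (le_of_max_le_right hn) hx]
      exact hN m (le_of_max_le_left hm) n (le_of_max_le_left hn) x hx
    · filter_upwards [hfg, h2] with m hm h2 using h2.congr hm
    · filter_upwards [hfg, h3] with m hm h3
      refine ⟨fun y hy => hm hy ▸ h3.1 y hy, fun x hx y hy => ?_⟩
      rw [← hm hx, ← hm hy]
      exact h3.2 x hx y hy
  weight := fun _ _ h => h
  add := by
    rintro s V f g - ⟨h1, h2, C, h3⟩ ⟨h1', h2', C', h3'⟩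
    refine ⟨?_, ?_, C + C', ?_⟩
    · rw [Metric.uniformCauchySeqOn_iff] at h1 h1' ⊢
      intro ε hε
      obtain ⟨N, hN⟩ := h1 (ε / 2) (by positivity)
      obtain ⟨N', hN'⟩ := h1' (ε / 2) (by positivity)
      refine ⟨max N N', fun m hm n hn x hx => ?_⟩
      have a1 := hN m (le_of_max_le_left hm) n (le_of_max_le_left hn) x hx
      have a2 := hN' m (le_of_max_le_right hm) n (le_of_max_le_right hn) x hx
      exact (dist_add_add_le _ _ _ _).trans_lt (by linarith)
    · filter_upwards [h2, h2'] with m a b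
      rw [uniformContinuousOn_iff_restrict] at a b ⊢
      exact a.add b
    · filter_upwards [h3, h3'] with m a b
      refine ⟨fun y hy => (abs_add_le _ _).trans (add_le_add (a.1 y hy) (b.1 y hy)), ?_⟩
      rw [holderOnWith_iff_dist]
      intro x hx y hy
      refine (dist_add_add_le _ _ _ _).trans ?_
      push_cast
      rw [add_mul]
      exact add_le_add ((holderOnWith_iff_dist.1 a.2) x hx y hy)
        ((holderOnWith_iff_dist.1 b.2) x hx y hy)
  mul := by
    rintro s t V f g - - - ⟨h1, h2, C, h3⟩ ⟨h1', h2', C', h3'⟩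
    have hmul : ∀ {a b a' b' : ℝ} {A B : ℝ≥0}, |a| ≤ A → |b'| ≤ B →
        dist (a * b) (a' * b') ≤ A * dist b b' + B * dist a a' := by
      intro a b a' b' A B ha hb
      rw [Real.dist_eq, Real.dist_eq, Real.dist_eq, show a * b - a' * b' = a * (b - b') +
        b' * (a - a') by ring]
      refine (abs_add_le _ _).trans ?_
      rw [abs_mul, abs_mul]
      gcongr
    refine ⟨?_, ?_, C * C' + C' * C, ?_⟩
    · rw [Metric.uniformCauchySeqOn_iff] at h1 h1' ⊢
      intro ε hε
      obtain ⟨N, hN⟩ := h1 (ε / 2 / (C' + 1)) (by positivity)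
      obtain ⟨N', hN'⟩ := h1' (ε / 2 / (C + 1)) (by positivity)
      obtain ⟨M, hM⟩ := eventually_atTop.1 (h3.and h3')
      refine ⟨max (max N N') M, fun m hm n hn x hx => ?_⟩
      have a1 := hN m (le_of_max_le_left (le_of_max_le_left hm)) n
        (le_of_max_le_left (le_of_max_le_left hn)) x hx
      have a2 := hN' m (le_of_max_le_right (le_of_max_le_left hm)) n
        (le_of_max_le_right (le_of_max_le_left hn)) x hx
      have a3 := (hM m (le_of_max_le_right hm)).1.1 x hx
      have a4 := (hM n (le_of_max_le_right hn)).2.1 x hx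
      refine (hmul a3 a4).trans_lt ?_
      rw [lt_div_iff₀ (by positivity)] at a1 a2
      have := dist_nonneg (x := f m x) (y := f n x)
      have := dist_nonneg (x := g m x) (y := g n x)
      by_cases h0 : dist (f m x) (f n x) = 0 ∧ dist (g m x) (g n x) = 0
      · rw [h0.1, h0.2]; simpa using hε
      · nlinarith
    · have hu : ∀ m, (∀ y ∈ V, |f m y| ≤ C) → (∀ y ∈ V, |g m y| ≤ C') →
          UniformContinuousOn (f m) V → UniformContinuousOn (g m) V →
          UniformContinuousOn (fun y => f m y * g m y) V := by
        intro m b1 b2 u1 u2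
        rw [Metric.uniformContinuousOn_iff] at u1 u2 ⊢
        intro ε hε
        obtain ⟨δ₁, hδ₁, e1⟩ := u1 (ε / 2 / (C' + 1)) (by positivity)
        obtain ⟨δ₂, hδ₂, e2⟩ := u2 (ε / 2 / (C + 1)) (by positivity)
        refine ⟨min δ₁ δ₂, lt_min hδ₁ hδ₂, fun x hx y hy hxy => ?_⟩
        have a1 := e1 x hx y hy (hxy.trans_le (min_le_left _ _))
        have a2 := e2 x hx y hy (hxy.trans_le (min_le_right _ _))
        refine (hmul (b1 x hx) (b2 y hy)).trans_lt ?_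
        rw [lt_div_iff₀ (by positivity)] at a1 a2
        have := dist_nonneg (x := f m x) (y := f m y)
        have := dist_nonneg (x := g m x) (y := g m y)
        by_cases h0 : dist (f m x) (f m y) = 0 ∧ dist (g m x) (g m y) = 0
        · rw [h0.1, h0.2]; simpa using hε
        · nlinarith
      filter_upwards [h2, h2', h3, h3'] with m a b c e using hu m c.1 e.1 a b
    · filter_upwards [h3, h3'] with m a b
      refine ⟨fun y hy => ?_, ?_⟩
      · rw [abs_mul]
        push_cast
        have := mul_le_mul (a.1 y hy) (b.1 y hy) (abs_nonneg _) C.2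
        have h0 : (0 : ℝ) ≤ C' * C := by positivity
        have h1 : |f m y| * |g m y| ≤ C * C' := this
        linarith
      · rw [holderOnWith_iff_dist]
        intro x hx y hy
        refine (hmul (a.1 x hx) (b.1 y hy)).trans ?_
        push_cast
        rw [add_mul, mul_assoc, mul_assoc]
        exact add_le_add (mul_le_mul_of_nonneg_left ((holderOnWith_iff_dist.1 b.2) x hx y hy) C.2)
          (mul_le_mul_of_nonneg_left ((holderOnWith_iff_dist.1 a.2) x hx y hy) C'.2)
  inv := by
    rintro V f c - - hc hfc ⟨h1, h2, C, h3⟩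
    have hinv : ∀ {a b : ℝ}, c ≤ a → c ≤ b → dist a⁻¹ b⁻¹ ≤ (c⁻¹ * c⁻¹) * dist a b := by
      intro a b ha hb
      have ha' := hc.trans_le ha
      have hb' := hc.trans_le hb
      rw [Real.dist_eq, Real.dist_eq, inv_sub_inv ha'.ne' hb'.ne', abs_div, abs_sub_comm,
        abs_of_pos (mul_pos ha' hb'), div_eq_inv_mul]
      refine mul_le_mul_of_nonneg_right ?_ (abs_nonneg _)
      rw [mul_inv]
      gcongr
    refine ⟨?_, ?_, (c⁻¹ * c⁻¹).toNNReal * C + c⁻¹.toNNReal, ?_⟩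
    · rw [Metric.uniformCauchySeqOn_iff] at h1 ⊢
      intro ε hε
      obtain ⟨N, hN⟩ := h1 (ε * (c * c)) (by positivity)
      obtain ⟨M, hM⟩ := eventually_atTop.1 hfc
      refine ⟨max N M, fun m hm n hn x hx => ?_⟩
      have a1 := hN m (le_of_max_le_left hm) n (le_of_max_le_left hn) x hx
      refine (hinv (hM m (le_of_max_le_right hm) x hx)
        (hM n (le_of_max_le_right hn) x hx)).trans_lt ?_
      calc _ < (c⁻¹ * c⁻¹) * (ε * (c * c)) := mul_lt_mul_of_pos_left a1 (by positivity)
        _ = ε := by field_simp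
    · filter_upwards [h2, hfc] with m a b
      rw [Metric.uniformContinuousOn_iff] at a ⊢
      intro ε hε
      obtain ⟨δ, hδ, e⟩ := a (ε * (c * c)) (by positivity)
      refine ⟨δ, hδ, fun x hx y hy hxy => (hinv (b x hx) (b y hy)).trans_lt ?_⟩
      calc _ < (c⁻¹ * c⁻¹) * (ε * (c * c)) :=
            mul_lt_mul_of_pos_left (e x hx y hy hxy) (by positivity)
        _ = ε := by field_simp
    · filter_upwards [h3, hfc] with m a b
      refine ⟨fun y hy => ?_, ?_⟩
      · rw [abs_inv, abs_of_pos (hc.trans_le (b y hy))]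
        push_cast
        have h0 : (f m y)⁻¹ ≤ c⁻¹ := by gcongr; exact b y hy
        have h1 := Real.le_coe_toNNReal c⁻¹
        have h2 : (0 : ℝ) ≤ (c⁻¹ * c⁻¹).toNNReal * C := by positivity
        linarith
      · rw [holderOnWith_iff_dist]
        intro x hx y hy
        refine (hinv (b x hx) (b y hy)).trans ?_
        have h0 := (holderOnWith_iff_dist.1 a.2) x hx y hy
        have h1 : (0 : ℝ) ≤ dist x y ^ (α : ℝ) := Real.rpow_nonneg dist_nonneg _
        push_cast
        rw [Real.coe_toNNReal _ (by positivity), add_mul, mul_assoc _ (C : ℝ)]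
        have h2 : (0 : ℝ) ≤ (c⁻¹.toNNReal : ℝ) * dist x y ^ (α : ℝ) := by positivity
        have h3 := mul_le_mul_of_nonneg_left h0 (by positivity : 0 ≤ c⁻¹ * c⁻¹)
        linarith
  unif := by
    rintro V f f₀ C hV hb hlip hunif
    have hcau := hunif.uniformCauchySeqOn
    refine ⟨hcau, hlip.mono fun m h => h.uniformContinuousOn, ?_⟩
    obtain ⟨D, hD⟩ := Metric.isBounded_iff.1 hb
    obtain ⟨N, hN⟩ := Metric.uniformCauchySeqOn_iff.1 hcau 1 one_pos
    obtain ⟨N', hN'⟩ := eventually_atTop.1 hlip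
    obtain ⟨M, hM⟩ : ∃ M, ∀ y ∈ V, |f (max N N') y| ≤ M := by
      rcases V.eq_empty_or_nonempty with rfl | ⟨y₀, hy₀⟩
      · exact ⟨0, fun y hy => hy.elim⟩
      · refine ⟨|f (max N N') y₀| + C * D, fun y hy => ?_⟩
        have h3 := (hN' _ (le_max_right N N')).dist_le_mul y hy y₀ hy₀
        have h4 : (C : ℝ) * dist y y₀ ≤ C * D := mul_le_mul_of_nonneg_left (hD hy hy₀) C.2
        rw [Real.dist_eq] at h3
        have h5 := abs_sub_abs_le_abs_sub (f (max N N') y) (f (max N N') y₀)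
        linarith
    refine ⟨(M + 1).toNNReal + C * D.toNNReal ^ ((1 : ℝ≥0) - α : ℝ), ?_⟩
    filter_upwards [hlip, eventually_ge_atTop N] with m hm hmN
    refine ⟨fun y hy => ?_, ?_⟩
    · have h1 := hN m hmN _ (le_max_left N N') y hy
      rw [Real.dist_eq] at h1
      have h5 := abs_sub_abs_le_abs_sub (f m y) (f (max N N') y)
      have h6 := Real.le_coe_toNNReal (M + 1)
      have h7 := hM y hy
      have h8 : (0 : ℝ) ≤ (C * D.toNNReal ^ ((1 : ℝ≥0) - α : ℝ) : ℝ≥0) := NNReal.coe_nonneg _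
      rw [NNReal.coe_add]
      linarith
    -- On a bounded set a Lipschitz bound implies an α-Hölder bound, the diameter supplying the
    -- constant; this is where α ≤ 1 enters.
    · have h1 := (holderOnWith_one.2 hm).of_le (s := α) (D := D.toNNReal) (fun x hx y hy => by
        rw [edist_dist]; exact ENNReal.ofReal_le_ofReal (hD hx hy)) hα
      exact h1.mono_const le_add_self
  comp := by
    rintro s V V' g Y Y₀ C - hV hb hV' hb' ⟨h1, h2, C', h3⟩ - hlip - hmaps hunif
    have hucY := hunif.uniformCauchySeqOn
    refine ⟨?_, ?_, C' + C' * C ^ (α : ℝ), ?_⟩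
    · rw [Metric.uniformCauchySeqOn_iff] at h1 hucY ⊢
      intro ε hε
      obtain ⟨N, hN⟩ := h1 (ε / 3) (by positivity)
      obtain ⟨M, hM⟩ := eventually_atTop.1 (h2.and hmaps)
      -- A single member of the sequence is uniformly continuous and uniformly close to all later
      -- ones; it absorbs the change of the argument from Y m to Y n.
      obtain ⟨δ, hδ, hδ'⟩ := Metric.uniformContinuousOn_iff.1 (hM _ (le_max_right N M)).1 (ε / 3)
        (by positivity)
      obtain ⟨N', hN'⟩ := hucY δ hδ
      refine ⟨max (max N M) N', fun m hm n hn x hx => ?_⟩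
      have hm1 := le_of_max_le_left hm
      have hn1 := le_of_max_le_left hn
      have b1 := (hM m (le_of_max_le_right hm1)).2 hx
      have b2 := (hM n (le_of_max_le_right hn1)).2 hx
      have a1 := hN m (le_of_max_le_left hm1) _ (le_max_left N M) _ b1
      have a2 := hN _ (le_max_left N M) n (le_of_max_le_left hn1) _ b2
      have a3 := hδ' _ b1 _ b2 (hN' m (le_of_max_le_right hm) n (le_of_max_le_right hn) x hx)
      have := dist_triangle4 (g m (Y m x)) (g (max N M) (Y m x)) (g (max N M) (Y n x)) (g n (Y n x))
      linarith
    · filter_upwards [h2, hlip, hmaps] with m a b c using a.comp b.uniformContinuousOn c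
    · filter_upwards [h3, hlip, hmaps] with m a b c
      refine ⟨fun y hy => (a.1 _ (c hy)).trans (by push_cast; simp; positivity), ?_⟩
      have := a.2.comp (holderOnWith_one.2 b) c
      rw [mul_one] at this
      exact this.mono_const le_add_self
  lim := by
    rintro s V f - hV hb hcont ⟨h1, h2, C, h3⟩
    have hlim : ∀ y ∈ V, ∃ z, Tendsto (fun m => f m y) atTop (𝓝 z) := fun y hy =>
      cauchySeq_tendsto_of_complete (h1.cauchySeq hy)
    choose! g hg using hlim
    have hu : TendstoUniformlyOn f g atTop V := h1.tendstoUniformlyOn_of_tendsto hg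
    have hguc : UniformContinuousOn g V := by
      rw [Metric.uniformContinuousOn_iff]
      intro ε hε
      obtain ⟨m, hm1, hm2⟩ := (h2.and
        (Metric.tendstoUniformlyOn_iff.1 hu (ε / 3) (by positivity))).exists
      obtain ⟨δ, hδ, e⟩ := Metric.uniformContinuousOn_iff.1 hm1 (ε / 3) (by positivity)
      refine ⟨δ, hδ, fun x hx y hy hxy => ?_⟩
      have a1 := hm2 x hx
      have a2 := hm2 y hy
      rw [dist_comm] at a2
      have := dist_triangle4 (g x) (f m x) (f m y) (g y)
      linarith [e x hx y hy hxy]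
    have hgb : ∀ y ∈ V, |g y| ≤ C := fun y hy =>
      le_of_tendsto ((hg y hy).abs) (h3.mono fun m h => h.1 y hy)
    refine ⟨g, ⟨hguc, C, hgb, ?_⟩, ?_, memLp_of_bound_on hV hb hguc.continuousOn hgb 1,
      tendsto_eLpNorm_of_tendstoUniformlyOn hV hb hu 1⟩
    · rw [holderOnWith_iff_dist]
      intro x hx y hy
      exact le_of_tendsto ((hg x hx).dist (hg y hy)) (h3.mono fun m h =>
        (holderOnWith_iff_dist.1 h.2) x hx y hy)
    · filter_upwards [hcont, h3] with m a b using memLp_of_bound_on hV hb a b.1 1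
  moll := by
    rintro s V V' g δ - hV hb ⟨h1, C, h2, h3⟩ hδ hVV hV'
    have hi : IntegrableOn g V :=
      memLp_one_iff_integrable.1 (memLp_of_bound_on hV hb h1.continuousOn h2 1)
    have hsub := eventually_ball_subset hδ hVV
    have hin : ∀ {m : ℕ} {x z : Sp d}, closedBall x (1 / (m : ℝ)) ⊆ V → z ∈ ball (0 : Sp d) (1 / m) →
        x - z ∈ V := fun hx hz => hx (by
      rw [mem_ball_zero_iff] at hz
      rw [mem_closedBall, dist_eq_norm]; simpa using hz.le)
    refine ⟨(tendstoUniformlyOn_mollify h1 hi hδ hVV).uniformCauchySeqOn, ?_, C, ?_⟩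
    · filter_upwards [hsub] with m hm
      rw [Metric.uniformContinuousOn_iff] at h1 ⊢
      intro ε hε
      obtain ⟨η, hη, e⟩ := h1 (ε / 2) (by positivity)
      refine ⟨η, hη, fun x hx y hy hxy => ?_⟩
      have := abs_mollify_sub_le hm.1 (hi.mono_set (ball_subset_closedBall.trans (hm.2 x hx)))
        (hi.mono_set (ball_subset_closedBall.trans (hm.2 y hy))) (c := ε / 2) fun z hz => by
          rw [← Real.dist_eq]
          exact (e _ (hin (hm.2 x hx) hz) _ (hin (hm.2 y hy) hz) (by rwa [dist_sub_right])).le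
      rw [Real.dist_eq]
      linarith
    · filter_upwards [hsub] with m hm
      refine ⟨fun y hy => ?_, ?_⟩
      · have := abs_mollify_sub_le (h' := fun _ => 0) (x' := y) hm.1
          (hi.mono_set (ball_subset_closedBall.trans (hm.2 y hy))) (by simp) (c := C) fun z hz => by
            rw [sub_zero]; exact h2 _ (hin (hm.2 y hy) hz)
        rwa [mollify_const hm.1, sub_zero] at this
      · rw [holderOnWith_iff_dist]
        intro x hx y hy
        rw [Real.dist_eq]
        refine abs_mollify_sub_le hm.1 (hi.mono_set (ball_subset_closedBall.trans (hm.2 x hx)))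
          (hi.mono_set (ball_subset_closedBall.trans (hm.2 y hy))) fun z hz => ?_
        have := (holderOnWith_iff_dist.1 h3) _ (hin (hm.2 x hx) hz) _ (hin (hm.2 y hy) hz)
        rwa [dist_sub_right, Real.dist_eq] at this

/-! ### Cauchy sequences in `L^p` -/

/-- The sequence `f` is eventually in `L^p(μ)`, and Cauchy there. -/
def LpCauchy (p : ℝ≥0∞) (μ : Measure (Sp d)) (f : ℕ → Sp d → ℝ) : Prop :=
  (∀ᶠ m in atTop, MemLp (f m) p μ) ∧
    ∀ ε : ℝ≥0∞, 0 < ε → ∃ N, ∀ m ≥ N, ∀ n ≥ N, eLpNorm (f m - f n) p μ ≤ ε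

namespace LpCauchy

variable {p r : ℝ≥0∞} {μ : Measure (Sp d)} {f g : ℕ → Sp d → ℝ}

lemma congr (h : LpCauchy p μ f) (hfg : ∀ᶠ m in atTop, f m =ᵐ[μ] g m) : LpCauchy p μ g := by
  refine ⟨?_, fun ε hε => ?_⟩
  · filter_upwards [h.1, hfg] with m h1 h2 using h1.ae_eq h2
  · obtain ⟨N, hN⟩ := h.2 ε hε
    obtain ⟨M, hM⟩ := eventually_atTop.1 hfg
    refine ⟨max N M, fun m hm n hn => ?_⟩
    rw [← eLpNorm_congr_ae ((hM m (le_of_max_le_right hm)).sub (hM n (le_of_max_le_right hn)))]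
    exact hN m (le_of_max_le_left hm) n (le_of_max_le_left hn)

lemma mono_measure {ν : Measure (Sp d)} (hν : ν ≤ μ) (h : LpCauchy p μ f) : LpCauchy p ν f := by
  refine ⟨h.1.mono fun m hm => hm.mono_measure hν, fun ε hε => ?_⟩
  obtain ⟨N, hN⟩ := h.2 ε hε
  exact ⟨N, fun m hm n hn => (eLpNorm_mono_measure _ hν).trans (hN m hm n hn)⟩

lemma mono_exponent [IsFiniteMeasure μ] (hrp : r ≤ p) (h : LpCauchy p μ f) : LpCauchy r μ f := by
  refine ⟨h.1.mono fun m hm => hm.mono_exponent hrp, fun ε hε => ?_⟩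
  by_cases hr0 : r = 0
  · exact ⟨0, fun m _ n _ => by simp [hr0]⟩
  have hfin : μ univ ^ (1 / r.toReal - 1 / p.toReal) ≠ ⊤ := by
    refine ENNReal.rpow_ne_top_of_nonneg ?_ (measure_ne_top μ _)
    by_cases hp : p = ⊤
    · simp [hp]
    · rw [sub_nonneg]
      have h1 : 0 < r.toReal := ENNReal.toReal_pos hr0 (ne_top_of_le_ne_top hp hrp)
      exact one_div_le_one_div_of_le h1 (ENNReal.toReal_mono hp hrp)
  obtain ⟨c, hc, hc'⟩ := ENNReal.exists_nnreal_pos_mul_lt hfin hε.ne'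
  obtain ⟨N, hN⟩ := h.2 c (by exact_mod_cast hc)
  obtain ⟨M, hM⟩ := eventually_atTop.1 h.1
  refine ⟨max N M, fun m hm n hn => ?_⟩
  refine (eLpNorm_le_eLpNorm_mul_rpow_measure_univ hrp
    ((hM m (le_of_max_le_right hm)).sub (hM n (le_of_max_le_right hn))).1).trans ?_
  refine (mul_le_mul_left (hN m (le_of_max_le_left hm) n (le_of_max_le_left hn)) _).trans hc'.le

lemma add (hp : 1 ≤ p) (hf : LpCauchy p μ f) (hg : LpCauchy p μ g) :
    LpCauchy p μ (fun m y => f m y + g m y) := by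
  refine ⟨?_, fun ε hε => ?_⟩
  · filter_upwards [hf.1, hg.1] with m h1 h2 using h1.add h2
  · have hε2 : 0 < ε / 2 := ENNReal.half_pos hε.ne'
    obtain ⟨N, hN⟩ := hf.2 _ hε2
    obtain ⟨N', hN'⟩ := hg.2 _ hε2
    obtain ⟨M, hM⟩ := eventually_atTop.1 (hf.1.and hg.1)
    refine ⟨max (max N N') M, fun m hm n hn => ?_⟩
    have e : (fun y => f m y + g m y) - (fun y => f n y + g n y) = (f m - f n) + (g m - g n) := by
      ext y; simp only [Pi.sub_apply, Pi.add_apply]; ring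
    have m1 := hM m (le_of_max_le_right hm)
    have m2 := hM n (le_of_max_le_right hn)
    beta_reduce
    rw [e]
    refine (eLpNorm_add_le (m1.1.sub m2.1).1 (m1.2.sub m2.2).1 hp).trans ?_
    calc _ ≤ ε / 2 + ε / 2 := add_le_add
          (hN m (le_of_max_le_left (le_of_max_le_left hm)) n
            (le_of_max_le_left (le_of_max_le_left hn)))
          (hN' m (le_of_max_le_right (le_of_max_le_left hm)) n
            (le_of_max_le_right (le_of_max_le_left hn)))
      _ = ε := ENNReal.add_halves ε

lemma exists_bound (hp : 1 ≤ p) (hf : LpCauchy p μ f) :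
    ∃ B : ℝ≥0∞, B ≠ ⊤ ∧ ∀ᶠ m in atTop, eLpNorm (f m) p μ ≤ B := by
  obtain ⟨N, hN⟩ := hf.2 1 one_pos
  obtain ⟨M, hM⟩ := eventually_atTop.1 hf.1
  refine ⟨1 + eLpNorm (f (max N M)) p μ,
    ENNReal.add_ne_top.2 ⟨ENNReal.one_ne_top, (hM _ (le_max_right N M)).2.ne⟩, ?_⟩
  filter_upwards [eventually_ge_atTop (max N M)] with m hm
  have e : f m = (f m - f (max N M)) + f (max N M) := by abel
  conv_lhs => rw [e]
  refine (eLpNorm_add_le ((hM m (le_of_max_le_right hm)).sub (hM _ (le_max_right N M))).1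
    (hM _ (le_max_right N M)).1 hp).trans ?_
  exact add_le_add_left (hN m (le_of_max_le_left hm) _ (le_max_left N M)) _

lemma exists_small {B ε : ℝ≥0∞} (hB : B ≠ ⊤) (hε : 0 < ε) : ∃ c : ℝ≥0∞, 0 < c ∧ B * c ≤ ε := by
  obtain ⟨c, hc, hc'⟩ := ENNReal.exists_nnreal_pos_mul_lt hB hε.ne'
  exact ⟨c, by exact_mod_cast hc, by rw [mul_comm]; exact hc'.le⟩

lemma eLpNorm_mul_le_of_bound {a b : Sp d → ℝ} {M : ℝ} (ha : ∀ᵐ y ∂μ, |a y| ≤ M) :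
    eLpNorm (fun y => a y * b y) p μ ≤ ENNReal.ofReal M * eLpNorm b p μ := by
  refine eLpNorm_le_mul_eLpNorm_of_ae_le_mul ?_ p
  filter_upwards [ha] with y hy
  rw [norm_mul, Real.norm_eq_abs]
  gcongr

/-- Product of a bounded sequence converging in measure with an `L^p`-convergent one. -/
lemma bdd_mul [IsFiniteMeasure μ] (hp : 1 ≤ p) (hp' : p ≠ ⊤) {M : ℝ}
    (hb : ∀ᶠ m in atTop, ∀ᵐ y ∂μ, |f m y| ≤ M)
    (hf : LpCauchy p μ f) (hg : LpCauchy p μ g) : LpCauchy p μ (fun m y => f m y * g m y) := by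
  have hmem : ∀ᶠ m in atTop, MemLp (fun y => f m y * g m y) p μ := by
    filter_upwards [hf.1, hg.1, hb] with m h1 h2 h3
    exact ⟨h1.1.mul h2.1, (eLpNorm_mul_le_of_bound h3).trans_lt
      (ENNReal.mul_lt_top ENNReal.ofReal_lt_top h2.2)⟩
  refine ⟨hmem, fun ε hε => ?_⟩
  obtain ⟨B, hB⟩ : ∃ B : ℝ≥0∞, B = ENNReal.ofReal M := ⟨_, rfl⟩
  have hBt : B ≠ ⊤ := hB ▸ ENNReal.ofReal_ne_top
  obtain ⟨c, hc, hc'⟩ := exists_small (B := 5 * B) (ENNReal.mul_ne_top (by simp) hBt)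
    (ENNReal.half_pos hε.ne')
  obtain ⟨N, hN⟩ := hg.2 c hc
  obtain ⟨N₁, hN₁⟩ := eventually_atTop.1 (hf.1.and (hg.1.and hb))
  -- Replace one late g by a bounded continuous h. The difference is harmless because f is bounded
  -- by M, and against h the Cauchy property of f applies directly.
  obtain ⟨h, hcs, hgh, hhc, hhm⟩ :=
    (hN₁ _ (le_max_right N N₁)).2.1.exists_hasCompactSupport_eLpNorm_sub_le hp' hc.ne'
  obtain ⟨H, hH⟩ := hcs.exists_bound_of_continuous hhc
  obtain ⟨c', hcp, hcp'⟩ := exists_small (B := ENNReal.ofReal H) ENNReal.ofReal_ne_top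
    (ENNReal.half_pos hε.ne')
  obtain ⟨N₂, hN₂⟩ := hf.2 c' hcp
  refine ⟨max (max N N₁) N₂, fun m hm n hn => ?_⟩
  set k := max N N₁
  have m1 := hN₁ m ((le_max_right N N₁).trans (le_of_max_le_left hm))
  have m2 := hN₁ n ((le_max_right N N₁).trans (le_of_max_le_left hn))
  have m3 := hN₁ k (le_max_right N N₁)
  have hgb : ∀ m ≥ k, eLpNorm (g m - h) p μ ≤ c + c := fun m hm => by
    have e : g m - h = (g m - g k) + (g k - h) := by abel
    rw [e]
    exact (eLpNorm_add_le ((hN₁ m ((le_max_right N N₁).trans hm)).2.1.sub m3.2.1).1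
      (m3.2.1.sub hhm).1 hp).trans (add_le_add (hN m ((le_max_left N N₁).trans hm) _
        (le_max_left N N₁)) hgh)
  have e : (fun y => f m y * g m y) - (fun y => f n y * g n y) =
      ((fun y => f m y * (g m - h) y) - (fun y => f n y * (g n - h) y)) +
        (fun y => h y * (f m - f n) y) := by
    ext y; simp only [Pi.sub_apply, Pi.add_apply]; ring
  beta_reduce
  rw [e]
  have a1 : AEStronglyMeasurable (fun y => f m y * (g m - h) y) μ := m1.1.1.mul (m1.2.1.sub hhm).1
  have a2 : AEStronglyMeasurable (fun y => f n y * (g n - h) y) μ := m2.1.1.mul (m2.2.1.sub hhm).1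
  have a3 : AEStronglyMeasurable (fun y => h y * (f m - f n) y) μ := hhm.1.mul (m1.1.sub m2.1).1
  refine (eLpNorm_add_le (a1.sub a2) a3 hp).trans ?_
  refine (add_le_add_left (eLpNorm_sub_le a1 a2 hp) _).trans ?_
  have b1 : eLpNorm (fun y => f m y * (g m - h) y) p μ ≤ B * (c + c) :=
    (eLpNorm_mul_le_of_bound m1.2.2).trans (hB ▸ mul_le_mul_right (hgb m (le_of_max_le_left hm)) _)
  have b2 : eLpNorm (fun y => f n y * (g n - h) y) p μ ≤ B * (c + c) :=
    (eLpNorm_mul_le_of_bound m2.2.2).trans (hB ▸ mul_le_mul_right (hgb n (le_of_max_le_left hn)) _)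
  have b3 : eLpNorm (fun y => h y * (f m - f n) y) p μ ≤ ε / 2 :=
    (eLpNorm_mul_le_of_bound (.of_forall hH)).trans ((mul_le_mul_right
      (hN₂ m (le_of_max_le_right hm) n (le_of_max_le_right hn)) _).trans hcp')
  calc _ ≤ (B * (c + c) + B * (c + c)) + ε / 2 := add_le_add (add_le_add b1 b2) b3
    _ ≤ 5 * B * c + ε / 2 := by
        refine add_le_add_left ?_ _
        calc B * (c + c) + B * (c + c) = 4 * B * c := by ring
          _ ≤ 5 * B * c := by gcongr; norm_num
    _ ≤ ε / 2 + ε / 2 := add_le_add_left hc' _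
    _ = ε := ENNReal.add_halves ε

/-- Hölder's inequality for Cauchy sequences. -/
lemma mul {q : ℝ≥0∞} [hpq : ENNReal.HolderTriple p q r] (hp : 1 ≤ p) (hq : 1 ≤ q) (hr : 1 ≤ r)
    (hf : LpCauchy p μ f) (hg : LpCauchy q μ g) : LpCauchy r μ (fun m y => f m y * g m y) := by
  have hqp : ENNReal.HolderTriple q p r := hpq.symm
  refine ⟨?_, fun ε hε => ?_⟩
  · filter_upwards [hf.1, hg.1] with m h1 h2 using h2.mul h1
  obtain ⟨B, hB, hfB⟩ := hf.exists_bound hp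
  obtain ⟨B', hB', hgB⟩ := hg.exists_bound hq
  obtain ⟨c, hc, hc1⟩ := exists_small hB (ENNReal.half_pos hε.ne')
  obtain ⟨c', hcp, hc1'⟩ := exists_small hB' (ENNReal.half_pos hε.ne')
  obtain ⟨N, hN⟩ := hf.2 c' hcp
  obtain ⟨N', hN'⟩ := hg.2 c hc
  obtain ⟨M, hM⟩ := eventually_atTop.1 ((hf.1.and hg.1).and (hfB.and hgB))
  refine ⟨max (max N N') M, fun m hm n hn => ?_⟩
  have m1 := hM m (le_of_max_le_right hm)
  have m2 := hM n (le_of_max_le_right hn)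
  have e : (fun y => f m y * g m y) - (fun y => f n y * g n y) =
      f m • (g m - g n) + g n • (f m - f n) := by
    ext y; simp only [Pi.sub_apply, Pi.add_apply, smul_eq_mul, Pi.mul_apply]; ring
  beta_reduce
  rw [e]
  refine (eLpNorm_add_le (m1.1.1.1.smul (m1.1.2.sub m2.1.2).1)
    (m2.1.2.1.smul (m1.1.1.sub m2.1.1).1) hr).trans ?_
  calc _ ≤ B * c + B' * c' := by
        refine add_le_add ?_ ?_
        · refine (eLpNorm_smul_le_mul_eLpNorm (p := p) (q := q) (m1.1.2.sub m2.1.2).1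
            m1.1.1.1).trans (mul_le_mul' m1.2.1 ?_)
          exact hN' m (le_of_max_le_right (le_of_max_le_left hm)) n
            (le_of_max_le_right (le_of_max_le_left hn))
        · refine (eLpNorm_smul_le_mul_eLpNorm (p := q) (q := p) (m1.1.1.sub m2.1.1).1
            m2.1.2.1).trans (mul_le_mul' m2.2.2 ?_)
          exact hN m (le_of_max_le_left (le_of_max_le_left hm)) n
            (le_of_max_le_left (le_of_max_le_left hn))
    _ ≤ ε / 2 + ε / 2 := add_le_add hc1 hc1'
    _ = ε := ENNReal.add_halves ε

lemma exists_limit (hp : 1 ≤ p) (hf : LpCauchy p μ f) :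
    ∃ g : Sp d → ℝ, MemLp g p μ ∧ Tendsto (fun m => eLpNorm (f m - g) p μ) atTop (𝓝 0) := by
  classical
  have : Fact (1 ≤ p) := ⟨hp⟩
  -- The finitely many terms that may fail to be in L^p are replaced by 0 so that the sequence lives
  -- in the complete space `Lp`.
  set f' : ℕ → Sp d → ℝ := fun m => if MemLp (f m) p μ then f m else 0 with hf'
  have hmem : ∀ m, MemLp (f' m) p μ := fun m => by
    simp only [hf']
    split_ifs with h
    · exact h
    · exact MemLp.zero
  have heq : ∀ᶠ m in atTop, f' m = f m := hf.1.mono fun m hm => by simp only [hf', if_pos hm]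
  have hcau : CauchySeq fun m => (hmem m).toLp (f' m) := by
    rw [EMetric.cauchySeq_iff]
    intro ε hε
    obtain ⟨c, hc, hcε⟩ := exists_between hε
    obtain ⟨N, hN⟩ := hf.2 c hc
    obtain ⟨M, hM⟩ := eventually_atTop.1 heq
    refine ⟨max N M, fun m hm n hn => ?_⟩
    rw [Lp.edist_toLp_toLp, hM m (le_of_max_le_right hm), hM n (le_of_max_le_right hn)]
    exact (hN m (le_of_max_le_left hm) n (le_of_max_le_left hn)).trans_lt hcε
  obtain ⟨G, hG⟩ := cauchySeq_tendsto_of_complete hcau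
  refine ⟨G, Lp.memLp G, ?_⟩
  have hG' : Tendsto (fun m => (hmem m).toLp (f' m)) atTop (𝓝 ((Lp.memLp G).toLp G)) := by
    rwa [Lp.toLp_coeFn]
  refine ((Lp.tendsto_Lp_iff_tendsto_eLpNorm'' f' hmem G (Lp.memLp G)).1 hG').congr' ?_
  filter_upwards [heq] with m hm using by rw [hm]

lemma of_tendsto (hp : 1 ≤ p) {g : Sp d → ℝ} (hf : ∀ᶠ m in atTop, MemLp (f m) p μ)
    (hg : MemLp g p μ) (h : Tendsto (fun m => eLpNorm (f m - g) p μ) atTop (𝓝 0)) :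
    LpCauchy p μ f := by
  refine ⟨hf, fun ε hε => ?_⟩
  obtain ⟨N, hN⟩ := eventually_atTop.1
    (hf.and (ENNReal.tendsto_nhds_zero.1 h _ (ENNReal.half_pos hε.ne')))
  refine ⟨N, fun m hm n hn => ?_⟩
  have e : f m - f n = (f m - g) - (f n - g) := by abel
  rw [e]
  refine (eLpNorm_sub_le ((hN m hm).1.sub hg).1 ((hN n hn).1.sub hg).1 hp).trans ?_
  exact (add_le_add (hN m hm).2 (hN n hn).2).trans (ENNReal.add_halves ε).le

lemma of_unif {V : Set (Sp d)} (hV : IsOpen V) (hb : Bornology.IsBounded V)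
    (hc : ∀ᶠ m in atTop, ContinuousOn (f m) V) {M : ℝ}
    (hM : ∀ᶠ m in atTop, ∀ y ∈ V, |f m y| ≤ M) (h : UniformCauchySeqOn f atTop V) (p : ℝ≥0∞) :
    LpCauchy p (volume.restrict V) f := by
  refine ⟨?_, fun ε hε => ?_⟩
  · filter_upwards [hc, hM] with m h1 h2 using memLp_of_bound_on hV hb h1 h2 p
  · obtain ⟨c, hc, hc'⟩ := exists_pos_measure_mul_le hb p hε
    obtain ⟨N, hN⟩ := Metric.uniformCauchySeqOn_iff.1 h c hc
    refine ⟨N, fun m hm n hn => (eLpNorm_restrict_le_of_bound hV (fun y hy => ?_) p).trans hc'⟩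
    rw [Pi.sub_apply, ← Real.dist_eq]
    exact (hN m hm n hn y hy).le

end LpCauchy

/-! ### Change of variables by bi-Lipschitz maps -/

/-- Lebesgue measure is a multiple of the d-dimensional Hausdorff measure, which a C-Lipschitz map
enlarges by at most the factor C^d. -/
lemma volume_image_le_of_lipschitzOnWith {f : Sp d → Sp d} {C : ℝ≥0} {s : Set (Sp d)}
    (hf : LipschitzOnWith C f s) : volume (f '' s) ≤ (C : ℝ≥0∞) ^ d * volume s := by
  have : (Measure.hausdorffMeasure (X := Sp d) (d : ℝ)).IsAddHaarMeasure := by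
    simpa using isAddHaarMeasure_hausdorffMeasure (E := EuclideanSpace ℝ (Fin d))
  rw [Measure.isAddLeftInvariant_eq_smul (volume : Measure (Sp d))
    (Measure.hausdorffMeasure (X := Sp d) (d : ℝ))]
  simp only [Measure.smul_apply, Measure.nnreal_smul_coe_apply]
  have h := hf.hausdorffMeasure_image_le (d := d) (by positivity)
  rw [ENNReal.rpow_natCast] at h
  calc _ ≤ _ := mul_le_mul_right h _
    _ = _ := by ring

/-- The lower distance bound makes Y injective with a C-Lipschitz inverse on its image. No Jacobian
and no differentiability are involved. -/
lemma map_restrict_le {Y : Sp d → Sp d} {C : ℝ≥0} {V V' : Set (Sp d)} (hV : MeasurableSet V)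
    (hY : ContinuousOn Y V) (hmaps : MapsTo Y V V')
    (hanti : ∀ y ∈ V, ∀ y' ∈ V, dist y y' ≤ C * dist (Y y) (Y y')) :
    (volume.restrict V).map Y ≤ (C : ℝ≥0∞) ^ d • volume.restrict V' := by
  have hYm : AEMeasurable Y (volume.restrict V) := hY.aemeasurable hV
  refine Measure.le_iff.2 fun B hB => ?_
  rw [Measure.map_apply_of_aemeasurable hYm hB, Measure.smul_apply, smul_eq_mul,
    Measure.restrict_apply hB]
  have hnull : NullMeasurableSet (Y ⁻¹' B) (volume.restrict V) := hYm.nullMeasurableSet_preimage hB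
  rw [Measure.restrict_apply₀ hnull]
  set s := Y ⁻¹' B ∩ V with hs
  have hinj : InjOn Y s := fun y hy y' hy' h => by
    have := hanti y hy.2 y' hy'.2
    rw [h, dist_self, mul_zero] at this
    exact dist_le_zero.1 this
  rcases s.eq_empty_or_nonempty with h0 | ⟨y₀, hy₀⟩
  · rw [h0]; simp
  have : Nonempty (Sp d) := ⟨y₀⟩
  have hlip : LipschitzOnWith C (Function.invFunOn Y s) (Y '' s) := by
    refine LipschitzOnWith.of_dist_le_mul ?_
    rintro _ ⟨y, hy, rfl⟩ _ ⟨y', hy', rfl⟩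
    rw [hinj.leftInvOn_invFunOn hy, hinj.leftInvOn_invFunOn hy']
    exact hanti y hy.2 y' hy'.2
  have himg : Function.invFunOn Y s '' (Y '' s) = s := hinj.leftInvOn_invFunOn.image_image
  calc volume s = volume (Function.invFunOn Y s '' (Y '' s)) := by rw [himg]
    _ ≤ (C : ℝ≥0∞) ^ d * volume (Y '' s) := volume_image_le_of_lipschitzOnWith hlip
    _ ≤ (C : ℝ≥0∞) ^ d * volume (B ∩ V') := by
        gcongr
        rintro _ ⟨y, hy, rfl⟩
        exact ⟨hy.1, hmaps hy.2⟩

lemma map_restrict_absolutelyContinuous {Y : Sp d → Sp d} {C : ℝ≥0} {V V' : Set (Sp d)}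
    (hV : MeasurableSet V) (hY : ContinuousOn Y V) (hmaps : MapsTo Y V V')
    (hanti : ∀ y ∈ V, ∀ y' ∈ V, dist y y' ≤ C * dist (Y y) (Y y')) :
    (volume.restrict V).map Y ≪ volume.restrict V' :=
  (Measure.absolutelyContinuous_of_le (map_restrict_le hV hY hmaps hanti)).trans
    Measure.smul_absolutelyContinuous

lemma aestronglyMeasurable_comp_of_antilipschitz {Y : Sp d → Sp d} {C : ℝ≥0} {V V' : Set (Sp d)}
    (hV : MeasurableSet V) (hY : ContinuousOn Y V) (hmaps : MapsTo Y V V')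
    (hanti : ∀ y ∈ V, ∀ y' ∈ V, dist y y' ≤ C * dist (Y y) (Y y')) {h : Sp d → ℝ}
    (hh : AEStronglyMeasurable h (volume.restrict V')) :
    AEStronglyMeasurable (fun y => h (Y y)) (volume.restrict V) :=
  (hh.mono_ac (map_restrict_absolutelyContinuous hV hY hmaps hanti)).comp_aemeasurable
    (hY.aemeasurable hV)

lemma eLpNorm_comp_le_of_antilipschitz {Y : Sp d → Sp d} {C : ℝ≥0} {V V' : Set (Sp d)}
    (hV : MeasurableSet V) (hY : ContinuousOn Y V) (hmaps : MapsTo Y V V')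
    (hanti : ∀ y ∈ V, ∀ y' ∈ V, dist y y' ≤ C * dist (Y y) (Y y')) {p : ℝ≥0∞} (hp : p ≠ ⊤)
    {h : Sp d → ℝ} (hh : AEStronglyMeasurable h (volume.restrict V')) :
    eLpNorm (fun y => h (Y y)) p (volume.restrict V) ≤
      ((C : ℝ≥0∞) ^ d) ^ (1 / p).toReal * eLpNorm h p (volume.restrict V') := by
  have h1 := hh.mono_ac (map_restrict_absolutelyContinuous hV hY hmaps hanti)
  have h2 := eLpNorm_map_measure (p := p) h1 (hY.aemeasurable hV)
  rw [show (fun y => h (Y y)) = h ∘ Y from rfl, ← h2]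
  refine (eLpNorm_mono_measure h (map_restrict_le hV hY hmaps hanti)).trans ?_
  rw [eLpNorm_smul_measure_of_ne_top hp, smul_eq_mul]

/-- Composition with the maps Y is bounded on L^p uniformly in m, so one late g may be replaced by a
continuous compactly supported h. For h, uniform continuity turns uniform convergence of Y into
uniform convergence of h ∘ Y. -/
lemma LpCauchy.comp {p : ℝ≥0∞} (hp : 1 ≤ p) (hp' : p ≠ ⊤) {V V' : Set (Sp d)} (hV : IsOpen V)
    (hb : Bornology.IsBounded V) (hb' : Bornology.IsBounded V')
    {g : ℕ → Sp d → ℝ} {Y : ℕ → Sp d → Sp d} {C : ℝ≥0} (hg : LpCauchy p (volume.restrict V') g)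
    (hlip : ∀ᶠ m in atTop, LipschitzOnWith C (Y m) V)
    (hanti : ∀ᶠ m in atTop, ∀ y ∈ V, ∀ y' ∈ V, dist y y' ≤ C * dist (Y m y) (Y m y'))
    (hmaps : ∀ᶠ m in atTop, MapsTo (Y m) V V') (hY : UniformCauchySeqOn Y atTop V) :
    LpCauchy p (volume.restrict V) (fun m y => g m (Y m y)) := by
  have := hb.volume_restrict_isFiniteMeasure
  have := hb'.volume_restrict_isFiniteMeasure
  set D : ℝ≥0∞ := ((C : ℝ≥0∞) ^ d) ^ (1 / p).toReal with hD
  have hDt : D ≠ ⊤ := ENNReal.rpow_ne_top_of_nonneg (by positivity)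
    (ENNReal.pow_ne_top ENNReal.coe_ne_top)
  have hev := (hlip.and hanti).and hmaps
  refine ⟨?_, fun ε hε => ?_⟩
  · filter_upwards [hev, hg.1] with m h1 h2
    exact ⟨aestronglyMeasurable_comp_of_antilipschitz hV.measurableSet h1.1.1.continuousOn h1.2
      h1.1.2 h2.1, (eLpNorm_comp_le_of_antilipschitz hV.measurableSet h1.1.1.continuousOn h1.2
      h1.1.2 hp' h2.1).trans_lt (ENNReal.mul_lt_top hDt.lt_top h2.2)⟩
  obtain ⟨c, hc, hcε⟩ := LpCauchy.exists_small (B := 5 * D) (ENNReal.mul_ne_top (by simp) hDt)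
    (ENNReal.half_pos hε.ne')
  obtain ⟨N, hN⟩ := hg.2 c hc
  obtain ⟨M, hM⟩ := eventually_atTop.1 (hev.and hg.1)
  set k := max N M
  have hk := (hM k (le_max_right N M)).2
  obtain ⟨h, hcs, hgh, hhc, hhm⟩ := hk.exists_hasCompactSupport_eLpNorm_sub_le hp' hc.ne'
  obtain ⟨η, hη, hηε⟩ := exists_pos_measure_mul_le hb p (ENNReal.half_pos hε.ne')
  obtain ⟨δ, hδ, hδη⟩ := Metric.uniformContinuous_iff.1
    (hcs.uniformContinuous_of_continuous hhc) η hη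
  obtain ⟨N', hN'⟩ := Metric.uniformCauchySeqOn_iff.1 hY δ hδ
  refine ⟨max k N', fun m hm n hn => ?_⟩
  have hgb : ∀ m ≥ k, eLpNorm (fun y => (g m - h) (Y m y)) p (volume.restrict V) ≤ D * (c + c) ∧
      AEStronglyMeasurable (fun y => (g m - h) (Y m y)) (volume.restrict V) := fun m hm => by
    have m1 := hM m ((le_max_right N M).trans hm)
    have e : g m - h = (g m - g k) + (g k - h) := by abel
    refine ⟨(eLpNorm_comp_le_of_antilipschitz hV.measurableSet m1.1.1.1.continuousOn m1.1.2
      m1.1.1.2 hp' (m1.2.sub hhm).1).trans (mul_le_mul_right ?_ _),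
      aestronglyMeasurable_comp_of_antilipschitz hV.measurableSet m1.1.1.1.continuousOn m1.1.2
      m1.1.1.2 (m1.2.sub hhm).1⟩
    rw [e]
    exact (eLpNorm_add_le (m1.2.sub hk).1 (hk.sub hhm).1 hp).trans
      (add_le_add (hN m ((le_max_left N M).trans hm) _ (le_max_left N M)) hgh)
  have e : (fun y => g m (Y m y)) - (fun y => g n (Y n y)) =
      ((fun y => (g m - h) (Y m y)) - (fun y => (g n - h) (Y n y))) +
        (fun y => h (Y m y) - h (Y n y)) := by
    ext y; simp only [Pi.sub_apply, Pi.add_apply]; ring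
  have hcont : ∀ m ≥ k, ContinuousOn (Y m) V := fun m hm =>
    (hM m ((le_max_right N M).trans hm)).1.1.1.continuousOn
  have a3 : AEStronglyMeasurable (fun y => h (Y m y) - h (Y n y)) (volume.restrict V) :=
    ((hhc.comp_continuousOn (hcont m (le_of_max_le_left hm))).sub
      (hhc.comp_continuousOn (hcont n (le_of_max_le_left hn)))).aestronglyMeasurable hV.measurableSet
  have b1 := hgb m (le_of_max_le_left hm)
  have b2 := hgb n (le_of_max_le_left hn)
  have b3 : eLpNorm (fun y => h (Y m y) - h (Y n y)) p (volume.restrict V) ≤ ε / 2 := by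
    refine (eLpNorm_restrict_le_of_bound hV (fun y hy => ?_) p).trans hηε
    rw [← Real.dist_eq]
    exact (hδη (hN' m (le_of_max_le_right hm) n (le_of_max_le_right hn) y hy)).le
  beta_reduce
  rw [e]
  refine (eLpNorm_add_le (b1.2.sub b2.2) a3 hp).trans ?_
  refine (add_le_add_left (eLpNorm_sub_le b1.2 b2.2 hp) _).trans ?_
  calc _ ≤ (D * (c + c) + D * (c + c)) + ε / 2 := add_le_add (add_le_add b1.1 b2.1) b3
    _ ≤ 5 * D * c + ε / 2 := by
        refine add_le_add_left ?_ _
        calc D * (c + c) + D * (c + c) = 4 * D * c := by ring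
          _ ≤ 5 * D * c := by gcongr; norm_num
    _ ≤ ε / 2 + ε / 2 := add_le_add_left hcε _
    _ = ε := ENNReal.add_halves ε

/-! ### The scale of Gagliardo–Nirenberg exponents -/

/-- The exponent `K q / s`. -/
def gnExp (K : ℕ) (q : ℝ≥0∞) (s : ℕ) : ℝ≥0∞ := (K : ℝ≥0∞) * q / s

lemma gnExp_ne_top {K : ℕ} {q : ℝ≥0∞} (hq : q ≠ ⊤) {s : ℕ} (hs : s ≠ 0) : gnExp K q s ≠ ⊤ :=
  ENNReal.div_ne_top (ENNReal.mul_ne_top (ENNReal.natCast_ne_top K) hq) (by exact_mod_cast hs)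

lemma le_gnExp {K : ℕ} {q : ℝ≥0∞} {s : ℕ} (hs : s ≠ 0) (hsK : s ≤ K) : q ≤ gnExp K q s := by
  rw [gnExp, ENNReal.le_div_iff_mul_le (Or.inl (by exact_mod_cast hs))
    (Or.inl (ENNReal.natCast_ne_top s)), mul_comm]
  gcongr

lemma gnExp_anti {K : ℕ} {q : ℝ≥0∞} {s t : ℕ} (hst : s ≤ t) : gnExp K q t ≤ gnExp K q s := by
  rw [gnExp, gnExp]
  gcongr

lemma gnExp_inv {K : ℕ} {q : ℝ≥0∞} (hK : K ≠ 0) (hq : q ≠ 0) (s : ℕ) :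
    (gnExp K q s)⁻¹ = s / (K * q) := by
  rw [gnExp, ENNReal.inv_div (Or.inl (ENNReal.natCast_ne_top s))
    (Or.inr (mul_ne_zero (by exact_mod_cast hK) hq))]

/-- The reciprocal exponent s/(Kq) is linear in the weight s, which is exactly additivity of weights
under Hölder's inequality. -/
lemma gnExp_holderTriple {K : ℕ} {q : ℝ≥0∞} (hK : K ≠ 0) (hq : q ≠ 0) (s t : ℕ) :
    ENNReal.HolderTriple (gnExp K q s) (gnExp K q t) (gnExp K q (s + t)) :=
  ⟨by rw [gnExp_inv hK hq, gnExp_inv hK hq, gnExp_inv hK hq, ← ENNReal.add_div]; push_cast; rfl⟩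

lemma LpCauchy.inv {p : ℝ≥0∞} {μ : Measure (Sp d)} [IsFiniteMeasure μ] {f : ℕ → Sp d → ℝ} {c : ℝ}
    (hc : 0 < c) (hfc : ∀ᶠ m in atTop, ∀ᵐ y ∂μ, c ≤ f m y) (hf : LpCauchy p μ f) :
    LpCauchy p μ (fun m y => (f m y)⁻¹) := by
  refine ⟨?_, fun ε hε => ?_⟩
  · filter_upwards [hfc, hf.1] with m h1 h2
    refine MemLp.of_bound h2.1.aemeasurable.inv.aestronglyMeasurable c⁻¹ ?_
    filter_upwards [h1] with y hy
    rw [Real.norm_eq_abs, abs_inv, abs_of_pos (hc.trans_le hy)]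
    gcongr
  · obtain ⟨e, he, he'⟩ := LpCauchy.exists_small (B := ENNReal.ofReal (c⁻¹ * c⁻¹))
      ENNReal.ofReal_ne_top hε
    obtain ⟨N, hN⟩ := hf.2 e he
    obtain ⟨M, hM⟩ := eventually_atTop.1 hfc
    refine ⟨max N M, fun m hm n hn => ?_⟩
    refine (eLpNorm_le_mul_eLpNorm_of_ae_le_mul (g := f m - f n) (c := c⁻¹ * c⁻¹) ?_ p).trans
      ((mul_le_mul_right (hN m (le_of_max_le_left hm) n (le_of_max_le_left hn)) _).trans he')
    filter_upwards [hM m (le_of_max_le_right hm), hM n (le_of_max_le_right hn)] with y h1 h2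
    have ha' := hc.trans_le h1
    have hb' := hc.trans_le h2
    rw [Pi.sub_apply, Pi.sub_apply, Real.norm_eq_abs, Real.norm_eq_abs,
      inv_sub_inv ha'.ne' hb'.ne', abs_div, abs_sub_comm, abs_of_pos (mul_pos ha' hb'),
      div_eq_inv_mul]
    refine mul_le_mul_of_nonneg_right ?_ (abs_nonneg _)
    rw [mul_inv]
    gcongr

lemma abs_mollify_le_of_ae_bound {m : ℕ} (hm : 1 ≤ m) {g : Sp d → ℝ} {M : ℝ}
    (hg : ∀ᵐ y, |g y| ≤ M) (x : Sp d) : |mollify m g x| ≤ M := by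
  have hi : Integrable fun y => M * kernelAt m (x - y) :=
    ((integrable_kernelAt hm).comp_sub_left x).const_mul M
  have h1 : |mollify m g x| ≤ ∫ y, M * kernelAt m (x - y) := by
    rw [mollify, ← Real.norm_eq_abs]
    refine norm_integral_le_of_norm_le hi ?_
    filter_upwards [hg] with y hy
    rw [norm_mul, Real.norm_eq_abs, Real.norm_of_nonneg (kernelAt_nonneg m _)]
    exact mul_le_mul_of_nonneg_right hy (kernelAt_nonneg m _)
  have h2 := mollify_const hm M x
  rw [mollify] at h2
  rwa [h2] at h1

/-- A subsequence converges almost everywhere, so the pointwise bound passes to the limit. -/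
lemma memLp_top_of_tendsto {p : ℝ≥0∞} (hp : 1 ≤ p) {μ : Measure (Sp d)} {f : ℕ → Sp d → ℝ}
    {g : Sp d → ℝ} {M : ℝ} (hf : ∀ᶠ m in atTop, MemLp (f m) p μ)
    (hb : ∀ᶠ m in atTop, ∀ᵐ y ∂μ, |f m y| ≤ M) (hg : MemLp g p μ)
    (h : Tendsto (fun m => eLpNorm (f m - g) p μ) atTop (𝓝 0)) : ∀ᵐ y ∂μ, |g y| ≤ M := by
  obtain ⟨N, hN⟩ := eventually_atTop.1 (hf.and hb)
  have h1 : TendstoInMeasure μ (fun m => f (m + N)) atTop g := by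
    refine tendstoInMeasure_of_tendsto_eLpNorm (zero_lt_one.trans_le hp).ne'
      (fun n => (hN (n + N) (Nat.le_add_left _ _)).1.1) hg.1 ?_
    exact h.comp (tendsto_add_atTop_nat N)
  obtain ⟨ns, -, hns⟩ := h1.exists_seq_tendsto_ae
  have h2 : ∀ᵐ y ∂μ, ∀ i, |f (ns i + N) y| ≤ M :=
    ae_all_iff.2 fun i => (hN _ (Nat.le_add_left _ _)).2
  filter_upwards [hns, h2] with y h3 h4
  exact le_of_tendsto h3.abs (.of_forall h4)

/-- For large m the mollification at a point of V' sees only values in V, so g may be cut off to V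
and the global convergence applied. -/
lemma LpCauchy.mollify {p : ℝ≥0∞} (hp : 1 ≤ p) (hp' : p ≠ ⊤) {V V' : Set (Sp d)} (hV : IsOpen V)
    {g : Sp d → ℝ} {δ : ℝ} (hδ : 0 < δ) (hVV : thickening δ V' ⊆ V) (hV' : IsOpen V')
    (hg : MemLp g p (volume.restrict V)) :
    LpCauchy p (volume.restrict V') (fun m => LipApprox.mollify m g) := by
  have hG : MemLp (V.indicator g) p volume := (memLp_indicator_iff_restrict hV.measurableSet).2 hg
  have hev : ∀ᶠ m in atTop, LipApprox.mollify m (V.indicator g) =ᵐ[volume.restrict V']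
      LipApprox.mollify m g := by
    filter_upwards [eventually_ball_subset hδ hVV] with m hm
    refine (ae_restrict_iff' hV'.measurableSet).2 (.of_forall fun x hx => ?_)
    exact mollify_congr hm.1 fun y hy =>
      indicator_of_mem (hm.2 x hx (ball_subset_closedBall hy)) _
  refine LpCauchy.congr ?_ hev
  have h1 : LpCauchy p volume (fun m => LipApprox.mollify m (V.indicator g)) := by
    refine LpCauchy.of_tendsto hp ?_ hG (tendsto_eLpNorm_mollify_sub hp hp' hG)
    filter_upwards [eventually_ge_atTop 1] with m hm
    exact ⟨(contDiff_mollify hm (hG.locallyIntegrable hp)).continuous.aestronglyMeasurable,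
      (eLpNorm_mollify_le hm hp hp' hG).trans_lt hG.2⟩
  exact h1.mono_measure Measure.restrict_le_self

/-- The scale in which functions of weight `0` are bounded and those of weight `s ≥ 1` converge in
`L^{Kq/s}`. -/
def sobolevScale (d K : ℕ) (q : ℝ≥0∞) (hq : 1 ≤ q) (hq' : q ≠ ⊤) : RegScale d K where
  Conv s V f := (s = 0 → (∃ M : ℝ, ∀ᶠ m in atTop, ∀ y ∈ V, |f m y| ≤ M) ∧
      ∀ p : ℝ≥0∞, 1 ≤ p → p ≠ ⊤ → LpCauchy p (volume.restrict V) f) ∧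
    (s ≠ 0 → s ≤ K → LpCauchy (gnExp K q s) (volume.restrict V) f)
  Reg s V g := (s = 0 → MemLp g ⊤ (volume.restrict V)) ∧
    (s ≠ 0 → s ≤ K → MemLp g (gnExp K q s) (volume.restrict V))
  congr := by
    rintro s V f g hV hfg ⟨h1, h2⟩
    have hae : ∀ᶠ m in atTop, f m =ᵐ[volume.restrict V] g m := hfg.mono fun m hm =>
      (ae_restrict_iff' hV.measurableSet).2 (.of_forall fun y hy => hm hy)
    refine ⟨fun hs => ⟨?_, fun p hp hp' => ((h1 hs).2 p hp hp').congr hae⟩,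
      fun hs hsK => (h2 hs hsK).congr hae⟩
    obtain ⟨M, hM⟩ := (h1 hs).1
    exact ⟨M, by filter_upwards [hM, hfg] with m a b y hy using b hy ▸ a y hy⟩
  weight := by
    rintro s V f hs hb ⟨h1, h2⟩
    have := hb.volume_restrict_isFiniteMeasure
    refine ⟨fun h => absurd h (Nat.succ_ne_zero s), fun _ _ => ?_⟩
    rcases Nat.eq_zero_or_pos s with rfl | h0
    -- From weight 0 to weight 1 the exponent becomes Kq. This is why weight 0 asks for convergence
    -- in every finite L^p, L^∞ convergence being unavailable.
    · exact (h1 rfl).2 _ (hq.trans (le_gnExp (by simp) hs)) (gnExp_ne_top hq' (by simp))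
    · exact (h2 h0.ne' (by omega)).mono_exponent (gnExp_anti (Nat.le_succ s))
  add := by
    rintro s V f g hs ⟨h1, h2⟩ ⟨h1', h2'⟩
    refine ⟨fun h => ⟨?_, fun p hp hp' => ((h1 h).2 p hp hp').add hp ((h1' h).2 p hp hp')⟩,
      fun h hK => (h2 h hK).add (hq.trans (le_gnExp h hK)) (h2' h hK)⟩
    obtain ⟨M, hM⟩ := (h1 h).1
    obtain ⟨M', hM'⟩ := (h1' h).1
    refine ⟨M + M', ?_⟩
    filter_upwards [hM, hM'] with m a b y hy
    exact (abs_add_le _ _).trans (add_le_add (a y hy) (b y hy))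
  mul := by
    rintro s t V f g hst hV hb ⟨h1, h2⟩ ⟨h1', h2'⟩
    have := hb.volume_restrict_isFiniteMeasure
    have hae : ∀ {k : ℕ → Sp d → ℝ} {M : ℝ}, (∀ᶠ m in atTop, ∀ y ∈ V, |k m y| ≤ M) →
        ∀ᶠ m in atTop, ∀ᵐ y ∂(volume.restrict V), |k m y| ≤ M := by
      intro k M hM
      filter_upwards [hM] with m a using (ae_restrict_iff' hV.measurableSet).2 (.of_forall a)
    -- A factor of weight 0 is bounded and leaves the exponent of the other unchanged; two factors
    -- of positive weight are multiplied by Hölder's inequality.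
    rcases Nat.eq_zero_or_pos s with rfl | hs0 <;> rcases Nat.eq_zero_or_pos t with rfl | ht0
    · refine ⟨fun _ => ⟨?_, fun p hp hp' => ?_⟩, fun h => absurd rfl h⟩
      · obtain ⟨M, hM⟩ := (h1 rfl).1
        obtain ⟨M', hM'⟩ := (h1' rfl).1
        refine ⟨|M| * |M'|, ?_⟩
        filter_upwards [hM, hM'] with m a b y hy
        rw [abs_mul]
        exact mul_le_mul ((a y hy).trans (le_abs_self M)) ((b y hy).trans (le_abs_self M'))
          (abs_nonneg _) (abs_nonneg _)
      · obtain ⟨M, hM⟩ := (h1 rfl).1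
        exact LpCauchy.bdd_mul hp hp' (hae hM) ((h1 rfl).2 p hp hp')
          ((h1' rfl).2 p hp hp')
    · refine ⟨fun h => absurd h (by omega), fun h hK => ?_⟩
      rw [zero_add] at hK ⊢
      have hp := hq.trans (le_gnExp (q := q) ht0.ne' hK)
      have hp' := gnExp_ne_top (K := K) hq' ht0.ne'
      obtain ⟨M, hM⟩ := (h1 rfl).1
      exact LpCauchy.bdd_mul hp hp' (hae hM) ((h1 rfl).2 _ hp hp')
        (h2' ht0.ne' hK)
    · refine ⟨fun h => absurd h (by omega), fun h hK => ?_⟩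
      rw [add_zero] at hK ⊢
      have hp := hq.trans (le_gnExp (q := q) hs0.ne' hK)
      have hp' := gnExp_ne_top (K := K) hq' hs0.ne'
      obtain ⟨M, hM⟩ := (h1' rfl).1
      have := LpCauchy.bdd_mul hp hp' (hae hM) ((h1' rfl).2 _ hp hp')
        (h2 hs0.ne' hK)
      simpa only [mul_comm] using this
    · refine ⟨fun h => absurd h (by omega), fun h hK => ?_⟩
      have := gnExp_holderTriple (K := K) (q := q) (by omega) (zero_lt_one.trans_le hq).ne' s t
      exact LpCauchy.mul (hq.trans (le_gnExp hs0.ne' (by omega)))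
        (hq.trans (le_gnExp ht0.ne' (by omega))) (hq.trans (le_gnExp h hK))
        (h2 hs0.ne' (by omega)) (h2' ht0.ne' (by omega))
  inv := by
    rintro V f c hV hb hc hfc ⟨h1, -⟩
    have := hb.volume_restrict_isFiniteMeasure
    have hae : ∀ᶠ m in atTop, ∀ᵐ y ∂(volume.restrict V), c ≤ f m y := hfc.mono fun m hm =>
      (ae_restrict_iff' hV.measurableSet).2 (.of_forall hm)
    refine ⟨fun _ => ⟨⟨c⁻¹, ?_⟩, fun p hp hp' => ?_⟩, fun h => absurd rfl h⟩
    · filter_upwards [hfc] with m hm y hy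
      rw [abs_inv, abs_of_pos (hc.trans_le (hm y hy))]
      gcongr
      exact hm y hy
    · exact ((h1 rfl).2 p hp hp').inv hc hae
  unif := by
    rintro V f f₀ C hV hb hlip hunif
    obtain ⟨-, -, M, hM⟩ := (holderScale d K 0 zero_le_one).unif hV hb hlip hunif
    refine ⟨fun _ => ⟨⟨M, hM.mono fun m h => h.1⟩, fun p _ _ => ?_⟩, fun h => absurd rfl h⟩
    exact LpCauchy.of_unif hV hb (hlip.mono fun m h => h.continuousOn) (hM.mono fun m h => h.1)
      hunif.uniformCauchySeqOn p
  comp := by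
    rintro s V V' g Y Y₀ C hs hV hb hV' hb' ⟨h1, h2⟩ hcont hlip hanti hmaps hunif
    have hY := hunif.uniformCauchySeqOn
    refine ⟨fun h => ⟨?_, fun p hp hp' => ((h1 h).2 p hp hp').comp hp hp' hV hb hb' hlip hanti
      hmaps hY⟩, fun h hK => (h2 h hK).comp (hq.trans (le_gnExp h hK)) (gnExp_ne_top hq' h) hV hb
      hb' hlip hanti hmaps hY⟩
    obtain ⟨M, hM⟩ := (h1 h).1
    exact ⟨M, by filter_upwards [hM, hmaps] with m a b y hy using a _ (b hy)⟩
  lim := by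
    rintro s V f hs hV hb hcont ⟨h1, h2⟩
    have := hb.volume_restrict_isFiniteMeasure
    rcases Nat.eq_zero_or_pos s with rfl | hs0
    · have h := (h1 rfl).2 1 le_rfl (by simp)
      obtain ⟨g, hg, hfg⟩ := h.exists_limit le_rfl
      obtain ⟨M, hM⟩ := (h1 rfl).1
      have hbd := memLp_top_of_tendsto le_rfl h.1 (hM.mono fun m hm =>
        (ae_restrict_iff' hV.measurableSet).2 (.of_forall hm)) hg hfg
      exact ⟨g, ⟨fun _ => memLp_top_of_bound hg.1 M hbd, fun h => absurd rfl h⟩, h.1, hg, hfg⟩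
    · have h := h2 hs0.ne' hs
      have hp := hq.trans (le_gnExp (q := q) hs0.ne' hs)
      obtain ⟨g, hg, hfg⟩ := h.exists_limit hp
      have hL1 := h.mono_exponent hp
      obtain ⟨g', hg', hfg'⟩ := hL1.exists_limit le_rfl
      -- The limits taken in L^{Kq/s} and in L¹ are both limits in measure, hence equal almost
      -- everywhere.
      have hgg : g =ᵐ[volume.restrict V] g' := by
        obtain ⟨N, hN⟩ := eventually_atTop.1 h.1
        have t1 := tendstoInMeasure_of_tendsto_eLpNorm (f := fun m => f (m + N))
          (zero_lt_one.trans_le hp).ne' (fun n => (hN (n + N) (Nat.le_add_left _ _)).1) hg.1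
          (hfg.comp (tendsto_add_atTop_nat N))
        have t2 := tendstoInMeasure_of_tendsto_eLpNorm (f := fun m => f (m + N))
          one_ne_zero (fun n => (hN (n + N) (Nat.le_add_left _ _)).1) hg'.1
          (hfg'.comp (tendsto_add_atTop_nat N))
        exact tendstoInMeasure_ae_unique t1 t2
      refine ⟨g, ⟨fun h => absurd h hs0.ne', fun _ _ => hg⟩, hL1.1, hg.mono_exponent hp, ?_⟩
      refine hfg'.congr fun m => eLpNorm_congr_ae ?_
      exact (ae_eq_refl (f m)).sub hgg.symm
  moll := by
    rintro s V V' g δ hs hV hb ⟨h1, h2⟩ hδ hVV hV'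
    have := hb.volume_restrict_isFiniteMeasure
    refine ⟨fun h => ⟨?_, fun p hp hp' => LpCauchy.mollify hp hp' hV hδ hVV hV'
      ((h1 h).mono_exponent le_top)⟩, fun h hK => LpCauchy.mollify (hq.trans (le_gnExp h hK))
      (gnExp_ne_top hq' h) hV hδ hVV hV' (h2 h hK)⟩
    -- An essential bound suffices here: mollification turns it into a bound at every point.
    have hm := (memLp_indicator_iff_restrict hV.measurableSet).2 (h1 h)
    refine ⟨(eLpNorm (V.indicator g) ⊤ volume).toReal, ?_⟩
    have hae : ∀ᵐ y, |V.indicator g y| ≤ (eLpNorm (V.indicator g) ⊤ volume).toReal := by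
      rw [eLpNorm_exponent_top]
      exact ae_le_eLpNormEssSup.mono fun y hy => by
        rw [← Real.norm_eq_abs, ← toReal_enorm]
        exact ENNReal.toReal_mono (by rw [← eLpNorm_exponent_top]; exact hm.2.ne) hy
    filter_upwards [eventually_ball_subset hδ hVV] with m hm x hx
    rw [← mollify_congr hm.1 (h := V.indicator g) fun y hy =>
      indicator_of_mem (hm.2 x hx (ball_subset_closedBall hy)) _]
    exact abs_mollify_le_of_ae_bound hm.1 hae x

/-! ### Weak regularity of a function and convergence of its mollifications -/

namespace RegScale

variable {K : ℕ} {Q : RegScale d K} {V : Set (Sp d)}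

lemma S.conv_partialD (hV : IsOpen V) {l s : ℕ} {f : ℕ → Sp d → ℝ} (h : Q.S V l s f) {j : ℕ}
    (hj : j < l) (σ : Fin j → Fin d) : Q.Conv (s + j) V (fun m => partialD σ (f m)) := by
  induction j generalizing l s f with
  | zero =>
    obtain ⟨l, rfl⟩ : ∃ l', l = l' + 1 := ⟨l - 1, by omega⟩
    refine Q.congr hV (.of_forall fun m y _ => ?_) h.2.1
    rw [partialD_fin_zero]
  | succ j ih =>
    obtain ⟨l, rfl⟩ : ∃ l', l = l' + 1 := ⟨l - 1, by omega⟩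
    have h1 := ih (h.2.2 (σ (Fin.last j))) (by omega) (Fin.init σ)
    rw [show s + 1 + j = s + (j + 1) by omega] at h1
    refine Q.congr hV ?_ h1
    filter_upwards [h.1] with m hm y hy
    exact (partialD_succ σ ((hm.contDiffAt (hV.mem_nhds hy)).of_le (by exact_mod_cast le_top))).symm

lemma S_of_conv_partialD (hV : IsOpen V) {l s : ℕ} {f : ℕ → Sp d → ℝ}
    (hf : ∀ᶠ m in atTop, ContDiffOn ℝ ∞ (f m) V)
    (h : ∀ j < l, ∀ σ : Fin j → Fin d, Q.Conv (s + j) V (fun m => partialD σ (f m))) :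
    Q.S V l s f := by
  induction l generalizing s f with
  | zero => exact hf
  | succ l ih =>
    refine ⟨hf, ?_, fun a => ih (hf.mono fun m hm => contDiffOn_pderiv_infty hV hm a)
      fun j hj σ => ?_⟩
    · refine Q.congr hV (.of_forall fun m y _ => ?_) (h 0 (by omega) Fin.elim0)
      rw [partialD_fin_zero]
    · have h1 := h (j + 1) (by omega) (Fin.snoc σ a)
      rw [show s + 1 + j = s + (j + 1) by omega]
      refine Q.congr hV ?_ h1
      filter_upwards [hf] with m hm y hy
      rw [partialD_succ _ ((hm.contDiffAt (hV.mem_nhds hy)).of_le (by exact_mod_cast le_top)),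
        Fin.init_snoc, Fin.snoc_last]

variable (Q) in
/-- The weak derivatives of order `j + 1 ≤ K + 1` exist and have the regularity of weight `j`. -/
def WReg (V : Set (Sp d)) (φ : Sp d → ℝ) : Prop :=
  ∀ j ≤ K, ∀ σ : Fin (j + 1) → Fin d, ∃ g, HasWeakDeriv σ V φ g ∧ Q.Reg j V g

lemma WReg.congr (hV : IsOpen V) {φ φ' : Sp d → ℝ} (h : Q.WReg V φ) (hφ : EqOn φ φ' V) :
    Q.WReg V φ' := fun j hj σ =>
  let ⟨g, hg, hr⟩ := h j hj σ
  ⟨g, hg.congr_left hV.measurableSet hφ, hr⟩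

/-- On the smaller set, derivatives of the mollification are mollified weak derivatives, to which
the axiom `moll` applies order by order. -/
lemma WReg.S_pderiv_mollify (hV : IsOpen V) (hb : Bornology.IsBounded V) {φ : Sp d → ℝ}
    (h : Q.WReg V φ) (hφ : LocallyIntegrable φ) {V' : Set (Sp d)} {δ : ℝ} (hδ : 0 < δ)
    (hVV : thickening δ V' ⊆ V) (hV' : IsOpen V') (a : Fin d) :
    Q.S V' (K + 1) 0 (fun m => pderiv a (mollify m φ)) := by
  refine S_of_conv_partialD hV' ?_ fun j hj σ => ?_
  · filter_upwards [eventually_ge_atTop 1] with m hm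
    exact (pderiv_contDiff (contDiff_mollify hm hφ) a).contDiffOn
  · obtain ⟨g, hg, hr⟩ := h j (by omega) (Fin.snoc σ a)
    rw [zero_add]
    refine Q.congr hV' ?_ (Q.moll (by omega) hV hb hr hδ hVV hV')
    filter_upwards [eventually_ball_subset hδ hVV] with m hm x hx
    have h1 := hg.partialD_mollify hφ hm.1 (hm.2 x hx)
    rw [partialD_succ _ ((contDiff_mollify hm.1 hφ).contDiffAt.of_le (by exact_mod_cast le_top)),
      Fin.init_snoc, Fin.snoc_last] at h1
    exact h1.symm

lemma conv_partialD_succ {ψ : ℕ → Sp d → ℝ} {ψ₀ : Sp d → ℝ} {Λ : ℝ≥0} (hG : GraphSeq V ψ ψ₀ Λ)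
    (h : ∀ a, Q.S V (K + 1) 0 (fun m => pderiv a (ψ m))) {j : ℕ} (hj : j ≤ K)
    (σ : Fin (j + 1) → Fin d) : Q.Conv j V (fun m => partialD σ (ψ m)) := by
  have hD : ∀ᶠ m in atTop, EqOn (partialD (Fin.init σ) (pderiv (σ (Fin.last j)) (ψ m)))
      (partialD σ (ψ m)) V := by
    filter_upwards [hG.smooth] with m hm y hy
    exact (partialD_succ σ ((hm.contDiffAt (hG.isOpen.mem_nhds hy)).of_le
      (by exact_mod_cast le_top))).symm
  have hc := Q.congr hG.isOpen hD ((h (σ (Fin.last j))).conv_partialD hG.isOpen (by omega)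
    (Fin.init σ))
  rwa [zero_add] at hc

/-- The limit of a convergent sequence of graphs inherits its regularity. -/
lemma WReg_of_S_pderiv {ψ : ℕ → Sp d → ℝ} {ψ₀ : Sp d → ℝ} {Λ : ℝ≥0} (hG : GraphSeq V ψ ψ₀ Λ)
    (h : ∀ a, Q.S V (K + 1) 0 (fun m => pderiv a (ψ m))) : Q.WReg V ψ₀ := by
  have hV := hG.isOpen
  intro j hj σ
  have hc := conv_partialD_succ hG h hj σ
  have hcont : ∀ᶠ m in atTop, ContinuousOn (partialD σ (ψ m)) V := by
    filter_upwards [hG.smooth] with m hm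
    exact continuousOn_partialD hV σ (hm.of_le (by exact_mod_cast le_top))
  obtain ⟨g, hr, h1, h2, h3⟩ := Q.lim hj hV hG.bounded hcont hc
  refine ⟨g, ?_, hr⟩
  obtain ⟨M, hM, hM₀⟩ := hG.exists_bound
  have hcont₀ : ContinuousOn ψ₀ V :=
    hG.unif.continuousOn (hG.smooth.mono fun m hm => hm.continuousOn).frequently
  refine hasWeakDeriv_of_tendsto_L1 ?_ ?_ (memLp_of_bound_on hV hG.bounded hcont₀ hM₀ 1) h1 h2
    (tendsto_eLpNorm_of_tendstoUniformlyOn hV hG.bounded hG.unif 1) h3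
  · filter_upwards [hG.smooth] with m hm
    exact hasWeakDeriv_partialD hV σ (hm.of_le (by exact_mod_cast le_top))
  · filter_upwards [hG.smooth, hM] with m hm hM
    exact memLp_of_bound_on hV hG.bounded hm.continuousOn hM 1

end RegScale

/-! ### Gagliardo–Nirenberg inequalities -/

/-- A continuity argument in place of a covering. From a point with f ≠ 0, the estimate `H` reaches
up to the point where f has spent a variation of half of |f x|; hence no point before X can be the
last one up to which the inequality holds. -/
lemma intervalIntegral_rpow_le_of_local {f f' G : ℝ → ℝ} (hf : ∀ x, HasDerivAt f (f' x) x)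
    (hf' : Continuous f') (hG : Continuous G) {r X : ℝ} (hr : 0 < r) (hX : 0 < X) (hfX : f X = 0)
    (H : ∀ x y, x < y → 0 < |f x| → (∀ z ∈ Icc x y, |f z - f x| ≤ |f x| / 2) →
      ∫ t in x..y, |f' t| = |f x| / 2 → ∫ t in x..y, |f t| ^ r ≤ ∫ t in x..y, G t)
    (hGX : ∀ t, 0 ≤ G t) :
    ∫ t in (-X)..X, |f t| ^ r ≤ ∫ t in (-X)..X, G t := by
  have hfc : Continuous f := continuous_iff_continuousAt.2 fun x => (hf x).continuousAt
  have hFc : Continuous fun t => |f t| ^ r := hfc.abs.rpow_const fun _ => Or.inr hr.le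
  have hi : ∀ {g : ℝ → ℝ}, Continuous g → ∀ a b, IntervalIntegrable g volume a b :=
    fun hg a b => hg.intervalIntegrable a b
  refine le_of_forall_pos_le_add fun δ hδ => ?_
  set ε := δ / (2 * X) with hεdef
  have hε : 0 < ε := by positivity
  -- Points up to which the inequality holds with slack ε per unit length. The slack is spent only
  -- to step over zeros of f.
  set Z := Icc (-X) X ∩ {x | ∫ t in (-X)..x, |f t| ^ r ≤ (∫ t in (-X)..x, G t) + ε * (x + X)}
  have hZ : IsCompact Z := isCompact_Icc.inter_right <| isClosed_le
    (intervalIntegral.continuous_primitive (hi hFc) _)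
    ((intervalIntegral.continuous_primitive (hi hG) _).add (by fun_prop))
  have hne : Z.Nonempty := ⟨-X, ⟨le_rfl, by linarith⟩, by simp⟩
  obtain ⟨x, ⟨hx, hxZ⟩, hmax⟩ := hZ.exists_isGreatest hne
  rcases hx.2.eq_or_lt with rfl | hlt
  · have : ε * (x + x) = δ := by rw [hεdef]; field_simp; norm_num
    rw [mem_ofPred_eq, this] at hxZ
    exact hxZ
  exfalso
  have step : ∀ y, x < y → y ≤ X →
      ∫ t in x..y, |f t| ^ r ≤ (∫ t in x..y, G t) + ε * (y - x) → False := by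
    intro y hxy hyX h
    refine absurd (hmax ⟨⟨hx.1.trans hxy.le, hyX⟩, ?_⟩) (not_le.2 hxy)
    rw [mem_ofPred_eq, ← intervalIntegral.integral_add_adjacent_intervals (hi hFc _ x) (hi hFc _ _),
      ← intervalIntegral.integral_add_adjacent_intervals (hi hG _ x) (hi hG _ _)]
    rw [mem_ofPred_eq] at hxZ
    linarith
  rcases eq_or_ne (f x) 0 with h0 | h0
  · have h1 : ∀ᶠ t in 𝓝 x, |f t| ^ r < ε := by
      refine hFc.continuousAt.eventually_lt continuousAt_const ?_
      rw [h0, abs_zero, Real.zero_rpow hr.ne']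
      exact hε
    obtain ⟨η, hη, hb⟩ := Metric.eventually_nhds_iff.1 h1
    have hxy : x < min X (x + η / 2) := lt_min hlt (by linarith)
    refine step _ hxy (min_le_left _ _) ?_
    have h2 : ∫ t in x..min X (x + η / 2), |f t| ^ r ≤ ∫ t in x..min X (x + η / 2), ε := by
      refine intervalIntegral.integral_mono_on hxy.le (hi hFc _ _) (hi continuous_const _ _)
        fun t ht => (hb ?_).le
      rw [Real.dist_eq, abs_of_nonneg (by linarith [ht.1])]
      linarith [ht.2.trans (min_le_right _ _)]
    rw [intervalIntegral.integral_const, smul_eq_mul, mul_comm] at h2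
    have h3 : 0 ≤ ∫ t in x..min X (x + η / 2), G t :=
      intervalIntegral.integral_nonneg hxy.le fun t _ => hGX t
    linarith
  · have hpos : 0 < |f x| := abs_pos.2 h0
    have hFTC : ∀ z, f z - f x = ∫ t in x..z, f' t := fun z =>
      (intervalIntegral.integral_eq_sub_of_hasDerivAt (fun t _ => hf t) (hi hf' _ _)).symm
    have habs : ∀ z, x ≤ z → |f z - f x| ≤ ∫ t in x..z, |f' t| := fun z hz => by
      rw [hFTC]; exact intervalIntegral.abs_integral_le_integral_abs hz
    have hcont : Continuous fun y => ∫ t in x..y, |f' t| :=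
      intervalIntegral.continuous_primitive (hi hf'.abs) _
    -- Since f vanishes at X, its variation on [x, X] is at least |f x|, so it attains the value |f
    -- x|/2 at some y.
    have h1 : |f x| / 2 ∈ Icc (∫ t in x..x, |f' t|) (∫ t in x..X, |f' t|) := by
      have := habs X hlt.le
      rw [hfX, zero_sub, abs_neg] at this
      rw [intervalIntegral.integral_same]
      exact ⟨by positivity, by linarith⟩
    obtain ⟨y, hy, hyv⟩ := intermediate_value_Icc hlt.le hcont.continuousOn h1
    have hxy : x < y := hy.1.lt_of_ne fun h => by
      rw [← h] at hyv
      simp only [intervalIntegral.integral_same] at hyv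
      linarith
    refine step y hxy hy.2 ?_
    have := H x y hxy hpos (fun z hz => (habs z hz.1).trans ?_) hyv
    · nlinarith
    · rw [← hyv]
      exact intervalIntegral.integral_mono_interval le_rfl hz.1 hz.2
        (.of_forall fun t => abs_nonneg _) (hi hf'.abs _ _)

/-- Jensen's inequality on an interval, obtained by integrating the tangent line of t ↦ t^p at the
mean value A; Bernoulli's inequality puts this line below the curve. -/
lemma mul_rpow_le_intervalIntegral {g : ℝ → ℝ} (hg : Continuous g) {x y A p : ℝ} (hxy : x < y)
    (hp : 1 ≤ p) (hA : 0 < A) (h : ∫ t in x..y, |g t| = (y - x) * A) :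
    (y - x) * A ^ p ≤ ∫ t in x..y, |g t| ^ p := by
  have hpt : ∀ t, A ^ p + p * A ^ (p - 1) * (|g t| - A) ≤ |g t| ^ p := fun t => by
    have h1 := one_add_mul_self_le_rpow_one_add (s := |g t| / A - 1)
      (by linarith [div_nonneg (abs_nonneg (g t)) hA.le]) hp
    rw [add_sub_cancel, Real.div_rpow (abs_nonneg _) hA.le, le_div_iff₀ (by positivity)] at h1
    refine le_trans (le_of_eq ?_) h1
    rw [Real.rpow_sub_one hA.ne']
    field_simp
  have hc : Continuous fun t => A ^ p + p * A ^ (p - 1) * (|g t| - A) := by fun_prop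
  have h1 := intervalIntegral.integral_mono_on (μ := volume) hxy.le (hc.intervalIntegrable x y)
    ((hg.abs.rpow_const fun _ => Or.inr (by linarith)).intervalIntegrable x y) fun t _ => hpt t
  have i1 : ∀ k : ℝ, IntervalIntegrable (fun _ => k) volume x y := fun k =>
    continuous_const.intervalIntegrable x y
  have i2 : IntervalIntegrable (fun t => p * A ^ (p - 1) * (|g t| - A)) volume x y :=
    (by fun_prop : Continuous fun t => p * A ^ (p - 1) * (|g t| - A)).intervalIntegrable x y
  refine le_trans (le_of_eq ?_) h1
  rw [intervalIntegral.integral_add (i1 _) i2, intervalIntegral.integral_const_mul,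
    intervalIntegral.integral_sub (hg.abs.intervalIntegrable x y) (i1 _), h]
  simp

/-- A function with slope at least l moves away from zero on one side of the midpoint, which side
depending on its sign there. The outer quarter on that side is a quarter of the length beyond the
midpoint. -/
lemma exists_quarter_le_abs {w f : ℝ → ℝ} (hw : ∀ x, HasDerivAt w (f x) x) {x y l : ℝ}
    (hxy : x < y) (hl : 0 ≤ l) (hf : ∀ z ∈ Icc x y, l ≤ f z) :
    ∃ a b, x ≤ a ∧ b ≤ y ∧ b = a + (y - x) / 4 ∧ ∀ z ∈ Icc a b, (y - x) / 4 * l ≤ |w z| := by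
  have hmono : ∀ a ∈ Icc x y, ∀ b ∈ Icc x y, a ≤ b → l * (b - a) ≤ w b - w a := by
    intro a ha b hb hab
    exact (convex_Icc x y).mul_sub_le_image_sub_of_le_deriv
      (fun z _ => (hw z).continuousAt.continuousWithinAt)
      (fun z _ => (hw z).differentiableAt.differentiableWithinAt)
      (fun z hz => by rw [(hw z).deriv]; exact hf z (interior_subset hz)) a ha b hb hab
  set c := (x + y) / 2 with hc
  have hcm : c ∈ Icc x y := ⟨by linarith, by linarith⟩
  rcases le_total 0 (w c) with h | h
  · refine ⟨y - (y - x) / 4, y, by linarith, le_rfl, by ring, fun z hz => ?_⟩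
    have h1 := hmono c hcm z ⟨by linarith [hz.1], hz.2⟩ (by linarith [hz.1])
    have h2 : l * ((y - x) / 4) ≤ l * (z - c) := mul_le_mul_of_nonneg_left (by linarith [hz.1]) hl
    exact le_trans (by linarith) (le_abs_self (w z))
  · refine ⟨x, x + (y - x) / 4, le_rfl, by linarith, by ring, fun z hz => ?_⟩
    have h1 := hmono z ⟨hz.1, by linarith [hz.2]⟩ c hcm (by linarith [hz.2])
    have h2 : l * ((y - x) / 4) ≤ l * (c - z) := mul_le_mul_of_nonneg_left (by linarith [hz.2]) hl
    exact le_trans (by linarith) (neg_le_abs (w z))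

/-- One-dimensional Gagliardo–Nirenberg inequality. -/
lemma intervalIntegral_deriv_rpow_le {w f f' : ℝ → ℝ} (hw : ∀ x, HasDerivAt w (f x) x)
    (hf : ∀ x, HasDerivAt f (f' x) x) (hf' : Continuous f') {r s p M τ c X : ℝ} (hr : 0 < r)
    (hs : 0 < s) (hp : 1 ≤ p) (hτ : 0 ≤ τ) (hc : 0 ≤ c) (hX : 0 < X) (hfX : f X = 0)
    (hM : ∀ x, |w x| ≤ M)
    (H : ∀ a b, 0 ≤ a → a ≤ M → 0 ≤ b → (a * b) ^ (r / 2) ≤ τ * a ^ s + c * b ^ p) :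
    ∫ t in (-X)..X, |f t| ^ r ≤
      ∫ t in (-X)..X, 6 ^ r * (4 * τ * |w t| ^ s + c * |f' t| ^ p) := by
  have hfc : Continuous f := continuous_iff_continuousAt.2 fun x => (hf x).continuousAt
  have hwc : Continuous w := continuous_iff_continuousAt.2 fun x => (hw x).continuousAt
  have hws : Continuous fun t => |w t| ^ s := hwc.abs.rpow_const fun _ => Or.inr hs.le
  have hfp : Continuous fun t => |f' t| ^ p := hf'.abs.rpow_const fun _ => Or.inr (by linarith)
  refine intervalIntegral_rpow_le_of_local hf hf' (by fun_prop) hr hX hfX ?_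
    (fun t => by positivity)
  intro x y hxy hpos hnear hvar
  set l := |f x| with hl
  set h := y - x with hh
  have hh0 : 0 < h := sub_pos.2 hxy
  have h1 : ∫ t in x..y, |f t| ^ r ≤ h * (3 / 2 * l) ^ r := by
    have : ∫ t in x..y, |f t| ^ r ≤ ∫ t in x..y, (3 / 2 * l) ^ r := by
      refine intervalIntegral.integral_mono_on hxy.le
        ((hfc.abs.rpow_const fun _ => Or.inr hr.le).intervalIntegrable _ _) (by simp) fun t ht => ?_
      have h2 := abs_sub_abs_le_abs_sub (f t) (f x)
      have h3 := hnear t ht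
      exact Real.rpow_le_rpow (abs_nonneg _) (by rw [← hl] at h2; linarith) hr.le
    rwa [intervalIntegral.integral_const, smul_eq_mul] at this
  have h2 : h * (l / (2 * h)) ^ p ≤ ∫ t in x..y, |f' t| ^ p := by
    refine mul_rpow_le_intervalIntegral hf' hxy hp (by positivity) ?_
    rw [hvar, ← hh]
    field_simp
  obtain ⟨a, b, hxa, hby, hab, hlow⟩ : ∃ a b, x ≤ a ∧ b ≤ y ∧ b = a + h / 4 ∧
      ∀ z ∈ Icc a b, h / 4 * (l / 2) ≤ |w z| := by
    rcases le_total 0 (f x) with h0 | h0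
    · rw [abs_of_nonneg h0] at hl
      refine exists_quarter_le_abs hw hxy (by positivity) fun z hz => ?_
      have := (abs_le.1 (hnear z hz)).1
      linarith
    · rw [abs_of_nonpos h0] at hl
      obtain ⟨a, b, h3, h4, h5, h6⟩ := exists_quarter_le_abs (w := fun t => -w t)
        (fun x => (hw x).neg) hxy (l := l / 2) (by positivity) fun z hz => by
          have := (abs_le.1 (hnear z hz)).2
          linarith
      exact ⟨a, b, h3, h4, h5, by simpa using h6⟩
  have h3 : h / 4 * (h * l / 8) ^ s ≤ ∫ t in x..y, |w t| ^ s := by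
    calc h / 4 * (h * l / 8) ^ s = ∫ t in a..b, (h * l / 8) ^ s := by
          rw [intervalIntegral.integral_const, smul_eq_mul, hab]; ring
      _ ≤ ∫ t in a..b, |w t| ^ s := by
          refine intervalIntegral.integral_mono_on (by linarith) (by simp)
            (hws.intervalIntegrable _ _) fun t ht => ?_
          exact Real.rpow_le_rpow (by positivity) (by linarith [hlow t ht]) hs.le
      _ ≤ ∫ t in x..y, |w t| ^ s :=
          intervalIntegral.integral_mono_interval hxa (by linarith) hby
            (.of_forall fun t => by positivity) (hws.intervalIntegrable _ _)
  have haM : h * l / 8 ≤ M := by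
    have := hlow a ⟨le_rfl, by linarith⟩
    linarith [hM a]
  -- On [x, y] of length h one has |f| ≤ 3l/2, the mean of |f'| is l/(2h), and |w| ≥ hl/8 on a
  -- quarter of the interval. The product of the last two values is (l/4)². Hence the factor 6 =
  -- (3/2)/(1/4), and the 4 in front of τ pays for the quarter.
  have h4 := H (h * l / 8) (l / (2 * h)) (by positivity) haM (by positivity)
  have h5 : (h * l / 8 * (l / (2 * h))) ^ (r / 2) = (l / 4) ^ r := by
    rw [show h * l / 8 * (l / (2 * h)) = (l / 4) ^ (2 : ℝ) by
      rw [Real.rpow_two]; field_simp; ring, ← Real.rpow_mul (by positivity)]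
    congr 1; ring
  rw [h5] at h4
  have h6 : (3 / 2 * l) ^ r = 6 ^ r * (l / 4) ^ r := by
    rw [← Real.mul_rpow (by norm_num) (by positivity)]
    congr 1; ring
  rw [intervalIntegral.integral_const_mul, intervalIntegral.integral_add
    ((hws.const_mul _).intervalIntegrable _ _) ((hfp.const_mul _).intervalIntegrable _ _),
    intervalIntegral.integral_const_mul, intervalIntegral.integral_const_mul]
  refine h1.trans ?_
  rw [h6, mul_left_comm]
  refine mul_le_mul_of_nonneg_left ?_ (by positivity)
  calc h * (l / 4) ^ r ≤ h * (τ * (h * l / 8) ^ s + c * (l / (2 * h)) ^ p) :=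
        mul_le_mul_of_nonneg_left h4 hh0.le
    _ = 4 * τ * (h / 4 * (h * l / 8) ^ s) + c * (h * (l / (2 * h)) ^ p) := by ring
    _ ≤ _ := add_le_add (mul_le_mul_of_nonneg_left h3 (by positivity))
        (mul_le_mul_of_nonneg_left h2 hc)

/-- Integration along the lines parallel to a coordinate axis. -/
lemma lintegral_eq_lintegral_lines (a : Fin d) {g : Sp d → ℝ≥0∞} (hg : Measurable g) :
    ∫⁻ x, g x = ∫⁻ x in {x : Sp d | x a ∈ Ico (0 : ℝ) 1},
      ∫⁻ t : ℝ, g (x + t • EuclideanSpace.single a (1 : ℝ)) := by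
  set e : Sp d := EuclideanSpace.single a (1 : ℝ)
  -- The slab has thickness 1 in the direction of the lines, so averaging over its translates
  -- inserts the factor 1 under the integral.
  set χ : Sp d → ℝ≥0∞ := {x : Sp d | x a ∈ Ico (0 : ℝ) 1}.indicator 1 with hχ
  have hms : MeasurableSet {x : Sp d | x a ∈ Ico (0 : ℝ) 1} :=
    measurableSet_Ico.preimage (by fun_prop)
  have hχm : Measurable χ := measurable_one.indicator hms
  have h1 : ∀ x : Sp d, ∫⁻ t : ℝ, χ (x - t • e) = 1 := by
    intro x
    have : (fun t : ℝ => χ (x - t • e)) = (Ioc (x a - 1) (x a)).indicator 1 := by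
      ext t
      by_cases ht : t ∈ Ioc (x a - 1) (x a)
      · rw [indicator_of_mem ht, hχ, indicator_of_mem]
        · rfl
        · simp only [mem_ofPred_eq, mem_Ico, e]
          simp
          exact ⟨ht.2, by linarith [ht.1]⟩
      · rw [indicator_of_notMem ht, hχ, indicator_of_notMem]
        simp only [mem_ofPred_eq, mem_Ico, e]
        simp
        intro h3
        by_contra h4
        exact ht ⟨by linarith, h3⟩
    rw [this, lintegral_indicator_one measurableSet_Ioc, Real.volume_Ioc]
    simp
  calc ∫⁻ x, g x = ∫⁻ x, ∫⁻ t : ℝ, χ (x - t • e) * g x := by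
        refine lintegral_congr fun x => ?_
        rw [lintegral_mul_const _ (by fun_prop), h1, one_mul]
    _ = ∫⁻ t : ℝ, ∫⁻ x, χ (x - t • e) * g x :=
        lintegral_lintegral_swap (by fun_prop)
    _ = ∫⁻ t : ℝ, ∫⁻ x, χ x * g (x + t • e) := by
        refine lintegral_congr fun t => ?_
        rw [← lintegral_add_right_eq_self _ (t • e)]
        simp
    _ = ∫⁻ x, ∫⁻ t : ℝ, χ x * g (x + t • e) :=
        lintegral_lintegral_swap (by fun_prop)
    _ = ∫⁻ x, {x : Sp d | x a ∈ Ico (0 : ℝ) 1}.indicator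
          (fun x => ∫⁻ t : ℝ, g (x + t • e)) x := by
        refine lintegral_congr fun x => ?_
        rw [lintegral_const_mul _ (by fun_prop), hχ]
        by_cases hx : x ∈ {x : Sp d | x a ∈ Ico (0 : ℝ) 1}
        · rw [indicator_of_mem hx, indicator_of_mem hx, Pi.one_apply, one_mul]
        · rw [indicator_of_notMem hx, indicator_of_notMem hx, zero_mul]
    _ = _ := lintegral_indicator hms _

lemma lintegral_ofReal_eq_intervalIntegral {F : ℝ → ℝ} (hF : Continuous F) (h0 : ∀ t, 0 ≤ F t)
    {X : ℝ} (hX : 0 ≤ X) (hs : ∀ t, X ≤ |t| → F t = 0) :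
    ∫⁻ t, ENNReal.ofReal (F t) = ENNReal.ofReal (∫ t in (-X)..X, F t) := by
  rw [intervalIntegral.integral_of_le (by linarith), ← integral_indicator measurableSet_Ioc]
  have : (Ioc (-X) X).indicator F = F := by
    ext t
    by_cases ht : t ∈ Ioc (-X) X
    · rw [indicator_of_mem ht]
    · rw [indicator_of_notMem ht, hs t]
      by_contra! h
      exact ht ⟨(abs_lt.1 h).1, (abs_lt.1 h).2.le⟩
  rw [this, ofReal_integral_eq_lintegral_ofReal _ (.of_forall h0)]
  refine hF.integrable_of_hasCompactSupport (HasCompactSupport.intro (isCompact_Icc (a := -X) (b := X)) fun t ht => hs t ?_)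
  by_contra! h
  exact ht ⟨(abs_lt.1 h).1.le, (abs_lt.1 h).2.le⟩

/-- The one-dimensional inequality on each line parallel to the axis. Compact support supplies the
endpoint where the derivative vanishes. -/
lemma lintegral_pderiv_rpow_le {u : Sp d → ℝ} (hu : ContDiff ℝ ∞ u) (huc : HasCompactSupport u)
    (a : Fin d) {r s p M τ c : ℝ} (hr : 0 < r) (hs : 0 < s) (hp : 1 ≤ p) (hτ : 0 ≤ τ) (hc : 0 ≤ c)
    (hM : ∀ x, |u x| ≤ M)
    (H : ∀ a b, 0 ≤ a → a ≤ M → 0 ≤ b → (a * b) ^ (r / 2) ≤ τ * a ^ s + c * b ^ p) :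
    ∫⁻ x, ENNReal.ofReal (|pderiv a u x| ^ r) ≤
      ENNReal.ofReal (6 ^ r * 4 * τ) * (∫⁻ x, ENNReal.ofReal (|u x| ^ s)) +
      ENNReal.ofReal (6 ^ r * c) * ∫⁻ x, ENNReal.ofReal (|pderiv a (pderiv a u) x| ^ p) := by
  set e : Sp d := EuclideanSpace.single a (1 : ℝ)
  have hd1 := pderiv_contDiff hu a
  have hd2 := pderiv_contDiff hd1 a
  have hline : ∀ (g : Sp d → ℝ), ContDiff ℝ ∞ g → ∀ (x : Sp d) (t : ℝ),
      HasDerivAt (fun t : ℝ => g (x + t • e)) (pderiv a g (x + t • e)) t := fun g hg x t => by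
    have h1 : HasDerivAt (fun t : ℝ => x + t • e) e t := by
      simpa using ((hasDerivAt_id t).smul_const e).const_add x
    exact ((hg.differentiable (by simp) (x + t • e)).hasFDerivAt).comp_hasDerivAt t h1
  have hmeas : ∀ {g : Sp d → ℝ} {k : ℝ}, Continuous g →
      Measurable fun x => ENNReal.ofReal (|g x| ^ k) := fun hg =>
    (hg.measurable.norm.pow_const _).ennreal_ofReal
  have h1d : ∀ x : Sp d, ∫⁻ t : ℝ, ENNReal.ofReal (|pderiv a u (x + t • e)| ^ r) ≤
      ∫⁻ t : ℝ, (ENNReal.ofReal (6 ^ r * 4 * τ) * ENNReal.ofReal (|u (x + t • e)| ^ s) +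
        ENNReal.ofReal (6 ^ r * c) * ENNReal.ofReal (|pderiv a (pderiv a u) (x + t • e)| ^ p)) := by
    intro x
    obtain ⟨B, hB⟩ := isBounded_iff_forall_norm_le.1 huc.isCompact.isBounded
    set X : ℝ := |B| + ‖x‖ + 1
    have hX : 0 < X := by positivity
    have hout : ∀ t : ℝ, X ≤ |t| → x + t • e ∉ tsupport u := fun t ht h => by
      have h1 := hB _ h
      have h2 : ‖t • e‖ = |t| := by rw [norm_smul, Real.norm_eq_abs]; simp [e]
      have h3 := norm_sub_le (x + t • e) x
      rw [add_sub_cancel_left, h2] at h3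
      have := le_abs_self B
      simp only [X] at ht
      linarith
    have z0 : ∀ t : ℝ, X ≤ |t| → u (x + t • e) = 0 := fun t ht =>
      image_eq_zero_of_notMem_tsupport (hout t ht)
    have z1 : ∀ t : ℝ, X ≤ |t| → pderiv a u (x + t • e) = 0 := fun t ht =>
      image_eq_zero_of_notMem_tsupport fun h => hout t ht (tsupport_pderiv_subset a u h)
    have z2 : ∀ t : ℝ, X ≤ |t| → pderiv a (pderiv a u) (x + t • e) = 0 := fun t ht =>
      image_eq_zero_of_notMem_tsupport fun h => hout t ht
        (tsupport_pderiv_subset a u (tsupport_pderiv_subset a _ h))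
    have hl : Continuous fun t : ℝ => x + t • e := by fun_prop
    have main := intervalIntegral_deriv_rpow_le (hline u hu x) (hline _ hd1 x)
      (hd2.continuous.comp hl) hr hs hp hτ hc hX (z1 X (le_abs_self X)) (fun t => hM _) H
    have hc1 : Continuous fun t : ℝ => pderiv a u (x + t • e) := hd1.continuous.comp hl
    rw [lintegral_ofReal_eq_intervalIntegral
      (hc1.abs.rpow_const fun _ => Or.inr hr.le) (fun t => by positivity)
      hX.le fun t ht => by rw [z1 t ht, abs_zero, Real.zero_rpow hr.ne']]
    refine (ENNReal.ofReal_le_ofReal main).trans (le_of_eq ?_)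
    rw [← lintegral_ofReal_eq_intervalIntegral]
    · refine lintegral_congr fun t => ?_
      rw [← ENNReal.ofReal_mul (by positivity), ← ENNReal.ofReal_mul (by positivity),
        ← ENNReal.ofReal_add (by positivity) (by positivity)]
      congr 1
      ring
    · have h1 : Continuous fun t : ℝ => |u (x + t • e)| ^ s :=
        (hu.continuous.comp hl).abs.rpow_const fun _ => Or.inr hs.le
      have h2 : Continuous fun t : ℝ => |pderiv a (pderiv a u) (x + t • e)| ^ p :=
        (hd2.continuous.comp hl).abs.rpow_const fun _ => Or.inr (by linarith)
      exact ((h1.const_mul _).add (h2.const_mul _)).const_mul _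
    · intro t; positivity
    · exact hX.le
    · intro t ht
      rw [z0 t ht, z2 t ht, abs_zero, Real.zero_rpow hs.ne', Real.zero_rpow (by linarith)]
      simp
  have hm0 := hmeas (k := s) hu.continuous
  have hm2 := hmeas (k := p) hd2.continuous
  rw [← lintegral_const_mul _ hm0, ← lintegral_const_mul _ hm2,
    ← lintegral_add_left (hm0.const_mul _), lintegral_eq_lintegral_lines a (hmeas hd1.continuous),
    lintegral_eq_lintegral_lines a (g := fun x => _ + _) ((hm0.const_mul _).add (hm2.const_mul _))]
  exact lintegral_mono h1d

/-- The sum of the `p`-th powers of the `L^p` norms of the derivatives of order `j`. -/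
def derivEnergy (j : ℕ) (p : ℝ) (v : Sp d → ℝ) : ℝ≥0∞ :=
  ∑ σ : Fin j → Fin d, ∫⁻ x, ENNReal.ofReal (|partialD σ v x| ^ p)

lemma le_derivEnergy {j : ℕ} (p : ℝ) (v : Sp d → ℝ) (σ : Fin j → Fin d) :
    ∫⁻ x, ENNReal.ofReal (|partialD σ v x| ^ p) ≤ derivEnergy j p v :=
  Finset.single_le_sum (f := fun σ : Fin j → Fin d =>
    ∫⁻ x, ENNReal.ofReal (|partialD σ v x| ^ p)) (fun _ _ => zero_le) (Finset.mem_univ σ)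

lemma partialD_snoc {j : ℕ} (τ : Fin j → Fin d) (a : Fin d) {v : Sp d → ℝ} (hv : ContDiff ℝ ∞ v) :
    partialD (Fin.snoc τ a : Fin (j + 1) → Fin d) v = pderiv a (partialD τ v) := by
  rw [pderiv_partialD τ a hv]
  ext y
  rw [partialD_succ _ (hv.contDiffAt.of_le (by exact_mod_cast le_top)), Fin.init_snoc,
    Fin.snoc_last]

lemma derivEnergy_ne_top {j : ℕ} {p : ℝ} (hp : 0 < p) {v : Sp d → ℝ} (hv : ContDiff ℝ ∞ v)
    (hc : HasCompactSupport v) : derivEnergy j p v ≠ ⊤ := by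
  refine ENNReal.sum_ne_top.2 fun σ _ => ?_
  have h1 : Continuous fun x => |partialD σ v x| ^ p :=
    (contDiff_partialD σ hv).continuous.abs.rpow_const fun _ => Or.inr hp.le
  have h2 : HasCompactSupport fun x => |partialD σ v x| ^ p :=
    (partialD_hasCompactSupport σ hc).comp_left (g := fun t : ℝ => |t| ^ p)
      (by simp [Real.zero_rpow hp.ne'])
  have h3 := (h1.integrable_of_hasCompactSupport (μ := volume) h2).2
  rw [hasFiniteIntegral_iff_ofReal (.of_forall fun x => by positivity)] at h3
  exact h3.ne

/-- Each derivative of order i+1 is ∂_a of one of order i. Its second derivative in the same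
direction a is among those of order i+2, so pure second derivatives suffice. The power of d counts
the multi-indices. -/
lemma derivEnergy_succ_le {i : ℕ} {v : Sp d → ℝ} (hv : ContDiff ℝ ∞ v) (hvc : HasCompactSupport v)
    {r s p M τ c : ℝ} (hr : 0 < r) (hs : 0 < s) (hp : 1 ≤ p) (hτ : 0 ≤ τ) (hc : 0 ≤ c)
    (hM : ∀ σ : Fin i → Fin d, ∀ x, |partialD σ v x| ≤ M)
    (H : ∀ a b, 0 ≤ a → a ≤ M → 0 ≤ b → (a * b) ^ (r / 2) ≤ τ * a ^ s + c * b ^ p) :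
    derivEnergy (i + 1) r v ≤ (d : ℝ≥0∞) ^ (i + 1) *
      (ENNReal.ofReal (6 ^ r * 4 * τ) * derivEnergy i s v +
        ENNReal.ofReal (6 ^ r * c) * derivEnergy (i + 2) p v) := by
  have h1 : ∀ σ : Fin (i + 1) → Fin d, ∫⁻ x, ENNReal.ofReal (|partialD σ v x| ^ r) ≤
      ENNReal.ofReal (6 ^ r * 4 * τ) * derivEnergy i s v +
        ENNReal.ofReal (6 ^ r * c) * derivEnergy (i + 2) p v := by
    intro σ
    have h2 : partialD σ v = pderiv (σ (Fin.last i)) (partialD (Fin.init σ) v) := by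
      rw [← partialD_snoc _ _ hv, Fin.snoc_init_self]
    have h3 := partialD_snoc (Fin.snoc (Fin.init σ) (σ (Fin.last i))) (σ (Fin.last i)) hv
    rw [partialD_snoc (Fin.init σ) _ hv] at h3
    rw [h2]
    refine (lintegral_pderiv_rpow_le (contDiff_partialD _ hv) (partialD_hasCompactSupport _ hvc) _
      hr hs hp hτ hc (hM _) H).trans (add_le_add (mul_le_mul_right (le_derivEnergy _ _ _) _)
        (mul_le_mul_right ?_ _))
    rw [← h3]
    exact le_derivEnergy _ _ _
  refine (Finset.sum_le_sum fun σ _ => h1 σ).trans (le_of_eq ?_)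
  rw [Finset.sum_const, nsmul_eq_mul, Finset.card_univ, Fintype.card_fun]
  simp

/-- Weighted geometric–arithmetic mean with weights r/(2s) and r/(2p), which sum to 1 by the
relation between the exponents. The powers of τ are chosen to cancel in the geometric mean. -/
lemma mul_rpow_half_le {r s p τ a b : ℝ} (hr : 0 < r) (hs : 0 < s) (hp : 0 < p)
    (hrsp : 2 / r = 1 / s + 1 / p) (hτ : 0 < τ) (ha : 0 ≤ a) (hb : 0 ≤ b) :
    (a * b) ^ (r / 2) ≤ τ * a ^ s + τ ^ (-(p / s)) * b ^ p := by
  have h1 : r / (2 * s) + r / (2 * p) = 1 := by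
    have : r / (2 * s) + r / (2 * p) = r / 2 * (1 / s + 1 / p) := by ring
    rw [this, ← hrsp]; field_simp
  have h2 := Real.geom_mean_le_arith_mean2_weighted (w₁ := r / (2 * s)) (w₂ := r / (2 * p))
    (p₁ := τ * a ^ s) (p₂ := τ ^ (-(p / s)) * b ^ p) (by positivity) (by positivity)
    (by positivity) (by positivity) h1
  have h3 : (τ * a ^ s) ^ (r / (2 * s)) * (τ ^ (-(p / s)) * b ^ p) ^ (r / (2 * p)) =
      (a * b) ^ (r / 2) := by
    rw [Real.mul_rpow hτ.le (by positivity), Real.mul_rpow (by positivity) (by positivity),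
      ← Real.rpow_mul ha, ← Real.rpow_mul hb, ← Real.rpow_mul hτ.le, Real.mul_rpow ha hb,
      show s * (r / (2 * s)) = r / 2 by field_simp, show p * (r / (2 * p)) = r / 2 by field_simp,
      mul_mul_mul_comm, ← Real.rpow_add hτ,
      show r / (2 * s) + -(p / s) * (r / (2 * p)) = 0 by field_simp; ring, Real.rpow_zero, one_mul]
  rw [h3] at h2
  have h4 : r / (2 * s) ≤ 1 := by linarith [(by positivity : 0 ≤ r / (2 * p))]
  have h5 : r / (2 * p) ≤ 1 := by linarith [(by positivity : 0 ≤ r / (2 * s))]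
  exact h2.trans (add_le_add (mul_le_of_le_one_left (by positivity) h4)
    (mul_le_of_le_one_left (by positivity) h5))

/-- Upward induction on the order. Interpolation bounds the middle energy by a small multiple of the
lower one plus a large multiple of the higher one. By induction the lower energy is at most a
constant times the middle one, so that term can be absorbed. The constant depends on v only through
M. -/
lemma exists_derivEnergy_le_succ (K : ℕ) {q M : ℝ} (hq : 1 ≤ q) (hM : 0 ≤ M) {i : ℕ}
    (hi : i + 2 ≤ K) : ∃ C : ℝ≥0, ∀ v : Sp d → ℝ, ContDiff ℝ ∞ v → HasCompactSupport v →
      (∀ x, |v x| ≤ M) →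
      derivEnergy (i + 1) (K * q / (i + 1 : ℕ)) v ≤ C * derivEnergy (i + 2) (K * q / (i + 2 : ℕ)) v := by
  have hK : (0 : ℝ) < K := by exact_mod_cast (by omega : 0 < K)
  have hpos : ∀ j : ℕ, 0 < j → 0 < K * q / (j : ℝ) := fun j hj => by
    have : (0 : ℝ) < j := by exact_mod_cast hj
    positivity
  have hone : ∀ i : ℕ, i + 2 ≤ K → 1 ≤ K * q / ((i + 2 : ℕ) : ℝ) := fun i hi => by
    have h1 : ((i + 2 : ℕ) : ℝ) ≤ K := by exact_mod_cast hi
    rw [le_div_iff₀ (by positivity), one_mul]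
    nlinarith
  induction i with
  | zero =>
    set p := K * q / ((0 + 2 : ℕ) : ℝ) with hp
    refine ⟨(d : ℝ≥0) ^ (0 + 1) * (6 ^ (K * q / ((0 + 1 : ℕ) : ℝ)) * M ^ p).toNNReal,
      fun v hv hvc hvM => ?_⟩
    have h1 := derivEnergy_succ_le (i := 0) hv hvc (r := K * q / ((0 + 1 : ℕ) : ℝ)) (s := 1) (p := p)
      (M := M) (τ := 0) (c := M ^ p) (hpos _ one_pos) one_pos (hone 0 hi) le_rfl (by positivity)
      (fun σ x => by rw [partialD_fin_zero]; exact hvM x) (fun a b ha haM hb => by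
        rw [zero_mul, zero_add (M ^ p * b ^ p), show K * q / ((0 + 1 : ℕ) : ℝ) / 2 = p by rw [hp]; push_cast; ring,
          Real.mul_rpow ha hb]
        exact mul_le_mul_of_nonneg_right
          (Real.rpow_le_rpow ha haM (zero_le_one.trans (hone 0 hi))) (by positivity))
    refine h1.trans (le_of_eq ?_)
    rw [mul_zero, ENNReal.ofReal_zero, zero_mul, zero_add (ENNReal.ofReal _ * _), ← mul_assoc]
    congr 1
  | succ i ih =>
    obtain ⟨C, hC⟩ := ih (by omega)
    set r := K * q / ((i + 1 + 1 : ℕ) : ℝ) with hr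
    set s := K * q / ((i + 1 : ℕ) : ℝ) with hs
    set p := K * q / ((i + 1 + 2 : ℕ) : ℝ) with hp
    have hr0 : 0 < r := hpos _ (by omega)
    have hs0 : 0 < s := hpos _ (by omega)
    have hp0 : 0 < p := hpos _ (by omega)
    have hrsp : 2 / r = 1 / s + 1 / p := by
      rw [hr, hs, hp]; push_cast; field_simp; ring
    set D : ℝ := (d : ℝ) ^ (i + 1 + 1) * (6 ^ r * 4) * C with hD
    have hD0 : 0 ≤ D := by positivity
    -- Chosen so that D τ ≤ 1/2, where D collects all factors in front of the middle energy.
    set τ : ℝ := 1 / (2 * (D + 1)) with hτ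
    have hτ0 : 0 < τ := by positivity
    refine ⟨2 * ((d : ℝ≥0) ^ (i + 1 + 1) * (6 ^ r * τ ^ (-(p / s))).toNNReal),
      fun v hv hvc hvM => ?_⟩
    -- Any finite bound will do and it does not enter the constant, since the weighted inequality
    -- holds for all a ≥ 0.
    obtain ⟨B, hB⟩ : ∃ B, ∀ σ : Fin (i + 1) → Fin d, ∀ x, |partialD σ v x| ≤ B := by
      have : ∀ σ : Fin (i + 1) → Fin d, ∃ B, ∀ x, |partialD σ v x| ≤ B := fun σ =>
        (partialD_hasCompactSupport σ hvc).exists_bound_of_continuous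
          (contDiff_partialD σ hv).continuous
      choose B hB using this
      exact ⟨∑ σ, |B σ|, fun σ x => (hB σ x).trans ((le_abs_self _).trans
        (Finset.single_le_sum (f := fun σ => |B σ|) (fun _ _ => abs_nonneg _)
          (Finset.mem_univ σ)))⟩
    have h1 := derivEnergy_succ_le hv hvc hr0 hs0 (hone (i + 1) hi) hτ0.le
      (c := τ ^ (-(p / s))) (by positivity) hB
      (fun a b ha _ hb => mul_rpow_half_le hr0 hs0 hp0 hrsp hτ0 ha hb)
    have h2 := hC v hv hvc hvM
    set E1 := derivEnergy (i + 1 + 1) r v with hE1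
    -- Finiteness permits subtracting half of the middle energy from both sides.
    have hE1t : E1 ≠ ⊤ := derivEnergy_ne_top hr0 hv hvc
    have h3 : (d : ℝ≥0∞) ^ (i + 1 + 1) * (ENNReal.ofReal (6 ^ r * 4 * τ) * (C * E1)) ≤ E1 / 2 := by
      have : (d : ℝ≥0∞) ^ (i + 1 + 1) * (ENNReal.ofReal (6 ^ r * 4 * τ) * (C * E1)) =
          ENNReal.ofReal (D * τ) * E1 := by
        rw [hD, show (d : ℝ) ^ (i + 1 + 1) * (6 ^ r * 4) * C * τ =
          (d : ℝ) ^ (i + 1 + 1) * ((6 ^ r * 4 * τ) * C) by ring,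
          ENNReal.ofReal_mul (p := (d : ℝ) ^ (i + 1 + 1)) (by positivity),
          ENNReal.ofReal_mul (p := 6 ^ r * 4 * τ) (by positivity), ENNReal.ofReal_pow (by positivity),
          ENNReal.ofReal_natCast, ENNReal.ofReal_coe_nnreal]
        ring
      rw [this, ENNReal.div_eq_inv_mul]
      refine mul_le_mul_left ?_ _
      rw [← ENNReal.ofReal_ofNat, ← ENNReal.ofReal_inv_of_pos (by norm_num)]
      refine ENNReal.ofReal_le_ofReal ?_
      rw [hτ, mul_one_div, div_le_iff₀ (by positivity)]
      norm_num
      linarith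
    have h4 : E1 ≤ E1 / 2 + (d : ℝ≥0∞) ^ (i + 1 + 1) *
        (ENNReal.ofReal (6 ^ r * τ ^ (-(p / s))) * derivEnergy (i + 1 + 2) p v) := by
      refine h1.trans ?_
      rw [mul_add]
      refine add_le_add (le_trans ?_ h3) le_rfl
      gcongr
    set Z := (d : ℝ≥0∞) ^ (i + 1 + 1) *
        (ENNReal.ofReal (6 ^ r * τ ^ (-(p / s))) * derivEnergy (i + 1 + 2) p v) with hZ
    have h5 : E1 / 2 ≤ Z := by
      have h6 : E1 / 2 ≠ ⊤ := ENNReal.div_ne_top hE1t (by norm_num)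
      refine (ENNReal.add_le_add_iff_left h6).1 ?_
      rwa [ENNReal.add_halves]
    have h7 : E1 ≤ 2 * Z := by
      rw [← ENNReal.add_halves E1, two_mul]
      exact add_le_add h5 h5
    refine h7.trans (le_of_eq ?_)
    rw [hZ]
    push_cast
    rw [mul_assoc, mul_assoc]
    rfl

/-- Gagliardo–Nirenberg inequality between `L^∞` and `W^{K,q}`. -/
theorem exists_derivEnergy_le (K : ℕ) {q M : ℝ} (hq : 1 ≤ q) (hM : 0 ≤ M) {j : ℕ} (hj : 1 ≤ j)
    (hjK : j ≤ K) : ∃ C : ℝ≥0, ∀ v : Sp d → ℝ, ContDiff ℝ ∞ v → HasCompactSupport v →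
      (∀ x, |v x| ≤ M) → derivEnergy j (K * q / (j : ℕ)) v ≤ C * derivEnergy K (K * q / (K : ℕ)) v := by
  induction hjK using Nat.decreasingInduction with
  | self => exact ⟨1, fun v _ _ _ => by simp⟩
  | of_succ i hi ih =>
    obtain ⟨C, hC⟩ := ih (by omega)
    obtain ⟨i, rfl⟩ : ∃ i', i = i' + 1 := ⟨i - 1, by omega⟩
    obtain ⟨C', hC'⟩ := exists_derivEnergy_le_succ (d := d) K hq hM hi
    refine ⟨C' * C, fun v hv hvc hvM => (hC' v hv hvc hvM).trans ?_⟩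
    rw [ENNReal.coe_mul, mul_assoc]
    exact mul_le_mul_right (hC v hv hvc hvM) _

/-! ### Sobolev and Hölder functions belong to the scales -/

lemma partialD_add {j : ℕ} (σ : Fin j → Fin d) {f g : Sp d → ℝ} (hf : ContDiff ℝ ∞ f)
    (hg : ContDiff ℝ ∞ g) :
    partialD σ (fun y => f y + g y) = fun y => partialD σ f y + partialD σ g y := by
  ext y
  rw [partialD, show (fun y => f y + g y) = f + g from rfl, iteratedFDeriv_add_apply
    (hf.contDiffAt.of_le (by exact_mod_cast le_top)) (hg.contDiffAt.of_le (by exact_mod_cast le_top))]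
  rfl

/-- Leibniz rule by induction on the order: a cut-off preserves uniform L^q bounds on derivatives.
-/
lemma exists_eLpNorm_partialD_mul_le {q : ℝ≥0∞} (hq : 1 ≤ q) {U : Set (Sp d)}
    {f : ℕ → Sp d → ℝ} {χ : Sp d → ℝ} (hχ : ContDiff ℝ ∞ χ) (hχc : HasCompactSupport χ)
    (hf : ∀ᶠ m in atTop, ContDiff ℝ ∞ (f m)) {K : ℕ}
    (h : ∀ j ≤ K, ∀ σ : Fin j → Fin d, ∃ B : ℝ≥0∞, B ≠ ⊤ ∧
      ∀ᶠ m in atTop, eLpNorm (partialD σ (f m)) q (volume.restrict U) ≤ B) (σ : Fin K → Fin d) :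
    ∃ B : ℝ≥0∞, B ≠ ⊤ ∧ ∀ᶠ m in atTop,
      eLpNorm (partialD σ (fun y => χ y * f m y)) q (volume.restrict U) ≤ B := by
  induction K generalizing χ f with
  | zero =>
    obtain ⟨B, hB, hB'⟩ := h 0 le_rfl σ
    obtain ⟨M, hM⟩ := hχc.exists_bound_of_continuous hχ.continuous
    refine ⟨ENNReal.ofReal M * B, ENNReal.mul_ne_top ENNReal.ofReal_ne_top hB, ?_⟩
    filter_upwards [hB'] with m hm
    rw [partialD_fin_zero] at hm ⊢
    exact (LpCauchy.eLpNorm_mul_le_of_bound (.of_forall hM)).trans (mul_le_mul_right hm _)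
  | succ K ih =>
    set a := σ (Fin.last K)
    obtain ⟨B, hB, hB'⟩ := ih (pderiv_contDiff hχ a) (pderiv_hasCompactSupport hχc a) hf
      (fun j hj τ => h j (by omega) τ) (Fin.init σ)
    obtain ⟨B₂, hB₂, hB₂'⟩ := ih (f := fun m => pderiv a (f m)) hχ hχc
      (hf.mono fun m hm => pderiv_contDiff hm a) (fun j hj τ => by
        obtain ⟨B, hB, hB'⟩ := h (j + 1) (by omega) (Fin.snoc τ a)
        refine ⟨B, hB, ?_⟩
        filter_upwards [hf, hB'] with m hm hmB
        rwa [partialD_snoc τ a hm, pderiv_partialD τ a hm] at hmB) (Fin.init σ)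
    refine ⟨B + B₂, ENNReal.add_ne_top.2 ⟨hB, hB₂⟩, ?_⟩
    filter_upwards [hf, hB', hB₂'] with m hm h1 h2
    have e1 : partialD σ (fun y => χ y * f m y) = fun y =>
        partialD (Fin.init σ) (fun y => pderiv a χ y * f m y) y +
        partialD (Fin.init σ) (fun y => χ y * pderiv a (f m) y) y := by
      rw [← partialD_add _ ((pderiv_contDiff hχ a).mul hm) (hχ.mul (pderiv_contDiff hm a))]
      ext y
      rw [partialD_succ σ ((hχ.mul hm).contDiffAt.of_le (by exact_mod_cast le_top))]
      congr 1
      ext z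
      exact (RegScale.pderiv_mul_eqOn isOpen_univ hχ.contDiffOn hm.contDiffOn a (mem_univ z)).symm
    have c1 : Continuous (partialD (Fin.init σ) (fun y => pderiv a χ y * f m y)) :=
      (contDiff_partialD _ ((pderiv_contDiff hχ a).mul hm)).continuous
    have c2 : Continuous (partialD (Fin.init σ) (fun y => χ y * pderiv a (f m) y)) :=
      (contDiff_partialD _ (hχ.mul (pderiv_contDiff hm a))).continuous
    rw [e1]
    exact (eLpNorm_add_le c1.aestronglyMeasurable c2.aestronglyMeasurable hq).trans
      (add_le_add h1 h2)

lemma lintegral_ofReal_abs_rpow {p : ℝ≥0∞} (hp : p ≠ 0) (hp' : p ≠ ⊤) (f : Sp d → ℝ)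
    (μ : Measure (Sp d)) :
    ∫⁻ x, ENNReal.ofReal (|f x| ^ p.toReal) ∂μ = eLpNorm f p μ ^ p.toReal := by
  have h0 : 0 < p.toReal := ENNReal.toReal_pos hp hp'
  rw [eLpNorm_eq_lintegral_rpow_enorm_toReal hp hp', ← ENNReal.rpow_mul,
    one_div_mul_cancel h0.ne', ENNReal.rpow_one]
  refine lintegral_congr fun x => ?_
  rw [← ENNReal.ofReal_rpow_of_nonneg (abs_nonneg _) h0.le, Real.enorm_eq_ofReal_abs]

/-- Fatou along an almost everywhere convergent subsequence: convergence in one exponent and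
boundedness in another put the limit in the second space. -/
lemma memLp_of_tendsto_of_bound {p q B : ℝ≥0∞} (hq : 1 ≤ q) (hB : B ≠ ⊤) {μ : Measure (Sp d)}
    {f : ℕ → Sp d → ℝ} {g : Sp d → ℝ} (hf : ∀ᶠ m in atTop, MemLp (f m) q μ) (hg : MemLp g q μ)
    (h : Tendsto (fun m => eLpNorm (f m - g) q μ) atTop (𝓝 0))
    (hb : ∀ᶠ m in atTop, eLpNorm (f m) p μ ≤ B) : MemLp g p μ := by
  obtain ⟨N, hN⟩ := eventually_atTop.1 (hf.and hb)
  have h1 : TendstoInMeasure μ (fun m => f (m + N)) atTop g := by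
    refine tendstoInMeasure_of_tendsto_eLpNorm (zero_lt_one.trans_le hq).ne'
      (fun n => (hN (n + N) (Nat.le_add_left _ _)).1.1) hg.1 ?_
    exact h.comp (tendsto_add_atTop_nat N)
  obtain ⟨ns, -, hns⟩ := h1.exists_seq_tendsto_ae
  refine ⟨hg.1, (Lp.eLpNorm_le_of_ae_tendsto (u := atTop) (f := fun i => f (ns i + N)) (C := B)
    (.of_forall fun i => (hN _ (Nat.le_add_left _ _)).2)
    (fun i => (hN _ (Nat.le_add_left _ _)).1.1) hns).trans_lt hB.lt_top⟩

lemma tendsto_eLpNorm_mollify_sub_restrict {p : ℝ≥0∞} (hp : 1 ≤ p) (hp' : p ≠ ⊤)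
    {V V' : Set (Sp d)} (hV : IsOpen V) {g : Sp d → ℝ} {δ : ℝ} (hδ : 0 < δ)
    (hVV : thickening δ V' ⊆ V) (hV' : IsOpen V') (hg : MemLp g p (volume.restrict V)) :
    Tendsto (fun m => eLpNorm (mollify m g - g) p (volume.restrict V')) atTop (𝓝 0) := by
  have hG : MemLp (V.indicator g) p volume := (memLp_indicator_iff_restrict hV.measurableSet).2 hg
  have h1 : Tendsto (fun m => eLpNorm (mollify m (V.indicator g) - V.indicator g) p
      (volume.restrict V')) atTop (𝓝 0) :=
    tendsto_of_tendsto_of_tendsto_of_le_of_le tendsto_const_nhds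
      (tendsto_eLpNorm_mollify_sub hp hp' hG) (fun _ => zero_le) fun m =>
        eLpNorm_mono_measure _ Measure.restrict_le_self
  refine h1.congr' ?_
  filter_upwards [eventually_ball_subset hδ hVV] with m hm
  refine eLpNorm_congr_ae ((ae_restrict_iff' hV'.measurableSet).2 (.of_forall fun x hx => ?_))
  rw [Pi.sub_apply, Pi.sub_apply, indicator_of_mem (hVV (self_subset_thickening hδ V' hx)),
    mollify_congr hm.1 fun y hy => indicator_of_mem (hm.2 x hx (ball_subset_closedBall hy)) g]

/-- A Lipschitz function of class `W^{K+1,q}` is regular in the Sobolev scale. -/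
theorem WReg_of_inSobolev {K : ℕ} {q : ℝ≥0∞} (hq : 1 ≤ q) (hq' : q ≠ ⊤) {φ : Sp d → ℝ} {L : ℝ≥0}
    (hφ : LipschitzWith L φ) {r : ℝ} (hr : 0 < r) (h : InSobolev (K + 1) q (ball 0 r) φ) :
    (sobolevScale d K q hq hq').WReg (ball 0 (r / 4)) φ := by
  have hloc : LocallyIntegrable φ := hφ.continuous.locallyIntegrable
  have hUV : thickening (r / 2) (ball (0 : Sp d) (r / 2)) ⊆ ball 0 r :=
    (Metric.thickening_ball _ _ _).trans (by rw [add_halves])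
  have hVU : thickening (r / 4) (ball (0 : Sp d) (r / 4)) ⊆ ball 0 r :=
    (Metric.thickening_ball _ _ _).trans (ball_subset_ball (by linarith))
  intro j hj σ
  rcases Nat.eq_zero_or_pos j with rfl | hj0
  -- Weight 0 demands a bounded gradient; this comes from the Lipschitz constant, not from the
  -- Sobolev class.
  · obtain ⟨g, hg, hgL, hgm⟩ := exists_hasWeakDeriv_of_lipschitzOnWith
      (isOpen_ball (x := (0 : Sp d)) (ε := r / 4)) hφ.lipschitzOnWith (σ 0)
    have e : (fun _ : Fin (0 + 1) => σ 0) = σ := by ext i; rw [Fin.fin_one_eq_zero i]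
    refine ⟨g, e ▸ hg, fun _ => memLp_top_of_bound hgm.aestronglyMeasurable L (.of_forall hgL),
      fun h => absurd rfl h⟩
  obtain ⟨g, hg, hgq⟩ := h (j + 1) (by omega) σ
  have hsub : ball (0 : Sp d) (r / 4) ⊆ ball 0 r := ball_subset_ball (by linarith)
  refine ⟨g, hg.mono hsub, fun h => absurd h hj0.ne', fun _ _ => ?_⟩
  set a := σ (Fin.last j)
  -- The Gagliardo–Nirenberg inequality is applied to χ ∂_a M_m φ, which is smooth, compactly
  -- supported and bounded by L uniformly in m. The resulting bounds in L^{Kq/j} pass to the weak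
  -- derivative in the limit.
  set f : ℕ → Sp d → ℝ := fun m => pderiv a (mollify m φ) with hf
  have hfs : ∀ᶠ m in atTop, ContDiff ℝ ∞ (f m) := by
    filter_upwards [eventually_ge_atTop 1] with m hm
    exact pderiv_contDiff (contDiff_mollify hm hloc) a
  -- The cut-off is 1 on the ball where the conclusion is wanted. It lives in the ball of radius
  -- r/2, where the mollified derivatives are bounded in L^q.
  let χ : ContDiffBump (0 : Sp d) := ⟨r / 4, r / 3, by positivity, by linarith⟩
  have hχc : HasCompactSupport χ := χ.hasCompactSupport
  have hχs : tsupport χ ⊆ ball 0 (r / 2) := by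
    rw [χ.tsupport_eq]
    exact closedBall_subset_ball (by change r / 3 < r / 2; linarith)
  have hbd : ∀ i ≤ K, ∀ τ : Fin i → Fin d, ∃ B : ℝ≥0∞, B ≠ ⊤ ∧ ∀ᶠ m in atTop,
      eLpNorm (partialD τ (f m)) q (volume.restrict (ball 0 (r / 2))) ≤ B := by
    intro i hi τ
    obtain ⟨g', hg', hgq'⟩ := h (i + 1) (by omega) (Fin.snoc τ a)
    obtain ⟨B, hB, hB'⟩ := (LpCauchy.mollify hq hq' isOpen_ball (by positivity) hUV isOpen_ball
      hgq').exists_bound hq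
    refine ⟨B, hB, ?_⟩
    filter_upwards [hB', eventually_ball_subset (by positivity) hUV] with m h1 h2
    refine le_trans (le_of_eq (eLpNorm_congr_ae ?_)) h1
    refine (ae_restrict_iff' measurableSet_ball).2 (.of_forall fun x hx => ?_)
    have h3 := hg'.partialD_mollify hloc h2.1 (h2.2 x hx)
    rwa [partialD_snoc _ _ (contDiff_mollify h2.1 hloc), pderiv_partialD _ _
      (contDiff_mollify h2.1 hloc)] at h3
  have hK0 : K ≠ 0 := by omega
  have hKr : (K : ℝ) ≠ 0 := by exact_mod_cast hK0
  have hq1 : 1 ≤ q.toReal := by simpa using ENNReal.toReal_mono hq' hq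
  have hq0 : q ≠ 0 := (zero_lt_one.trans_le hq).ne'
  have hE : ∃ E : ℝ≥0∞, E ≠ ⊤ ∧ ∀ᶠ m in atTop,
      derivEnergy K (K * q.toReal / K) (fun y => χ y * f m y) ≤ E := by
    have := fun τ => exists_eLpNorm_partialD_mul_le hq χ.contDiff hχc hfs hbd τ
    choose B hB hB' using this
    refine ⟨∑ τ, B τ ^ q.toReal, ENNReal.sum_ne_top.2 fun τ _ =>
      ENNReal.rpow_ne_top_of_nonneg (by linarith) (hB τ), ?_⟩
    filter_upwards [eventually_all.2 hB'] with m hm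
    refine Finset.sum_le_sum fun τ _ => ?_
    rw [mul_div_cancel_left₀ _ hKr, lintegral_ofReal_abs_rpow hq0 hq']
    refine ENNReal.rpow_le_rpow ?_ (by linarith)
    rw [← eLpNorm_restrict_eq_of_support_subset (s := ball 0 (r / 2))]
    · exact hm τ
    · exact (support_partialD_subset _ _).trans ((tsupport_mul_subset_left).trans hχs)
  obtain ⟨E, hEt, hE⟩ := hE
  obtain ⟨C, hC⟩ := exists_derivEnergy_le (d := d) K hq1 L.2 hj0 hj
  have hp : (gnExp K q j).toReal = K * q.toReal / (j : ℕ) := by simp [gnExp]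
  have hp0 : gnExp K q j ≠ 0 := (zero_lt_one.trans_le (hq.trans (le_gnExp hj0.ne' hj))).ne'
  have hpt := gnExp_ne_top (K := K) hq' hj0.ne'
  have hpr : 0 < (gnExp K q j).toReal := ENNReal.toReal_pos hp0 hpt
  refine memLp_of_tendsto_of_bound (f := fun m => mollify m g) (q := q)
    (B := (C * E) ^ (1 / (gnExp K q j).toReal)) hq
    (ENNReal.rpow_ne_top_of_nonneg (by positivity) (ENNReal.mul_ne_top ENNReal.coe_ne_top hEt))
    (LpCauchy.mollify hq hq' isOpen_ball (by positivity) hVU isOpen_ball hgq).1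
    (hgq.mono_measure (Measure.restrict_mono hsub le_rfl))
    (tendsto_eLpNorm_mollify_sub_restrict hq hq' isOpen_ball (by positivity) hVU isOpen_ball hgq) ?_
  filter_upwards [hE, hfs, eventually_ball_subset (by positivity) hVU] with m h1 h2 h3
  have h4 : ∀ x, |χ x * f m x| ≤ (L : ℝ) := fun x => by
    have h5 : |f m x| ≤ L := by
      have h6 := norm_fderiv_le_of_lipschitz ℝ (lipschitzWith_mollify h3.1 hφ) (x₀ := x)
      have h7 := (fderiv ℝ (mollify m φ) x).le_of_opNorm_le h6 (EuclideanSpace.single a 1)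
      simpa [hf, pderiv] using h7
    rw [abs_mul, abs_of_nonneg χ.nonneg]
    exact (mul_le_of_le_one_left (abs_nonneg _) χ.le_one).trans h5
  have h5 := (le_derivEnergy _ _ (Fin.init σ)).trans
    ((hC _ (χ.contDiff.mul h2) hχc.mul_right h4).trans (mul_le_mul_right h1 _))
  rw [← hp, lintegral_ofReal_abs_rpow hp0 hpt] at h5
  rw [one_div, ENNReal.le_rpow_inv_iff hpr]
  refine le_trans (ENNReal.rpow_le_rpow ?_ hpr.le) h5
  refine le_trans (le_of_eq (eLpNorm_congr_ae ?_)) (eLpNorm_mono_measure _ Measure.restrict_le_self)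
  refine (ae_restrict_iff' measurableSet_ball).2 (.of_forall fun x hx => ?_)
  have h6 := hg.partialD_mollify hloc h3.1 (h3.2 x hx)
  have h7 : EqOn (fun y => χ y * f m y) (f m) (ball 0 (r / 4)) := fun y hy => by
    have : χ y = 1 := χ.one_of_mem_closedBall (ball_subset_closedBall hy)
    simp only [this, one_mul]
  rw [partialD_congr _ isOpen_ball h7 hx, ← h6, partialD_succ _
    ((contDiff_mollify h3.1 hloc).contDiffAt.of_le (by exact_mod_cast le_top))]

/-- A function of class `C^{K+1,α}` is regular in the Hölder scale. -/
theorem WReg_of_inHolder {K : ℕ} {α : ℝ≥0} (hα : α ≤ 1) {φ : Sp d → ℝ} {r : ℝ} (hr : 0 < r)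
    (h : ContDiffOn ℝ (K + 1 : ℕ) φ (ball 0 r))
    (hH : ∀ j ≤ K + 1, ∃ C : ℝ≥0, HolderOnWith C α (iteratedFDeriv ℝ j φ) (ball 0 (r / 2))) :
    (holderScale d K α hα).WReg (ball 0 (r / 2)) φ := by
  intro j hj σ
  have hsub : ball (0 : Sp d) (r / 2) ⊆ ball 0 r := ball_subset_ball (by linarith)
  have hsub' : closedBall (0 : Sp d) (r / 2) ⊆ ball 0 r := closedBall_subset_ball (by linarith)
  have hd : ContDiffOn ℝ (j + 1 : ℕ) φ (ball 0 r) := h.of_le (by exact_mod_cast by omega)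
  -- On the closed smaller ball, compactness yields the boundedness and uniform continuity which the
  -- scale demands but the class on the open ball does not state.
  have hc : ContinuousOn (partialD σ φ) (closedBall 0 (r / 2)) :=
    (continuousOn_partialD isOpen_ball σ hd).mono hsub'
  obtain ⟨M, hM⟩ := (isCompact_closedBall (0 : Sp d) (r / 2)).exists_bound_of_continuousOn hc
  obtain ⟨C, hC⟩ := hH (j + 1) (by omega)
  have hHol : HolderOnWith C α (partialD σ φ) (ball 0 (r / 2)) := by
    rw [holderOnWith_iff_dist] at hC ⊢
    intro x hx y hy
    refine le_trans ?_ (hC x hx y hy)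
    rw [dist_eq_norm, dist_eq_norm, partialD, partialD, ← sub_apply]
    refine (ContinuousMultilinearMap.le_opNorm _ _).trans (le_of_eq ?_)
    simp
  refine ⟨partialD σ φ, hasWeakDeriv_partialD isOpen_ball σ (hd.mono hsub), ?_, max C M.toNNReal,
    fun y hy => ?_, ?_⟩
  · exact ((isCompact_closedBall (0 : Sp d) (r / 2)).uniformContinuousOn_of_continuous hc).mono
      ball_subset_closedBall
  · refine (hM y (ball_subset_closedBall hy)).trans ?_
    exact (Real.le_coe_toNNReal M).trans (by exact_mod_cast le_max_right _ _)
  · rw [holderOnWith_iff_dist] at hHol ⊢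
    intro x hx y hy
    refine (hHol x hx y hy).trans ?_
    gcongr
    exact le_max_left _ _

/-! ### Transversality -/

/-- Near `p`, the set `G` is the subgraph of the Lipschitz function `φ` in the coordinate system
with origin `x` and frame `T`. -/
structure LocalChart (G : Set (Sp (d + 1))) (x : Sp (d + 1)) (T : Frame d) (Λ : ℝ≥0) (φ : Sp d → ℝ)
    (p : Sp (d + 1)) : Prop where
  lip : LipschitzWith Λ φ
  near : ∀ᶠ q in 𝓝 p, (q ∈ frontier G ↔ vert T (q - x) = φ (horiz T (q - x))) ∧
    (q ∈ G ↔ vert T (q - x) < φ (horiz T (q - x)))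

lemma isOpen_cylinder (x : Sp (d + 1)) (T : Frame d) (r h : ℝ) : IsOpen (cylinder x T r h) := by
  have h1 : Continuous fun q => horiz T (q - x) :=
    (horiz T).continuous.comp (continuous_id.sub continuous_const)
  have h2 : Continuous fun q => vert T (q - x) :=
    (vert T).continuous.comp (continuous_id.sub continuous_const)
  exact (isOpen_ball.preimage h1).inter (isOpen_Ioo.preimage h2)

lemma IsGraphIn.mem_iff {G : Set (Sp (d + 1))} {x : Sp (d + 1)} {T : Frame d} {r h : ℝ}
    {φ : Sp d → ℝ} (hG : IsGraphIn G x T r h φ) {q : Sp (d + 1)} (hq : q ∈ cylinder x T r h) :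
    (q ∈ frontier G ↔ vert T (q - x) = φ (horiz T (q - x))) ∧
    (q ∈ G ↔ vert T (q - x) < φ (horiz T (q - x))) := by
  have := (hG (horiz T (q - x)) hq.1).2 (vert T (q - x)) hq.2
  rwa [pt_horiz_vert] at this

lemma IsGraphIn.localChart {G : Set (Sp (d + 1))} {x : Sp (d + 1)} {T : Frame d} {r h : ℝ}
    {φ φ' : Sp d → ℝ} {Λ : ℝ≥0} (hG : IsGraphIn G x T r h φ) (hφ : LipschitzWith Λ φ')
    (he : EqOn φ φ' (ball 0 r)) {p : Sp (d + 1)} (hp : p ∈ cylinder x T r h) :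
    LocalChart G x T Λ φ' p := by
  refine ⟨hφ, ?_⟩
  filter_upwards [(isOpen_cylinder x T r h).mem_nhds hp] with q hq
  have h1 : φ (horiz T (q - x)) = φ' (horiz T (q - x)) := he hq.1
  rw [← h1]
  exact hG.mem_iff hq

lemma LocalChart.vert_eq {G : Set (Sp (d + 1))} {x : Sp (d + 1)} {T : Frame d} {Λ : ℝ≥0}
    {φ : Sp d → ℝ} {p : Sp (d + 1)} (h : LocalChart G x T Λ φ p) (hp : p ∈ frontier G) :
    vert T (p - x) = φ (horiz T (p - x)) := h.near.self_of_nhds.1.1 hp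

/-- The cone condition of one chart, expressed in another chart. -/
lemma LocalChart.exists_add_smul_le {G : Set (Sp (d + 1))} {p x₁ x₂ : Sp (d + 1)}
    {T₁ T₂ : Frame d} {Λ₁ Λ₂ : ℝ≥0} {φ₁ φ₂ : Sp d → ℝ} (h₁ : LocalChart G x₁ T₁ Λ₁ φ₁ p)
    (h₂ : LocalChart G x₂ T₂ Λ₂ φ₂ p) (hp : p ∈ frontier G) :
    ∃ ρ : ℝ, 0 < ρ ∧ ∀ w ∈ ball (horiz T₂ (p - x₂)) ρ, ∀ s ∈ Icc (0 : ℝ) ρ,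
      φ₂ (w + s • horiz T₂ (frameInv T₁ (0, 1))) ≤
        φ₂ w + s * (vert T₂ (frameInv T₁ (0, 1)) - 1 / (1 + Λ₁)) := by
  set e := frameInv T₁ (0, 1) with he
  set e₂ := frameInv T₂ (0, 1) with he₂
  set c : ℝ := 1 / (1 + Λ₁) with hc
  have hc0 : 0 < c := by positivity
  have hcL : 1 - c = c * Λ₁ := by rw [hc]; field_simp; ring
  set y₀ := horiz T₂ (p - x₂)
  -- Start at the point of the second graph over w and move by s along e - c e₂. In the first frame
  -- this vector has height at least 1 - c and horizontal length at most c. Since 1 - c = cΛ₁, the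
  -- path stays in the upward cone of the first chart.
  set Q : Sp d × ℝ → Sp (d + 1) := fun z => pt x₂ T₂ z.1 (φ₂ z.1) + z.2 • (e - c • e₂) with hQ
  have hQc : Continuous Q := by
    refine Continuous.add ?_ (continuous_snd.smul continuous_const)
    simp only [pt_eq]
    exact continuous_const.add ((frameInv T₂).continuous.comp
      (continuous_fst.prodMk (h₂.lip.continuous.comp continuous_fst)))
  have hQ0 : Q (y₀, 0) = p := by
    simp only [hQ, zero_smul, add_zero]
    rw [← h₂.vert_eq hp, pt_horiz_vert]
  have hQt : Tendsto Q (𝓝 (y₀, 0)) (𝓝 p) := hQ0 ▸ hQc.continuousAt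
  obtain ⟨ρ, hρ, hball⟩ := Metric.eventually_nhds_iff.1 (hQt.eventually (h₁.near.and h₂.near))
  refine ⟨ρ / 2, by positivity, fun w hw s hs => ?_⟩
  have hmem : ∀ s' ∈ Icc (0 : ℝ) (ρ / 2), dist (w, s') (y₀, (0 : ℝ)) < ρ := fun s' hs' => by
    rw [Prod.dist_eq, max_lt_iff]
    refine ⟨(mem_ball.1 hw).trans (by linarith), ?_⟩
    rw [Real.dist_eq, sub_zero, abs_of_nonneg hs'.1]
    linarith [hs'.2]
  obtain ⟨⟨hf1, -⟩, hf2, -⟩ := hball (hmem 0 ⟨le_rfl, by positivity⟩)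
  have hQw : Q (w, 0) = pt x₂ T₂ w (φ₂ w) := by simp [hQ]
  have hfr : Q (w, 0) ∈ frontier G := by
    rw [hf2, hQw]; simp
  have hv1 := hf1.1 hfr
  obtain ⟨⟨-, hg1⟩, -, hg2⟩ := hball (hmem s hs)
  have hQs : Q (w, s) = Q (w, 0) + s • (e - c • e₂) := by simp [hQ]
  have hn : ‖horiz T₁ e₂‖ ≤ 1 ∧ |vert T₁ e₂| ≤ 1 := by
    have h1 := norm_frameInv_le T₂ (0 : Sp d) 1
    rw [norm_zero, zero_add, abs_one] at h1
    exact ⟨(norm_horiz_le _ _).trans h1, (abs_vert_le _ _).trans h1⟩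
  have hnot : Q (w, s) ∉ G := by
    rw [hg1, not_lt, hQs, add_sub_right_comm, map_add, map_add, map_smul, map_smul, hv1, smul_eq_mul]
    have h3 : horiz T₁ (e - c • e₂) = -(c • horiz T₁ e₂) := by
      rw [map_sub, he, horiz_frameInv, map_smul, zero_sub]
    have h4 : vert T₁ (e - c • e₂) = 1 - c * vert T₁ e₂ := by
      rw [map_sub, he, vert_frameInv, map_smul, smul_eq_mul]
    have h5 := h₁.lip.dist_le_mul (horiz T₁ (Q (w, 0) - x₁) + s • horiz T₁ (e - c • e₂))
      (horiz T₁ (Q (w, 0) - x₁))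
    rw [dist_eq_norm (_ + _), add_sub_cancel_left, h3, norm_smul, norm_neg, norm_smul,
      Real.norm_of_nonneg hs.1, Real.norm_of_nonneg hc0.le] at h5
    have h6 := (abs_le.1 h5).2
    rw [h3, h4]
    have h7 : (Λ₁ : ℝ) * (s * (c * ‖horiz T₁ e₂‖)) ≤ s * (1 - c) := by
      rw [hcL]
      have : (Λ₁ : ℝ) * (s * (c * ‖horiz T₁ e₂‖)) = (s * (c * Λ₁)) * ‖horiz T₁ e₂‖ := by ring
      rw [this]
      have h8 : 0 ≤ s * (c * Λ₁) := mul_nonneg hs.1 (by positivity)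
      nlinarith [hn.1]
    have h9 : s * (c * vert T₁ e₂) ≤ s * c := by
      refine mul_le_mul_of_nonneg_left ?_ hs.1
      nlinarith [(abs_le.1 hn.2).2]
    linarith
  -- A point outside G is not below the second graph, which is the asserted inequality.
  rw [hg2, not_lt, hQs, hQw, add_sub_right_comm, map_add, map_add, map_smul, map_smul,
    horiz_pt_sub, vert_pt_sub, smul_eq_mul, map_sub, map_sub, map_smul, map_smul, he₂,
    horiz_frameInv, vert_frameInv, smul_zero, sub_zero, smul_eq_mul, mul_one] at hnot
  exact hnot

/-- The difference bound holds uniformly on a ball of base points. It is therefore inherited by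
averages over radius 1/m and holds at all points near p for all large m. -/
lemma LocalChart.eventually_fderiv_mollify_le {G : Set (Sp (d + 1))} {p x₁ x₂ : Sp (d + 1)}
    {T₁ T₂ : Frame d} {Λ₁ Λ₂ : ℝ≥0} {φ₁ φ₂ : Sp d → ℝ} (h₁ : LocalChart G x₁ T₁ Λ₁ φ₁ p)
    (h₂ : LocalChart G x₂ T₂ Λ₂ φ₂ p) (hp : p ∈ frontier G) :
    ∀ᶠ z : ℕ × Sp (d + 1) in atTop ×ˢ 𝓝 p,
      fderiv ℝ (mollify z.1 φ₂) (horiz T₂ (z.2 - x₂)) (horiz T₂ (frameInv T₁ (0, 1))) ≤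
        vert T₂ (frameInv T₁ (0, 1)) - 1 / (1 + Λ₁) := by
  obtain ⟨ρ, hρ, H⟩ := h₁.exists_add_smul_le h₂ hp
  have h1 : ∀ᶠ m : ℕ in atTop, 1 ≤ m ∧ 1 / (m : ℝ) < ρ / 2 :=
    (eventually_ge_atTop 1).and (tendsto_one_div_atTop_nhds_zero_nat.eventually
      (gt_mem_nhds (by positivity)))
  have h2 : ∀ᶠ q in 𝓝 p, horiz T₂ (q - x₂) ∈ ball (horiz T₂ (p - x₂)) (ρ / 2) := by
    have : Continuous fun q => horiz T₂ (q - x₂) :=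
      (horiz T₂).continuous.comp (continuous_id.sub continuous_const)
    exact this.continuousAt.eventually (ball_mem_nhds _ (by positivity))
  filter_upwards [h1.prod_mk h2] with z hz
  refine fderiv_mollify_le hz.1.1 h₂.lip.continuous hρ fun w hw s hs => H w ?_ s hs
  have := dist_triangle w (horiz T₂ (z.2 - x₂)) (horiz T₂ (p - x₂))
  have h3 := mem_ball.1 hw
  have h4 := mem_ball.1 hz.2
  rw [mem_ball]
  linarith [hz.1.2]

/-! ### Monotonicity and convergence of the approximate defining functions -/

namespace Patches

variable (A : Patches d)

/-- Mollified and vertically shifted charts. -/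
def approx (φ : Fin A.N → Sp d → ℝ) (c : ℕ → Fin A.N → ℝ) (m : ℕ) (j : Fin A.N) (y : Sp d) : ℝ :=
  mollify m (φ j) y + c m j

variable {A} {φ : Fin A.N → Sp d → ℝ} {c : ℕ → Fin A.N → ℝ} {Λ : ℝ≥0}

lemma contDiff_approx (hφ : ∀ j, LipschitzWith Λ (φ j)) {m : ℕ} (hm : 1 ≤ m) (j : Fin A.N) :
    ContDiff ℝ ∞ (A.approx φ c m j) :=
  (contDiff_mollify hm (hφ j).continuous.locallyIntegrable).add contDiff_const

lemma fderiv_approx (m : ℕ) (j : Fin A.N) (y : Sp d) :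
    fderiv ℝ (A.approx φ c m j) y = fderiv ℝ (mollify m (φ j)) y :=
  fderiv_add_const (c m j)

lemma tendstoUniformly_approx (hφ : ∀ j, LipschitzWith Λ (φ j))
    (hc : ∀ j, Tendsto (fun m => c m j) atTop (𝓝 0)) (j : Fin A.N) :
    TendstoUniformly (fun m => A.approx φ c m j) (φ j) atTop := by
  rw [Metric.tendstoUniformly_iff]
  intro ε hε
  have h1 : Tendsto (fun m : ℕ => (Λ : ℝ) / m + |c m j|) atTop (𝓝 0) := by
    simpa using (tendsto_const_div_atTop_nhds_zero_nat (Λ : ℝ)).add (hc j).abs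
  filter_upwards [h1.eventually (gt_mem_nhds hε), eventually_ge_atTop 1] with m hm h1m y
  have h2 := abs_mollify_sub_le_of_lipschitz h1m (hφ j) y
  rw [dist_comm, Real.dist_eq, approx, add_sub_right_comm]
  exact ((abs_add_le _ _).trans (add_le_add_left h2 _)).trans_lt hm

/-- Near the boundary point `p`, the weights form a partition of unity and the active coordinate
systems are charts of `G`. -/
structure AdaptedAt (A : Patches d) (φ : Fin A.N → Sp d → ℝ) (Λ : ℝ≥0) (G : Set (Sp (d + 1)))
    (p : Sp (d + 1)) : Prop where
  mem_frontier : p ∈ frontier G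
  pou : ∀ᶠ q in 𝓝 p, A.ξ₀ q = 0 ∧ (∀ j, 0 ≤ A.ξ j q) ∧ ∑ j, A.ξ j q = 1
  chart : ∀ j, p ∈ tsupport (A.ξ j) → LocalChart G (A.x j) (A.T j) Λ (φ j) p

variable {G : Set (Sp (d + 1))} {p : Sp (d + 1)}

lemma tendsto_ver_sub_approx (hφ : ∀ j, LipschitzWith Λ (φ j))
    (hc : ∀ j, Tendsto (fun m => c m j) atTop (𝓝 0)) (j : Fin A.N) :
    Tendsto (fun z : ℕ × Sp (d + 1) => A.ver j z.2 - A.approx φ c z.1 j (A.hor j z.2))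
      (atTop ×ˢ 𝓝 p) (𝓝 (A.ver j p - φ j (A.hor j p))) := by
  have h1 : Tendsto (fun z : ℕ × Sp (d + 1) => A.ver j z.2) (atTop ×ˢ 𝓝 p) (𝓝 (A.ver j p)) :=
    ((A.contDiff_ver j).continuous.tendsto p).comp tendsto_snd
  have h2 : Tendsto (fun z : ℕ × Sp (d + 1) => A.hor j z.2) (atTop ×ˢ 𝓝 p) (𝓝 (A.hor j p)) :=
    ((A.contDiff_hor j).continuous.tendsto p).comp tendsto_snd
  refine h1.sub ?_
  have h3 := ((hφ j).continuous.tendsto (A.hor j p)).comp h2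
  rw [Metric.tendsto_nhds] at h3 ⊢
  intro ε hε
  have h4 := Metric.tendstoUniformly_iff.1 (tendstoUniformly_approx hφ hc j) (ε / 2) (by positivity)
  filter_upwards [h3 (ε / 2) (by positivity), h4.prod_inl (𝓝 p)] with z h5 h6
  have := dist_triangle (A.approx φ c z.1 j (A.hor j z.2)) (φ j (A.hor j z.2)) (φ j (A.hor j p))
  have h7 := h6 (A.hor j z.2)
  rw [dist_comm] at h7
  simp only [Function.comp] at h5
  linarith

/-- The approximate defining functions increase in the vertical direction of every chart. -/
theorem AdaptedAt.eventually_le_fderiv (h : A.AdaptedAt φ Λ G p) (hφ : ∀ j, LipschitzWith Λ (φ j))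
    (hc : ∀ j, Tendsto (fun m => c m j) atTop (𝓝 0)) {x : Sp (d + 1)} {T : Frame d} {Λ₁ : ℝ≥0}
    {φ₁ : Sp d → ℝ} (h₁ : LocalChart G x T Λ₁ φ₁ p) :
    ∀ᶠ z : ℕ × Sp (d + 1) in atTop ×ˢ 𝓝 p,
      1 / (1 + (Λ₁ : ℝ)) / 2 ≤ fderiv ℝ (A.F (A.approx φ c z.1)) z.2 (frameInv T (0, 1)) := by
  set e := frameInv T (0, 1)
  set κ : ℝ := 1 / (1 + (Λ₁ : ℝ)) with hκ
  have hκ0 : 0 < κ := by positivity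
  -- The N error terms together may cost half of κ; the added 1 keeps the denominator positive.
  set δ : ℝ := κ / (2 * (A.N + 1)) with hδ
  have hδ0 : 0 < δ := by positivity
  have hterm : ∀ j, ∀ᶠ z : ℕ × Sp (d + 1) in atTop ×ˢ 𝓝 p, κ * A.ξ j z.2 - δ ≤
      (vert (A.T j) e - fderiv ℝ (A.approx φ c z.1 j) (A.hor j z.2) (horiz (A.T j) e)) * A.ξ j z.2 +
        (A.ver j z.2 - A.approx φ c z.1 j (A.hor j z.2)) * fderiv ℝ (A.ξ j) z.2 e := by
    intro j
    by_cases hj : p ∈ tsupport (A.ξ j)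
    · have hch := h.chart j hj
      have h1 := h₁.eventually_fderiv_mollify_le hch h.mem_frontier
      -- The derivative of the weight is multiplied by the height above the graph, which tends to 0
      -- at a boundary point.
      have h2 : Tendsto (fun z : ℕ × Sp (d + 1) => (A.ver j z.2 -
          A.approx φ c z.1 j (A.hor j z.2)) * fderiv ℝ (A.ξ j) z.2 e) (atTop ×ˢ 𝓝 p) (𝓝 0) := by
        have h3 : Continuous fun q => fderiv ℝ (A.ξ j) q e :=
          ((A.ξ_smooth j).continuous_fderiv (by simp)).clm_apply continuous_const
        have h4 := (tendsto_ver_sub_approx (p := p) hφ hc j).mul ((h3.tendsto p).comp tendsto_snd)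
        have h5 : A.ver j p - φ j (A.hor j p) = 0 := sub_eq_zero.2 (hch.vert_eq h.mem_frontier)
        rw [h5, zero_mul] at h4
        exact h4
      filter_upwards [h1, h2.eventually (lt_mem_nhds (neg_lt_zero.2 hδ0)),
        (h.pou.prod_inr atTop)] with z h5 h6 h7
      have h8 := h7.2.1 j
      rw [fderiv_approx]
      have h9 : κ * A.ξ j z.2 ≤ (vert (A.T j) e -
          fderiv ℝ (mollify z.1 (φ j)) (A.hor j z.2) (horiz (A.T j) e)) * A.ξ j z.2 :=
        mul_le_mul_of_nonneg_right (by
          have : fderiv ℝ (mollify z.1 (φ j)) (A.hor j z.2) (horiz (A.T j) e) ≤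
            vert (A.T j) e - κ := h5
          linarith) h8
      linarith
    · have h1 : ∀ᶠ q in 𝓝 p, q ∉ tsupport (A.ξ j) :=
        (isClosed_tsupport _).isOpen_compl.mem_nhds hj
      filter_upwards [h1.prod_inr atTop] with z hz
      rw [image_eq_zero_of_notMem_tsupport hz, image_eq_zero_of_notMem_tsupport
        (fun h => hz (tsupport_fderiv_apply_subset ℝ e h))]
      linarith
  have h0 : ∀ᶠ q in 𝓝 p, fderiv ℝ A.ξ₀ q = 0 := by
    have : A.ξ₀ =ᶠ[𝓝 p] fun _ => 0 := h.pou.mono fun q hq => hq.1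
    filter_upwards [this.fderiv (𝕜 := ℝ)] with q hq
    rw [hq]; simp
  filter_upwards [eventually_all.2 hterm, h0.prod_inr atTop, h.pou.prod_inr atTop,
    (eventually_ge_atTop 1).prod_inl (𝓝 p)] with z h1 h2 h3 h4
  rw [A.fderiv_F (fun j => contDiff_approx hφ h4 j), h2]
  have h5 := Finset.sum_le_sum fun j (_ : j ∈ Finset.univ) => h1 j
  rw [Finset.sum_sub_distrib, ← Finset.mul_sum, h3.2.2, Finset.sum_const, Finset.card_univ,
    Fintype.card_fin, nsmul_eq_mul, mul_one] at h5
  have h6 : A.N * δ ≤ κ / 2 := by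
    rw [hδ, mul_div_assoc', div_le_div_iff₀ (by positivity) (by norm_num)]
    nlinarith
  simp only [zero_apply, sub_zero]
  linarith

/-- Mollification does not increase the Lipschitz constant, so the gradients are bounded
independently of m on bounded sets. -/
theorem exists_norm_fderiv_le (hφ : ∀ j, LipschitzWith Λ (φ j))
    (hc : ∀ j, Tendsto (fun m => c m j) atTop (𝓝 0)) (b : ℝ) :
    ∃ C : ℝ≥0, ∀ᶠ m in atTop, ∀ q ∈ closedBall (0 : Sp (d + 1)) b,
      ‖fderiv ℝ (A.F (A.approx φ c m)) q‖ ≤ C := by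
  have hK := isCompact_closedBall (0 : Sp (d + 1)) b
  have hb : ∀ j, ∃ B : ℝ, 0 ≤ B ∧ ∀ᶠ m in atTop, ∀ q ∈ closedBall (0 : Sp (d + 1)) b,
      (1 + Λ) * |A.ξ j q| +
      |A.ver j q - A.approx φ c m j (A.hor j q)| * ‖fderiv ℝ (A.ξ j) q‖ ≤ B := by
    intro j
    have h1 : Continuous fun q => (1 + (Λ : ℝ)) * |A.ξ j q| +
        (|A.ver j q - φ j (A.hor j q)| + 1) * ‖fderiv ℝ (A.ξ j) q‖ :=
      ((A.ξ_smooth j).continuous.abs.const_mul _).add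
        ((((A.contDiff_ver j).continuous.sub ((hφ j).continuous.comp
          (A.contDiff_hor j).continuous)).abs.add continuous_const).mul
          ((A.ξ_smooth j).continuous_fderiv (by simp)).norm)
    obtain ⟨B, hB⟩ := hK.exists_bound_of_continuousOn h1.continuousOn
    refine ⟨|B|, abs_nonneg _, ?_⟩
    filter_upwards [Metric.tendstoUniformly_iff.1 (tendstoUniformly_approx hφ hc j) 1 one_pos]
      with m hm q hq
    refine le_trans (add_le_add le_rfl (mul_le_mul_of_nonneg_right ?_ (norm_nonneg _)))
      ((le_abs_self _).trans ((hB q hq).trans (le_abs_self B)))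
    have h2 := hm (A.hor j q)
    rw [Real.dist_eq] at h2
    have h3 := abs_sub_le (A.ver j q) (φ j (A.hor j q)) (A.approx φ c m j (A.hor j q))
    linarith
  choose B hB0 hB using hb
  obtain ⟨B₀, hB₀⟩ := hK.exists_bound_of_continuousOn
    (A.ξ₀_smooth.continuous_fderiv (by simp)).norm.continuousOn
  refine ⟨(∑ j, B j + |B₀|).toNNReal, ?_⟩
  filter_upwards [eventually_all.2 hB, eventually_ge_atTop 1] with m h1 h3 q hq
  have h2 : ‖fderiv ℝ A.ξ₀ q‖ ≤ |B₀| := by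
    have := hB₀ q hq
    rw [norm_norm] at this
    exact this.trans (le_abs_self _)
  refine le_trans ?_ (Real.le_coe_toNNReal _)
  refine ContinuousLinearMap.opNorm_le_bound _
    (add_nonneg (Finset.sum_nonneg fun j _ => hB0 j) (by positivity)) fun v => ?_
  rw [A.fderiv_F (fun j => contDiff_approx hφ h3 j), add_mul, Real.norm_eq_abs]
  refine (abs_sub _ _).trans (add_le_add ?_ ?_)
  · rw [Finset.sum_mul]
    refine (Finset.abs_sum_le_sum_abs _ _).trans (Finset.sum_le_sum fun j _ => ?_)
    refine le_trans ?_ (mul_le_mul_of_nonneg_right (h1 j q hq) (norm_nonneg v))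
    rw [add_mul]
    refine (abs_add_le _ _).trans (add_le_add ?_ ?_)
    · rw [abs_mul, mul_right_comm]
      refine mul_le_mul_of_nonneg_right ?_ (abs_nonneg _)
      rw [fderiv_approx]
      have h4 := norm_fderiv_le_of_lipschitz ℝ (lipschitzWith_mollify h3 (hφ j))
        (x₀ := A.hor j q)
      have h5 := (fderiv ℝ (mollify m (φ j)) (A.hor j q)).le_of_opNorm_le h4 (horiz (A.T j) v)
      rw [Real.norm_eq_abs] at h5
      have h6 := norm_horiz_le (A.T j) v
      have h7 := abs_vert_le (A.T j) v
      have h8 := mul_le_mul_of_nonneg_left h6 Λ.2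
      refine (abs_sub _ _).trans ?_
      have h9 : (Λ : ℝ) * ‖horiz (A.T j) v‖ ≤ Λ * ‖v‖ := h8
      linarith
    · rw [abs_mul, mul_assoc]
      exact mul_le_mul_of_nonneg_left ((fderiv ℝ (A.ξ j) q).le_opNorm v) (abs_nonneg _)
  · exact ((fderiv ℝ A.ξ₀ q).le_opNorm v).trans (mul_le_mul_of_nonneg_right h2 (norm_nonneg v))

lemma tendstoUniformlyOn_F (hφ : ∀ j, LipschitzWith Λ (φ j))
    (hc : ∀ j, Tendsto (fun m => c m j) atTop (𝓝 0)) (b : ℝ) :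
    TendstoUniformlyOn (fun m => A.F (A.approx φ c m)) (A.F φ) atTop
      (closedBall (0 : Sp (d + 1)) b) := by
  have hK := isCompact_closedBall (0 : Sp (d + 1)) b
  have hb : ∀ j, ∃ B : ℝ, ∀ q ∈ closedBall (0 : Sp (d + 1)) b, ‖A.ξ j q‖ ≤ B := fun j =>
    hK.exists_bound_of_continuousOn (A.ξ_smooth j).continuous.continuousOn
  choose B hB using hb
  rw [Metric.tendstoUniformlyOn_iff]
  intro ε hε
  set D : ℝ := ∑ j, |B j| + 1
  have hD : 0 < D := add_pos_of_nonneg_of_pos (Finset.sum_nonneg fun j _ => abs_nonneg _) one_pos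
  have h1 : ∀ᶠ m in atTop, ∀ j y, dist (φ j y) (A.approx φ c m j y) < ε / D :=
    eventually_all.2 fun j => Metric.tendstoUniformly_iff.1 (tendstoUniformly_approx hφ hc j) _
      (by positivity)
  filter_upwards [h1] with m hm q hq
  rw [Real.dist_eq, F_eq, F_eq, sub_sub_sub_cancel_right, ← Finset.sum_sub_distrib]
  have h2 : ∀ j, |(A.ver j q - φ j (A.hor j q)) * A.ξ j q -
      (A.ver j q - A.approx φ c m j (A.hor j q)) * A.ξ j q| ≤ ε / D * |B j| := fun j => by
    have h3 := hm j (A.hor j q)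
    rw [Real.dist_eq] at h3
    rw [← sub_mul, abs_mul, sub_sub_sub_cancel_left, abs_sub_comm]
    exact mul_le_mul h3.le ((hB j q hq).trans (le_abs_self _)) (abs_nonneg _) (by positivity)
  refine ((Finset.abs_sum_le_sum_abs _ _).trans (Finset.sum_le_sum fun j _ => h2 j)).trans_lt ?_
  rw [← Finset.mul_sum, div_mul_eq_mul_div, div_lt_iff₀ hD]
  exact mul_lt_mul_of_pos_left (lt_add_one _) hε

lemma AdaptedAt.F_eq_zero (h : A.AdaptedAt φ Λ G p) : A.F φ p = 0 := by
  rw [F_eq, h.pou.self_of_nhds.1, sub_zero]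
  refine Finset.sum_eq_zero fun j _ => ?_
  by_cases hj : p ∈ tsupport (A.ξ j)
  · have h5 : A.ver j p - φ j (A.hor j p) = 0 :=
      sub_eq_zero.2 ((h.chart j hj).vert_eq h.mem_frontier)
    rw [h5, zero_mul]
  · rw [image_eq_zero_of_notMem_tsupport hj, mul_zero]

end Patches

/-! ### Solving for the approximating graphs -/

lemma exists_root_of_deriv_ge {g : ℝ → ℝ} (hg : Differentiable ℝ g) {a η κ : ℝ} (hη : 0 < η)
    (hd : ∀ t ∈ Icc (a - η) (a + η), κ ≤ deriv g t) (h0 : |g a| < κ * η) :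
    ∃ t, |t - a| < η ∧ g t = 0 := by
  have hmono : ∀ s ∈ Icc (a - η) (a + η), ∀ t ∈ Icc (a - η) (a + η), s ≤ t →
      κ * (t - s) ≤ g t - g s :=
    (convex_Icc _ _).mul_sub_le_image_sub_of_le_deriv hg.continuous.continuousOn
      hg.differentiableOn fun t ht => hd t (interior_subset ht)
  have ha : a ∈ Icc (a - η) (a + η) := ⟨by linarith, by linarith⟩
  have h1 := hmono (a - η) ⟨le_rfl, by linarith⟩ a ha (by linarith)
  have h2 := hmono a ha (a + η) ⟨by linarith, le_rfl⟩ (by linarith)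
  rw [sub_sub_cancel] at h1
  rw [add_sub_cancel_left] at h2
  have h3 := abs_lt.1 h0
  obtain ⟨t, ht, ht0⟩ := intermediate_value_Ioo (by linarith : a - η ≤ a + η)
    hg.continuous.continuousOn (show (0 : ℝ) ∈ Ioo _ _ from ⟨by linarith, by linarith⟩)
  exact ⟨t, abs_lt.2 ⟨by linarith [ht.1], by linarith [ht.2]⟩, ht0⟩

lemma strictMonoOn_of_deriv_ge {g : ℝ → ℝ} (hg : Differentiable ℝ g) {a η κ : ℝ} (hκ : 0 < κ)
    (hd : ∀ t ∈ Icc (a - η) (a + η), κ ≤ deriv g t) : StrictMonoOn g (Icc (a - η) (a + η)) :=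
  strictMonoOn_of_deriv_pos (convex_Icc _ _) hg.continuous.continuousOn fun t ht =>
    hκ.trans_le (hd t (interior_subset ht))

/-- Compactness makes the neighbourhood and the index from which the property holds independent of
the point. -/
lemma exists_thickening_of_eventually {X : Type*} [PseudoMetricSpace X] {K : Set X}
    (hK : IsCompact K) {P : ℕ → X → Prop} (h : ∀ p ∈ K, ∀ᶠ z : ℕ × X in atTop ×ˢ 𝓝 p, P z.1 z.2) :
    ∃ ε > 0, ∀ᶠ m in atTop, ∀ p ∈ thickening ε K, P m p := by
  have h1 : {z : ℕ × X | P z.1 z.2} ∈ atTop ×ˢ 𝓝ˢ K := hK.mem_prod_nhdsSet_of_forall h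
  obtain ⟨s, hs, t, ht, hst⟩ := mem_prod_iff.1 h1
  obtain ⟨U, hU, hKU, hUt⟩ := mem_nhdsSet_iff_exists.1 ht
  obtain ⟨ε, hε, hεU⟩ := hK.exists_thickening_subset_open hU hKU
  exact ⟨ε, hε, mem_of_superset hs fun m hm p hp =>
    hst (mk_mem_prod hm (hUt (hεU hp)))⟩

/-- No continuity of ψ is assumed: the smooth implicit function through the point stays in the band,
and uniqueness of roots there identifies it with ψ. -/
lemma contDiffAt_of_implicit {H : Sp d × ℝ → ℝ} (hH : ContDiff ℝ ∞ H) {ψ φ : Sp d → ℝ} {y : Sp d}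
    {η : ℝ} (hφ : Continuous φ) (hy : |ψ y - φ y| < η) (h0 : H (y, ψ y) = 0)
    (hd : fderiv ℝ H (y, ψ y) (0, 1) ≠ 0)
    (huniq : ∀ᶠ z in 𝓝 y, ∀ t, |t - φ z| < η → H (z, t) = 0 → t = ψ z) : ContDiffAt ℝ ∞ ψ y := by
  have hinv : (fderiv ℝ H (y, ψ y) ∘L .inr ℝ (Sp d) ℝ).IsInvertible := by
    refine ⟨ContinuousLinearEquiv.unitsEquivAut ℝ (Units.mk0 _ hd), ?_⟩
    ext
    simp
  have hat : ContDiffAt ℝ ∞ H (y, ψ y) := hH.contDiffAt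
  have hne : (∞ : WithTop ℕ∞) ≠ 0 := by simp
  set θ := hat.implicitFunction hne hinv
  have h1 : θ y = ψ y := hat.implicitFunction_apply_self hne hinv
  have h2 : ContDiffAt ℝ ∞ θ y := hat.contDiffAt_implicitFunction hne hinv
  have h3 : ∀ᶠ z in 𝓝 y, H (z, θ z) = H (y, ψ y) :=
    hat.eventually_apply_implicitFunction hne hinv
  have h4 : ∀ᶠ z in 𝓝 y, |θ z - φ z| < η := by
    refine ContinuousAt.eventually_lt (h2.continuousAt.sub hφ.continuousAt).abs
      continuousAt_const ?_
    rwa [h1]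
  refine h2.congr_of_eventuallyEq ?_
  filter_upwards [h3, h4, huniq] with z h5 h6 h7
  exact (h7 _ h6 (h5.trans h0)).symm

namespace Patches

variable {A : Patches d} {φ : Fin A.N → Sp d → ℝ} {c : ℕ → Fin A.N → ℝ} {Λ Λ₁ : ℝ≥0}
  {G : Set (Sp (d + 1))} {x : Sp (d + 1)} {T : Frame d} {φ₁ : Sp d → ℝ} {y₀ : Sp d} {r η₁ : ℝ}

lemma deriv_comp_pt {F : Sp (d + 1) → ℝ} (hF : Differentiable ℝ F) (x : Sp (d + 1)) (T : Frame d)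
    (y : Sp d) (t : ℝ) :
    HasDerivAt (fun t => F (pt x T y t)) (fderiv ℝ F (pt x T y t) (frameInv T (0, 1))) t := by
  have h1 : HasDerivAt (fun t : ℝ => pt x T y t) (frameInv T (0, 1)) t := by
    have h2 : HasDerivAt (fun t : ℝ => ((y, t) : Sp d × ℝ)) (0, 1) t :=
      (hasDerivAt_const t y).prodMk (hasDerivAt_id t)
    exact ((frameInv T).hasFDerivAt.comp_hasDerivAt t h2).const_add x
  exact (hF _).hasFDerivAt.comp_hasDerivAt t h1

/-- On a compact piece of the graph the vertical derivative of F_m is at least κ throughout a band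
of fixed width, while F_m is uniformly small on the graph, where F vanishes. So each vertical
segment of the band carries exactly one root. -/
theorem exists_graphSeq (hφ : ∀ j, LipschitzWith Λ (φ j))
    (hc : ∀ j, Tendsto (fun m => c m j) atTop (𝓝 0)) (hφ₁ : LipschitzWith Λ₁ φ₁)
    (hA : ∀ y ∈ closedBall y₀ r, A.AdaptedAt φ Λ G (pt x T y (φ₁ y)))
    (hch : ∀ y ∈ closedBall y₀ r, LocalChart G x T Λ₁ φ₁ (pt x T y (φ₁ y))) (hη₁ : 0 < η₁) :
    ∃ (η κ : ℝ) (Λ' : ℝ≥0) (ψ : ℕ → Sp d → ℝ), 0 < η ∧ η ≤ η₁ ∧ 0 < κ ∧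
      GraphSeq (ball y₀ r) ψ φ₁ Λ' ∧ ∀ᶠ m in atTop, ∀ y ∈ closedBall y₀ r,
        |ψ m y - φ₁ y| < η ∧ A.F (A.approx φ c m) (pt x T y (ψ m y)) = 0 ∧
        κ ≤ fderiv ℝ (A.F (A.approx φ c m)) (pt x T y (ψ m y)) (frameInv T (0, 1)) ∧
        ∀ t, |t - φ₁ y| ≤ η → (A.F (A.approx φ c m) (pt x T y t) < 0 ↔ t < ψ m y) := by
  classical
  set e := frameInv T (0, 1) with he
  set κ : ℝ := 1 / (1 + (Λ₁ : ℝ)) / 2 with hκ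
  have hκ0 : 0 < κ := by positivity
  have hptc : Continuous fun z : Sp d × ℝ => pt x T z.1 z.2 :=
    continuous_const.add (frameInv T).continuous
  have hgc : Continuous fun y => pt x T y (φ₁ y) :=
    hptc.comp (continuous_id.prodMk hφ₁.continuous)
  set Γ : Set (Sp (d + 1)) := (fun y => pt x T y (φ₁ y)) '' closedBall y₀ r
  have hΓ : IsCompact Γ := (isCompact_closedBall y₀ r).image hgc
  obtain ⟨ε, hε, hder⟩ := exists_thickening_of_eventually hΓ (P := fun m p =>
      κ ≤ fderiv ℝ (A.F (A.approx φ c m)) p e) (by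
    rintro _ ⟨y, hy, rfl⟩
    exact (hA y hy).eventually_le_fderiv hφ hc (hch y hy))
  set η := min (ε / 2) η₁ with hη
  have hη0 : 0 < η := by positivity
  have hband : ∀ y ∈ closedBall y₀ r, ∀ t, |t - φ₁ y| ≤ η → pt x T y t ∈ thickening ε Γ := by
    intro y hy t ht
    refine mem_thickening_iff.2 ⟨_, mem_image_of_mem _ hy, (dist_pt_le x T y y t (φ₁ y)).trans_lt ?_⟩
    rw [dist_self, zero_add]
    linarith [ht.trans (min_le_left (ε / 2) η₁)]
  obtain ⟨b, hb⟩ := isBounded_iff_forall_norm_le.1 (hΓ.isBounded.thickening (δ := ε))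
  obtain ⟨C, hC⟩ := exists_norm_fderiv_le hφ hc b
  have hball : ∀ p ∈ thickening ε Γ, p ∈ closedBall (0 : Sp (d + 1)) b := fun p hp =>
    mem_closedBall_zero_iff.2 (hb p hp)
  have hsm : ∀ᶠ m in atTop, ContDiff ℝ ∞ (A.F (A.approx φ c m)) :=
    (eventually_ge_atTop 1).mono fun m hm => A.contDiff_F fun j => contDiff_approx hφ hm j
  have hd : ∀ᶠ m in atTop, ∀ y ∈ closedBall y₀ r, ∀ t ∈ Icc (φ₁ y - η) (φ₁ y + η),
      κ ≤ deriv (fun t => A.F (A.approx φ c m) (pt x T y t)) t := by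
    filter_upwards [hsm, hder] with m h1 h2 y hy t ht
    rw [(deriv_comp_pt (h1.differentiable (by simp)) x T y t).deriv]
    exact h2 _ (hband y hy t (abs_le.2 ⟨by linarith [ht.1], by linarith [ht.2]⟩))
  have hdiff : ∀ᶠ m in atTop, ∀ y, Differentiable ℝ fun t => A.F (A.approx φ c m) (pt x T y t) :=
    hsm.mono fun m h1 y t =>
      (deriv_comp_pt (h1.differentiable (by simp)) x T y t).differentiableAt
  -- Taken with η' = η this defines ψ; arbitrarily small η' give the uniform convergence, since
  -- roots in the band are unique.
  have hroot : ∀ η' : ℝ, 0 < η' → η' ≤ η → ∀ᶠ m in atTop, ∀ y ∈ closedBall y₀ r,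
      ∃ t, |t - φ₁ y| < η' ∧ A.F (A.approx φ c m) (pt x T y t) = 0 := by
    intro η' hη' hle
    have hu := Metric.tendstoUniformlyOn_iff.1 (tendstoUniformlyOn_F (A := A) hφ hc b) (κ * η')
      (by positivity)
    filter_upwards [hu, hd, hdiff] with m h1 h2 h3 y hy
    refine exists_root_of_deriv_ge (h3 y) hη' (fun t ht => h2 y hy t
      ⟨by linarith [ht.1], by linarith [ht.2]⟩) ?_
    have h4 := h1 _ (hball _ (hband y hy (φ₁ y) (by simpa using hη0.le)))
    rwa [(hA y hy).F_eq_zero, dist_comm, Real.dist_eq, sub_zero] at h4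
  have hmono : ∀ᶠ m in atTop, ∀ y ∈ closedBall y₀ r,
      StrictMonoOn (fun t => A.F (A.approx φ c m) (pt x T y t)) (Icc (φ₁ y - η) (φ₁ y + η)) := by
    filter_upwards [hd, hdiff] with m h1 h2 y hy
    exact strictMonoOn_of_deriv_ge (h2 y) hκ0 (h1 y hy)
  set ψ : ℕ → Sp d → ℝ := fun m y =>
    if h : ∃ t, |t - φ₁ y| < η ∧ A.F (A.approx φ c m) (pt x T y t) = 0 then h.choose else 0 with hψ
  have hspec : ∀ᶠ m in atTop, ∀ y ∈ closedBall y₀ r, |ψ m y - φ₁ y| < η ∧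
      A.F (A.approx φ c m) (pt x T y (ψ m y)) = 0 := by
    filter_upwards [hroot η hη0 le_rfl] with m hm y hy
    simp only [hψ, dif_pos (hm y hy)]
    exact (hm y hy).choose_spec
  have hIcc : ∀ {a t : ℝ}, |t - a| ≤ η → t ∈ Icc (a - η) (a + η) := fun h => by
    have := abs_le.1 h
    exact ⟨by linarith, by linarith⟩
  have huniq : ∀ᶠ m in atTop, ∀ y ∈ closedBall y₀ r, ∀ t, |t - φ₁ y| < η →
      A.F (A.approx φ c m) (pt x T y t) = 0 → t = ψ m y := by
    filter_upwards [hspec, hmono] with m h1 h2 y hy t ht h0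
    exact (h2 y hy).injOn (hIcc ht.le) (hIcc (h1 y hy).1.le) (h0.trans (h1 y hy).2.symm)
  have hsmooth : ∀ᶠ m in atTop, ContDiffOn ℝ ∞ (ψ m) (ball y₀ r) := by
    filter_upwards [hspec, huniq, hsm, hder] with m h1 h2 h3 h4 y hy
    have hy' := ball_subset_closedBall hy
    have hptd : ContDiff ℝ ∞ fun z : Sp d × ℝ => pt x T z.1 z.2 :=
      contDiff_const.add (frameInv T).contDiff
    refine (contDiffAt_of_implicit (H := fun z => A.F (A.approx φ c m) (pt x T z.1 z.2))
      (h3.comp hptd) hφ₁.continuous (h1 y hy').1 (h1 y hy').2 ?_ ?_).contDiffWithinAt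
    · have h5 : HasFDerivAt (fun z : Sp d × ℝ => pt x T z.1 z.2) (frameInv T) (y, ψ m y) :=
        (frameInv T).hasFDerivAt.const_add x
      have h6 := ((h3.differentiable (by simp) (pt x T y (ψ m y))).hasFDerivAt.comp (y, ψ m y) h5)
      have h7 : fderiv ℝ (fun z : Sp d × ℝ => A.F (A.approx φ c m) (pt x T z.1 z.2)) (y, ψ m y) =
          _ := h6.fderiv
      rw [h7]
      exact (hκ0.trans_le (h4 _ (hband y hy' _ (h1 y hy').1.le))).ne'
    · filter_upwards [isOpen_ball.mem_nhds hy] with z hz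
      exact h2 z (ball_subset_closedBall hz)
  -- Implicit differentiation bounds the gradient of ψ_m by |∇F_m| divided by the vertical
  -- derivative, hence by C/κ.
  refine ⟨η, κ, C / κ.toNNReal, ψ, hη0, min_le_right _ _, hκ0,
    ⟨isOpen_ball, isBounded_ball, hsmooth, ?_, ?_⟩, ?_⟩
  · filter_upwards [hsmooth, hspec, hder, hC, hsm] with m h1 h2 h3 h4 h5
    refine (convex_ball y₀ r).lipschitzOnWith_of_nnnorm_fderiv_le
      (fun y hy => (h1.contDiffAt (isOpen_ball.mem_nhds hy)).differentiableAt (by simp))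
      fun y hy => ?_
    have hy' := ball_subset_closedBall hy
    have hin := hband y hy' _ (h2 y hy').1.le
    have hψd := ((h1.contDiffAt (isOpen_ball.mem_nhds hy)).differentiableAt (by simp)).hasFDerivAt
    have h6 := (h5.differentiable (by simp) (pt x T y (ψ m y))).hasFDerivAt.comp y
      (GraphSeq.hasFDerivAt_graph x T hψd)
    have h7 : (fun y => A.F (A.approx φ c m) (pt x T y (ψ m y))) =ᶠ[𝓝 y] fun _ => 0 := by
      filter_upwards [isOpen_ball.mem_nhds hy] with z hz using (h2 z (ball_subset_closedBall hz)).2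
    have h8 := h6.unique ((hasFDerivAt_const (0 : ℝ) y).congr_of_eventuallyEq h7)
    have h9 : ∀ v, fderiv ℝ (A.F (A.approx φ c m)) (pt x T y (ψ m y)) (frameInv T (v, 0)) +
        fderiv ℝ (ψ m) y v * fderiv ℝ (A.F (A.approx φ c m)) (pt x T y (ψ m y)) e = 0 := fun v => by
      have := DFunLike.congr_fun h8 v
      simp only [ContinuousLinearMap.comp_apply, ContinuousLinearMap.prod_apply,
        ContinuousLinearMap.id_apply] at this
      rwa [GraphSeq.frameInv_split, map_add, map_smul, smul_eq_mul] at this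
    rw [← NNReal.coe_le_coe, coe_nnnorm, NNReal.coe_div, Real.coe_toNNReal _ hκ0.le]
    refine ContinuousLinearMap.opNorm_le_bound _ (by positivity) fun v => ?_
    have h10 := (fderiv ℝ (A.F (A.approx φ c m)) (pt x T y (ψ m y))).le_of_opNorm_le
      (h4 _ (hball _ hin)) (frameInv T (v, 0))
    have h11 : ‖frameInv T (v, 0)‖ ≤ ‖v‖ := by simpa using norm_frameInv_le T v 0
    have h12 := h3 _ hin
    rw [div_mul_eq_mul_div, le_div_iff₀ hκ0]
    have h13 : ‖fderiv ℝ (ψ m) y v‖ * fderiv ℝ (A.F (A.approx φ c m)) (pt x T y (ψ m y)) e =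
        ‖fderiv ℝ (A.F (A.approx φ c m)) (pt x T y (ψ m y)) (frameInv T (v, 0))‖ := by
      rw [← neg_eq_of_add_eq_zero_left (h9 v), norm_neg, norm_mul,
        Real.norm_of_nonneg (hκ0.le.trans h12)]
    have h14 : (C : ℝ) * ‖frameInv T (v, 0)‖ ≤ C * ‖v‖ := mul_le_mul_of_nonneg_left h11 C.2
    have h15 := mul_le_mul_of_nonneg_left h12 (norm_nonneg (fderiv ℝ (ψ m) y v))
    linarith
  · rw [Metric.tendstoUniformlyOn_iff]
    intro δ hδ
    filter_upwards [hroot (min δ η) (by positivity) (min_le_right _ _), huniq] with m h1 h2 y hy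
    have hy' := ball_subset_closedBall hy
    obtain ⟨t, ht, ht0⟩ := h1 y hy'
    rw [dist_comm, Real.dist_eq, ← h2 y hy' t (ht.trans_le (min_le_right _ _)) ht0]
    exact ht.trans_le (min_le_left _ _)
  · filter_upwards [hspec, hmono, hder] with m h1 h2 h3 y hy
    refine ⟨(h1 y hy).1, (h1 y hy).2, h3 _ (hband y hy _ (h1 y hy).1.le), fun t ht => ?_⟩
    have := (h2 y hy).lt_iff_lt (hIcc ht) (hIcc (h1 y hy).1.le)
    rw [(h1 y hy).2] at this
    exact this

end Patches

/-! ### Local regularity of the approximating graphs -/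

/-- On a level set of a function increasing in the vertical direction of a frame, the horizontal
projection is injective with a Lipschitz inverse. -/
lemma dist_le_mul_dist_horiz {F : Sp (d + 1) → ℝ} (hF : Differentiable ℝ F) (T : Frame d)
    {p₁ p p' : Sp (d + 1)} {δ κ C : ℝ} (hκ : 0 < κ)
    (hd : ∀ q ∈ ball p₁ δ, κ ≤ fderiv ℝ F q (frameInv T (0, 1)))
    (hC : ∀ q ∈ ball p₁ δ, ‖fderiv ℝ F q‖ ≤ C) (hp : p ∈ ball p₁ (δ / 4))
    (hp' : p' ∈ ball p₁ (δ / 4)) (h : F p = F p') :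
    dist p p' ≤ (1 + C / κ) * ‖horiz T (p - p')‖ := by
  set e := frameInv T (0, 1) with he
  -- Slide p vertically to the height of p'. The difference is then horizontal, so F changes by at
  -- most C times the horizontal distance; but the slide changes F by at least κ|τ|. With both
  -- points in the ball of radius δ/4 the slide stays in the ball of radius δ.
  set τ := vert T (p' - p) with hτ
  have hδ : 0 < δ := by
    have := (dist_nonneg (x := p) (y := p₁)).trans_lt (mem_ball.1 hp)
    linarith
  have hτd : |τ| ≤ δ / 2 := by
    refine (abs_vert_le _ _).trans ?_
    rw [← dist_eq_norm]
    have := dist_triangle_right p' p p₁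
    linarith [mem_ball.1 hp, mem_ball.1 hp']
  have hen : ‖e‖ ≤ 1 := by simpa using norm_frameInv_le T 0 1
  have hmem : ∀ s : ℝ, |s| ≤ δ / 2 → p + s • e ∈ ball p₁ δ := fun s hs => by
    rw [mem_ball, dist_eq_norm, add_sub_right_comm]
    refine (norm_add_le _ _).trans_lt ?_
    rw [← dist_eq_norm, norm_smul, Real.norm_eq_abs]
    have : |s| * ‖e‖ ≤ δ / 2 := (mul_le_of_le_one_right (abs_nonneg _) hen).trans hs
    linarith [mem_ball.1 hp]
  have hder : ∀ s, HasDerivAt (fun s : ℝ => F (p + s • e)) (fderiv ℝ F (p + s • e) e) s := fun s => by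
    have h1 : HasDerivAt (fun t : ℝ => p + t • e) e s := by
      simpa using ((hasDerivAt_id s).smul_const e).const_add p
    exact (hF _).hasFDerivAt.comp_hasDerivAt s h1
  have hmono := (convex_Icc (-(δ / 2)) (δ / 2)).mul_sub_le_image_sub_of_le_deriv
    (f := fun s : ℝ => F (p + s • e)) (C := κ)
    (fun s _ => (hder s).continuousAt.continuousWithinAt)
    (fun s _ => (hder s).differentiableAt.differentiableWithinAt)
    (fun s hs => by
      rw [(hder s).deriv]
      have h1 : s ∈ Icc (-(δ / 2)) (δ / 2) := interior_subset hs
      exact hd _ (hmem s (abs_le.2 h1)))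
  have h0 : (0 : ℝ) ∈ Icc (-(δ / 2)) (δ / 2) := ⟨by linarith, by linarith⟩
  have h1 : κ * |τ| ≤ |F (p + τ • e) - F p| := by
    rcases le_total 0 τ with hs | hs
    · have := hmono 0 h0 τ (abs_le.1 hτd) hs
      simp only [zero_smul, add_zero, sub_zero] at this
      rw [abs_of_nonneg hs]
      exact this.trans (le_abs_self _)
    · have := hmono τ (abs_le.1 hτd) 0 h0 hs
      simp only [zero_smul, add_zero, zero_sub] at this
      rw [abs_of_nonpos hs, abs_sub_comm]
      exact this.trans (le_abs_self _)
  have h2 : ‖F (p + τ • e) - F p'‖ ≤ C * ‖p + τ • e - p'‖ :=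
    (convex_ball p₁ δ).norm_image_sub_le_of_norm_fderiv_le (fun q _ => hF q) hC
      (ball_subset_ball (by linarith) hp') (hmem τ hτd)
  have h3 : ‖p + τ • e - p'‖ ≤ ‖horiz T (p - p')‖ := by
    refine (norm_le_horiz_add_vert T _).trans (le_of_eq ?_)
    rw [add_sub_right_comm, map_add, map_add, map_smul, map_smul, he, horiz_frameInv,
      vert_frameInv, smul_zero, add_zero, hτ, ← neg_sub p p', map_neg]
    simp
  have hC0 : 0 ≤ C := (norm_nonneg _).trans (hC p (ball_subset_ball (by linarith) hp))
  rw [← h, Real.norm_eq_abs] at h2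
  have h4 : |τ| ≤ C / κ * ‖horiz T (p - p')‖ := by
    rw [div_mul_eq_mul_div, le_div_iff₀ hκ, mul_comm]
    exact h1.trans (h2.trans (mul_le_mul_of_nonneg_left h3 hC0))
  rw [dist_eq_norm]
  refine (norm_le_horiz_add_vert T _).trans ?_
  have h5 : |vert T (p - p')| = |τ| := by rw [hτ, ← neg_sub p p', map_neg, abs_neg]
  rw [h5]
  linarith

lemma GraphSeq.exists_ball_mapsTo {V : Set (Sp d)} {ψ : ℕ → Sp d → ℝ} {φ₁ : Sp d → ℝ} {Λ : ℝ≥0}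
    (hG : GraphSeq V ψ φ₁ Λ) (x : Sp (d + 1)) (T : Frame d) {y₁ : Sp d} (hy₁ : y₁ ∈ V)
    (hφ₁ : Continuous φ₁) {δ : ℝ} (hδ : 0 < δ) :
    ∃ ρ > 0, ball y₁ ρ ⊆ V ∧ ∀ᶠ m in atTop, ∀ y ∈ ball y₁ ρ,
      pt x T y (ψ m y) ∈ ball (pt x T y₁ (φ₁ y₁)) δ := by
  obtain ⟨ρ₁, hρ₁, h1⟩ := Metric.isOpen_iff.1 hG.isOpen y₁ hy₁
  obtain ⟨ρ₂, hρ₂, h2⟩ := Metric.continuous_iff.1 hφ₁ y₁ (δ / 3) (by positivity)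
  refine ⟨min (min ρ₁ ρ₂) (δ / 3), by positivity, (ball_subset_ball
    ((min_le_left _ _).trans (min_le_left _ _))).trans h1, ?_⟩
  filter_upwards [Metric.tendstoUniformlyOn_iff.1 hG.unif (δ / 3) (by positivity)] with m hm y hy
  have hy1 := mem_ball.1 hy
  have hyV := h1 (ball_subset_ball ((min_le_left _ _).trans (min_le_left _ _)) hy)
  have h3 := h2 y (hy1.trans_le ((min_le_left _ _).trans (min_le_right _ _)))
  have h4 := hm y hyV
  have h5 := dist_pt_le x T y y₁ (ψ m y) (φ₁ y₁)
  have h6 : |ψ m y - φ₁ y₁| ≤ dist (φ₁ y) (ψ m y) + dist (φ₁ y) (φ₁ y₁) := by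
    rw [← Real.dist_eq, dist_comm (φ₁ y) (ψ m y)]
    exact dist_triangle _ _ _
  have h7 := hy1.trans_le (min_le_right _ _)
  rw [mem_ball]
  linarith

namespace Patches

variable {A : Patches d} {φ : Fin A.N → Sp d → ℝ} {c : ℕ → Fin A.N → ℝ} {Λ Λ₁ Λ' : ℝ≥0}
  {G : Set (Sp (d + 1))} {x : Sp (d + 1)} {T : Frame d} {φ₁ : Sp d → ℝ} {y₁ : Sp d} {V : Set (Sp d)}
  {ψ : ℕ → Sp d → ℝ} {κ : ℝ} {K : ℕ} {Q : RegScale d K}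

/-- Verifies the hypotheses of the bootstrap near one point. Inactive weights are avoided by
shrinking the ball. An active chart is regular near the projected point, and the projection of the
graphs to its coordinates is bi-Lipschitz. -/
theorem exists_ball_S_pderiv (hφ : ∀ j, LipschitzWith Λ (φ j))
    (hc : ∀ j, Tendsto (fun m => c m j) atTop (𝓝 0)) (hφ₁ : Continuous φ₁)
    (hG : GraphSeq V ψ φ₁ Λ') (hy₁ : y₁ ∈ V) (hκ : 0 < κ)
    (hψ : ∀ᶠ m in atTop, ∀ y ∈ V, A.F (A.approx φ c m) (pt x T y (ψ m y)) = 0 ∧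
      κ ≤ fderiv ℝ (A.F (A.approx φ c m)) (pt x T y (ψ m y)) (frameInv T (0, 1)))
    (hA : A.AdaptedAt φ Λ G (pt x T y₁ (φ₁ y₁)))
    (hreg : ∀ j, pt x T y₁ (φ₁ y₁) ∈ tsupport (A.ξ j) → ∃ U : Set (Sp d), IsOpen U ∧
      Bornology.IsBounded U ∧ A.hor j (pt x T y₁ (φ₁ y₁)) ∈ U ∧ Q.WReg U (φ j)) :
    ∃ ρ > 0, ball y₁ ρ ⊆ V ∧ ∀ a, Q.S (ball y₁ ρ) (K + 1) 0 (fun m => pderiv a (ψ m)) := by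
  set p₁ := pt x T y₁ (φ₁ y₁) with hp₁
  have hsmΦ : ∀ᶠ m in atTop, ∀ j, ContDiff ℝ ∞ (A.approx φ c m j) :=
    (eventually_ge_atTop 1).mono fun m hm j => contDiff_approx hφ hm j
  have hloc : ∀ j, ∃ ρ > 0, ∃ C : ℝ≥0, ball y₁ ρ ⊆ V ∧
      ((∀ᶠ m in atTop, ∀ y ∈ ball y₁ ρ, pt x T y (ψ m y) ∉ tsupport (A.ξ j)) ∨
      ∃ V' : Set (Sp d), IsOpen V' ∧ Bornology.IsBounded V' ∧
        (∀ᶠ m in atTop, MapsTo (fun y => A.hor j (pt x T y (ψ m y))) (ball y₁ ρ) V') ∧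
        (∀ᶠ m in atTop, ∀ y ∈ ball y₁ ρ, ∀ y' ∈ ball y₁ ρ, dist y y' ≤
          C * dist (A.hor j (pt x T y (ψ m y))) (A.hor j (pt x T y' (ψ m y')))) ∧
        Q.Conv 0 V' (fun m => A.approx φ c m j) ∧
        ∀ b, Q.S V' (K + 1) 0 (fun m => pderiv b (A.approx φ c m j))) := by
    intro j
    by_cases hj : p₁ ∈ tsupport (A.ξ j)
    · obtain ⟨U, hU, hUb, hpU, hW⟩ := hreg j hj
      obtain ⟨δ₁, hδ₁, hδU⟩ := Metric.isOpen_iff.1 hU _ hpU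
      -- Transversality in the vertical direction of chart j, not of the frame in which the graph is
      -- written: this gives the inverse Lipschitz bound for the projection.
      obtain ⟨ε, hε, hder⟩ := exists_thickening_of_eventually (isCompact_singleton (x := p₁))
        (P := fun m p => 1 / (1 + (Λ : ℝ)) / 2 ≤
          fderiv ℝ (A.F (A.approx φ c m)) p (frameInv (A.T j) (0, 1))) (by
        rintro _ rfl
        exact hA.eventually_le_fderiv hφ hc (hA.chart j hj))
      rw [thickening_singleton] at hder
      obtain ⟨C, hC⟩ := exists_norm_fderiv_le (A := A) hφ hc (‖p₁‖ + ε)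
      set δ := min ε δ₁
      have hδ : 0 < δ := by positivity
      obtain ⟨ρ, hρ, hρV, hmaps⟩ := hG.exists_ball_mapsTo x T hy₁ hφ₁
        (show 0 < δ / 4 by positivity)
      refine ⟨ρ, hρ, (1 + C / (1 / (1 + (Λ : ℝ)) / 2)).toNNReal, hρV, Or.inr
        ⟨ball (A.hor j p₁) (δ / 2), isOpen_ball, isBounded_ball, ?_, ?_, ?_, ?_⟩⟩
      · filter_upwards [hmaps] with m hm y hy
        exact mem_ball.2 ((A.dist_hor_le j _ _).trans_lt ((mem_ball.1 (hm y hy)).trans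
          (by linarith)))
      · filter_upwards [hmaps, hder, hC, hψ, hsmΦ] with m h1 h2 h3 h4 h5 y hy y' hy'
        have hbb : ball p₁ δ ⊆ ball p₁ ε := ball_subset_ball (min_le_left _ _)
        have h6 := dist_le_mul_dist_horiz ((A.contDiff_F h5).differentiable (by simp)) (A.T j)
          (δ := δ) (κ := 1 / (1 + (Λ : ℝ)) / 2) (C := C) (by positivity) (fun q hq => h2 q (hbb hq))
          (fun q hq => h3 q ?_) (h1 y hy) (h1 y' hy')
          ((h4 y (hρV hy)).1.trans (h4 y' (hρV hy')).1.symm)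
        · rw [Real.coe_toNNReal _ (by positivity)]
          refine (dist_le_dist_pt x T y y' _ _).trans (h6.trans (le_of_eq ?_))
          rw [dist_eq_norm (A.hor j _), hor, hor, ← map_sub, sub_sub_sub_cancel_right]
        · rw [mem_closedBall_zero_iff]
          have h7 := norm_le_norm_add_norm_sub p₁ q
          have h8 := mem_ball.1 (hbb hq)
          rw [dist_comm, dist_eq_norm] at h8
          linarith
      · refine Q.unif (C := Λ) isOpen_ball isBounded_ball ?_
          ((tendstoUniformly_approx hφ hc j).tendstoUniformlyOn (s := ball (A.hor j p₁) (δ / 2)))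
        filter_upwards [eventually_ge_atTop 1] with m hm
        refine LipschitzWith.lipschitzOnWith (LipschitzWith.of_dist_le_mul fun y y' => ?_)
        rw [approx, approx, dist_add_right]
        exact (lipschitzWith_mollify hm (hφ j)).dist_le_mul y y'
      · intro b
        have h1 := hW.S_pderiv_mollify hU hUb (hφ j).continuous.locallyIntegrable
          (V' := ball (A.hor j p₁) (δ / 2)) (δ := δ / 2) (by positivity)
          ((Metric.thickening_ball _ _ _).trans ((ball_subset_ball (by
            rw [add_halves]; exact min_le_right _ _)).trans hδU)) isOpen_ball b
        refine h1.congr isOpen_ball (.of_forall fun m y _ => ?_)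
        rw [pderiv, pderiv, fderiv_approx]
    · obtain ⟨δ, hδ, hδs⟩ := Metric.isOpen_iff.1 (isClosed_tsupport (A.ξ j)).isOpen_compl p₁ hj
      obtain ⟨ρ, hρ, hρV, hmaps⟩ := hG.exists_ball_mapsTo x T hy₁ hφ₁ hδ
      exact ⟨ρ, hρ, 0, hρV, Or.inl (hmaps.mono fun m hm y hy => hδs (hm y hy))⟩
  choose ρ hρ C hρV hact using hloc
  obtain ⟨ρ₀, hρ₀, hρ₀V⟩ := Metric.isOpen_iff.1 hG.isOpen y₁ hy₁
  obtain ⟨ρ', hρ', hle⟩ : ∃ ρ' > 0, ρ' ≤ ρ₀ ∧ ∀ j, ρ' ≤ ρ j := by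
    rcases isEmpty_or_nonempty (Fin A.N) with h | h
    · exact ⟨ρ₀, hρ₀, le_rfl, fun j => h.elim j⟩
    · obtain ⟨j₀, hj₀⟩ := Finite.exists_min ρ
      exact ⟨min ρ₀ (ρ j₀), lt_min hρ₀ (hρ j₀), min_le_left _ _, fun j =>
        (min_le_right _ _).trans (hj₀ j)⟩
  have hsub : ball y₁ ρ' ⊆ V := (ball_subset_ball hle.1).trans hρ₀V
  refine ⟨ρ', hρ', hsub, A.S_pderiv_implicit (hG.mono isOpen_ball hsub) x T hsmΦ (C := ∑ j, C j) hκ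
    (hψ.mono fun m hm y hy => (hm y (hsub hy)).1) (hψ.mono fun m hm y hy => (hm y (hsub hy)).2)
    fun j => ?_⟩
  have hbj : ball y₁ ρ' ⊆ ball y₁ (ρ j) := ball_subset_ball (hle.2 j)
  rcases hact j with h | ⟨V', h1, h2, h3, h4, h5, h6⟩
  · exact Or.inl (h.mono fun m hm y hy => hm y (hbj hy))
  · refine Or.inr ⟨V', h1, h2, h3.mono fun m hm => hm.mono_left hbj,
      h4.mono fun m hm y hy y' hy' => ?_, h5, h6⟩
    refine (hm y (hbj hy) y' (hbj hy')).trans (mul_le_mul_of_nonneg_right ?_ dist_nonneg)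
    exact_mod_cast Finset.single_le_sum (f := C) (fun _ _ => zero_le) (Finset.mem_univ j)

end Patches

/-! ### Charts of a Lipschitz domain -/

lemma ball_subset_cylinder (x : Sp (d + 1)) (T : Frame d) {s r h : ℝ} (hr : s ≤ r) (hh : s ≤ h) :
    ball x s ⊆ cylinder x T r h := fun p hp => by
  rw [mem_ball, dist_eq_norm] at hp
  have h1 := norm_horiz_le T (p - x)
  have h2 := abs_vert_le T (p - x)
  refine ⟨mem_ball_zero_iff.2 ?_, abs_lt.1 ?_⟩
  · exact (h1.trans_lt hp).trans_le hr
  · exact (h2.trans_lt hp).trans_le hh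

lemma pt_mem_cylinder (x : Sp (d + 1)) (T : Frame d) {r h t : ℝ} {y : Sp d} (hy : y ∈ ball 0 r)
    (ht : t ∈ Ioo (-h) h) : pt x T y t ∈ cylinder x T r h := by
  refine ⟨?_, ?_⟩
  · rw [← horiz_apply, horiz_pt_sub]; exact hy
  · rw [← vert_apply, vert_pt_sub]; exact ht

lemma LocalChart.eventually {G : Set (Sp (d + 1))} {x : Sp (d + 1)} {T : Frame d} {Λ : ℝ≥0}
    {φ : Sp d → ℝ} {p : Sp (d + 1)} (h : LocalChart G x T Λ φ p) :
    ∀ᶠ q in 𝓝 p, LocalChart G x T Λ φ q :=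
  h.near.eventually_nhds.mono fun _ hq => ⟨h.lip, hq⟩

/-- Each boundary point is the centre of a chart which is regular in the scale `Q`. -/
def HasRegularCharts {K : ℕ} (Q : RegScale d K) (G : Set (Sp (d + 1))) : Prop :=
  ∀ p ∈ frontier G, ∃ (r : ℝ) (Λ : ℝ≥0) (T : Frame d) (φ : Sp d → ℝ), 0 < r ∧
    LocalChart G p T Λ φ p ∧ Q.WReg (ball 0 r) φ

/-- A single coordinate system. -/
def Patches.single (x : Sp (d + 1)) (T : Frame d) : Patches d where
  N := 1
  x := fun _ => x
  T := fun _ => T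
  ξ₀ := fun _ => 0
  ξ := fun _ _ => 1
  ξ₀_smooth := contDiff_const
  ξ_smooth := fun _ => contDiff_const

/-- Regularity of the boundary does not depend on the chart. -/
theorem HasRegularCharts.exists_WReg {K : ℕ} {Q : RegScale d K} {G : Set (Sp (d + 1))}
    (hQ : HasRegularCharts Q G) {x : Sp (d + 1)} {T : Frame d} {Λ : ℝ≥0} {φ : Sp d → ℝ} {y : Sp d}
    (hch : LocalChart G x T Λ φ (pt x T y (φ y))) : ∃ ρ > 0, Q.WReg (ball y ρ) φ := by
  have hfr : pt x T y (φ y) ∈ frontier G := by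
    rw [hch.near.self_of_nhds.1]; simp
  set p := pt x T y (φ y) with hp
  obtain ⟨r', Λ', T', φ', hr', hch', hW⟩ := hQ p hfr
  have hgc : Continuous fun z => pt x T z (φ z) :=
    continuous_const.add ((frameInv T).continuous.comp
      (continuous_id.prodMk hch.lip.continuous))
  have hev : ∀ᶠ z in 𝓝 y, LocalChart G p T' Λ' φ' (pt x T z (φ z)) ∧
      LocalChart G x T Λ φ (pt x T z (φ z)) :=
    hgc.continuousAt.eventually (hch'.eventually.and hch.eventually)
  obtain ⟨r, hr, hball⟩ := Metric.nhds_basis_closedBall.eventually_iff.1 hev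
  -- The regular chart alone, with weight 1 and no shift, serves as defining function; its zero set
  -- is solved for in the other frame T.
  set A := Patches.single p T' with hA
  have hAd : ∀ z ∈ closedBall y r, A.AdaptedAt (fun _ => φ') Λ' G (pt x T z (φ z)) := by
    intro z hz
    obtain ⟨h1, h2⟩ := hball hz
    refine ⟨?_, .of_forall fun q => ⟨rfl, fun _ => zero_le_one, ?_⟩, fun j _ => h1⟩
    · rw [h2.near.self_of_nhds.1]; simp
    · change ∑ j : Fin 1, (1 : ℝ) = 1
      simp
  obtain ⟨η, κ, Λ₂, ψ, -, -, hκ, hG, hψ⟩ := Patches.exists_graphSeq (A := A) (φ := fun _ => φ')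
    (c := fun _ _ => 0) (Λ := Λ') (fun _ => hch'.lip) (fun _ => tendsto_const_nhds) hch.lip hAd
    (fun z hz => (hball hz).2) one_pos
  obtain ⟨ρ, hρ, hρV, hS⟩ := Patches.exists_ball_S_pderiv (A := A) (φ := fun _ => φ')
    (c := fun _ _ => 0) (Λ := Λ') (Q := Q) (fun _ => hch'.lip) (fun _ => tendsto_const_nhds)
    hch.lip.continuous hG (mem_ball_self hr) hκ
    (hψ.mono fun m hm z hz => ⟨(hm z (ball_subset_closedBall hz)).2.1,
      (hm z (ball_subset_closedBall hz)).2.2.1⟩) (hAd y (mem_closedBall_self hr.le))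
    (fun j _ => ⟨ball 0 r', isOpen_ball, isBounded_ball, by
      change horiz T' (p - p) ∈ ball 0 r'
      simpa using hr', hW⟩)
  -- The graphs found in the frame T converge to φ itself, so the regularity of their limit is that
  -- of φ.
  exact ⟨ρ, hρ, RegScale.WReg_of_S_pderiv (hG.mono isOpen_ball hρV) hS⟩

namespace Atlas

variable {G : Set (Sp (d + 1))} {L : ℝ≥0} {R : ℝ} (D : Atlas G L R)

/-- The coordinate systems and weights of an atlas. -/
def patches : Patches d where
  N := D.N
  x := D.x
  T := D.T
  ξ₀ := D.ξ₀
  ξ := D.ξ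
  ξ₀_smooth := D.ξ₀_smooth
  ξ_smooth := D.ξ_smooth

lemma exists_extension : ∃ φ : Fin D.N → Sp d → ℝ, (∀ j, LipschitzWith L (φ j)) ∧
    ∀ j, EqOn (D.φ j) (φ j) (ball 0 R) := by
  have := fun j => (D.chart j).1.extend_real
  choose φ h1 h2 using this
  exact ⟨φ, h1, h2⟩

variable {D} {φ : Fin D.N → Sp d → ℝ}

lemma localChart (hφ : ∀ j, LipschitzWith L (φ j)) (he : ∀ j, EqOn (D.φ j) (φ j) (ball 0 R))
    (j : Fin D.N) {p : Sp (d + 1)} (hp : p ∈ cylinder (D.x j) (D.T j) R (R * (1 + L))) :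
    LocalChart G (D.x j) (D.T j) L (φ j) p :=
  (D.chart j).2.2.localChart (hφ j) (he j) hp

lemma pt_mem_cylinder (he : ∀ j, EqOn (D.φ j) (φ j) (ball 0 R)) (j : Fin D.N) {y : Sp d}
    (hy : y ∈ ball 0 R) :
    pt (D.x j) (D.T j) y (φ j y) ∈ cylinder (D.x j) (D.T j) R (R * (1 + L)) := by
  rw [← he j hy]
  exact LipApprox.pt_mem_cylinder _ _ hy ((D.chart j).2.2 y hy).1

lemma ball_subset_cylinder (hR : 0 < R) (j : Fin D.N) :
    ball (D.x j) (R / 4) ⊆ cylinder (D.x j) (D.T j) R (R * (1 + L)) := by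
  have h1 : (0 : ℝ) ≤ L := L.2
  exact LipApprox.ball_subset_cylinder _ _ (by linarith) (by nlinarith)

lemma adaptedAt (hG : IsOpen G) (hR : 0 < R) (hφ : ∀ j, LipschitzWith L (φ j))
    (he : ∀ j, EqOn (D.φ j) (φ j) (ball 0 R)) {p : Sp (d + 1)} (hp : p ∈ frontier G) :
    D.patches.AdaptedAt φ L G p := by
  have hpG : p ∉ G := (hG.frontier_eq ▸ hp).2
  refine ⟨hp, ?_, fun j hj => D.localChart hφ he j (D.ball_subset_cylinder hR j (D.ξ_supp j hj))⟩
  filter_upwards [D.W_open.mem_nhds (D.closure_subset (frontier_subset_closure hp)),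
    (isClosed_tsupport D.ξ₀).isOpen_compl.mem_nhds fun h => hpG (D.ξ₀_supp h)] with q h1 h2
  have h3 : D.ξ₀ q = 0 := image_eq_zero_of_notMem_tsupport h2
  have h4 := D.sum_eq_one q h1
  rw [h3, zero_add] at h4
  exact ⟨h3, fun j => D.ξ_nonneg j q, h4⟩

/-- The weight ξ_j restricts the horizontal coordinate to radius R/4 and, for 1/m < R/2,
mollification there sees only the ball of radius R. So the Lipschitz extension of a chart does not
change the construction. -/
lemma definingFun_eq (hR : 0 < R) (he : ∀ j, EqOn (D.φ j) (φ j) (ball 0 R))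
    (c : ℕ → Fin D.N → ℝ) : ∀ᶠ m : ℕ in atTop, ∀ p,
      D.definingFun (fun j y => mollify m (D.φ j) y + c m j) p =
        D.patches.F (D.patches.approx φ c m) p := by
  filter_upwards [eventually_ge_atTop 1, tendsto_one_div_atTop_nhds_zero_nat.eventually
      (gt_mem_nhds (show 0 < R / 2 by positivity))] with m h1 h2 p
  change _ - _ = _ - _
  congr 1
  refine Finset.sum_congr rfl fun j _ => ?_
  by_cases hj : p ∈ tsupport (D.ξ j)
  · have h3 : horiz (D.T j) (p - D.x j) ∈ ball 0 (R / 4) := by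
      have h4 := mem_ball.1 (D.ξ_supp j hj)
      rw [dist_eq_norm] at h4
      exact mem_ball_zero_iff.2 ((norm_horiz_le _ _).trans_lt h4)
    have h5 : mollify m (D.φ j) (horiz (D.T j) (p - D.x j)) =
        mollify m (φ j) (horiz (D.T j) (p - D.x j)) := by
      refine mollify_congr h1 ((he j).mono fun z hz => ?_)
      rw [mem_ball] at hz
      rw [mem_ball_zero_iff] at h3 ⊢
      have h6 := norm_le_norm_add_norm_sub (horiz (D.T j) (p - D.x j)) z
      rw [dist_comm, dist_eq_norm] at hz
      linarith
    change ((D.T j (p - D.x j)).snd - (mollify m (D.φ j) (horiz (D.T j) (p - D.x j)) + c m j)) *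
        D.ξ j p = ((D.T j (p - D.x j)).snd - (mollify m (φ j) (horiz (D.T j) (p - D.x j)) + c m j)) *
        D.ξ j p
    rw [h5]
  · have h3 : D.ξ j p = 0 := image_eq_zero_of_notMem_tsupport hj
    change _ * D.ξ j p = _ * D.ξ j p
    rw [h3, mul_zero, mul_zero]

/-- Mollification moves an L-Lipschitz function by at most L/m. That the shift tends to 0 is all
that is used about it. -/
lemma tendsto_shift (j : Fin D.N) :
    Tendsto (fun m => shift L R m (D.φ j)) atTop (𝓝 0) := by
  obtain ⟨φ, hφ, he⟩ := D.exists_extension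
  have h0 : Tendsto (fun m : ℕ => (L : ℝ) / m + L / m) atTop (𝓝 0) := by
    simpa using (tendsto_const_div_atTop_nhds_zero_nat (L : ℝ)).add
      (tendsto_const_div_atTop_nhds_zero_nat (L : ℝ))
  refine tendsto_of_tendsto_of_tendsto_of_le_of_le' tendsto_const_nhds h0
    (.of_forall fun m => ?_) ?_
  · refine add_nonneg (Real.sSup_nonneg ?_) (by positivity)
    rintro _ ⟨y, -, rfl⟩
    exact abs_nonneg _
  · filter_upwards [eventually_ge_atTop 1] with m hm
    refine add_le_add (Real.sSup_le ?_ (by positivity)) le_rfl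
    rintro _ ⟨y, hy, rfl⟩
    have h1 : ball y (1 / (m : ℝ)) ⊆ ball 0 R := fun z hz => by
      rw [mem_ball_zero_iff] at hy ⊢
      rw [mem_ball, dist_comm, dist_eq_norm] at hz
      have := norm_le_norm_add_norm_sub y z
      linarith
    have hm0 : 0 < 1 / (m : ℝ) := one_div_pos.2 (by exact_mod_cast hm)
    have h3 : mollify m (D.φ j) y = mollify m (φ j) y := mollify_congr hm ((he j).mono h1)
    beta_reduce
    rw [h3, he j (h1 (mem_ball_self hm0))]
    exact abs_mollify_sub_le_of_lipschitz hm (hφ j) y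

end Atlas

/-! ### The approximating sets are subgraphs -/

lemma mem_frontier_congr {X : Type*} [TopologicalSpace X] {A B : Set X} {p : X}
    (h : ∀ᶠ q in 𝓝 p, q ∈ A ↔ q ∈ B) : p ∈ frontier A ↔ p ∈ frontier B := by
  rw [frontier_eq_closure_inter_closure, frontier_eq_closure_inter_closure, mem_inter_iff,
    mem_inter_iff, mem_closure_iff_frequently, mem_closure_iff_frequently,
    mem_closure_iff_frequently, mem_closure_iff_frequently, frequently_congr h,
    frequently_congr (h.mono fun q hq => show q ∈ Aᶜ ↔ q ∈ Bᶜ from not_congr hq)]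

/-- Inside an open cylinder membership determines the frontier: for continuous ψ the frontier of the
region strictly below the graph is the graph. -/
lemma isGraphIn_of_mem_iff {A : Set (Sp (d + 1))} {x : Sp (d + 1)} {T : Frame d} {r h : ℝ}
    {ψ : Sp d → ℝ} (hψ : ContinuousOn ψ (ball 0 r)) (hr : ∀ y ∈ ball (0 : Sp d) r, ψ y ∈ Ioo (-h) h)
    (hA : ∀ y ∈ ball (0 : Sp d) r, ∀ t ∈ Ioo (-h) h, pt x T y t ∈ A ↔ t < ψ y) :
    IsGraphIn A x T r h ψ := by
  refine fun y hy => ⟨hr y hy, fun t ht => ⟨?_, hA y hy t ht⟩⟩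
  have hcyl : ∀ᶠ q in 𝓝 (pt x T y t), q ∈ A ↔ vert T (q - x) < ψ (horiz T (q - x)) := by
    filter_upwards [(isOpen_cylinder x T r h).mem_nhds (pt_mem_cylinder x T hy ht)] with q hq
    have := hA _ hq.1 _ hq.2
    rwa [← horiz_apply, ← vert_apply, pt_horiz_vert] at this
  have hc1 : Tendsto (fun q => vert T (q - x)) (𝓝 (pt x T y t)) (𝓝 t) := by
    have : Continuous fun q => vert T (q - x) :=
      (vert T).continuous.comp (continuous_id.sub continuous_const)
    simpa only [vert_pt_sub] using this.tendsto (pt x T y t)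
  have hc2 : Tendsto (fun q => ψ (horiz T (q - x))) (𝓝 (pt x T y t)) (𝓝 (ψ y)) := by
    have : Continuous fun q => horiz T (q - x) :=
      (horiz T).continuous.comp (continuous_id.sub continuous_const)
    have h2 := this.tendsto (pt x T y t)
    rw [horiz_pt_sub] at h2
    exact (hψ.continuousAt (isOpen_ball.mem_nhds hy)).tendsto.comp h2
  rw [mem_frontier_congr (B := {q | vert T (q - x) < ψ (horiz T (q - x))}) hcyl]
  constructor
  · intro hp
    rcases lt_trichotomy t (ψ y) with h1 | h1 | h1
    · refine absurd hp fun hp => hp.2 (mem_interior_iff_mem_nhds.2 ?_)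
      exact hc1.eventually_lt hc2 h1
    · exact h1
    · rw [frontier_eq_closure_inter_closure] at hp
      refine absurd hp.1 ?_
      rw [mem_closure_iff_frequently, not_frequently]
      exact (hc2.eventually_lt hc1 h1).mono fun q hq => not_lt_of_ge hq.le
  · rintro rfl
    refine ⟨?_, fun h1 => ?_⟩
    · have hc3 : Continuous fun s => pt x T y s :=
        continuous_const.add ((frameInv T).continuous.comp (continuous_const.prodMk continuous_id))
      refine mem_closure_of_tendsto (hc3.continuousWithinAt (s := Iio (ψ y)) (x := ψ y)).tendsto ?_
      filter_upwards [self_mem_nhdsWithin] with s hs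
      rw [vert_pt_sub, horiz_pt_sub]
      exact hs
    · have h2 : pt x T y (ψ y) ∈ {q | vert T (q - x) < ψ (horiz T (q - x))} := interior_subset h1
      change vert T _ < ψ (horiz T _) at h2
      rw [vert_pt_sub, horiz_pt_sub] at h2
      exact lt_irrefl _ h2

namespace Atlas

variable {G : Set (Sp (d + 1))} {L : ℝ≥0} {R : ℝ} {D : Atlas G L R}
  {φ : Fin D.N → Sp d → ℝ} {c : ℕ → Fin D.N → ℝ}

lemma sum_eq_one_closure {z : Sp (d + 1)} (hz : z ∈ closure D.W) :
    D.ξ₀ z + ∑ i, D.ξ i z = 1 := by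
  have hc : Continuous fun z => D.ξ₀ z + ∑ i, D.ξ i z :=
    D.ξ₀_smooth.continuous.add (continuous_finsetSum _ fun i _ => (D.ξ_smooth i).continuous)
  exact closure_minimal (t := {z | D.ξ₀ z + ∑ i, D.ξ i z = 1}) D.sum_eq_one
    (isClosed_eq hc continuous_const) hz

/-- On W some weight is non-zero, and all weights are supported in G or in finitely many balls;
hence W is bounded although this is not part of the data. -/
lemma isCompact_closure_W (hb : Bornology.IsBounded G) : IsCompact (closure D.W) := by
  refine (Bornology.IsBounded.subset (t := G ∪ ⋃ i, ball (D.x i) (R / 4)) ?_ ?_).isCompact_closure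
  · exact hb.union (Bornology.isBounded_iUnion.2 fun i => isBounded_ball)
  · intro z hz
    by_contra hn
    rw [mem_union, mem_iUnion, not_or, not_exists] at hn
    have h1 : D.ξ₀ z = 0 := image_eq_zero_of_notMem_tsupport fun h => hn.1 (D.ξ₀_supp h)
    have h2 : ∀ i, D.ξ i z = 0 := fun i =>
      image_eq_zero_of_notMem_tsupport fun h => hn.2 i (D.ξ_supp i h)
    have := D.sum_eq_one z hz
    simp [h1, h2] at this

lemma continuous_F (hφ : ∀ j, LipschitzWith L (φ j)) : Continuous (D.patches.F φ) := by
  refine (continuous_finsetSum _ fun j _ => ?_).sub D.ξ₀_smooth.continuous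
  exact ((D.patches.contDiff_ver j).continuous.sub
    ((hφ j).continuous.comp (D.patches.contDiff_hor j).continuous)).mul (D.ξ_smooth j).continuous

lemma F_neg (hR : 0 < R) (hφ : ∀ j, LipschitzWith L (φ j))
    (he : ∀ j, EqOn (D.φ j) (φ j) (ball 0 R)) {p : Sp (d + 1)} (hp : p ∈ G) :
    D.patches.F φ p < 0 := by
  have h1 : ∀ j, (D.patches.ver j p - φ j (D.patches.hor j p)) * D.ξ j p ≤ 0 ∧
      (D.ξ j p ≠ 0 → (D.patches.ver j p - φ j (D.patches.hor j p)) * D.ξ j p < 0) := by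
    intro j
    by_cases hj : D.ξ j p = 0
    · simp [hj]
    · have h2 := (D.localChart hφ he j (D.ball_subset_cylinder hR j
        (D.ξ_supp j (subset_tsupport _ hj)))).near.self_of_nhds.2.1 hp
      have h3 : D.patches.ver j p - φ j (D.patches.hor j p) < 0 := sub_neg.2 h2
      have h4 := (D.ξ_nonneg j p).lt_of_ne' hj
      exact ⟨(mul_neg_of_neg_of_pos h3 h4).le, fun _ => mul_neg_of_neg_of_pos h3 h4⟩
  have h2 := D.sum_eq_one p (D.closure_subset (subset_closure hp))
  have h3 := D.ξ₀_nonneg p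
  change ∑ j, (D.patches.ver j p - φ j (D.patches.hor j p)) * D.ξ j p - D.ξ₀ p < 0
  by_cases h4 : ∃ j, D.ξ j p ≠ 0
  · obtain ⟨j, hj⟩ := h4
    have := Finset.sum_neg' (s := Finset.univ) (fun j _ => (h1 j).1)
      ⟨j, Finset.mem_univ j, (h1 j).2 hj⟩
    exact sub_neg.2 (this.trans_le h3)
  · push Not at h4
    rw [Finset.sum_eq_zero fun j _ => by rw [h4 j, mul_zero]]
    rw [Finset.sum_eq_zero fun j _ => h4 j] at h2
    linarith

/-- Off the closure of G the weight ξ₀ vanishes and every active chart has the point above its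
graph. The closure of W is allowed so that compactness can be used. -/
lemma F_pos (hR : 0 < R) (hφ : ∀ j, LipschitzWith L (φ j))
    (he : ∀ j, EqOn (D.φ j) (φ j) (ball 0 R)) {p : Sp (d + 1)} (hp : p ∈ closure D.W)
    (hpG : p ∉ closure G) : 0 < D.patches.F φ p := by
  have h0 : D.ξ₀ p = 0 :=
    image_eq_zero_of_notMem_tsupport fun h => hpG (subset_closure (D.ξ₀_supp h))
  have h1 : ∀ j, 0 ≤ (D.patches.ver j p - φ j (D.patches.hor j p)) * D.ξ j p ∧
      (D.ξ j p ≠ 0 → 0 < (D.patches.ver j p - φ j (D.patches.hor j p)) * D.ξ j p) := by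
    intro j
    by_cases hj : D.ξ j p = 0
    · simp [hj]
    · have h2 := (D.localChart hφ he j (D.ball_subset_cylinder hR j
        (D.ξ_supp j (subset_tsupport _ hj)))).near.self_of_nhds
      have h3 : 0 < D.patches.ver j p - φ j (D.patches.hor j p) := by
        refine sub_pos.2 (lt_of_le_of_ne (not_lt.1 fun h => ?_) fun h => ?_)
        · exact hpG (subset_closure (h2.2.2 h))
        · exact hpG (frontier_subset_closure (h2.1.2 h.symm))
      have h4 := (D.ξ_nonneg j p).lt_of_ne' hj
      exact ⟨(mul_pos h3 h4).le, fun _ => mul_pos h3 h4⟩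
  have h2 := D.sum_eq_one_closure hp
  change 0 < ∑ j, (D.patches.ver j p - φ j (D.patches.hor j p)) * D.ξ j p - D.ξ₀ p
  rw [h0, sub_zero]
  rw [h0, zero_add] at h2
  obtain ⟨j, -, hj⟩ := Finset.exists_ne_zero_of_sum_ne_zero (h2.trans_ne one_ne_zero)
  exact Finset.sum_pos' (fun j _ => (h1 j).1) ⟨j, Finset.mem_univ j, (h1 j).2 hj⟩

/-- Off a neighbourhood of ∂G, |F| has a positive lower bound by compactness and its sign decides
membership in G. Uniform convergence carries the sign to F_m. -/
lemma eventually_neg_iff_mem (hG : IsOpen G) (hb : Bornology.IsBounded G) (hR : 0 < R)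
    (hφ : ∀ j, LipschitzWith L (φ j)) (he : ∀ j, EqOn (D.φ j) (φ j) (ball 0 R))
    (hc : ∀ j, Tendsto (fun m => c m j) atTop (𝓝 0)) {η : ℝ} (hη : 0 < η) :
    ∀ᶠ m in atTop, ∀ p ∈ D.W, p ∉ thickening η (frontier G) →
      (D.patches.F (D.patches.approx φ c m) p < 0 ↔ p ∈ G) := by
  have hK : IsCompact (closure D.W \ thickening η (frontier G)) :=
    (D.isCompact_closure_W hb).diff isOpen_thickening
  have hsg : ∀ p ∈ closure D.W \ thickening η (frontier G),
      (p ∈ G ∧ D.patches.F φ p < 0) ∨ (p ∉ G ∧ 0 < D.patches.F φ p) := by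
    rintro p ⟨hp, hpt⟩
    by_cases hpG : p ∈ G
    · exact .inl ⟨hpG, D.F_neg hR hφ he hpG⟩
    · refine .inr ⟨hpG, D.F_pos hR hφ he hp fun h => hpt (self_subset_thickening hη _ ?_)⟩
      rw [hG.frontier_eq]
      exact ⟨h, hpG⟩
  obtain ⟨δ, hδ, hle⟩ := hK.exists_forall_le' (f := fun p => |D.patches.F φ p|) (a := 0)
    (D.continuous_F hφ).abs.continuousOn fun p hp => by
      rcases hsg p hp with h | h
      · exact abs_pos.2 h.2.ne
      · exact abs_pos.2 h.2.ne'
  obtain ⟨b, hbW⟩ := (D.isCompact_closure_W hb).isBounded.subset_closedBall 0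
  filter_upwards [Metric.tendstoUniformlyOn_iff.1 (Patches.tendstoUniformlyOn_F (A := D.patches) hφ hc b) δ hδ]
    with m hm p hp hpt
  have h1 := hm p (hbW (subset_closure hp))
  have h2 := hle p ⟨subset_closure hp, hpt⟩
  rw [Real.dist_eq, abs_sub_lt_iff] at h1
  rcases hsg p ⟨subset_closure hp, hpt⟩ with h | h
  · rw [abs_of_neg h.2] at h2
    exact iff_of_true (by linarith) h.1
  · rw [abs_of_pos h.2] at h2
    exact iff_of_false (by linarith) h.1

end Atlas

/-! ### Smooth graphs describing the approximating sets -/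

namespace Atlas

variable {G : Set (Sp (d + 1))} {L : ℝ≥0} {R : ℝ} {D : Atlas G L R}
  {φ : Fin D.N → Sp d → ℝ} {c : ℕ → Fin D.N → ℝ}

lemma abs_le_of_mem_ball (hφ : ∀ j, LipschitzWith L (φ j))
    (he : ∀ j, EqOn (D.φ j) (φ j) (ball 0 R)) (hR : 0 < R) (j : Fin D.N) {r : ℝ} {y : Sp d}
    (hy : y ∈ ball 0 r) : |φ j y| ≤ L * r := by
  have h1 := (hφ j).dist_le_mul y 0
  rw [← he j (mem_ball_self hR), (D.chart j).2.1, dist_zero_right, dist_zero_right] at h1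
  exact h1.trans (mul_le_mul_of_nonneg_left (mem_ball_zero_iff.1 hy).le L.2)

/-- A point near the boundary has a vertical coordinate close to the graph. -/
lemma abs_sub_le_of_mem_thickening (hφ : ∀ j, LipschitzWith L (φ j))
    (he : ∀ j, EqOn (D.φ j) (φ j) (ball 0 R)) (j : Fin D.N) {r σ t : ℝ} {y : Sp d}
    (hy : y ∈ ball 0 r) (ht : t ∈ Ioo (-(r * (1 + L))) (r * (1 + L))) (hσ : r + σ ≤ R)
    (hp : pt (D.x j) (D.T j) y t ∈ thickening σ (frontier G)) : |t - φ j y| ≤ σ * (1 + L) := by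
  obtain ⟨q, hq, hpq⟩ := mem_thickening_iff.1 hp
  set z := horiz (D.T j) (q - D.x j) with hz
  set s := vert (D.T j) (q - D.x j) with hs
  have hL : (0 : ℝ) ≤ L := L.2
  have hqe : pt (D.x j) (D.T j) z s = q := pt_horiz_vert _ _ _
  have h1 : dist y z < σ := (hqe ▸ dist_le_dist_pt (D.x j) (D.T j) y z t s).trans_lt hpq
  have h2 : |t - s| < σ := by
    have h3 := abs_vert_le (D.T j) (pt (D.x j) (D.T j) y t - pt (D.x j) (D.T j) z s)
    rw [pt_sub_pt, vert_frameInv, ← pt_sub_pt, ← dist_eq_norm, hqe] at h3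
    exact h3.trans_lt hpq
  have hσ0 : 0 < σ := dist_nonneg.trans_lt h1
  have hzR : z ∈ ball 0 R := by
    rw [mem_ball_zero_iff] at hy ⊢
    have := norm_le_norm_add_norm_sub y z
    rw [dist_comm, dist_eq_norm, norm_sub_rev] at h1
    linarith
  -- The nearby boundary point stays in the larger cylinder because (r + σ)(1 + L) ≤ R(1 + L).
  have hsR : s ∈ Ioo (-(R * (1 + L))) (R * (1 + L)) := by
    have h3 : (r + σ) * (1 + (L : ℝ)) ≤ R * (1 + L) := mul_le_mul_of_nonneg_right hσ (by positivity)
    have h4 : 0 ≤ σ * L := by positivity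
    obtain ⟨h5, h6⟩ := abs_sub_lt_iff.1 h2
    exact ⟨by linarith [ht.1], by linarith [ht.2]⟩
  have h3 : s = φ j z := (((D.chart j).2.2.mem_iff (q := q) ⟨hzR, hsR⟩).1.1 hq).trans (he j hzR)
  have h4 := (hφ j).dist_le_mul z y
  rw [Real.dist_eq, dist_comm] at h4
  have h5 : |t - φ j y| ≤ |t - s| + |φ j z - φ j y| := by
    rw [← h3]
    exact abs_sub_le _ _ _
  have h6 := mul_le_mul_of_nonneg_left h1.le hL
  linarith

/-- The sublevel sets of the approximate defining functions are described by smooth graphs, which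
inherit the regularity of the boundary. -/
theorem exists_describes (hG : IsOpen G) (hb : Bornology.IsBounded G) (hR : 0 < R)
    (hφ : ∀ j, LipschitzWith L (φ j)) (he : ∀ j, EqOn (D.φ j) (φ j) (ball 0 R))
    (hc : ∀ j, Tendsto (fun m => c m j) atTop (𝓝 0)) {ε : ℝ} (hε : ε ∈ Ioo 0 (R / 2)) :
    ∃ ψ : ℕ → Fin D.N → Sp d → ℝ,
      (∀ᶠ m in atTop, D.Describes ε {p ∈ D.W | D.patches.F (D.patches.approx φ c m) p < 0} (ψ m)) ∧
      ∀ i, ∃ Λ', GraphSeq (ball 0 (R - ε / 2)) (fun m => ψ m i) (φ i) Λ' ∧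
        ∀ (K : ℕ) (Q : RegScale d K), HasRegularCharts Q G → ∀ y ∈ ball (0 : Sp d) (R - ε / 2),
          ∃ ρ > 0, ball y ρ ⊆ ball 0 (R - ε / 2) ∧
            ∀ a, Q.S (ball y ρ) (K + 1) 0 (fun m => pderiv a (ψ m i)) := by
  obtain ⟨hε0, hεR⟩ := hε
  have hL : (0 : ℝ) ≤ L := L.2
  have hsub : closedBall (0 : Sp d) (R - ε / 2) ⊆ ball 0 R := closedBall_subset_ball (by linarith)
  have hΓ : IsCompact (frontier G) :=
    hb.isCompact_closure.of_isClosed_subset isClosed_frontier frontier_subset_closure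
  obtain ⟨δ, hδ, hδW⟩ := hΓ.exists_thickening_subset_open D.W_open
    (frontier_subset_closure.trans D.closure_subset)
  have hfr : ∀ i, ∀ y ∈ ball (0 : Sp d) R, pt (D.x i) (D.T i) y (φ i y) ∈ frontier G :=
    fun i y hy => by
      rw [(D.localChart hφ he i (D.pt_mem_cylinder he i hy)).near.self_of_nhds.1]; simp
  -- The graphs are built over radius R - ε/2, so that the closed ball of radius R - ε is a compact
  -- subset and local regularity can be patched there.
  have hex := fun i => Patches.exists_graphSeq (A := D.patches) (φ := φ) (c := c) (x := D.x i)
    (T := D.T i) (φ₁ := φ i) (y₀ := 0) (r := R - ε / 2) (Λ := L) (Λ₁ := L) (G := G)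
    (η₁ := min (δ / 2) (R / 4)) hφ hc (hφ i)
    (fun y hy => D.adaptedAt hG hR hφ he (hfr i y (hsub hy)))
    (fun y hy => D.localChart hφ he i (D.pt_mem_cylinder he i (hsub hy))) (by positivity)
  choose η κ Λ' ψ hη hη₁ hκ hgs hψ using hex
  refine ⟨fun m i => ψ i m, ?_, fun i => ⟨Λ' i, hgs i, fun K Q hQ y hy => ?_⟩⟩
  -- The distance σ is so small that a point within σ of ∂G lies in the bands of all charts, and
  -- that the covering by balls of radius R/8 leaves room.
  · obtain ⟨σ, hσ0, hση, hσε, hσR⟩ : ∃ σ : ℝ, 0 < σ ∧ (∀ i, σ * (1 + L) ≤ η i) ∧ σ ≤ ε ∧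
        σ ≤ R / 16 := by
      have h1 : ∀ᶠ σ : ℝ in 𝓝[>] 0, (∀ i, σ * (1 + L) ≤ η i) ∧ σ ≤ ε ∧ σ ≤ R / 16 := by
        refine nhdsWithin_le_nhds ?_
        refine (eventually_all.2 fun i => ?_).and
          ((eventually_le_nhds hε0).and (eventually_le_nhds (by positivity)))
        have h2 : Tendsto (fun σ : ℝ => σ * (1 + L)) (𝓝 0) (𝓝 0) := by
          simpa using (tendsto_id (x := 𝓝 (0 : ℝ))).mul_const (1 + (L : ℝ))
        exact h2.eventually (eventually_le_nhds (hη i))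
      obtain ⟨σ, h2, h3⟩ := (h1.and self_mem_nhdsWithin).exists
      exact ⟨σ, h3, h2⟩
    filter_upwards [eventually_all.2 hψ, eventually_all.2 fun i => (hgs i).smooth,
      eventually_neg_iff_mem hG hb hR hφ he hc hσ0] with m h1 h2 h3
    set A : Set (Sp (d + 1)) := {p ∈ D.W | D.patches.F (D.patches.approx φ c m) p < 0} with hA
    have hAG : ∀ p ∉ thickening σ (frontier G), (p ∈ A ↔ p ∈ G) := fun p hp =>
      ⟨fun h => (h3 p h.1 hp).1 h.2, fun h =>
        have h4 := D.closure_subset (subset_closure h)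
        ⟨h4, (h3 p h4 hp).2 h⟩⟩
    have hball : ball (0 : Sp d) (R - ε) ⊆ ball 0 (R - ε / 2) := ball_subset_ball (by linarith)
    refine ⟨fun i => ⟨(h2 i).mono hball, ?_⟩, fun p hp => ?_⟩
    · refine isGraphIn_of_mem_iff ((h2 i).mono hball).continuousOn (fun y hy => ?_)
        fun y hy t ht => ?_
      -- The graph stays within L(R - ε) + R/4, which is below (R - ε)(1 + L) because ε < R/2.
      · have h4 := (h1 i y (ball_subset_closedBall (hball hy))).1
        have h5 := D.abs_le_of_mem_ball hφ he hR i hy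
        have h6 := (hη₁ i).trans (min_le_right _ _)
        refine abs_lt.1 ?_
        have h7 := abs_sub_abs_le_abs_sub (ψ i m y) (φ i y)
        linarith
      · obtain ⟨h4, -, -, h5⟩ := h1 i y (ball_subset_closedBall (hball hy))
        have hyR : y ∈ ball (0 : Sp d) R := ball_subset_ball (by linarith) hy
        -- Inside the band, monotonicity of F_m decides membership. Outside it the point is at
        -- distance at least σ from ∂G, where the set agrees with G, and t lies on the same side of
        -- ψ as of φ.
        rcases le_or_gt |t - φ i y| (η i) with h6 | h6
        · rw [← h5 t h6]
          refine ⟨fun h => h.2, fun h => ⟨hδW (mem_thickening_iff.2 ⟨_, hfr i y hyR, ?_⟩), h⟩⟩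
          refine (dist_pt_le _ _ _ _ _ _).trans_lt ?_
          rw [dist_self, zero_add]
          linarith [(hη₁ i).trans (min_le_left _ _)]
        · have hL' : (R - ε) * (1 + L) ≤ R * (1 + L) :=
            mul_le_mul_of_nonneg_right (by linarith) (by positivity)
          rw [hAG _ fun h => not_lt_of_ge ((D.abs_sub_le_of_mem_thickening hφ he i hy ht
            (by linarith) h).trans (hση i)) h6,
            ((D.chart i).2.2 y hyR |>.2 t ⟨by linarith [ht.1], by linarith [ht.2]⟩).2, he i hyR]
          rw [abs_sub_lt_iff] at h4
          rcases lt_abs.1 h6 with h7 | h7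
          · exact iff_of_false (by linarith [hη i]) (by linarith)
          · exact iff_of_true (by linarith [hη i]) (by linarith)
    · have hpΓ : p ∈ cthickening σ (frontier G) := by
        by_contra hn
        refine hn (self_subset_cthickening _ ((mem_frontier_congr ?_).1 hp))
        filter_upwards [isClosed_cthickening.isOpen_compl.mem_nhds hn] with q hq
        exact hAG q fun h => hq (thickening_subset_cthickening _ _ h)
      obtain ⟨q, hq, hpq⟩ := mem_thickening_iff.1
        (cthickening_subset_thickening' (by positivity) (by linarith : σ < 2 * σ) _ hpΓ)
      -- The distance to the centre is below R/8 + 2σ ≤ R/4 < R - ε.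
      obtain ⟨i, hi⟩ := mem_iUnion.1 (D.cover hq)
      refine mem_iUnion.2 ⟨i, LipApprox.ball_subset_cylinder (s := R - ε) _ _ le_rfl ?_ ?_⟩
      · nlinarith
      · rw [mem_ball] at hi ⊢
        linarith [dist_triangle p q (D.x i)]
  · have hyR := hsub (ball_subset_closedBall hy)
    refine Patches.exists_ball_S_pderiv (A := D.patches) (c := c) hφ hc (hφ i).continuous (hgs i) hy
      (hκ i) ((hψ i).mono fun m hm z hz => ?_) (D.adaptedAt hG hR hφ he (hfr i y hyR)) fun j hj => ?_
    · exact ⟨(hm z (ball_subset_closedBall hz)).2.1, (hm z (ball_subset_closedBall hz)).2.2.1⟩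
    · have hloc := D.localChart hφ he j (D.ball_subset_cylinder hR j (D.ξ_supp j hj))
      have hpj : pt (D.x j) (D.T j) (D.patches.hor j (pt (D.x i) (D.T i) y (φ i y)))
          (φ j (D.patches.hor j (pt (D.x i) (D.T i) y (φ i y)))) =
          pt (D.x i) (D.T i) y (φ i y) := by
        have := hloc.vert_eq (hfr i y hyR)
        exact (congrArg (pt (D.x j) (D.T j) (horiz (D.T j) (_ - D.x j))) this.symm).trans
          (pt_horiz_vert _ _ _)
      -- Each active chart of the atlas is regular near the projected point by independence of the
      -- chart.
      obtain ⟨ρ, hρ, hW⟩ := hQ.exists_WReg (hpj.symm ▸ hloc)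
      exact ⟨_, isOpen_ball, isBounded_ball, mem_ball_self hρ, hW⟩

end Atlas

/-! ### Convergence in `C^k` and in Hölder spaces -/

lemma norm_le_sum_abs {j : ℕ} (M : ContinuousMultilinearMap ℝ (fun _ : Fin j => Sp d) ℝ) :
    ‖M‖ ≤ ∑ σ : Fin j → Fin d, |M fun a => EuclideanSpace.single (σ a) (1 : ℝ)| := by
  refine M.opNorm_le_bound (Finset.sum_nonneg fun _ _ => abs_nonneg _) fun v => ?_
  have h1 : v = fun i => ∑ b, v i b • EuclideanSpace.single b (1 : ℝ) := by
    ext i l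
    simp [Finset.sum_apply, Pi.single_apply]
  conv_lhs => rw [h1]
  rw [M.map_sum, Finset.sum_mul]
  refine (norm_sum_le _ _).trans (Finset.sum_le_sum fun σ _ => ?_)
  rw [M.map_smul_univ, norm_smul, mul_comm, Real.norm_eq_abs]
  refine mul_le_mul_of_nonneg_left ?_ (abs_nonneg _)
  rw [norm_prod]
  exact Finset.prod_le_prod (fun _ _ => norm_nonneg _) fun i _ => PiLp.norm_apply_le (v i) (σ i)

lemma norm_iteratedFDeriv_sub_le {j : ℕ} (f g : Sp d → ℝ) (y z : Sp d) :
    ‖iteratedFDeriv ℝ j f y - iteratedFDeriv ℝ j g z‖ ≤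
      ∑ σ : Fin j → Fin d, |partialD σ f y - partialD σ g z| :=
  norm_le_sum_abs _

lemma abs_partialD_sub_le {j : ℕ} (σ : Fin j → Fin d) (f g : Sp d → ℝ) (y z : Sp d) :
    |partialD σ f y - partialD σ g z| ≤ ‖iteratedFDeriv ℝ j f y - iteratedFDeriv ℝ j g z‖ := by
  have := (iteratedFDeriv ℝ j f y - iteratedFDeriv ℝ j g z).le_opNorm
    (fun a => EuclideanSpace.single (σ a) (1 : ℝ))
  simpa [partialD] using this

variable {U : Set (Sp d)} {u : ℕ → Sp d → ℝ} {φ : Sp d → ℝ} {k : ℕ}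

/-- The limits of the derivatives form a Taylor series of φ, since differentiation commutes with
uniform convergence of the derivatives. Existence of derivatives of φ is a conclusion, not an
assumption. -/
theorem tendstoCk_of_uniformCauchySeqOn (hU : IsOpen U)
    (hs : ∀ᶠ m in atTop, ContDiffOn ℝ ∞ (u m) U)
    (h0 : ∀ y ∈ U, Tendsto (fun m => u m y) atTop (𝓝 (φ y)))
    (hC : ∀ j ≤ k, UniformCauchySeqOn (fun m => iteratedFDeriv ℝ j (u m)) atTop U) :
    TendstoCk k U u φ := by
  set p : Sp d → FormalMultilinearSeries ℝ (Sp d) ℝ := fun y j =>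
    limUnder atTop fun m => iteratedFDeriv ℝ j (u m) y with hp
  have hlim : ∀ j ≤ k, TendstoUniformlyOn (fun m => iteratedFDeriv ℝ j (u m)) (fun y => p y j)
      atTop U := fun j hj => (hC j hj).tendstoUniformlyOn_of_tendsto fun y hy =>
    tendsto_nhds_limUnder (cauchySeq_tendsto_of_complete ((hC j hj).cauchySeq hy))
  have hcont : ∀ j : ℕ, ∀ᶠ m in atTop, ContinuousOn (iteratedFDeriv ℝ j (u m)) U := fun j => by
    filter_upwards [hs] with m hm y hy
    exact (((hm.contDiffAt (hU.mem_nhds hy)).iteratedFDeriv_right (m := 0) (i := j)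
      (by rw [zero_add]; exact_mod_cast le_top)).continuousAt).continuousWithinAt
  have hT : HasFTaylorSeriesUpToOn k φ p U := by
    refine ⟨fun y hy => ?_, fun j hj y hy => ?_, fun j hj => ?_⟩
    · have h1 := (hlim 0 (Nat.zero_le k)).tendsto_at hy
      have h2 := ((continuousMultilinearCurryFin0 ℝ (Sp d) ℝ).continuous.tendsto _).comp h1
      refine tendsto_nhds_unique h2 ((h0 y hy).congr fun m => ?_)
      simp
    · have hj' : j < k := by exact_mod_cast hj
      have h1 : TendstoUniformlyOn (fun m => fderiv ℝ (iteratedFDeriv ℝ j (u m)))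
          (fun y => (p y (j + 1)).curryLeft) atTop U := by
        have := (continuousMultilinearCurryLeftEquiv ℝ (fun _ : Fin (j + 1) => Sp d)
          ℝ).isometry.uniformContinuous.comp_tendstoUniformlyOn (hlim (j + 1) hj')
        exact this
      have h2 : TendstoUniformlyOnFilter (fun m => fderiv ℝ (iteratedFDeriv ℝ j (u m)))
          (fun y => (p y (j + 1)).curryLeft) atTop (𝓝 y) :=
        (tendstoUniformlyOn_iff_tendstoUniformlyOnFilter.1 h1).mono_right
          (le_principal_iff.2 (hU.mem_nhds hy))
      refine (hasFDerivAt_of_tendstoUniformlyOnFilter (𝕜 := ℝ) (f := fun m => iteratedFDeriv ℝ j (u m))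
        h2 ?_ ?_).hasFDerivWithinAt
      · filter_upwards [hs.prod_mk (hU.mem_nhds hy)] with z hz
        exact ((((hz.1.contDiffAt (hU.mem_nhds hz.2)).iteratedFDeriv_right (m := 1) (i := j)
          (by exact_mod_cast le_top)).differentiableAt (by simp))).hasFDerivAt
      · filter_upwards [hU.mem_nhds hy] with z hz
        exact (hlim j hj'.le).tendsto_at hz
    · exact (hlim j (by exact_mod_cast hj)).continuousOn (hcont j).frequently
  refine ⟨hT.contDiffOn (n := k), hs.mono fun m hm => hm.of_le (by exact_mod_cast le_top),
    fun j hj => (hlim j hj).congr_right fun y hy => ?_⟩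
  beta_reduce
  rw [hT.eq_iteratedFDerivWithin_of_uniqueDiffOn (by exact_mod_cast hj) hU.uniqueDiffOn hy,
    iteratedFDerivWithin_of_isOpen j hU hy]

section Holder

variable {E : Type*} [NormedAddCommGroup E] {F : ℕ → Sp d → E} {F₀ : Sp d → E} {α α' C : ℝ≥0}

lemma holderOnWith_of_tendsto (hF : ∀ y ∈ U, Tendsto (fun m => F m y) atTop (𝓝 (F₀ y)))
    (hC : ∀ᶠ m in atTop, HolderOnWith C α (F m) U) : HolderOnWith C α F₀ U := by
  rw [holderOnWith_iff_dist]
  intro x hx y hy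
  refine le_of_tendsto ((hF x hx).dist (hF y hy)) (hC.mono fun m hm => ?_)
  exact holderOnWith_iff_dist.1 hm x hx y hy

/-- Hölder convergence with a smaller exponent, by interpolation. -/
lemma eventually_holderOnWith_sub (hF : TendstoUniformlyOn F F₀ atTop U)
    (hC : ∀ᶠ m in atTop, HolderOnWith C α (F m) U) (hα : α' < α) {δ : ℝ≥0} (hδ : 0 < δ) :
    ∀ᶠ m in atTop, HolderOnWith δ α' (fun y => F m y - F₀ y) U := by
  have hC₀ := holderOnWith_of_tendsto (fun y hy => hF.tendsto_at hy) hC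
  have hαα : 0 < (α : ℝ) - α' := sub_pos.2 (by exact_mod_cast hα)
  -- The distance τ separates two regimes: closer points use the α-Hölder bounds and gain a factor
  -- τ^{α-α'}, farther ones use uniform convergence.
  obtain ⟨τ, hτ, hτδ⟩ : ∃ τ : ℝ, 0 < τ ∧ 2 * C * τ ^ ((α : ℝ) - α') ≤ δ := by
    have h1 : Tendsto (fun τ : ℝ => 2 * C * τ ^ ((α : ℝ) - α')) (𝓝[>] 0) (𝓝 0) := by
      refine tendsto_nhdsWithin_of_tendsto_nhds ?_
      have := (Real.continuousAt_rpow_const 0 ((α : ℝ) - α') (.inr hαα.le)).tendsto.const_mul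
        (2 * (C : ℝ))
      simpa [Real.zero_rpow hαα.ne'] using this
    obtain ⟨τ, h2, h3⟩ := ((h1.eventually (eventually_le_nhds
      (show (0 : ℝ) < δ by exact_mod_cast hδ))).and self_mem_nhdsWithin).exists
    exact ⟨τ, h3, h2⟩
  have hp : 0 < δ * τ ^ (α' : ℝ) / 2 := by positivity
  filter_upwards [hC, Metric.tendstoUniformlyOn_iff.1 hF _ hp] with m h1 h2
  rw [holderOnWith_iff_dist] at h1 hC₀ ⊢
  intro x hx y hy
  rcases le_or_gt (dist x y) τ with h | h
  · have h3 := h1 x hx y hy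
    have h4 := hC₀ x hx y hy
    have h5 : dist x y ^ (α : ℝ) ≤ τ ^ ((α : ℝ) - α') * dist x y ^ (α' : ℝ) := by
      rcases dist_nonneg.eq_or_lt (a := (0 : ℝ)) (b := dist x y) with h0 | h0
      · rw [← h0, Real.zero_rpow (by linarith [α'.coe_nonneg])]
        positivity
      · rw [show (α : ℝ) = ((α : ℝ) - α') + α' by ring, Real.rpow_add h0, add_sub_cancel_right]
        exact mul_le_mul_of_nonneg_right (Real.rpow_le_rpow h0.le h hαα.le) (by positivity)
    calc dist (F m x - F₀ x) (F m y - F₀ y) ≤ dist (F m x) (F m y) + dist (F₀ x) (F₀ y) :=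
          dist_sub_sub_le _ _ _ _
      _ ≤ 2 * C * dist x y ^ (α : ℝ) := by linarith
      _ ≤ 2 * C * (τ ^ ((α : ℝ) - α') * dist x y ^ (α' : ℝ)) :=
          mul_le_mul_of_nonneg_left h5 (by positivity)
      _ = 2 * C * τ ^ ((α : ℝ) - α') * dist x y ^ (α' : ℝ) := by ring
      _ ≤ δ * dist x y ^ (α' : ℝ) := mul_le_mul_of_nonneg_right hτδ (by positivity)
  · have h3 := h2 x hx
    have h4 := h2 y hy
    rw [dist_comm, dist_eq_norm] at h3 h4
    have h5 : τ ^ (α' : ℝ) ≤ dist x y ^ (α' : ℝ) := Real.rpow_le_rpow hτ.le h.le α'.coe_nonneg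
    have h6 := mul_le_mul_of_nonneg_left h5 δ.coe_nonneg
    rw [dist_eq_norm]
    linarith [norm_sub_le (F m x - F₀ x) (F m y - F₀ y)]

/-- Uniform convergence and Hölder bounds are local on a relatively compact set. -/
lemma exists_holderOnWith_of_local {K : Set (Sp d)} (hK : IsCompact K)
    (h : ∀ y ∈ K, ∃ ρ > 0, UniformCauchySeqOn F atTop (ball y ρ) ∧ ∃ C : ℝ≥0, ∀ᶠ m in atTop,
      (∀ z ∈ ball y ρ, ‖F m z‖ ≤ C) ∧ HolderOnWith C α (F m) (ball y ρ)) :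
    UniformCauchySeqOn F atTop K ∧ ∃ C : ℝ≥0, ∀ᶠ m in atTop, HolderOnWith C α (F m) K := by
  have h' : ∀ y : K, ∃ ρ > 0, UniformCauchySeqOn F atTop (ball y.1 ρ) ∧ ∃ C : ℝ≥0, ∀ᶠ m in atTop,
      (∀ z ∈ ball y.1 ρ, ‖F m z‖ ≤ C) ∧ HolderOnWith C α (F m) (ball y.1 ρ) := fun y => h y y.2
  choose ρ hρ hcau C hC using h'
  obtain ⟨t, ht⟩ := hK.elim_finite_subcover (fun y : K => ball y.1 (ρ y)) (fun _ => isOpen_ball)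
    fun y hy => mem_iUnion.2 ⟨⟨y, hy⟩, mem_ball_self (hρ _)⟩
  -- Points closer than the Lebesgue number share a ball and its Hölder bound; for the others the
  -- sup bound gives the constant 2B/δ^α.
  obtain ⟨δ, hδ, hδt⟩ := lebesgue_number_lemma_of_metric (c := fun y : t => ball y.1.1 (ρ y.1)) hK
    (fun _ => isOpen_ball) (by simpa only [iUnion_coe_set, iUnion_subtype] using ht)
  refine ⟨?_, ?_⟩
  · rw [Metric.uniformCauchySeqOn_iff]
    intro ε hε
    have h1 : ∀ y : t, ∃ N, ∀ m ≥ N, ∀ n ≥ N, ∀ x ∈ ball y.1.1 (ρ y.1), dist (F m x) (F n x) < ε :=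
      fun y => Metric.uniformCauchySeqOn_iff.1 (hcau y.1) ε hε
    choose N hN using h1
    refine ⟨Finset.univ.sup N, fun m hm n hn x hx => ?_⟩
    obtain ⟨y, hy⟩ := hδt x hx
    exact hN y m ((Finset.le_sup (Finset.mem_univ y)).trans hm) n
      ((Finset.le_sup (Finset.mem_univ y)).trans hn) x (hy (mem_ball_self hδ))
  · set B : ℝ≥0 := ∑ y : t, C y.1
    have hB : ∀ y : t, (C y.1 : ℝ) ≤ B := fun y => by
      exact_mod_cast Finset.single_le_sum (f := fun y : t => C y.1) (fun _ _ => zero_le)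
        (Finset.mem_univ y)
    set τ : ℝ≥0 := δ.toNNReal ^ (α : ℝ)
    have hτ0 : 0 < τ := NNReal.rpow_pos (Real.toNNReal_pos.2 hδ)
    have hτ : (τ : ℝ) = δ ^ (α : ℝ) := by simp [τ, hδ.le]
    refine ⟨B + 2 * B / τ, ?_⟩
    filter_upwards [eventually_all.2 fun y : t => hC y.1] with m hm
    rw [holderOnWith_iff_dist]
    intro x hx z hz
    obtain ⟨y, hy⟩ := hδt x hx
    obtain ⟨y', hy'⟩ := hδt z hz
    have h0 : 0 ≤ dist x z ^ (α : ℝ) := by positivity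
    push_cast
    rw [add_mul]
    rcases lt_or_ge (dist x z) δ with h1 | h1
    · have h2 := holderOnWith_iff_dist.1 (hm y).2 x (hy (mem_ball_self hδ)) z
        (hy (by rwa [mem_ball, dist_comm]))
      have h3 := mul_le_mul_of_nonneg_right (hB y) h0
      have h4 : 0 ≤ 2 * (B : ℝ) / τ * dist x z ^ (α : ℝ) := by positivity
      linarith
    · have h2 := (hm y).1 x (hy (mem_ball_self hδ))
      have h3 := (hm y').1 z (hy' (mem_ball_self hδ))
      have h4 : (τ : ℝ) ≤ dist x z ^ (α : ℝ) := by
        rw [hτ]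
        exact Real.rpow_le_rpow hδ.le h1 α.coe_nonneg
      have h5 : 2 * (B : ℝ) ≤ 2 * (B : ℝ) / τ * dist x z ^ (α : ℝ) := by
        have h6 : (0 : ℝ) < τ := by exact_mod_cast hτ0
        rw [div_mul_eq_mul_div, le_div_iff₀ h6]
        exact mul_le_mul_of_nonneg_left h4 (by positivity)
      have h7 : 0 ≤ (B : ℝ) * dist x z ^ (α : ℝ) := by positivity
      rw [dist_eq_norm]
      linarith [norm_sub_le (F m x) (F m z), hB y, hB y']

end Holder

/-- A sequence of smooth functions on `U` with limit `φ`, whose derivatives up to order `k` converge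
uniformly and are bounded in the Hölder seminorm. -/
structure HolderSeq (k : ℕ) (α : ℝ≥0) (U : Set (Sp d)) (u : ℕ → Sp d → ℝ) (φ : Sp d → ℝ) : Prop where
  isOpen : IsOpen U
  bounded : Bornology.IsBounded U
  smooth : ∀ᶠ m in atTop, ContDiffOn ℝ ∞ (u m) U
  tendsto : ∀ y ∈ U, Tendsto (fun m => u m y) atTop (𝓝 (φ y))
  cauchy : ∀ j ≤ k, UniformCauchySeqOn (fun m => iteratedFDeriv ℝ j (u m)) atTop U
  holder : ∀ j ≤ k, ∃ C : ℝ≥0, ∀ᶠ m in atTop, HolderOnWith C α (iteratedFDeriv ℝ j (u m)) U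

namespace HolderSeq

variable {k : ℕ} {α α' : ℝ≥0} {U : Set (Sp d)} {u : ℕ → Sp d → ℝ} {φ : Sp d → ℝ}

theorem tendstoCk (h : HolderSeq k α U u φ) : TendstoCk k U u φ :=
  tendstoCk_of_uniformCauchySeqOn h.isOpen h.smooth h.tendsto h.cauchy

theorem tendstoHolder (h : HolderSeq k α U u φ) (hα : α' < α) : TendstoHolder k α' U u φ := by
  obtain ⟨D, hD⟩ : ∃ D : ℝ≥0, ∀ x ∈ U, ∀ y ∈ U, edist x y ≤ D := by
    obtain ⟨D, hD⟩ := Metric.isBounded_iff.1 h.bounded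
    refine ⟨D.toNNReal, fun x hx y hy => ?_⟩
    rw [edist_dist]
    exact ENNReal.ofReal_le_ofReal (hD hx hy)
  have hCk := h.tendstoCk
  refine ⟨⟨hCk.1, fun j hj => ?_⟩, ?_, hCk, fun j hj δ hδ => ?_⟩
  · obtain ⟨C, hC⟩ := h.holder j hj
    exact ⟨_, (holderOnWith_of_tendsto (fun y hy => (hCk.2.2 j hj).tendsto_at hy) hC).of_le hD hα.le⟩
  · have h1 : ∀ᶠ m in atTop, ∀ j : Fin (k + 1), ∃ C : ℝ≥0,
        HolderOnWith C α (iteratedFDeriv ℝ j (u m)) U := by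
      refine eventually_all.2 fun j => ?_
      obtain ⟨C, hC⟩ := h.holder j (by omega)
      exact hC.mono fun m hm => ⟨C, hm⟩
    filter_upwards [hCk.2.1, h1] with m hm h2
    refine ⟨hm, fun j hj => ?_⟩
    obtain ⟨C, hC⟩ := h2 ⟨j, by omega⟩
    exact ⟨_, hC.of_le hD hα.le⟩
  · obtain ⟨C, hC⟩ := h.holder j hj
    exact eventually_holderOnWith_sub (hCk.2.2 j hj) hC hα hδ

end HolderSeq

/-! ### Weak-* convergence -/

lemma mollify_eq_zero {g : Sp d → ℝ} {m : ℕ} (hm : 1 ≤ m) {s : ℝ} (hg : ∀ y ∉ ball (0 : Sp d) s, g y = 0)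
    {x : Sp d} (hx : s + 1 / m ≤ ‖x‖) : mollify m g x = 0 := by
  have h1 : EqOn g (fun _ => (0 : ℝ)) (ball x (1 / m)) := fun y hy => hg y fun hy' => by
    rw [mem_ball_zero_iff] at hy'
    rw [mem_ball, dist_comm, dist_eq_norm] at hy
    linarith [norm_le_norm_add_norm_sub y x, norm_sub_rev x y]
  rw [mollify_congr hm h1, mollify_const hm]

/-- Test functions are dense in `L¹` of a ball. -/
lemma exists_test_eLpNorm_sub_le {r : ℝ} {h : Sp d → ℝ}
    (hh : Integrable h (volume.restrict (ball 0 r))) {ε : ℝ≥0∞} (hε : 0 < ε) :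
    ∃ η : Sp d → ℝ, ContDiff ℝ ∞ η ∧ HasCompactSupport η ∧ tsupport η ⊆ ball 0 r ∧
      eLpNorm (h - η) 1 (volume.restrict (ball 0 r)) ≤ ε := by
  -- Cutting off to a slightly smaller ball first keeps the support of the mollification inside the
  -- original ball.
  have h1 : Tendsto (fun n : ℕ => eLpNorm (fun y => (ball (0 : Sp d) (r - 1 / (n + 1 : ℝ))).indicator h y
      - h y) 1 (volume.restrict (ball 0 r))) atTop (𝓝 0) := by
    simp only [eLpNorm_one_eq_lintegral_enorm, ← ofReal_norm]
    refine tendsto_lintegral_norm_of_dominated_convergence (bound := fun y => ‖h y‖)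
      (fun n => hh.1.indicator measurableSet_ball) hh.norm.2 (fun n => ?_) ?_
    · exact .of_forall fun y => norm_indicator_le_norm_self _ _
    · refine (ae_restrict_iff' measurableSet_ball).2 (.of_forall fun y hy => ?_)
      rw [mem_ball_zero_iff] at hy
      refine tendsto_const_nhds.congr' ?_
      filter_upwards [tendsto_one_div_add_atTop_nhds_zero_nat.eventually
        (gt_mem_nhds (sub_pos.2 hy))] with n hn
      rw [indicator_of_mem]
      rw [mem_ball_zero_iff]
      linarith
  obtain ⟨n, hn⟩ := (ENNReal.tendsto_nhds_zero.1 h1 _ (ENNReal.half_pos hε.ne')).exists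
  set s := r - 1 / (n + 1 : ℝ) with hs
  have hsr : s < r := sub_lt_self _ (by positivity)
  set g := (ball (0 : Sp d) s).indicator h with hg
  have hgi : MemLp g 1 volume := by
    rw [memLp_one_iff_integrable, hg, integrable_indicator_iff measurableSet_ball]
    exact IntegrableOn.mono_set hh (ball_subset_ball hsr.le)
  have h2 := tendsto_eLpNorm_mollify_sub le_rfl ENNReal.one_ne_top hgi
  obtain ⟨m, h3, h4, h5⟩ := ((ENNReal.tendsto_nhds_zero.1 h2 _ (ENNReal.half_pos hε.ne')).and
    ((eventually_ge_atTop 1).and (tendsto_one_div_atTop_nhds_zero_nat.eventually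
      (gt_mem_nhds (sub_pos.2 hsr))))).exists
  have hsub : tsupport (mollify m g) ⊆ closedBall 0 (s + 1 / m) := by
    refine closure_minimal (fun x hx => ?_) isClosed_closedBall
    rw [mem_closedBall_zero_iff]
    by_contra hn
    exact hx (mollify_eq_zero h4 (fun y hy => indicator_of_notMem hy _) (not_le.1 hn).le)
  refine ⟨mollify m g, contDiff_mollify h4 (memLp_one_iff_integrable.1 hgi).locallyIntegrable,
    (isCompact_closedBall _ _).of_isClosed_subset (isClosed_tsupport _) hsub,
    hsub.trans (closedBall_subset_ball (by linarith)), ?_⟩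
  have h6 : h - mollify m g = -((fun y => g y - h y) + (mollify m g - g)) := by
    ext y; simp
  have hm : AEStronglyMeasurable (mollify m g) (volume.restrict (ball 0 r)) :=
    (contDiff_mollify h4 (memLp_one_iff_integrable.1 hgi).locallyIntegrable).continuous.aestronglyMeasurable
  have hgm : AEStronglyMeasurable g (volume.restrict (ball 0 r)) :=
    hgi.1.mono_measure Measure.restrict_le_self
  rw [h6, eLpNorm_neg]
  refine (eLpNorm_add_le (hgm.sub hh.1) (hm.sub hgm) le_rfl).trans ?_
  refine (add_le_add hn ((eLpNorm_mono_measure _ Measure.restrict_le_self).trans h3)).trans_eq ?_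
  exact ENNReal.add_halves ε

/-- For bounded sequences, weak-* convergence may be tested on smooth functions. -/
lemma tendsto_setIntegral_mul_of_test {r : ℝ} {g : ℕ → Sp d → ℝ} {g₀ : Sp d → ℝ} {C : ℝ} (hC : 0 < C)
    (hg : ∀ᶠ m in atTop, AEStronglyMeasurable (g m) (volume.restrict (ball 0 r)) ∧
      ∀ y ∈ ball (0 : Sp d) r, |g m y| ≤ C)
    (hg₀ : AEStronglyMeasurable g₀ (volume.restrict (ball 0 r)) ∧ ∀ y ∈ ball (0 : Sp d) r, |g₀ y| ≤ C)
    (ht : ∀ η : Sp d → ℝ, ContDiff ℝ ∞ η → HasCompactSupport η → tsupport η ⊆ ball 0 r →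
      Tendsto (fun m => ∫ y in ball 0 r, g m y * η y) atTop (𝓝 (∫ y in ball 0 r, g₀ y * η y)))
    {h : Sp d → ℝ} (hh : Integrable h (volume.restrict (ball 0 r))) :
    Tendsto (fun m => ∫ y in ball 0 r, g m y * h y) atTop (𝓝 (∫ y in ball 0 r, g₀ y * h y)) := by
  have key : ∀ {f η : Sp d → ℝ}, AEStronglyMeasurable f (volume.restrict (ball 0 r)) →
      (∀ y ∈ ball (0 : Sp d) r, |f y| ≤ C) → Integrable η (volume.restrict (ball 0 r)) →
      ∀ {ε : ℝ}, 0 < ε → eLpNorm (h - η) 1 (volume.restrict (ball 0 r)) ≤ ENNReal.ofReal (ε / C) →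
      |(∫ y in ball 0 r, f y * h y) - ∫ y in ball 0 r, f y * η y| ≤ ε := by
    intro f η hf hfC hη ε hε hle
    have hfa : ∀ᵐ y ∂(volume.restrict (ball (0 : Sp d) r)), ‖f y‖ ≤ C :=
      (ae_restrict_iff' measurableSet_ball).2 (.of_forall hfC)
    have hi : ∀ {w : Sp d → ℝ}, Integrable w (volume.restrict (ball 0 r)) →
        Integrable (fun y => f y * w y) (volume.restrict (ball 0 r)) := fun hw =>
      hw.bdd_mul hf hfa
    rw [← integral_sub (hi hh) (hi hη), ← Real.norm_eq_abs]
    refine (norm_integral_le_integral_norm _).trans ?_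
    have h1 : ∫ y in ball 0 r, ‖h y - η y‖ ≤ ε / C := by
      refine (integral_norm_eq_lintegral_enorm (hh.1.sub hη.1)).trans_le ?_
      rw [eLpNorm_one_eq_lintegral_enorm] at hle
      exact ENNReal.toReal_le_of_le_ofReal (by positivity) hle
    refine (integral_mono_ae ((hi hh).sub (hi hη)).norm ((hh.sub hη).norm.const_mul C) ?_).trans ?_
    · filter_upwards [hfa] with y hy
      rw [Pi.sub_apply, ← mul_sub, norm_mul]
      exact mul_le_mul_of_nonneg_right hy (norm_nonneg _)
    · rw [integral_const_mul]
      calc C * ∫ y in ball 0 r, ‖h y - η y‖ ≤ C * (ε / C) := mul_le_mul_of_nonneg_left h1 hC.le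
        _ = ε := mul_div_cancel₀ _ hC.ne'
  rw [Metric.tendsto_nhds]
  intro ε hε
  obtain ⟨η, hη, hηc, hηs, hηε⟩ := exists_test_eLpNorm_sub_le hh
    (ε := ENNReal.ofReal (ε / 3 / C)) (ENNReal.ofReal_pos.2 (by positivity))
  have hηi : Integrable η (volume.restrict (ball 0 r)) :=
    (hη.continuous.integrable_of_hasCompactSupport hηc).restrict
  have h0 := key hg₀.1 hg₀.2 hηi (by positivity) hηε
  filter_upwards [hg, Metric.tendsto_nhds.1 (ht η hη hηc hηs) (ε / 3) (by positivity)] with m h1 h2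
  have h3 := key h1.1 h1.2 hηi (by positivity) hηε
  rw [Real.dist_eq] at h2 ⊢
  rw [abs_lt] at h2 ⊢
  rw [abs_le] at h0 h3
  exact ⟨by linarith, by linarith⟩

lemma abs_partialD_le {j : ℕ} (σ : Fin j → Fin d) (f : Sp d → ℝ) (y : Sp d) :
    |partialD σ f y| ≤ ‖iteratedFDeriv ℝ j f y‖ := by
  have := (iteratedFDeriv ℝ j f y).le_opNorm (fun a => EuclideanSpace.single (σ a) (1 : ℝ))
  simpa [partialD] using this

/-- A bounded weak derivative is the weak-* limit of the derivatives of the approximations. -/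
lemma tendsto_setIntegral_partialD_mul {r C : ℝ} {u : ℕ → Sp d → ℝ} {φ g₀ : Sp d → ℝ} {j : ℕ}
    {σ : Fin j → Fin d} (hC : 0 < C) (hs : ∀ᶠ m in atTop, ContDiffOn ℝ ∞ (u m) (ball 0 r))
    (hu : TendstoUniformlyOn u φ atTop (ball 0 r))
    (hb : ∀ᶠ m in atTop, MemLp (u m) 1 (volume.restrict (ball 0 r)))
    (hφ : MemLp φ 1 (volume.restrict (ball 0 r)))
    (hC' : ∀ᶠ m in atTop, ∀ y ∈ ball (0 : Sp d) r, |partialD σ (u m) y| ≤ C)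
    (hg₀ : HasWeakDeriv σ (ball 0 r) φ g₀)
    (hg₀m : AEStronglyMeasurable g₀ (volume.restrict (ball 0 r)))
    (hg₀C : ∀ y ∈ ball (0 : Sp d) r, |g₀ y| ≤ C)
    {h : Sp d → ℝ} (hh : Integrable h (volume.restrict (ball 0 r))) :
    Tendsto (fun m => ∫ y in ball 0 r, partialD σ (u m) y * h y) atTop
      (𝓝 (∫ y in ball 0 r, g₀ y * h y)) := by
  refine tendsto_setIntegral_mul_of_test hC ?_ ⟨hg₀m, hg₀C⟩ (fun η h1 h2 h3 => ?_) hh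
  · filter_upwards [hs, hC'] with m h1 h2
    exact ⟨(continuousOn_partialD isOpen_ball σ (h1.of_le (by exact_mod_cast le_top))).aestronglyMeasurable
      measurableSet_ball, h2⟩
  · have h4 : Tendsto (fun m => ∫ y in ball 0 r, u m y * partialD σ η y) atTop
        (𝓝 (∫ y in ball 0 r, φ y * partialD σ η y)) := by
      have h5 := (contDiff_partialD σ h1).continuous
      obtain ⟨B, hB⟩ := (partialD_hasCompactSupport σ h2).exists_bound_of_continuous h5
      exact tendsto_setIntegral_mul_of_L1 h5 hB hb hφ
        (tendsto_eLpNorm_of_tendstoUniformlyOn isOpen_ball isBounded_ball hu 1)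
    have h6 : ∀ {a b : ℝ}, a = (-1) ^ j * b → b = (-1) ^ j * a := fun {a b} hab => by
      rw [hab, ← mul_assoc, ← mul_pow]; simp
    rw [h6 (hg₀.2.2 η h1 h2 h3)]
    refine (h4.const_mul _).congr' ?_
    filter_upwards [hs] with m hm
    exact (h6 ((hasWeakDeriv_partialD isOpen_ball σ (hm.of_le (by exact_mod_cast le_top))).2.2
      η h1 h2 h3)).symm

/-- Uniform Lipschitz bounds on derivatives of order up to k bound those of order up to k+1 and give
φ bounded weak derivatives. Given the bounds, integration by parts and uniform convergence of u
identify the weak-* limit. -/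
theorem HolderSeq.tendstoWeakStar {k : ℕ} {r : ℝ} {u : ℕ → Sp d → ℝ} {φ : Sp d → ℝ} {Λ : ℝ≥0}
    (h : HolderSeq k 1 (ball 0 r) u φ) (hG : GraphSeq (ball 0 r) u φ Λ) :
    TendstoWeakStar (k + 1) (ball 0 r) u φ := by
  obtain ⟨M, hM, hM₀⟩ := hG.exists_bound
  have hCk := h.tendstoCk
  have hb : ∀ᶠ m in atTop, MemLp (u m) 1 (volume.restrict (ball 0 r)) := by
    filter_upwards [h.smooth, hM] with m h1 h2
    exact memLp_of_bound_on isOpen_ball isBounded_ball h1.continuousOn h2 1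
  have hφc : ContinuousOn φ (ball 0 r) := hCk.1.continuousOn
  have hφ : MemLp φ 1 (volume.restrict (ball 0 r)) :=
    memLp_of_bound_on isOpen_ball isBounded_ball hφc hM₀ 1
  intro j hj σ
  obtain ⟨C, g₀, hC, hC', hg₀, hg₀m, hg₀C⟩ : ∃ (C : ℝ) (g₀ : Sp d → ℝ), 0 < C ∧
      (∀ᶠ m in atTop, ∀ y ∈ ball (0 : Sp d) r, |partialD σ (u m) y| ≤ C) ∧
      HasWeakDeriv σ (ball 0 r) φ g₀ ∧ AEStronglyMeasurable g₀ (volume.restrict (ball 0 r)) ∧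
      ∀ y ∈ ball (0 : Sp d) r, |g₀ y| ≤ C := by
    cases j with
    | zero =>
      refine ⟨|M| + 1, φ, by positivity, ?_, ?_, hφ.1, fun y hy => ?_⟩
      · filter_upwards [hM] with m hm y hy
        rw [partialD_fin_zero]
        linarith [hm y hy, le_abs_self M]
      · have := hasWeakDeriv_partialD isOpen_ball σ (f := φ) (V := ball 0 r)
          (contDiffOn_zero.2 hφc)
        rwa [partialD_fin_zero] at this
      · linarith [hM₀ y hy, le_abs_self M]
    | succ i =>
      -- A derivative of order i+1 is a first derivative of a Lipschitz function of order i; this is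
      -- how order k+1 is reached.
      have hi : i ≤ k := by omega
      obtain ⟨C, hC⟩ := h.holder i hi
      have h1 := holderOnWith_of_tendsto (fun y hy => (hCk.2.2 i hi).tendsto_at hy) hC
      have h2 : LipschitzOnWith C (partialD (Fin.init σ) φ) (ball 0 r) :=
        LipschitzOnWith.of_dist_le_mul fun y hy z hz => by
          have h3 := (holderOnWith_one.1 h1).dist_le_mul y hy z hz
          rw [dist_eq_norm] at h3
          exact (abs_partialD_sub_le _ _ _ _ _).trans h3
      obtain ⟨g, hg, hgC, hgm⟩ := exists_hasWeakDeriv_of_lipschitzOnWith isOpen_ball h2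
        (σ (Fin.last i))
      refine ⟨C + 1, g, by positivity, ?_, ?_, hgm.aestronglyMeasurable, fun y _ =>
        (hgC y).trans (by linarith)⟩
      · filter_upwards [hC] with m hm y hy
        refine (abs_partialD_le _ _ _).trans ?_
        rw [← norm_fderiv_iteratedFDeriv]
        have := norm_fderiv_le_of_lipschitzOn ℝ (isOpen_ball.mem_nhds hy) (holderOnWith_one.1 hm)
        linarith
      · exact HasWeakDeriv.snoc (hasWeakDeriv_partialD isOpen_ball _
          (hCk.1.of_le (by exact_mod_cast hi))) hg
  refine ⟨fun m => partialD σ (u m), g₀, ⟨hg₀, ?_⟩, ?_, fun w hw =>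
    tendsto_setIntegral_partialD_mul hC h.smooth hG.unif hb hφ hC' hg₀ hg₀m hg₀C hw⟩
  · have := (isBounded_ball (x := (0 : Sp d)) (r := r)).volume_restrict_isFiniteMeasure
    exact MemLp.of_bound hg₀m C ((ae_restrict_iff' measurableSet_ball).2 (.of_forall hg₀C))
  · filter_upwards [h.smooth, hC'] with m h1 h2
    have h3 : ContDiffOn ℝ j (u m) (ball 0 r) := h1.of_le (by exact_mod_cast le_top)
    exact ⟨hasWeakDeriv_partialD isOpen_ball σ h3, memLp_of_bound_on isOpen_ball isBounded_ball
      (continuousOn_partialD isOpen_ball σ h3) h2 ⊤⟩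

/-! ### From local regularity to convergence -/

section Holder

variable {α : ℝ≥0} {u : ℕ → Sp d → ℝ} {φ : Sp d → ℝ} {Λ : ℝ≥0} {B V : Set (Sp d)} {k K : ℕ}

lemma exists_holderOnWith_iteratedFDeriv {j : ℕ}
    (h : ∀ σ : Fin j → Fin d, UniformCauchySeqOn (fun m => partialD σ (u m)) atTop B ∧
      ∃ C : ℝ≥0, ∀ᶠ m in atTop, (∀ y ∈ B, |partialD σ (u m) y| ≤ C) ∧
        HolderOnWith C α (partialD σ (u m)) B) :
    UniformCauchySeqOn (fun m => iteratedFDeriv ℝ j (u m)) atTop B ∧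
      ∃ C : ℝ≥0, ∀ᶠ m in atTop, (∀ y ∈ B, ‖iteratedFDeriv ℝ j (u m) y‖ ≤ C) ∧
        HolderOnWith C α (iteratedFDeriv ℝ j (u m)) B := by
  choose hcau C hC using h
  constructor
  · rw [Metric.uniformCauchySeqOn_iff]
    intro ε hε
    set n : ℝ := Fintype.card (Fin j → Fin d) + 1
    have hn : 0 < n := by positivity
    have h1 := fun σ => Metric.uniformCauchySeqOn_iff.1 (hcau σ) (ε / n) (by positivity)
    choose N hN using h1
    refine ⟨Finset.univ.sup N, fun m hm l hl y hy => ?_⟩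
    rw [dist_eq_norm]
    calc ‖iteratedFDeriv ℝ j (u m) y - iteratedFDeriv ℝ j (u l) y‖
        ≤ ∑ σ : Fin j → Fin d, |partialD σ (u m) y - partialD σ (u l) y| :=
          norm_iteratedFDeriv_sub_le _ _ _ _
      _ ≤ ∑ _σ : Fin j → Fin d, ε / n := Finset.sum_le_sum fun σ hσ =>
          (hN σ m ((Finset.le_sup hσ).trans hm) l ((Finset.le_sup hσ).trans hl) y hy).le
      _ = (n - 1) * (ε / n) := by
          rw [Finset.sum_const, nsmul_eq_mul, Finset.card_univ, add_sub_cancel_right]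
      _ < n * (ε / n) := mul_lt_mul_of_pos_right (by linarith) (by positivity)
      _ = ε := mul_div_cancel₀ _ hn.ne'
  · refine ⟨∑ σ, C σ, ?_⟩
    filter_upwards [eventually_all.2 hC] with m hm
    rw [holderOnWith_iff_dist]
    push_cast
    refine ⟨fun y hy => ?_, fun y hy z hz => ?_⟩
    · exact (norm_le_sum_abs _).trans (Finset.sum_le_sum fun σ _ => (hm σ).1 y hy)
    · rw [dist_eq_norm, Finset.sum_mul]
      refine (norm_iteratedFDeriv_sub_le _ _ _ _).trans (Finset.sum_le_sum fun σ _ => ?_)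
      exact holderOnWith_iff_dist.1 (hm σ).2 y hy z hz

theorem holderSeq_of_local (hα : α ≤ 1) (hG : GraphSeq V u φ Λ) {r : ℝ}
    (hV : closedBall (0 : Sp d) r ⊆ V)
    (h : ∀ y ∈ closedBall (0 : Sp d) r, ∃ ρ > 0, ∀ j ≤ k, ∀ σ : Fin j → Fin d,
      (holderScale d K α hα).Conv 0 (ball y ρ) (fun m => partialD σ (u m))) :
    HolderSeq k α (ball 0 r) u φ := by
  have hG' := hG.mono isOpen_ball (ball_subset_closedBall.trans hV)
  have key : ∀ j ≤ k, UniformCauchySeqOn (fun m => iteratedFDeriv ℝ j (u m)) atTop (closedBall 0 r) ∧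
      ∃ C : ℝ≥0, ∀ᶠ m in atTop, HolderOnWith C α (iteratedFDeriv ℝ j (u m)) (closedBall 0 r) := by
    intro j hj
    refine exists_holderOnWith_of_local (isCompact_closedBall _ _) fun y hy => ?_
    obtain ⟨ρ, hρ, hc⟩ := h y hy
    exact ⟨ρ, hρ, exists_holderOnWith_iteratedFDeriv fun σ =>
      ⟨(hc j hj σ).1, (hc j hj σ).2.2⟩⟩
  exact ⟨isOpen_ball, isBounded_ball, hG'.smooth, fun y hy => hG'.unif.tendsto_at hy,
    fun j hj => (key j hj).1.mono ball_subset_closedBall, fun j hj =>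
    let ⟨C, hC⟩ := (key j hj).2
    ⟨C, hC.mono fun m hm => hm.mono ball_subset_closedBall⟩⟩

lemma holderSeq_zero (hα : α ≤ 1) (hG : GraphSeq V u φ Λ) {r : ℝ}
    (hV : closedBall (0 : Sp d) r ⊆ V) : HolderSeq 0 α (ball 0 r) u φ := by
  refine holderSeq_of_local (K := 0) hα hG hV fun y hy => ?_
  obtain ⟨ρ, hρ, hρV⟩ := Metric.isOpen_iff.1 hG.isOpen y (hV hy)
  refine ⟨ρ, hρ, fun j hj σ => ?_⟩
  obtain rfl : j = 0 := by omega
  simp only [partialD_fin_zero]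
  have hG' := hG.mono isOpen_ball hρV
  exact (holderScale d 0 α hα).unif isOpen_ball isBounded_ball hG'.lip hG'.unif

lemma holderSeq_succ (hα : α ≤ 1) (hG : GraphSeq V u φ Λ) {r : ℝ}
    (hV : closedBall (0 : Sp d) r ⊆ V)
    (h : ∀ y ∈ V, ∃ ρ > 0, ball y ρ ⊆ V ∧
      ∀ a, (holderScale d K α hα).S (ball y ρ) (K + 1) 0 (fun m => pderiv a (u m))) :
    HolderSeq (K + 1) α (ball 0 r) u φ := by
  refine holderSeq_of_local (K := K) hα hG hV fun y hy => ?_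
  obtain ⟨ρ, hρ, hρV, hS⟩ := h y (hV hy)
  have hG' := hG.mono isOpen_ball hρV
  refine ⟨ρ, hρ, fun j hj σ => ?_⟩
  cases j with
  | zero =>
    simp only [partialD_fin_zero]
    exact (holderScale d K α hα).unif isOpen_ball isBounded_ball hG'.lip hG'.unif
  | succ i => exact RegScale.conv_partialD_succ hG' hS (by omega) σ

end Holder

section Sobolev

variable {q : ℝ≥0∞} {u : ℕ → Sp d → ℝ} {φ : Sp d → ℝ} {Λ : ℝ≥0} {V : Set (Sp d)} {k K : ℕ}

lemma eLpNorm_restrict_union_le (hq : 1 ≤ q) (hq' : q ≠ ⊤) (μ : Measure (Sp d)) (f : Sp d → ℝ)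
    (A B : Set (Sp d)) : eLpNorm f q (μ.restrict (A ∪ B)) ≤
      eLpNorm f q (μ.restrict A) + eLpNorm f q (μ.restrict B) := by
  have hq0 : q ≠ 0 := (one_pos.trans_le hq).ne'
  have hq1 : 1 ≤ q.toReal := by
    simpa using ENNReal.toReal_mono hq' hq
  simp only [eLpNorm_eq_lintegral_rpow_enorm_toReal hq0 hq']
  refine (ENNReal.rpow_le_rpow (lintegral_union_le _ A B) (by positivity)).trans ?_
  exact ENNReal.rpow_add_le_add_rpow _ _ (by positivity) (by rw [div_le_one (by linarith)]; exact hq1)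

lemma LpCauchy.union (hq : 1 ≤ q) (hq' : q ≠ ⊤) {A B : Set (Sp d)}
    (hA : LpCauchy q (volume.restrict A) u) (hB : LpCauchy q (volume.restrict B) u) :
    LpCauchy q (volume.restrict (A ∪ B)) u := by
  refine ⟨?_, fun ε hε => ?_⟩
  · filter_upwards [hA.1, hB.1] with m h1 h2
    exact ⟨aestronglyMeasurable_union_iff.2 ⟨h1.1, h2.1⟩,
      (eLpNorm_restrict_union_le hq hq' _ _ _ _).trans_lt (ENNReal.add_lt_top.2 ⟨h1.2, h2.2⟩)⟩
  · obtain ⟨N, hN⟩ := hA.2 _ (ENNReal.half_pos hε.ne')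
    obtain ⟨N', hN'⟩ := hB.2 _ (ENNReal.half_pos hε.ne')
    refine ⟨max N N', fun m hm n hn => (eLpNorm_restrict_union_le hq hq' _ _ _ _).trans ?_⟩
    refine (add_le_add (hN m (le_of_max_le_left hm) n (le_of_max_le_left hn))
      (hN' m (le_of_max_le_right hm) n (le_of_max_le_right hn))).trans_eq ?_
    exact ENNReal.add_halves ε

/-- L^q seminorms are subadditive over unions of sets, so the Cauchy property passes from finitely
many balls to the compact set they cover. -/
lemma LpCauchy.of_local (hq : 1 ≤ q) (hq' : q ≠ ⊤) {S : Set (Sp d)} (hS : IsCompact S)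
    (h : ∀ y ∈ S, ∃ ρ > 0, LpCauchy q (volume.restrict (ball y ρ)) u) :
    LpCauchy q (volume.restrict S) u := by
  refine hS.induction_on (p := fun A => LpCauchy q (volume.restrict A) u) ?_
    (fun A B hAB hB => hB.mono_measure (Measure.restrict_mono hAB le_rfl))
    (fun A B hA hB => hA.union hq hq' hB) fun y hy => ?_
  · refine ⟨.of_forall fun m => by simp, fun ε hε => ⟨0, fun m _ n _ => by simp⟩⟩
  · obtain ⟨ρ, hρ, hc⟩ := h y hy
    exact ⟨_, nhdsWithin_le_nhds (ball_mem_nhds y hρ), hc⟩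

/-- Order zero is covered by uniform convergence. In higher orders the L^q limit is a weak
derivative of φ, because weak derivatives are closed under L¹ limits. -/
theorem tendstoSobolev_of_lpCauchy (hq : 1 ≤ q) (hG : GraphSeq V u φ Λ)
    (h : ∀ j < k, ∀ σ : Fin (j + 1) → Fin d,
      LpCauchy q (volume.restrict V) (fun m => partialD σ (u m))) : TendstoSobolev k q V u φ := by
  have hV := hG.isOpen
  have := hG.bounded.volume_restrict_isFiniteMeasure
  obtain ⟨M, hM, hM₀⟩ := hG.exists_bound
  have hφc : ContinuousOn φ V :=
    hG.unif.continuousOn (hG.smooth.mono fun m hm => hm.continuousOn).frequently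
  have hb : ∀ p, ∀ᶠ m in atTop, MemLp (u m) p (volume.restrict V) := fun p => by
    filter_upwards [hG.smooth, hM] with m h1 h2
    exact memLp_of_bound_on hV hG.bounded h1.continuousOn h2 p
  have hφ := fun p => memLp_of_bound_on hV hG.bounded hφc hM₀ p
  have hw : ∀ᶠ m in atTop, ∀ (j : ℕ) (σ : Fin j → Fin d),
      HasWeakDeriv σ V (u m) (partialD σ (u m)) := by
    filter_upwards [hG.smooth] with m hm j σ
    exact hasWeakDeriv_partialD hV σ (hm.of_le (by exact_mod_cast le_top))
  intro j hj σ
  cases j with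
  | zero =>
    have h1 := hasWeakDeriv_partialD hV σ (f := φ) (contDiffOn_zero.2 hφc)
    rw [partialD_fin_zero] at h1
    refine ⟨u, φ, ⟨h1, hφ q⟩, ?_, tendsto_eLpNorm_of_tendstoUniformlyOn hV hG.bounded hG.unif q⟩
    filter_upwards [hw, hb q] with m h2 h3
    refine ⟨?_, h3⟩
    have := h2 0 σ
    rwa [partialD_fin_zero] at this
  | succ i =>
    have hc := h i (by omega) σ
    obtain ⟨g, hg, hgt⟩ := hc.exists_limit hq
    have hle : ∀ f : Sp d → ℝ, AEStronglyMeasurable f (volume.restrict V) →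
        eLpNorm f 1 (volume.restrict V) ≤
          eLpNorm f q (volume.restrict V) * volume.restrict V univ ^ (1 - 1 / q.toReal) :=
      fun f hf => by simpa using eLpNorm_le_eLpNorm_mul_rpow_measure_univ hq hf
    have hexp : 0 ≤ 1 - 1 / q.toReal := by
      rcases eq_or_ne q ⊤ with rfl | hq'
      · simp
      · have h3 : 1 ≤ q.toReal := by simpa using ENNReal.toReal_mono hq' hq
        rw [sub_nonneg, div_le_one (by linarith)]
        exact h3
    have ht1 : Tendsto (fun m => eLpNorm (partialD σ (u m) - g) 1 (volume.restrict V)) atTop (𝓝 0) := by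
      have h2 := ENNReal.Tendsto.mul_const (b := volume.restrict V univ ^ (1 - 1 / q.toReal)) hgt
        (.inr (ENNReal.rpow_ne_top_of_nonneg hexp (measure_ne_top _ _)))
      rw [zero_mul] at h2
      refine tendsto_of_tendsto_of_tendsto_of_le_of_le' tendsto_const_nhds h2
        (.of_forall fun _ => zero_le) ?_
      filter_upwards [hc.1] with m hm
      exact hle _ (hm.1.sub hg.1)
    refine ⟨fun m => partialD σ (u m), g, ⟨?_, hg⟩, ?_, hgt⟩
    · exact hasWeakDeriv_of_tendsto_L1 (hw.mono fun m hm => hm _ σ) (hb 1) (hφ 1)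
        (hc.1.mono fun m hm => hm.mono_exponent hq) (hg.mono_exponent hq)
        (tendsto_eLpNorm_of_tendstoUniformlyOn hV hG.bounded hG.unif 1) ht1
    · filter_upwards [hw, hc.1] with m h2 h3 using ⟨h2 _ σ, h3⟩

theorem tendstoSobolev_zero (hq : 1 ≤ q) (hG : GraphSeq V u φ Λ) : TendstoSobolev 0 q V u φ :=
  tendstoSobolev_of_lpCauchy hq hG fun j hj => absurd hj (Nat.not_lt_zero j)

theorem tendstoSobolev_succ (hq : 1 ≤ q) (hq' : q ≠ ⊤) (hG : GraphSeq V u φ Λ) {r : ℝ}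
    (hV : closedBall (0 : Sp d) r ⊆ V)
    (h : ∀ y ∈ V, ∃ ρ > 0, ball y ρ ⊆ V ∧
      ∀ a, (sobolevScale d K q hq hq').S (ball y ρ) (K + 1) 0 (fun m => pderiv a (u m))) :
    TendstoSobolev (K + 1) q (ball 0 r) u φ := by
  refine tendstoSobolev_of_lpCauchy hq (hG.mono isOpen_ball (ball_subset_closedBall.trans hV))
    fun j hj σ => ?_
  refine LpCauchy.mono_measure (Measure.restrict_mono ball_subset_closedBall le_rfl)
    (LpCauchy.of_local hq hq' (isCompact_closedBall _ _) fun y hy => ?_)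
  obtain ⟨ρ, hρ, hρV, hS⟩ := h y (hV hy)
  refine ⟨ρ, hρ, ?_⟩
  have hc := RegScale.conv_partialD_succ (hG.mono isOpen_ball hρV) hS (show j ≤ K by omega) σ
  -- Order j+1 has weight j. For j ≥ 1 the exponent Kq/j is at least q; for j = 0 every finite
  -- exponent is available.
  rcases Nat.eq_zero_or_pos j with rfl | hj0
  · exact (hc.1 rfl).2 q hq hq'
  · have := (isBounded_ball (x := y) (r := ρ)).volume_restrict_isFiniteMeasure
    exact (hc.2 hj0.ne' (by omega)).mono_exponent (le_gnExp hj0.ne' (by omega))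

end Sobolev

/-! ### Regularity of the boundary -/

/-- A chart of the class is controlled only on its ball, whereas mollification uses a global
function; so `hP` must carry the class over to a Lipschitz extension, possibly on a smaller ball. -/
lemma HasRegularCharts.of_boundaryOfClass {K : ℕ} {Q : RegScale d K} {G : Set (Sp (d + 1))}
    {P : Set (Sp d) → (Sp d → ℝ) → Prop}
    (hP : ∀ {r : ℝ} {L : ℝ≥0} {φ φ' : Sp d → ℝ}, 0 < r → LipschitzWith L φ' →
      EqOn φ φ' (ball 0 r) → P (ball 0 r) φ → ∃ r' > 0, Q.WReg (ball 0 r') φ')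
    (h : BoundaryOfClass P G) : HasRegularCharts Q G := by
  intro p hp
  obtain ⟨r, L, T, φ, hr, ⟨hLip, -, hgr⟩, hφ⟩ := h p hp
  obtain ⟨φ', hφ', he⟩ := hLip.extend_real
  obtain ⟨r', hr', hW⟩ := hP hr hφ' he hφ
  refine ⟨r', L, T, φ', hr', hgr.localChart hφ' he
    (ball_subset_cylinder p T (s := r) le_rfl ?_ (mem_ball_self hr)), hW⟩
  nlinarith [L.coe_nonneg]

lemma hasRegularCharts_of_inHolder {K : ℕ} {α : ℝ≥0} (hα : α ≤ 1) {G : Set (Sp (d + 1))}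
    (h : BoundaryOfClass (InHolder (K + 1) α) G) : HasRegularCharts (holderScale d K α hα) G := by
  refine .of_boundaryOfClass (fun {r L φ φ'} hr _ he hφ => ⟨r / 2, half_pos hr, ?_⟩) h
  have hsub : ball (0 : Sp d) (r / 2) ⊆ ball 0 r := ball_subset_ball (by linarith)
  refine RegScale.WReg.congr isOpen_ball (WReg_of_inHolder hα hr hφ.1 fun j hj => ?_) (he.mono hsub)
  obtain ⟨C, hC⟩ := hφ.2 j hj
  exact ⟨C, hC.mono hsub⟩

lemma hasRegularCharts_of_inCk {K : ℕ} {G : Set (Sp (d + 1))}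
    (h : BoundaryOfClass (InCk (K + 1)) G) :
    HasRegularCharts (holderScale d K 0 zero_le) G := by
  refine .of_boundaryOfClass (fun {r L φ φ'} hr _ he hφ => ⟨r / 2, half_pos hr, ?_⟩) h
  have hsub : closedBall (0 : Sp d) (r / 2) ⊆ ball 0 r := closedBall_subset_ball (by linarith)
  refine RegScale.WReg.congr isOpen_ball (WReg_of_inHolder zero_le hr hφ fun j hj => ?_)
    (he.mono (ball_subset_closedBall.trans hsub))
  have hc : ContinuousOn (iteratedFDeriv ℝ j φ) (closedBall 0 (r / 2)) := fun y hy =>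
    (((hφ.contDiffAt (isOpen_ball.mem_nhds (hsub hy))).iteratedFDeriv_right (m := 0) (i := j)
      (by rw [zero_add]; exact_mod_cast hj)).continuousAt).continuousWithinAt
  obtain ⟨M, hM⟩ := (isCompact_closedBall (0 : Sp d) (r / 2)).exists_bound_of_continuousOn hc
  -- With exponent 0 a Hölder bound is a bound on the oscillation, and `Real.rpow` gives 1 even for
  -- the zeroth power of 0.
  refine ⟨(2 * M).toNNReal, holderOnWith_iff_dist.2 fun x hx y hy => ?_⟩
  have h1 := hM x (ball_subset_closedBall hx)
  have h2 := hM y (ball_subset_closedBall hy)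
  rw [NNReal.coe_zero, Real.rpow_zero, mul_one, dist_eq_norm]
  refine le_trans ?_ (Real.le_coe_toNNReal _)
  linarith [norm_sub_le (iteratedFDeriv ℝ j φ x) (iteratedFDeriv ℝ j φ y)]

lemma hasRegularCharts_of_inSobolev {K : ℕ} {q : ℝ≥0∞} (hq : 1 ≤ q) (hq' : q ≠ ⊤)
    {G : Set (Sp (d + 1))} (h : BoundaryOfClass (InSobolev (K + 1) q) G) :
    HasRegularCharts (sobolevScale d K q hq hq') G := by
  refine .of_boundaryOfClass (fun {r L φ φ'} hr hL he hφ => ⟨r / 4, by positivity, ?_⟩) h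
  refine WReg_of_inSobolev hq hq' hL hr fun j hj s => ?_
  obtain ⟨g, hg, hgm⟩ := hφ j hj s
  exact ⟨g, hg.congr_left measurableSet_ball he, hgm⟩

lemma GraphSeq.congr_right {V : Set (Sp d)} {ψ : ℕ → Sp d → ℝ} {φ φ' : Sp d → ℝ} {Λ : ℝ≥0}
    (h : GraphSeq V ψ φ Λ) (he : EqOn φ φ' V) : GraphSeq V ψ φ' Λ :=
  ⟨h.isOpen, h.bounded, h.smooth, h.lip, h.unif.congr_right he⟩

/-! ### Existence of an atlas and assembly of the convergence statements -/

namespace Atlas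

variable {G : Set (Sp (d + 1))} {L : ℝ≥0} {R : ℝ}

theorem nonempty (hG : IsLipschitzDomain G L R) (hb : Bornology.IsBounded G) :
    Nonempty (Atlas G L R) := by
  obtain ⟨hGo, -, -, ⟨hR, -⟩, hch⟩ := hG
  have hΓ : IsCompact (frontier G) :=
    hb.isCompact_closure.of_isClosed_subset isClosed_frontier frontier_subset_closure
  have hR8 : 0 < R / 8 := by positivity
  obtain ⟨t, htΓ, htf, ht⟩ := hΓ.elim_finite_subcover_image (b := frontier G)
    (c := fun x => ball x (R / 8)) (fun _ _ => isOpen_ball)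
    fun x hx => mem_biUnion hx (mem_ball_self hR8)
  have := htf.fintype
  obtain ⟨e⟩ := Fintype.truncEquivFin t |>.nonempty
  set x : Fin (Fintype.card t) → Sp (d + 1) := fun i => (e.symm i).1 with hx
  have hxmem : ∀ i, x i ∈ frontier G := fun i => htΓ (e.symm i).2
  have hcov : frontier G ⊆ ⋃ i, ball (x i) (R / 8) := fun p hp => by
    obtain ⟨y, hy, hpy⟩ := mem_iUnion₂.1 (ht hp)
    refine mem_iUnion.2 ⟨e ⟨y, hy⟩, ?_⟩
    simpa [hx] using hpy
  choose T φ hφ using fun i => hch (x i) (hxmem i) R ⟨hR, le_rfl⟩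
  -- The index `none` stands for G itself and yields ξ₀; the others are the balls of radius R/4.
  set U : Option (Fin (Fintype.card t)) → Set (Sp (d + 1)) := fun o =>
    o.elim G fun i => ball (x i) (R / 4) with hU
  have hUo : ∀ o, IsOpen (U o) := fun o => by
    cases o with
    | none => exact hGo
    | some i => exact isOpen_ball
  have hKU : closure G ⊆ ⋃ o, U o := fun p hp => by
    by_cases hpG : p ∈ G
    · exact mem_iUnion.2 ⟨none, hpG⟩
    · have hpf : p ∈ frontier G := hGo.frontier_eq ▸ mem_sdiff_of_mem hp hpG
      obtain ⟨i, hi⟩ := mem_iUnion.1 (hcov hpf)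
      exact mem_iUnion.2 ⟨some i, ball_subset_ball (by linarith) hi⟩
  -- The partition of unity sums to 1 on a closed thickening of the closure of G; W is the open
  -- thickening inside it.
  obtain ⟨δ, hδ, hδU⟩ := hb.isCompact_closure.exists_cthickening_subset_open
    (isOpen_iUnion hUo) hKU
  obtain ⟨f, hf⟩ := SmoothPartitionOfUnity.exists_isSubordinate
    (modelWithCornersSelf ℝ (Sp (d + 1))) (isClosed_cthickening (δ := δ) (E := closure G)) U hUo hδU
  exact ⟨{
    N := Fintype.card t
    x := x
    x_mem := hxmem
    cover := hcov
    T := T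
    φ := φ
    chart := hφ
    W := thickening δ (closure G)
    W_open := isOpen_thickening
    closure_subset := self_subset_thickening hδ _
    ξ₀ := f none
    ξ := fun i => f (some i)
    ξ₀_smooth := (f none).contMDiff.contDiff
    ξ_smooth := fun i => (f (some i)).contMDiff.contDiff
    ξ₀_nonneg := f.nonneg none
    ξ_nonneg := fun i => f.nonneg (some i)
    ξ₀_supp := hf none
    ξ_supp := fun i => hf (some i)
    sum_eq_one := fun z hz => by
      have h1 := f.sum_eq_one (thickening_subset_cthickening _ _ hz)
      rwa [finsum_eq_sum_of_fintype, Fintype.sum_option] at h1 }⟩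

/-- The convergence statements for one of the two families of approximating sets. -/
theorem exists_approximation (hG : IsOpen G) (hb : Bornology.IsBounded G) (hR : 0 < R)
    (D : Atlas G L R) {c : ℕ → Fin D.N → ℝ} (hc : ∀ j, Tendsto (fun m => c m j) atTop (𝓝 0))
    {ε : ℝ} (hε : ε ∈ Ioo 0 (R / 2)) :
    ∃ ψ : ℕ → Fin D.N → Sp d → ℝ,
      (∀ᶠ m in atTop, D.Describes ε
        {p ∈ D.W | D.definingFun (fun j y => mollify m (D.φ j) y + c m j) p < 0} (ψ m)) ∧
      (∀ k : ℕ, BoundaryOfClass (InCk k) G → ∀ i,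
        TendstoCk k (ball 0 (R - ε)) (fun m => ψ m i) (D.φ i)) ∧
      (∀ (k : ℕ) (α : ℝ≥0), α < 1 → BoundaryOfClass (InHolder k α) G → ∀ α' : ℝ≥0, α' < α → ∀ i,
        TendstoHolder k α' (ball 0 (R - ε)) (fun m => ψ m i) (D.φ i)) ∧
      (∀ (k : ℕ) (q : ℝ≥0∞), 1 ≤ q → q ≠ ⊤ → BoundaryOfClass (InSobolev k q) G → ∀ i,
        TendstoSobolev k q (ball 0 (R - ε)) (fun m => ψ m i) (D.φ i)) ∧
      (∀ k : ℕ, BoundaryOfClass (InHolder k 1) G → ∀ i,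
        TendstoWeakStar (k + 1) (ball 0 (R - ε)) (fun m => ψ m i) (D.φ i)) := by
  obtain ⟨φ, hφ, he⟩ := D.exists_extension
  obtain ⟨ψ, hψ, hreg⟩ := D.exists_describes hG hb hR hφ he hc hε
  have hV : closedBall (0 : Sp d) (R - ε) ⊆ ball 0 (R - ε / 2) :=
    closedBall_subset_ball (by linarith [hε.1])
  have hreg' : ∀ i, ∃ Λ', GraphSeq (ball 0 (R - ε / 2)) (fun m => ψ m i) (D.φ i) Λ' := fun i => by
    obtain ⟨Λ', h1, -⟩ := hreg i
    exact ⟨Λ', h1.congr_right ((he i).symm.mono (ball_subset_ball (by linarith [hε.1])))⟩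
  choose Λ' hGS using hreg'
  have hloc := fun i => (hreg i).choose_spec.2
  refine ⟨ψ, ?_, fun k hk i => ?_, fun k α hα hk α' hα' i => ?_, fun k q hq hq' hk i => ?_,
    fun k hk i => ?_⟩
  · filter_upwards [hψ, D.definingFun_eq hR he c] with m h1 h2
    simp only [h2]
    exact h1
  · cases k with
    -- For k = 0 the class of the boundary plays no role: uniform convergence and uniform Lipschitz
    -- bounds of the graphs suffice.
    | zero => exact (holderSeq_zero (α := 0) zero_le (hGS i) hV).tendstoCk
    | succ K => exact (holderSeq_succ _ (hGS i) hV
        (hloc i K _ (hasRegularCharts_of_inCk hk))).tendstoCk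
  · cases k with
    | zero => exact (holderSeq_zero hα.le (hGS i) hV).tendstoHolder hα'
    | succ K => exact (holderSeq_succ _ (hGS i) hV
        (hloc i K _ (hasRegularCharts_of_inHolder hα.le hk))).tendstoHolder hα'
  · cases k with
    | zero => exact tendstoSobolev_zero hq ((hGS i).mono isOpen_ball
        (ball_subset_closedBall.trans hV))
    | succ K =>
      exact tendstoSobolev_succ hq hq' (hGS i) hV
        (hloc i K _ (hasRegularCharts_of_inSobolev hq hq' hk))
  · have hGi := (hGS i).mono isOpen_ball (ball_subset_closedBall.trans hV)
    cases k with
    | zero => exact (holderSeq_zero le_rfl (hGS i) hV).tendstoWeakStar hGi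
    | succ K => exact (holderSeq_succ _ (hGS i) hV
        (hloc i K _ (hasRegularCharts_of_inHolder le_rfl hk))).tendstoWeakStar hGi

end Atlas

end LipApprox

end

theorem theorem3p2 (d : ℕ) (hd : 1 ≤ d) (Ω : Set (EuclideanSpace ℝ (Fin (d + 1))))
    (L : ℝ≥0) (R : ℝ) (hΩ : LipApprox.IsLipschitzDomain Ω L R) (hb : Bornology.IsBounded Ω) :
    Nonempty (LipApprox.Atlas Ω L R) ∧
    ∀ (D : LipApprox.Atlas Ω L R) (ε₀ : ℝ), ε₀ ∈ Ioo (0 : ℝ) (R / 2) →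
      ∃ ψ φm : ℕ → Fin D.N → EuclideanSpace ℝ (Fin d) → ℝ,
        (∀ᶠ m in atTop, D.Describes ε₀ (D.outer m) (ψ m) ∧ D.Describes ε₀ (D.inner m) (φm m)) ∧
        (∀ k : ℕ, LipApprox.BoundaryOfClass (LipApprox.InCk k) Ω → ∀ i,
          LipApprox.TendstoCk k (ball 0 (R - ε₀)) (fun m => ψ m i) (D.φ i) ∧
          LipApprox.TendstoCk k (ball 0 (R - ε₀)) (fun m => φm m i) (D.φ i)) ∧
        (∀ (k : ℕ) (α : ℝ≥0), 0 < α → α < 1 →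
          LipApprox.BoundaryOfClass (LipApprox.InHolder k α) Ω →
          ∀ α' : ℝ≥0, 0 < α' → α' < α → ∀ i,
          LipApprox.TendstoHolder k α' (ball 0 (R - ε₀)) (fun m => ψ m i) (D.φ i) ∧
          LipApprox.TendstoHolder k α' (ball 0 (R - ε₀)) (fun m => φm m i) (D.φ i)) ∧
        (∀ (k : ℕ) (q : ℝ≥0∞), 1 ≤ q → q ≠ ⊤ →
          LipApprox.BoundaryOfClass (LipApprox.InSobolev k q) Ω → ∀ i,
          LipApprox.TendstoSobolev k q (ball 0 (R - ε₀)) (fun m => ψ m i) (D.φ i) ∧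
          LipApprox.TendstoSobolev k q (ball 0 (R - ε₀)) (fun m => φm m i) (D.φ i)) ∧
        (∀ k : ℕ, LipApprox.BoundaryOfClass (LipApprox.InHolder k 1) Ω → ∀ i,
          LipApprox.TendstoWeakStar (k + 1) (ball 0 (R - ε₀)) (fun m => ψ m i) (D.φ i) ∧
          LipApprox.TendstoWeakStar (k + 1) (ball 0 (R - ε₀)) (fun m => φm m i) (D.φ i)) := by
  obtain ⟨hG, -, -, ⟨hR, -⟩, -⟩ := id hΩ
  refine ⟨LipApprox.Atlas.nonempty hΩ hb, fun D ε₀ hε => ?_⟩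
  obtain ⟨ψ, h1, h2, h3, h4, h5⟩ := D.exists_approximation hG hb hR
    (c := fun m j => LipApprox.shift L R m (D.φ j)) (fun j => D.tendsto_shift j) hε
  -- The inner sets arise from the same construction with the sign of the shift reversed.
  obtain ⟨φm, h1', h2', h3', h4', h5'⟩ := D.exists_approximation hG hb hR
    (c := fun m j => -LipApprox.shift L R m (D.φ j))
    (fun j => by simpa using (D.tendsto_shift j).neg) hε
  exact ⟨ψ, φm, h1.and h1', fun k hk i => ⟨h2 k hk i, h2' k hk i⟩,
    fun k α _ hα hk α' _ hα' i => ⟨h3 k α hα hk α' hα' i, h3' k α hα hk α' hα' i⟩,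
    fun k q hq hq' hk i => ⟨h4 k q hq hq' hk i, h4' k q hq hq' hk i⟩,
    fun k hk i => ⟨h5 k hk i, h5' k hk i⟩⟩
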